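/- Let $\Sigma$ be a smooth closed connected $n$-manifold, let $r\ge 2$ and $k\ge 1$ be integers, and let $U$ be a smooth (real) Banach manifold. Let $\mathcal D^r(\Sigma)$ be the space of linear differential operators of order at most two on $\Sigma$ which in local coordinates have the form $$L u = a^{ij}\,\partial_i\partial_j u + b^i\,\partial_i u + c\,u$$ with coefficients $a^{ij}, b^i, c$ of class $C^r$, normed by the $C^r$ norm of the coefficients (computed on finitely many compact pieces of coordinate charts covering $\Sigma$). Let $\Phi: U\to \mathcal D^r(\Sigma)$, $\gamma\mapsto L_\gamma$, be a map of class $C^k$ such that for every $\gamma\in U$ the matrix $(a^{ij})$ of $L_\gamma$ is symmetric and positive definite at every point, and $L_\gamma$ is self-adjoint with respect to some volume measure $\nu_\gamma$ on $\Sigma$ (a measure with a positive continuous density in every chart), i.e. $\int_\Sigma (L_\gamma u)\,v\,d\nu_\gamma=\int_\Sigma u\,(L_\gamma v)\,d\nu_\gamma$ for all $u,v\in C^2(\Sigma)$. A real number $\lambda$ is called the first eigenvalue of $L_\gamma$ if there is a function $\varphi\in H^1(\Sigma)\cap C^0(\Sigma)$ with $\varphi>0$ on $\Sigma$ and $L_\gamma\varphi=-\lambda\varphi$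 in the weak sense. Then for every $\gamma\in U$ the operator $L_\gamma$ has exactly one first eigenvalue $\lambda_1(\gamma)$, and the function $\lambda_1:U\to\mathbb R$ is of class $C^k$. -/

import Mathlib

open MeasureTheory
open scoped Manifold ContDiff

namespace FirstEigenvalue

/-- The model space `ℝⁿ`. -/
abbrev Rn (n : ℕ) : Type := EuclideanSpace ℝ (Fin n)

/-- The values at a point of the coefficients `((a^{ij}), (b^i), c)` of a second-order operator,
`n² + n + 1` real numbers. -/
abbrev Coef (n : ℕ) : Type := (Fin n → Fin n → ℝ) × (Fin n → ℝ) × ℝ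

/-- The partial derivative `∂_i w` of a function on `ℝⁿ`. -/
noncomputable def pd {n : ℕ} (i : Fin n) (w : Rn n → ℝ) (y : Rn n) : ℝ :=
  fderiv ℝ w y (EuclideanSpace.single i 1)

/-- `a^{ij} ∂_i ∂_j w + b^i ∂_i w + c w` at the point `y`. -/
noncomputable def Coef.eval {n : ℕ} (A : Coef n) (w : Rn n → ℝ) (y : Rn n) : ℝ :=
  (∑ i, ∑ j, A.1 i j * pd i (pd j w) y) + (∑ i, A.2.1 i * pd i w y) + A.2.2 * w y

/-- The coefficients, in the new coordinates `z = τ y`, of the operator which has the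
coefficients `A` at the point `y` in the old coordinates:
`a'^{kl} = a^{ij} ∂_iτ^k ∂_jτ^l`, `b'^k = a^{ij} ∂_i∂_jτ^k + b^i ∂_iτ^k`, `c' = c`. -/
noncomputable def Coef.change {n : ℕ} (τ : Rn n → Rn n) (y : Rn n) (A : Coef n) : Coef n :=
  (fun k l => ∑ i, ∑ j, A.1 i j * (pd i (fun z => τ z k) y * pd j (fun z => τ z l) y),
   fun k => (∑ i, ∑ j, A.1 i j * pd i (pd j (fun z => τ z k)) y)
      + ∑ i, A.2.1 i * pd i (fun z => τ z k) y,
   A.2.2)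

theorem Coef.change_zero {n : ℕ} (τ : Rn n → Rn n) (y : Rn n) :
    Coef.change τ y 0 = 0 := by
  refine Prod.ext ?_ (Prod.ext ?_ rfl)
  · funext k l
    simp [Coef.change]
  · funext k
    simp [Coef.change]

theorem Coef.change_add {n : ℕ} (τ : Rn n → Rn n) (y : Rn n) (A A' : Coef n) :
    Coef.change τ y (A + A') = Coef.change τ y A + Coef.change τ y A' := by
  refine Prod.ext ?_ (Prod.ext ?_ rfl)
  · funext k l
    simp [Coef.change, add_mul, Finset.sum_add_distrib]
  · funext k
    simp [Coef.change, add_mul, Finset.sum_add_distrib]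
    ring

theorem Coef.change_smul {n : ℕ} (τ : Rn n → Rn n) (y : Rn n) (s : ℝ) (A : Coef n) :
    Coef.change τ y (s • A) = s • Coef.change τ y A := by
  refine Prod.ext ?_ (Prod.ext ?_ rfl)
  · funext k l
    simp [Coef.change, mul_assoc, Finset.mul_sum]
  · funext k
    simp [Coef.change, mul_assoc, Finset.mul_sum, mul_add]

/-- The coefficient families of linear differential operators of order at most two with `C^r`
coefficients on the manifold `S`. For each preferred chart `e_x = chartAt x` one gives the
coefficients in the coordinates of `e_x`, as a `C^r` function on the open set `e_x.target`
(extended by zero outside of it), and the coefficients in any two charts are related by the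
transformation law of differential operators. -/
noncomputable def diffOpSubmodule (n r : ℕ) (S : Type*) [TopologicalSpace S]
    [ChartedSpace (Rn n) S] : Submodule ℝ (S → Rn n → Coef n) where
  carrier := {A | (∀ x, ContDiffOn ℝ r (A x) (chartAt (Rn n) x).target) ∧
    (∀ x, ∀ y ∉ (chartAt (Rn n) x).target, A x y = 0) ∧
    ∀ x x' : S, ∀ p ∈ (chartAt (Rn n) x).source, p ∈ (chartAt (Rn n) x').source →
      A x' (chartAt (Rn n) x' p) =
        Coef.change (chartAt (Rn n) x' ∘ (chartAt (Rn n) x).symm) (chartAt (Rn n) x p)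
          (A x (chartAt (Rn n) x p))}
  zero_mem' := ⟨fun _ => contDiffOn_const, fun _ _ _ => rfl,
    fun _ _ _ _ _ => (Coef.change_zero _ _).symm⟩
  add_mem' := by
    rintro A A' ⟨h1, h2, h3⟩ ⟨h1', h2', h3'⟩
    refine ⟨fun x => (h1 x).add (h1' x), fun x y hy => ?_, fun x x' p hp hp' => ?_⟩
    · simp [h2 x y hy, h2' x y hy]
    · simp only [Pi.add_apply, Coef.change_add]
      rw [h3 x x' p hp hp', h3' x x' p hp hp']
  smul_mem' := by
    rintro s A ⟨h1, h2, h3⟩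
    refine ⟨fun x => (h1 x).const_smul s, fun x y hy => ?_, fun x x' p hp hp' => ?_⟩
    · simp [h2 x y hy]
    · simp only [Pi.smul_apply, Coef.change_smul]
      rw [h3 x x' p hp hp']

/-- The space of linear differential operators of order at most two with `C^r` coefficients on
`S`. It is given the `C^r` norm of the coefficients below. -/
def DiffOp (n r : ℕ) (S : Type*) [TopologicalSpace S] [ChartedSpace (Rn n) S] : Type _ :=
  diffOpSubmodule n r S

section

variable {n r : ℕ} {S : Type*} [TopologicalSpace S] [ChartedSpace (Rn n) S]

noncomputable instance : AddCommGroup (DiffOp n r S) :=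
  inferInstanceAs (AddCommGroup (diffOpSubmodule n r S))

noncomputable instance : Module ℝ (DiffOp n r S) :=
  inferInstanceAs (Module ℝ (diffOpSubmodule n r S))

/-- `A.coef x y` are the coefficients of `A` in the chart `chartAt x`, at the point with
coordinates `y`. -/
def DiffOp.coef (A : DiffOp n r S) (x : S) (y : Rn n) : Coef n := A.1 x y

/-- A compact manifold is covered by finitely many compact pieces of charts. -/
theorem exists_finite_cover (n : ℕ) (S : Type*) [TopologicalSpace S] [ChartedSpace (Rn n) S]
    [CompactSpace S] :
    ∃ (K : S → Set (Rn n)) (t : Finset S),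
      (∀ x, IsCompact (K x) ∧ K x ⊆ (chartAt (Rn n) x).target) ∧
      ∀ p, ∃ x ∈ t, p ∈ (chartAt (Rn n) x).source ∧ chartAt (Rn n) x p ∈ K x := by
  have h : ∀ x : S, ∃ K : Set (Rn n), IsCompact K ∧
      chartAt (Rn n) x x ∈ interior K ∧ K ⊆ (chartAt (Rn n) x).target := fun x =>
    exists_compact_subset (chartAt (Rn n) x).open_target (mem_chart_target (Rn n) x)
  choose K hK hxK hKt using h
  obtain ⟨t, ht⟩ := CompactSpace.elim_nhds_subcover
    (fun x : S => (chartAt (Rn n) x).source ∩ chartAt (Rn n) x ⁻¹' interior (K x))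
    (fun x => ((chartAt (Rn n) x).isOpen_inter_preimage isOpen_interior).mem_nhds
      ⟨mem_chart_source (Rn n) x, hxK x⟩)
  refine ⟨K, t, fun x => ⟨hK x, hKt x⟩, fun p => ?_⟩
  have hp : p ∈ ⋃ x ∈ t, (chartAt (Rn n) x).source ∩ chartAt (Rn n) x ⁻¹' interior (K x) := by
    rw [ht]; trivial
  simp only [Set.mem_iUnion] at hp
  obtain ⟨x, hx, h1, h2⟩ := hp
  exact ⟨x, hx, h1, interior_subset h2⟩

/-- A choice of a compact subset of the image of each chart. -/
noncomputable def piece (n : ℕ) (S : Type*) [TopologicalSpace S] [ChartedSpace (Rn n) S]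
    [CompactSpace S] : S → Set (Rn n) :=
  (exists_finite_cover n S).choose

/-- A choice of finitely many charts whose compact pieces cover the manifold. -/
noncomputable def centers (n : ℕ) (S : Type*) [TopologicalSpace S] [ChartedSpace (Rn n) S]
    [CompactSpace S] : Finset S :=
  (exists_finite_cover n S).choose_spec.choose

variable [CompactSpace S]

theorem isCompact_piece (x : S) : IsCompact (piece n S x) :=
  ((exists_finite_cover n S).choose_spec.choose_spec.1 x).1

theorem piece_subset (x : S) : piece n S x ⊆ (chartAt (Rn n) x).target :=
  ((exists_finite_cover n S).choose_spec.choose_spec.1 x).2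

theorem exists_mem_piece (n : ℕ) {S : Type*} [TopologicalSpace S] [ChartedSpace (Rn n) S]
    [CompactSpace S] (p : S) : ∃ x ∈ centers n S,
    p ∈ (chartAt (Rn n) x).source ∧ chartAt (Rn n) x p ∈ piece n S x :=
  (exists_finite_cover n S).choose_spec.choose_spec.2 p

instance (x : S) : CompactSpace (piece n S x) :=
  isCompact_iff_compactSpace.mp (isCompact_piece x)

/-- Continuous functions on the chosen compact piece of the chart at `x`, with values in the
`i`-linear maps (the derivatives of order `i` of coefficients), with the sup norm. -/
def JetAt (n : ℕ) {S : Type*} [TopologicalSpace S] [ChartedSpace (Rn n) S] [CompactSpace S]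
    (x : S) (i : ℕ) : Type :=
  C(piece n S x, ContinuousMultilinearMap ℝ (fun _ : Fin i => Rn n) (Coef n))

noncomputable instance (x : S) (i : ℕ) : NormedAddCommGroup (JetAt n x i) :=
  inferInstanceAs
    (NormedAddCommGroup C(piece n S x, ContinuousMultilinearMap ℝ (fun _ : Fin i => Rn n) (Coef n)))

noncomputable instance (x : S) (i : ℕ) : NormedSpace ℝ (JetAt n x i) :=
  inferInstanceAs
    (NormedSpace ℝ C(piece n S x, ContinuousMultilinearMap ℝ (fun _ : Fin i => Rn n) (Coef n)))

/-- Tuples of such functions, over the chosen charts and the orders `i ≤ r`, with the maximum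
norm. -/
abbrev JetSpace (n r : ℕ) (S : Type*) [TopologicalSpace S] [ChartedSpace (Rn n) S]
    [CompactSpace S] : Type _ :=
  (x : centers n S) → (i : Fin (r + 1)) → JetAt n x.1 i.1

/-- The derivatives up to order `r` of the coefficients, on the chosen compact pieces, as
continuous functions (with the sup norm). -/
noncomputable def DiffOp.jet (n r : ℕ) (S : Type*) [TopologicalSpace S] [ChartedSpace (Rn n) S]
    [CompactSpace S] :
    DiffOp n r S →ₗ[ℝ] JetSpace n r S where
  toFun A x i :=
    (show C(piece n S x.1, _) from
    { toFun := fun y =>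
        iteratedFDerivWithin ℝ i.1 (A.coef x.1) (chartAt (Rn n) x.1).target y.1
      continuous_toFun := by
        have h := (A.2.1 x.1).continuousOn_iteratedFDerivWithin (m := i.1)
          (by exact_mod_cast Nat.le_of_lt_succ i.2) (chartAt (Rn n) x.1).open_target.uniqueDiffOn
        exact (h.mono (piece_subset x.1)).domRestrict })
  map_add' A A' := by
    funext x i
    refine ContinuousMap.ext fun y => ?_
    have hi : ((i.1 : ℕ) : WithTop ℕ∞) ≤ r := by exact_mod_cast Nat.le_of_lt_succ i.2
    have hy := piece_subset x.1 y.2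
    exact iteratedFDerivWithin_add_apply (((A.2.1 x.1).of_le hi) _ hy)
      (((A'.2.1 x.1).of_le hi) _ hy) (chartAt (Rn n) x.1).open_target.uniqueDiffOn hy
  map_smul' s A := by
    funext x i
    refine ContinuousMap.ext fun y => ?_
    have hi : ((i.1 : ℕ) : WithTop ℕ∞) ≤ r := by exact_mod_cast Nat.le_of_lt_succ i.2
    have hy := piece_subset x.1 y.2
    exact iteratedFDerivWithin_const_smul_apply (a := s) (((A.2.1 x.1).of_le hi) _ hy)
      (chartAt (Rn n) x.1).open_target.uniqueDiffOn hy

theorem DiffOp.jet_injective : Function.Injective (DiffOp.jet n r S) := by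
  rw [← LinearMap.ker_eq_bot, LinearMap.ker_eq_bot']
  intro A hA
  refine Subtype.ext (funext fun x => funext fun y => ?_)
  by_cases hy : y ∈ (chartAt (Rn n) x).target
  · obtain ⟨z, hz, hp, hpz⟩ := exists_mem_piece n ((chartAt (Rn n) x).symm y)
    have h0 : A.1 z (chartAt (Rn n) z ((chartAt (Rn n) x).symm y)) = 0 := by
      have h := congrFun (congrFun hA ⟨z, hz⟩) 0
      have h' := DFunLike.congr_fun (F := C(piece n S z, _)) h ⟨_, hpz⟩
      have h'' := congrArg (fun L => L (fun _ => 0)) h'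
      exact h''
    have h := A.2.2.2 z x _ hp ((chartAt (Rn n) x).map_target hy)
    rw [h0, Coef.change_zero, (chartAt (Rn n) x).right_inv hy] at h
    exact h
  · exact A.2.2.1 x y hy

/-- The `C^r` norm: the maximum of the sup norms of the derivatives of order at most `r` of the
coefficients on the finitely many compact chart pieces covering the manifold (another cover
gives an equivalent norm). -/
noncomputable instance : NormedAddCommGroup (DiffOp n r S) :=
  NormedAddCommGroup.induced (DiffOp n r S) (JetSpace n r S) (DiffOp.jet n r S) DiffOp.jet_injective

noncomputable instance : NormedSpace ℝ (DiffOp n r S) :=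
  NormedSpace.induced ℝ (DiffOp n r S) (JetSpace n r S) (DiffOp.jet n r S)

end

section

variable {n r : ℕ} {S : Type*} [TopologicalSpace S] [ChartedSpace (Rn n) S]

/-- The operator `L u = a^{ij} u_{ij} + b^i u_i + c u` acting on functions on `S`; at each point
it is computed in the preferred chart there (for `u` of class `C²` any chart gives the same). -/
noncomputable def DiffOp.op (A : DiffOp n r S) (u : S → ℝ) (p : S) : ℝ :=
  (A.coef p (chartAt (Rn n) p p)).eval (u ∘ (chartAt (Rn n) p).symm) (chartAt (Rn n) p p)

/-- `(a^{ij})` is (symmetric and) positive definite in every chart, at every point. -/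
def DiffOp.IsElliptic (A : DiffOp n r S) : Prop :=
  ∀ x : S, ∀ y ∈ (chartAt (Rn n) x).target, (Matrix.of (A.coef x y).1).PosDef

/-- `ν` is a volume measure on `S`: in every chart it has a positive continuous density with
respect to Lebesgue measure. -/
def IsVolumeMeasure (n : ℕ) {S : Type*} [TopologicalSpace S] [ChartedSpace (Rn n) S]
    [MeasurableSpace S] (ν : Measure S) : Prop :=
  ∀ x : S, ∃ ρ : Rn n → ℝ, ContinuousOn ρ (chartAt (Rn n) x).target ∧
    (∀ y ∈ (chartAt (Rn n) x).target, 0 < ρ y) ∧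
    ∀ s ⊆ (chartAt (Rn n) x).source, MeasurableSet s →
      ν s = ∫⁻ y in chartAt (Rn n) x '' s, ENNReal.ofReal (ρ y)

/-- `L` is (formally) self-adjoint with respect to `ν`:
`∫ (L u) v dν = ∫ u (L v) dν` for all `u, v` of class `C²`. -/
def DiffOp.IsSelfAdjointWrt [MeasurableSpace S] (A : DiffOp n r S) (ν : Measure S) : Prop :=
  ∀ u v : S → ℝ, ContMDiff (𝓡 n) 𝓘(ℝ, ℝ) 2 u → ContMDiff (𝓡 n) 𝓘(ℝ, ℝ) 2 v →
    ∫ p, A.op u p * v p ∂ν = ∫ p, u p * A.op v p ∂ν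

/-- Smooth test functions with compact support in `Ω ⊆ ℝⁿ`. -/
def IsTest {n : ℕ} (Ω : Set (Rn n)) (ψ : Rn n → ℝ) : Prop :=
  ContDiff ℝ ∞ ψ ∧ HasCompactSupport ψ ∧ tsupport ψ ⊆ Ω

/-- `w ∈ L²_loc(Ω)`. -/
def MemL2Loc {n : ℕ} (Ω : Set (Rn n)) (w : Rn n → ℝ) : Prop :=
  ∀ K ⊆ Ω, IsCompact K → MemLp w 2 (volume.restrict K)

/-- `g ∈ L²_loc(Ω; ℝⁿ)` is the weak gradient of `w` on `Ω`. -/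
def IsWeakGradient {n : ℕ} (Ω : Set (Rn n)) (w : Rn n → ℝ) (g : Fin n → Rn n → ℝ) : Prop :=
  ∀ i, MemL2Loc Ω (g i) ∧
    ∀ ψ, IsTest Ω ψ → ∫ y, w y * pd i ψ y = - ∫ y, g i y * ψ y

/-- `φ ∈ H¹(S)`, for a compact manifold `S`: in every chart, `φ` is in `L²_loc` and has a weak
gradient in `L²_loc`. -/
def MemH1 (n : ℕ) {S : Type*} [TopologicalSpace S] [ChartedSpace (Rn n) S] (φ : S → ℝ) : Prop :=
  ∀ x : S, MemL2Loc (chartAt (Rn n) x).target (φ ∘ (chartAt (Rn n) x).symm) ∧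
    ∃ g, IsWeakGradient (chartAt (Rn n) x).target (φ ∘ (chartAt (Rn n) x).symm) g

/-- `L φ = f` in the weak sense, for `φ ∈ H¹`: in every chart and for every test function `ψ`,
`∫ (- ∂_iφ ∂_j(a^{ij} ψ) + b^i ∂_iφ ψ + c φ ψ) = ∫ f ψ`, with `∂_iφ` the weak derivatives. -/
def DiffOp.IsWeakSolution (A : DiffOp n r S) (φ f : S → ℝ) : Prop :=
  ∀ x : S, ∃ g, IsWeakGradient (chartAt (Rn n) x).target (φ ∘ (chartAt (Rn n) x).symm) g ∧
    ∀ ψ, IsTest (chartAt (Rn n) x).target ψ →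
      ∫ y, (-(∑ i, ∑ j, g i y * pd j (fun z => (A.coef x z).1 i j * ψ z) y)
          + (∑ i, (A.coef x y).2.1 i * g i y * ψ y)
          + (A.coef x y).2.2 * φ ((chartAt (Rn n) x).symm y) * ψ y)
        = ∫ y, f ((chartAt (Rn n) x).symm y) * ψ y

/-- `μ` is the first eigenvalue of `L`: `L φ = - μ φ` for some `φ ∈ H¹(S) ∩ C⁰(S)` with
`φ > 0`. -/
def DiffOp.IsFirstEigenvalue (A : DiffOp n r S) (μ : ℝ) : Prop :=
  ∃ φ : S → ℝ, MemH1 n φ ∧ Continuous φ ∧ (∀ p, 0 < φ p) ∧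
    A.IsWeakSolution φ (fun p => -μ * φ p)

end

end FirstEigenvalue

open MeasureTheory Filter Topology
open scoped Manifold ContDiff
open Finset (sum_congr sum_nonneg sum_le_sum sum_comm mul_sum sum_mul sum_add_distrib univ
  mem_univ abs_sum_le_sum_abs single_le_sum sum_sub_distrib sum_neg_distrib)
open _root_.ContinuousMap (evalCLM)
open _root_.ContinuousMap renaming smul_apply → smul_at, sub_apply → sub_at, one_apply → one_at,
  mul_apply → mul_at, neg_apply → neg_at
open Real (exp exp_pos norm_eq_abs)
open Function (comp_apply comp_def)
open Set (Icc)

namespace FirstEigenvalue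

variable {n r : ℕ} {S : Type*} [TopologicalSpace S] [ChartedSpace (Rn n) S]

/-- Real functions of class `C^m` on a manifold of dimension `d`. -/
notation:max "SmoothFn[" d "]" => ContMDiff (𝓡 d) 𝓘(ℝ, ℝ)

/-- The preferred chart at a point of a manifold of dimension `d`. -/
notation:max "ch" d:max => chartAt (Rn d)

theorem sum_sum_congr {ι κ : Type*} [Fintype ι] [Fintype κ] {f g : ι → κ → ℝ}
    (h : ∀ i j, f i j = g i j) : ∑ i, ∑ j, f i j = ∑ i, ∑ j, g i j :=
  sum_congr rfl fun i _ => sum_congr rfl fun j _ => h i j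

theorem pd_congr {i : Fin n} {w v : Rn n → ℝ} {y : Rn n} (h : w =ᶠ[𝓝 y] v) :
    pd i w y = pd i v y := by
  simp only [pd, h.fderiv_eq]

theorem pd_eventuallyEq {i : Fin n} {w v : Rn n → ℝ} {y : Rn n} (h : w =ᶠ[𝓝 y] v) :
    pd i w =ᶠ[𝓝 y] pd i v :=
  h.eventuallyEq_nhds.mono fun _ h => pd_congr h

theorem pd_const (i : Fin n) (s : ℝ) (y : Rn n) : pd i (fun _ => s) y = 0 := by
  simp [pd]

theorem pd_add {i : Fin n} {w v : Rn n → ℝ} {y : Rn n} (hw : DifferentiableAt ℝ w y)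
    (hv : DifferentiableAt ℝ v y) : pd i (fun z => w z + v z) y = pd i w y + pd i v y := by
  simp only [pd, fderiv_fun_add hw hv, _root_.add_apply]

theorem pd_sub {i : Fin n} {w v : Rn n → ℝ} {y : Rn n} (hw : DifferentiableAt ℝ w y)
    (hv : DifferentiableAt ℝ v y) : pd i (fun z => w z - v z) y = pd i w y - pd i v y := by
  simp only [pd, fderiv_fun_sub hw hv, _root_.sub_apply]

theorem pd_mul {i : Fin n} {w v : Rn n → ℝ} {y : Rn n} (hw : DifferentiableAt ℝ w y)
    (hv : DifferentiableAt ℝ v y) :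
    pd i (fun z => w z * v z) y = w y * pd i v y + v y * pd i w y := by
  simp only [pd, fderiv_fun_mul hw hv, _root_.add_apply,
    _root_.smul_apply, smul_eq_mul]

theorem pd_const_mul {i : Fin n} {w : Rn n → ℝ} {y : Rn n} (s : ℝ)
    (hw : DifferentiableAt ℝ w y) : pd i (fun z => s * w z) y = s * pd i w y := by
  rw [pd_mul (differentiableAt_const s) hw, pd_const]; ring

theorem pd_sum {ι : Type*} (t : Finset ι) {i : Fin n} {w : ι → Rn n → ℝ} {y : Rn n}
    (hw : ∀ j ∈ t, DifferentiableAt ℝ (w j) y) :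
    pd i (fun z => ∑ j ∈ t, w j z) y = ∑ j ∈ t, pd i (w j) y := by
  simp only [pd, fderiv_fun_sum hw, _root_.sum_apply]

theorem pd_coord (i k : Fin n) (y : Rn n) :
    pd i (fun z : Rn n => z k) y = if i = k then 1 else 0 := by
  have h : HasFDerivAt (fun z : Rn n => z k) (EuclideanSpace.proj (𝕜 := ℝ) k : Rn n →L[ℝ] ℝ) y :=
    (EuclideanSpace.proj (𝕜 := ℝ) k : Rn n →L[ℝ] ℝ).hasFDerivAt
  simp only [pd, h.fderiv, PiLp.proj_apply, PiLp.single_apply]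
  simp [eq_comm]

theorem contDiffAt_pd {m k : WithTop ℕ∞} {w : Rn n → ℝ} {y : Rn n} (i : Fin n)
    (hw : ContDiffAt ℝ k w y) (hk : m + 1 ≤ k) : ContDiffAt ℝ m (pd i w) y :=
  (hw.fderiv_right hk).clm_apply contDiffAt_const

theorem contDiff_pd {m k : WithTop ℕ∞} {w : Rn n → ℝ} (i : Fin n)
    (hw : ContDiff ℝ k w) (hk : m + 1 ≤ k) : ContDiff ℝ m (pd i w) :=
  contDiff_iff_contDiffAt.2 fun _ => contDiffAt_pd i hw.contDiffAt hk

theorem contDiffOn_pd {m k : WithTop ℕ∞} {w : Rn n → ℝ} {Ω : Set (Rn n)} (hΩ : IsOpen Ω)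
    (i : Fin n) (hw : ContDiffOn ℝ k w Ω) (hk : m + 1 ≤ k) : ContDiffOn ℝ m (pd i w) Ω :=
  fun _ hy => (contDiffAt_pd i (hw.contDiffAt (hΩ.mem_nhds hy)) hk).contDiffWithinAt

theorem sum_smul_single (v : Rn n) : v = ∑ i, v i • EuclideanSpace.single i (1 : ℝ) := by
  ext j
  simp [Pi.single_apply]

theorem fderiv_apply_eq_sum (w : Rn n → ℝ) (y v : Rn n) :
    fderiv ℝ w y v = ∑ i, v i * pd i w y := by
  conv_lhs => rw [sum_smul_single v]
  simp [pd]

theorem tsupport_pd_subset (i : Fin n) (w : Rn n → ℝ) : tsupport (pd i w) ⊆ tsupport w :=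
  closure_minimal (fun y hy => by
    by_contra h
    apply hy
    have : w =ᶠ[𝓝 y] fun _ => 0 := notMem_tsupport_iff_eventuallyEq.1 h
    rw [pd_congr this, pd_const]) (isClosed_tsupport _)

theorem contDiffAt_coord {m : WithTop ℕ∞} {τ : Rn n → Rn n} {y : Rn n} (h : ContDiffAt ℝ m τ y)
    (k : Fin n) : ContDiffAt ℝ m (fun z => τ z k) y :=
  ((EuclideanSpace.proj (𝕜 := ℝ) k : Rn n →L[ℝ] ℝ).contDiff.contDiffAt).comp y h

theorem pd_comp {w : Rn n → ℝ} {τ : Rn n → Rn n} {y : Rn n} (j : Fin n)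
    (hw : DifferentiableAt ℝ w (τ y)) (hτ : DifferentiableAt ℝ τ y) :
    pd j (w ∘ τ) y = ∑ k, pd k w (τ y) * pd j (fun z => τ z k) y := by
  have h1 : ∀ k, pd j (fun z => τ z k) y = (fderiv ℝ τ y (EuclideanSpace.single j 1)) k := by
    intro k
    have : HasFDerivAt (fun z => τ z k)
        ((EuclideanSpace.proj (𝕜 := ℝ) k : Rn n →L[ℝ] ℝ).comp (fderiv ℝ τ y)) y :=
      ((EuclideanSpace.proj (𝕜 := ℝ) k : Rn n →L[ℝ] ℝ).hasFDerivAt).comp y hτ.hasFDerivAt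
    simp [pd, this.fderiv]
  rw [pd, fderiv_comp y hw hτ, ContinuousLinearMap.comp_apply, fderiv_apply_eq_sum]
  exact sum_congr rfl fun k _ => by rw [h1, mul_comm]

theorem pd_pd_mul {u v : Rn n → ℝ} {y : Rn n} (hu : ContDiffAt ℝ 2 u y)
    (hv : ContDiffAt ℝ 2 v y) (i j : Fin n) :
    pd i (pd j (fun z => u z * v z)) y = u y * pd i (pd j v) y + v y * pd i (pd j u) y
      + pd i u y * pd j v y + pd i v y * pd j u y := by
  have hu1 := hu.eventually (by simp)
  have hv1 := hv.eventually (by simp)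
  have h : pd j (fun z => u z * v z) =ᶠ[𝓝 y] fun z => u z * pd j v z + v z * pd j u z := by
    filter_upwards [hu1, hv1] with z hz hz'
    exact pd_mul (hz.differentiableAt (by simp)) (hz'.differentiableAt (by simp))
  have du := hu.differentiableAt (by simp)
  have dv := hv.differentiableAt (by simp)
  have dju := (contDiffAt_pd (m := 1) j hu (by norm_num)).differentiableAt (by simp)
  have djv := (contDiffAt_pd (m := 1) j hv (by norm_num)).differentiableAt (by simp)
  rw [pd_congr h, pd_add (du.fun_mul djv) (dv.fun_mul dju), pd_mul du djv, pd_mul dv dju]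
  ring

namespace Coef

theorem eval_congr (A : Coef n) {w v : Rn n → ℝ} {y : Rn n} (h : w =ᶠ[𝓝 y] v) :
    A.eval w y = A.eval v y := by
  simp only [eval, h.eq_of_nhds, pd_congr h, pd_congr (pd_eventuallyEq h)]

theorem add_eval (A A' : Coef n) (w : Rn n → ℝ) (y : Rn n) :
    (A + A').eval w y = A.eval w y + A'.eval w y := by
  simp only [eval, Prod.fst_add, Prod.snd_add, Pi.add_apply, add_mul, sum_add_distrib]
  ring

theorem smul_eval (s : ℝ) (A : Coef n) (w : Rn n → ℝ) (y : Rn n) :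
    (s • A).eval w y = s * A.eval w y := by
  simp only [eval, Prod.smul_fst, Prod.smul_snd, Pi.smul_apply, smul_eq_mul, mul_assoc,
    mul_add, mul_sum]

theorem eval_add (A : Coef n) {u v : Rn n → ℝ} {y : Rn n} (hu : ContDiffAt ℝ 2 u y)
    (hv : ContDiffAt ℝ 2 v y) : A.eval (fun z => u z + v z) y = A.eval u y + A.eval v y := by
  have hu1 := hu.eventually (by simp)
  have hv1 := hv.eventually (by simp)
  have h : ∀ j, pd j (fun z => u z + v z) =ᶠ[𝓝 y] fun z => pd j u z + pd j v z := by
    intro j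
    filter_upwards [hu1, hv1] with z hz hz'
    exact pd_add (hz.differentiableAt (by simp)) (hz'.differentiableAt (by simp))
  have du := hu.differentiableAt (by simp)
  have dv := hv.differentiableAt (by simp)
  have dju := fun j => (contDiffAt_pd (m := 1) j hu (by norm_num)).differentiableAt (by simp)
  have djv := fun j => (contDiffAt_pd (m := 1) j hv (by norm_num)).differentiableAt (by simp)
  simp only [eval, pd_congr (h _), pd_add (dju _) (djv _), pd_add du dv, mul_add,
    sum_add_distrib]
  ring

theorem eval_const (A : Coef n) (s : ℝ) (y : Rn n) : A.eval (fun _ => s) y = A.2.2 * s := by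
  have h : ∀ i : Fin n, pd i (fun _ : Rn n => s) = fun _ => 0 := fun i => funext (pd_const i s)
  simp [eval, h, pd_const]

theorem eval_mul (A : Coef n) {u v : Rn n → ℝ} {y : Rn n} (hu : ContDiffAt ℝ 2 u y)
    (hv : ContDiffAt ℝ 2 v y) : A.eval (fun z => u z * v z) y =
      u y * A.eval v y + v y * A.eval u y - A.2.2 * (u y * v y)
      + ∑ i, ∑ j, A.1 i j * (pd i u y * pd j v y + pd i v y * pd j u y) := by
  have du := hu.differentiableAt (by simp)
  have dv := hv.differentiableAt (by simp)
  have e1 : ∑ i, ∑ j, A.1 i j * pd i (pd j (fun z => u z * v z)) y =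
      u y * (∑ i, ∑ j, A.1 i j * pd i (pd j v) y) + v y * (∑ i, ∑ j, A.1 i j * pd i (pd j u) y)
      + ∑ i, ∑ j, A.1 i j * (pd i u y * pd j v y + pd i v y * pd j u y) := by
    simp only [mul_sum, ← sum_add_distrib]
    refine sum_sum_congr fun i j => ?_
    rw [pd_pd_mul hu hv]; ring
  have e2 : ∑ i, A.2.1 i * pd i (fun z => u z * v z) y =
      u y * (∑ i, A.2.1 i * pd i v y) + v y * (∑ i, A.2.1 i * pd i u y) := by
    simp only [mul_sum, ← sum_add_distrib]
    refine sum_congr rfl fun i _ => ?_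
    rw [pd_mul du dv]; ring
  simp only [eval, e1, e2]
  ring

theorem eval_const_mul (A : Coef n) (s : ℝ) {u : Rn n → ℝ} {y : Rn n}
    (hu : ContDiffAt ℝ 2 u y) : A.eval (fun z => s * u z) y = s * A.eval u y := by
  rw [eval_mul A contDiffAt_const hu, eval_const]
  simp only [pd_const]
  simp
  ring

theorem eval_comp (A : Coef n) {w : Rn n → ℝ} {τ : Rn n → Rn n} {y : Rn n}
    (hw : ContDiffAt ℝ 2 w (τ y)) (hτ : ContDiffAt ℝ 2 τ y) :
    (change τ y A).eval w (τ y) = A.eval (w ∘ τ) y := by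
  have hw1 := hτ.continuousAt.eventually (hw.eventually (by simp))
  have hτ1 := hτ.eventually (by simp)
  have h : ∀ j, pd j (w ∘ τ) =ᶠ[𝓝 y]
      fun z => ∑ k, (pd k w ∘ τ) z * pd j (fun z => τ z k) z := by
    intro j
    filter_upwards [hw1, hτ1] with z hz hz'
    exact pd_comp j (hz.differentiableAt (by simp)) (hz'.differentiableAt (by simp))
  have dτ := hτ.differentiableAt (by simp)
  have dw := hw.differentiableAt (by simp)
  have djw := fun j => (contDiffAt_pd (m := 1) j hw (by norm_num)).differentiableAt (by simp)
  have djτ := fun j k => (contDiffAt_pd (m := 1) j (contDiffAt_coord hτ k)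
    (by norm_num)).differentiableAt (by simp)
  have h2 : ∀ i j, pd i (pd j (w ∘ τ)) y =
      ∑ k, (pd k w (τ y) * pd i (pd j (fun z => τ z k)) y
        + ∑ l, pd l (pd k w) (τ y) * (pd i (fun z => τ z l) y * pd j (fun z => τ z k) y)) := by
    intro i j
    rw [pd_congr (h j), pd_sum]
    · refine sum_congr rfl fun k _ => ?_
      rw [pd_mul ((djw k).comp y dτ) (djτ j k), pd_comp i (djw k) dτ, mul_sum]
      simp only [Function.comp]
      congr 1
      exact sum_congr rfl fun l _ => by ring
    · exact fun k _ => ((djw k).comp y dτ).mul (djτ j k)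
  simp only [eval, change, h2, pd_comp _ dw dτ, Function.comp]
  simp only [sum_add_distrib, mul_sum, mul_add, sum_mul, add_mul]
  have e1 : ∑ k, ∑ l, ∑ i, ∑ j, A.1 i j * (pd i (fun z => τ z k) y * pd j (fun z => τ z l) y)
      * pd k (pd l w) (τ y) = ∑ i, ∑ j, ∑ k, ∑ l, A.1 i j *
      (pd l (pd k w) (τ y) * (pd i (fun z => τ z l) y * pd j (fun z => τ z k) y)) := by
    have : ∀ k, ∑ l, ∑ i, ∑ j, A.1 i j * (pd i (fun z => τ z k) y * pd j (fun z => τ z l) y)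
      * pd k (pd l w) (τ y) = ∑ i, ∑ j, ∑ l, A.1 i j * (pd i (fun z => τ z k) y *
        pd j (fun z => τ z l) y) * pd k (pd l w) (τ y) := by
      intro k
      rw [sum_comm]
      exact sum_congr rfl fun i _ => sum_comm
    rw [sum_congr rfl fun k _ => this k, sum_comm]
    refine sum_congr rfl fun i _ => ?_
    rw [sum_comm]
    refine sum_congr rfl fun j _ => ?_
    rw [sum_comm]
    exact sum_sum_congr fun k l => by ring
  have e2 : ∑ k, ∑ i, ∑ j, A.1 i j * pd i (pd j (fun z => τ z k)) y * pd k w (τ y) =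
      ∑ i, ∑ j, ∑ k, A.1 i j * (pd k w (τ y) * pd i (pd j (fun z => τ z k)) y) := by
    rw [sum_comm]
    refine sum_congr rfl fun i _ => ?_
    rw [sum_comm]
    exact sum_sum_congr fun j l => by ring
  have e3 : ∑ k, ∑ i, A.2.1 i * pd i (fun z => τ z k) y * pd k w (τ y) =
      ∑ i, ∑ k, A.2.1 i * (pd k w (τ y) * pd i (fun z => τ z k) y) := by
    rw [sum_comm]
    exact sum_sum_congr fun j l => by ring
  rw [e1, e2, e3]
  ring

end Coef

open scoped MatrixOrder Matrix.Norms.L2Operator in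
theorem exists_eq_conjTranspose_mul_self {a : Matrix (Fin n) (Fin n) ℝ} (ha : a.PosSemidef) :
    ∃ b : Matrix (Fin n) (Fin n) ℝ, a = b.conjTranspose * b :=
  CStarAlgebra.nonneg_iff_eq_star_mul_self.mp ha.nonneg

/-- The second derivatives of a function at a local minimum. -/
theorem sum_pd_pd_nonneg_of_isLocalMin {w : Rn n → ℝ} {y : Rn n} (hw : ContDiffAt ℝ 2 w y)
    (hmin : IsLocalMin w y) {a : Fin n → Fin n → ℝ} (ha : (Matrix.of a).PosSemidef) :
    0 ≤ ∑ i, ∑ j, a i j * pd i (pd j w) y := by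
  set D := fderiv ℝ (fderiv ℝ w) y with hD
  have hw1 : ∀ᶠ z in 𝓝 y, ContDiffAt ℝ 2 w z := hw.eventually (by simp)
  have hDw : DifferentiableAt ℝ (fderiv ℝ w) y :=
    (hw.fderiv_right (m := 1) (by norm_num)).differentiableAt (by simp)
  have hpd : ∀ i j, pd i (pd j w) y = D (EuclideanSpace.single i 1) (EuclideanSpace.single j 1) := by
    intro i j
    have : HasFDerivAt (pd j w) ((ContinuousLinearMap.apply ℝ ℝ
        (EuclideanSpace.single j (1 : ℝ))).comp D) y :=
      (ContinuousLinearMap.apply ℝ ℝ (EuclideanSpace.single j (1 : ℝ))).hasFDerivAt.comp y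
        hDw.hasFDerivAt
    rw [pd, this.fderiv]; rfl
  have key : ∀ ξ : Rn n, 0 ≤ D ξ ξ := by
    intro ξ
    by_contra hneg
    push Not at hneg
    set l : ℝ → Rn n := fun t => y + t • ξ with hl
    have hl' : ∀ t, HasDerivAt l ξ t := fun t => by
      
      have h := ((hasDerivAt_id t).smul_const ξ).const_add y
      rwa [one_smul] at h
    have hl0 : l 0 = y := by simp [hl]
    have hlc : Tendsto l (𝓝 0) (𝓝 y) := by
      have := (hl' 0).continuousAt.tendsto; rwa [hl0] at this
    have hd : deriv (w ∘ l) =ᶠ[𝓝 0] fun t => fderiv ℝ w (l t) ξ := by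
      filter_upwards [hlc.eventually hw1] with t ht
      exact ((ht.differentiableAt (by simp)).hasFDerivAt.comp_hasDerivAt t (hl' t)).deriv
    have hdd : deriv (deriv (w ∘ l)) 0 = D ξ ξ := by
      rw [hd.deriv_eq]
      have hDw' : HasFDerivAt (fderiv ℝ w) D (l 0) := by rw [hl0]; exact hDw.hasFDerivAt
      have := (hDw'.comp_hasDerivAt 0 (hl' 0)).clm_apply (hasDerivAt_const (0 : ℝ) ξ)
      simpa using this.deriv
    have hminl : IsLocalMin (w ∘ l) 0 := by
      have : ∀ᶠ t in 𝓝 (0 : ℝ), w y ≤ w (l t) := hlc.eventually hmin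
      filter_upwards [this] with t ht
      simpa [hl0] using ht
    have hd0 : deriv (w ∘ l) 0 = 0 := hminl.deriv_eq_zero
    have hcont : ContinuousAt (w ∘ l) 0 := by
      apply ContinuousAt.comp
      · rw [hl0]; exact hw.continuousAt
      · exact (hl' 0).continuousAt
    have hmax := isLocalMax_of_deriv_deriv_neg (by rw [hdd]; exact hneg) hd0 hcont
    have hc : (w ∘ l) =ᶠ[𝓝 0] fun _ => (w ∘ l) 0 := by
      filter_upwards [hminl, hmax] with t h1 h2
      exact le_antisymm h2 h1
    have : deriv (deriv (w ∘ l)) 0 = 0 := by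
      rw [hc.deriv.deriv_eq]; simp
    rw [hdd] at this
    exact hneg.ne this
  obtain ⟨b, hb⟩ := exists_eq_conjTranspose_mul_self ha
  have hab : ∀ i j, a i j = ∑ k, b k i * b k j := by
    intro i j
    have := congrFun (congrFun hb i) j
    simpa [Matrix.mul_apply, Matrix.conjTranspose_apply] using this
  have : ∑ i, ∑ j, a i j * pd i (pd j w) y =
      ∑ k, D (∑ i, b k i • EuclideanSpace.single i 1) (∑ j, b k j • EuclideanSpace.single j 1) := by
    simp only [hab, hpd, map_sum, map_smul, _root_.sum_apply,
      _root_.smul_apply, smul_eq_mul, sum_mul, mul_sum]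
    conv_rhs => rw [sum_comm]
    rw [sum_comm]
    refine sum_congr rfl fun j _ => ?_
    rw [sum_comm]
    exact sum_sum_congr fun k i => by ring
  rw [this]
  exact sum_nonneg fun k _ => key _

theorem pd_eq_zero_of_isLocalMin {w : Rn n → ℝ} {y : Rn n} (hmin : IsLocalMin w y) (i : Fin n) :
    pd i w y = 0 := by
  simp [pd, hmin.fderiv_eq_zero]

theorem Coef.eval_ge_of_isLocalMin (A : Coef n) (hA : (Matrix.of A.1).PosSemidef)
    {w : Rn n → ℝ} {y : Rn n} (hw : ContDiffAt ℝ 2 w y) (hmin : IsLocalMin w y) :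
    A.2.2 * w y ≤ A.eval w y := by
  have := sum_pd_pd_nonneg_of_isLocalMin hw hmin hA
  simp only [eval, pd_eq_zero_of_isLocalMin hmin]
  simpa using this

theorem contDiff_of_tsupport_subset {E : Type*} [NormedAddCommGroup E] [NormedSpace ℝ E]
    {m : WithTop ℕ∞} {F : Rn n → E} {Ω : Set (Rn n)}
    (hΩ : IsOpen Ω) (hF : ContDiffOn ℝ m F Ω) (h : tsupport F ⊆ Ω) : ContDiff ℝ m F :=
  contDiff_iff_contDiffAt.2 fun y => by
    by_cases hy : y ∈ tsupport F
    · exact hF.contDiffAt (hΩ.mem_nhds (h hy))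
    · exact (contDiffAt_const (c := (0 : E))).congr_of_eventuallyEq
        (notMem_tsupport_iff_eventuallyEq.1 hy)

theorem integral_pd_eq_zero {F : Rn n → ℝ} (hF : ContDiff ℝ 1 F) (hc : HasCompactSupport F)
    (i : Fin n) : ∫ y, pd i F y = 0 := by
  have h1 : Integrable F := hF.continuous.integrable_of_hasCompactSupport hc
  have h2 : Integrable (pd i F) := by
    refine (contDiff_pd (m := 0) i hF (by simp)).continuous.integrable_of_hasCompactSupport ?_
    exact hc.mono' ((subset_tsupport _).trans (tsupport_pd_subset i F))
  have := integral_mul_fderiv_eq_neg_fderiv_mul_of_integrable (μ := volume) (𝕜 := ℝ)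
    (f := fun _ : Rn n => (1 : ℝ)) (g := F) (v := EuclideanSpace.single i (1 : ℝ))
    (by simp) (by simp only [one_mul]; exact h2) (by simpa using h1)
    (fun _ _ => differentiableAt_const _) (fun x _ => hF.differentiable (by simp) x)
  simpa [pd] using this

/-- Integration by parts on an open set, one factor having compact support in it. -/
theorem integral_pd_mul {Ω : Set (Rn n)} (hΩ : IsOpen Ω) {w ζ : Rn n → ℝ}
    (hw : ContDiffOn ℝ 1 w Ω) (hζ : ContDiffOn ℝ 1 ζ Ω) (hc : HasCompactSupport ζ)
    (hs : tsupport ζ ⊆ Ω) (i : Fin n) :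
    ∫ y, pd i w y * ζ y = - ∫ y, w y * pd i ζ y := by
  have hF : ContDiff ℝ 1 (fun y => w y * ζ y) :=
    contDiff_of_tsupport_subset hΩ (hw.mul hζ) ((tsupport_mul_subset_right).trans hs)
  have hFc : HasCompactSupport (fun y => w y * ζ y) := hc.mul_left
  have hζ' : ContDiff ℝ 1 ζ := contDiff_of_tsupport_subset hΩ hζ hs
  have e : ∀ y, pd i (fun y => w y * ζ y) y = w y * pd i ζ y + pd i w y * ζ y := by
    intro y
    by_cases hy : y ∈ tsupport ζ
    · rw [pd_mul ((hw.contDiffAt (hΩ.mem_nhds (hs hy))).differentiableAt (by simp))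
        (hζ'.differentiable (by simp) y)]
      ring
    · have h0 : ζ =ᶠ[𝓝 y] fun _ => 0 := notMem_tsupport_iff_eventuallyEq.1 hy
      have h1 : (fun y => w y * ζ y) =ᶠ[𝓝 y] fun _ => 0 := by
        filter_upwards [h0] with z hz; simp [hz]
      rw [pd_congr h0, pd_congr h1, h0.eq_of_nhds]
      simp [pd_const]
  have i1 : Integrable (fun y => w y * pd i ζ y) := by
    refine Continuous.integrable_of_hasCompactSupport ?_ ?_
    · refine (contDiff_of_tsupport_subset (m := 0) hΩ ((hw.of_le (by simp)).mul
        (contDiffOn_pd hΩ i hζ (by simp))) ?_).continuous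
      exact (tsupport_mul_subset_right).trans ((tsupport_pd_subset i ζ).trans hs)
    · exact (hc.mono' ((subset_tsupport _).trans (tsupport_pd_subset i ζ))).mul_left
  have i2 : Integrable (fun y => pd i w y * ζ y) := by
    refine Continuous.integrable_of_hasCompactSupport ?_ hc.mul_left
    exact (contDiff_of_tsupport_subset (m := 0) hΩ ((contDiffOn_pd hΩ i hw (by simp)).mul
        (hζ.of_le (by simp))) ((tsupport_mul_subset_right).trans hs)).continuous
  have := integral_pd_eq_zero hF hFc i
  simp only [e] at this
  rw [integral_add i1 i2] at this
  linarith

theorem two_le_infty : (2 : WithTop ℕ∞) ≤ ∞ :=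
  WithTop.coe_le_coe.2 (le_top : (2 : ℕ∞) ≤ ⊤)

theorem one_le_infty : (1 : WithTop ℕ∞) ≤ ∞ := by
  exact_mod_cast (le_top : ((1 : ℕ∞)) ≤ ⊤)

section Charts

theorem contDiffOn_comp_chart_symm [IsManifold (𝓡 n) ∞ S] {m : WithTop ℕ∞} (hm : m ≤ ∞)
    {u : S → ℝ} (hu : SmoothFn[n] m u) (x : S) :
    ContDiffOn ℝ m (u ∘ (ch n x).symm) (ch n x).target := by
  rw [← contMDiffOn_iff_contDiffOn]
  exact hu.comp_contMDiffOn ((contMDiffOn_chart_symm (I := 𝓡 n) (n := ∞) (x := x)).of_le hm)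

theorem contDiffAt_comp_chart_symm [IsManifold (𝓡 n) ∞ S] {m : WithTop ℕ∞} (hm : m ≤ ∞)
    {u : S → ℝ} (hu : SmoothFn[n] m u) (x : S) {y : Rn n}
    (hy : y ∈ (ch n x).target) :
    ContDiffAt ℝ m (u ∘ (ch n x).symm) y :=
  (contDiffOn_comp_chart_symm hm hu x).contDiffAt ((ch n x).open_target.mem_nhds hy)

theorem contDiffAt_transition [IsManifold (𝓡 n) ∞ S] (x x' : S) {p : S}
    (hp : p ∈ (ch n x).source) (hp' : p ∈ (ch n x').source) :
    ContDiffAt ℝ ∞ (ch n x' ∘ (ch n x).symm) (ch n x p) := by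
  rw [← contMDiffAt_iff_contDiffAt]
  have h1 : ContMDiffAt (𝓡 n) (𝓡 n) ∞ (ch n x') p :=
    (contMDiffOn_chart (I := 𝓡 n) (n := ∞) (x := x')).contMDiffAt
      ((ch n x').open_source.mem_nhds hp')
  have h2 : ContMDiffAt (𝓡 n) (𝓡 n) ∞ (ch n x).symm (ch n x p) :=
    (contMDiffOn_chart_symm (I := 𝓡 n) (n := ∞) (x := x)).contMDiffAt
      ((ch n x).open_target.mem_nhds ((ch n x).map_source hp))
  refine ContMDiffAt.comp _ ?_ h2
  rw [(ch n x).left_inv hp]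
  exact h1

/-- The function on the manifold which is `w` in the chart at `x`, and zero outside of it. -/
noncomputable def extendChart (x : S) (w : Rn n → ℝ) : S → ℝ :=
  (ch n x).source.indicator (w ∘ ch n x)

theorem extendChart_of_mem {x p : S} (w : Rn n → ℝ) (hp : p ∈ (ch n x).source) :
    extendChart x w p = w (ch n x p) :=
  Set.indicator_of_mem hp _

theorem extendChart_symm {x : S} (w : Rn n → ℝ) {y : Rn n}
    (hy : y ∈ (ch n x).target) :
    extendChart x w ((ch n x).symm y) = w y := by
  rw [extendChart_of_mem w ((ch n x).map_target hy), (ch n x).right_inv hy]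

theorem extendChart_of_notMem {x p : S} (w : Rn n → ℝ) (hp : p ∉ (ch n x).source) :
    extendChart x w p = 0 :=
  Set.indicator_of_notMem hp _

theorem tsupport_extendChart [T2Space S] {x : S} {w : Rn n → ℝ} (hc : HasCompactSupport w)
    (hs : tsupport w ⊆ (ch n x).target) :
    tsupport (extendChart x w) ⊆ (ch n x).symm '' tsupport w := by
  apply closure_minimal
  · intro p hp
    by_cases hpx : p ∈ (ch n x).source
    · rw [Function.mem_support, extendChart_of_mem w hpx] at hp
      exact ⟨_, subset_tsupport _ hp, (ch n x).left_inv hpx⟩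
    · exact absurd (extendChart_of_notMem w hpx) hp
  · exact (hc.isCompact.image_of_continuousOn
      ((ch n x).continuousOn_symm.mono hs)).isClosed

theorem tsupport_extendChart_subset_source [T2Space S] {x : S} {w : Rn n → ℝ}
    (hc : HasCompactSupport w) (hs : tsupport w ⊆ (ch n x).target) :
    tsupport (extendChart x w) ⊆ (ch n x).source :=
  (tsupport_extendChart hc hs).trans (by
    rintro _ ⟨y, hy, rfl⟩
    exact (ch n x).map_target (hs hy))

theorem contMDiff_extendChart [IsManifold (𝓡 n) ∞ S] [T2Space S] {m : WithTop ℕ∞} (hm : m ≤ ∞)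
    {x : S} {w : Rn n → ℝ}
    (hw : ContDiffOn ℝ m w (ch n x).target) (hc : HasCompactSupport w)
    (hs : tsupport w ⊆ (ch n x).target) :
    SmoothFn[n] m (extendChart x w) := by
  intro p
  by_cases hp : p ∈ (ch n x).source
  · have hpt := (ch n x).map_source hp
    have h1 : ContMDiffAt (𝓡 n) 𝓘(ℝ, ℝ) m w (ch n x p) :=
      contMDiffAt_iff_contDiffAt.2
        (hw.contDiffAt ((ch n x).open_target.mem_nhds hpt))
    have h2 : ContMDiffAt (𝓡 n) (𝓡 n) m (ch n x) p :=
      ((contMDiffOn_chart (I := 𝓡 n) (n := ∞) (x := x)).contMDiffAt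
        ((ch n x).open_source.mem_nhds hp)).of_le hm
    refine (h1.comp p h2).congr_of_eventuallyEq ?_
    filter_upwards [(ch n x).open_source.mem_nhds hp] with q hq
    exact extendChart_of_mem w hq
  · have : p ∉ tsupport (extendChart x w) := fun h =>
      hp (tsupport_extendChart_subset_source hc hs h)
    exact (contMDiffAt_const (c := (0 : ℝ))).congr_of_eventuallyEq
      (notMem_tsupport_iff_eventuallyEq.1 this)

theorem continuous_extendChart [T2Space S] {x : S} {w : Rn n → ℝ}
    (hw : ContinuousOn w (ch n x).target) (hc : HasCompactSupport w)
    (hs : tsupport w ⊆ (ch n x).target) : Continuous (extendChart x w) := by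
  rw [continuous_iff_continuousAt]
  intro p
  by_cases hp : p ∈ (ch n x).source
  · have h1 : ContinuousAt (w ∘ ch n x) p :=
      ContinuousAt.comp (hw.continuousAt ((ch n x).open_target.mem_nhds
        ((ch n x).map_source hp))) ((ch n x).continuousAt hp)
    refine h1.congr ?_
    filter_upwards [(ch n x).open_source.mem_nhds hp] with q hq
    exact (extendChart_of_mem w hq).symm
  · have : p ∉ tsupport (extendChart x w) := fun h =>
      hp (tsupport_extendChart_subset_source hc hs h)
    exact (continuousAt_const (y := (0 : ℝ))).congr
      (notMem_tsupport_iff_eventuallyEq.1 this).symm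

namespace DiffOp

theorem contDiffOn_coef (A : DiffOp n r S) (x : S) :
    ContDiffOn ℝ r (A.coef x) (ch n x).target :=
  A.2.1 x

theorem continuousOn_coef (A : DiffOp n r S) (x : S) :
    ContinuousOn (A.coef x) (ch n x).target :=
  (A.contDiffOn_coef x).continuousOn

theorem coef_change (A : DiffOp n r S) (x x' : S) {p : S} (hp : p ∈ (ch n x).source)
    (hp' : p ∈ (ch n x').source) :
    A.coef x' (ch n x' p) =
      Coef.change (ch n x' ∘ (ch n x).symm) (ch n x p)
        (A.coef x (ch n x p)) :=
  A.2.2.2 x x' p hp hp'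

theorem coef_add (A A' : DiffOp n r S) (x : S) (y : Rn n) :
    (A + A').coef x y = A.coef x y + A'.coef x y := rfl

theorem coef_smul (s : ℝ) (A : DiffOp n r S) (x : S) (y : Rn n) :
    (s • A).coef x y = s • A.coef x y := rfl

theorem add_op (A A' : DiffOp n r S) (u : S → ℝ) (p : S) :
    (A + A').op u p = A.op u p + A'.op u p := by
  simp only [op, coef_add, Coef.add_eval]

theorem smul_op (s : ℝ) (A : DiffOp n r S) (u : S → ℝ) (p : S) :
    (s • A).op u p = s * A.op u p := by
  simp only [op, coef_smul, Coef.smul_eval]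

theorem op_congr (A : DiffOp n r S) {u v : S → ℝ} {p : S} (h : u =ᶠ[𝓝 p] v) :
    A.op u p = A.op v p := by
  apply Coef.eval_congr
  have hc := (ch n p).continuousAt_symm
    ((ch n p).map_source (mem_chart_source (Rn n) p))
  have h' : u =ᶠ[𝓝 ((ch n p).symm (ch n p p))] v := by
    rwa [(ch n p).left_inv (mem_chart_source (Rn n) p)]
  exact hc.eventually h'

theorem op_const (A : DiffOp n r S) (s : ℝ) (p : S) :
    A.op (fun _ => s) p = (A.coef p (ch n p p)).2.2 * s :=
  Coef.eval_const _ s _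

theorem op_eq_zero_of_notMem_tsupport (A : DiffOp n r S) {u : S → ℝ} {p : S}
    (h : p ∉ tsupport u) : A.op u p = 0 := by
  rw [A.op_congr (notMem_tsupport_iff_eventuallyEq.1 h)]
  have : (0 : S → ℝ) ∘ (ch n p).symm = fun _ => 0 := rfl
  rw [op, this, Coef.eval_const, mul_zero]

theorem continuousOn_eval (A : DiffOp n r S) {w : Rn n → ℝ} {x : S}
    (hw : ContDiffOn ℝ 2 w (ch n x).target) :
    ContinuousOn (fun y => (A.coef x y).eval w y) (ch n x).target := by
  have hΩ := (ch n x).open_target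
  have hc := A.continuousOn_coef x
  have h1 := fun i => (contDiffOn_pd (m := 1) hΩ i hw (by norm_num))
  have h2 := fun i j => (contDiffOn_pd (m := 0) hΩ i (h1 j) (by norm_num)).continuousOn
  have ha : ∀ i j, ContinuousOn (fun y => (A.coef x y).1 i j) (ch n x).target :=
    fun i j => (continuous_apply_apply i j).comp_continuousOn (continuous_fst.comp_continuousOn hc)
  have hb : ∀ i, ContinuousOn (fun y => (A.coef x y).2.1 i) (ch n x).target :=
    fun i => (continuous_apply i).comp_continuousOn
      (continuous_fst.comp_continuousOn (continuous_snd.comp_continuousOn hc))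
  have hcc : ContinuousOn (fun y => (A.coef x y).2.2) (ch n x).target :=
    continuous_snd.comp_continuousOn (continuous_snd.comp_continuousOn hc)
  refine ContinuousOn.add (ContinuousOn.add ?_ ?_) (hcc.mul hw.continuousOn)
  · exact continuousOn_finsetSum _ fun i _ => continuousOn_finsetSum _ fun j _ =>
      (ha i j).mul (h2 i j)
  · exact continuousOn_finsetSum _ fun i _ => (hb i).mul (h1 i).continuousOn

variable [IsManifold (𝓡 n) ∞ S]

/-- The operator may be computed in any chart. -/
theorem op_eq (A : DiffOp n r S) {u : S → ℝ} (hu : SmoothFn[n] 2 u) (x : S) {p : S}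
    (hp : p ∈ (ch n x).source) :
    A.op u p = (A.coef x (ch n x p)).eval (u ∘ (ch n x).symm)
      (ch n x p) := by
  have hpp := mem_chart_source (Rn n) p
  set τ := ch n p ∘ (ch n x).symm with hτ
  set y := ch n x p with hy
  have hτy : τ y = ch n p p := by
    simp [hτ, hy, (ch n x).left_inv hp]
  have hτd : ContDiffAt ℝ 2 τ y := (contDiffAt_transition x p hp hpp).of_le two_le_infty
  have hw : ContDiffAt ℝ 2 (u ∘ (ch n p).symm) (τ y) := by
    rw [hτy]
    exact contDiffAt_comp_chart_symm two_le_infty hu p ((ch n p).map_source hpp)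
  rw [op, A.coef_change x p hp hpp, ← hτy, Coef.eval_comp _ hw hτd]
  apply Coef.eval_congr
  have hc : ContinuousAt (ch n x).symm y :=
    (ch n x).continuousAt_symm ((ch n x).map_source hp)
  have : ∀ᶠ z in 𝓝 y, (ch n x).symm z ∈ (ch n p).source := by
    apply hc.eventually
    rw [hy, (ch n x).left_inv hp]
    exact (ch n p).open_source.mem_nhds hpp
  filter_upwards [this] with z hz
  simp [hτ, (ch n p).left_inv hz]

theorem op_symm_eq (A : DiffOp n r S) {u : S → ℝ} (hu : SmoothFn[n] 2 u) (x : S)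
    {y : Rn n} (hy : y ∈ (ch n x).target) :
    A.op u ((ch n x).symm y) = (A.coef x y).eval (u ∘ (ch n x).symm) y := by
  rw [A.op_eq hu x ((ch n x).map_target hy), (ch n x).right_inv hy]

theorem op_add (A : DiffOp n r S) {u v : S → ℝ} (hu : SmoothFn[n] 2 u)
    (hv : SmoothFn[n] 2 v) (p : S) :
    A.op (fun q => u q + v q) p = A.op u p + A.op v p :=
  have h := (ch n p).map_source (mem_chart_source (Rn n) p)
  Coef.eval_add _ (contDiffAt_comp_chart_symm two_le_infty hu p h)
    (contDiffAt_comp_chart_symm two_le_infty hv p h)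

theorem op_const_mul (A : DiffOp n r S) (s : ℝ) {u : S → ℝ}
    (hu : SmoothFn[n] 2 u) (p : S) :
    A.op (fun q => s * u q) p = s * A.op u p :=
  Coef.eval_const_mul _ s (contDiffAt_comp_chart_symm two_le_infty hu p
    ((ch n p).map_source (mem_chart_source (Rn n) p)))

theorem op_sum (A : DiffOp n r S) {ι : Type*} (t : Finset ι) {u : ι → S → ℝ}
    (hu : ∀ i, SmoothFn[n] 2 (u i)) (p : S) :
    A.op (fun q => ∑ i ∈ t, u i q) p = ∑ i ∈ t, A.op (u i) p := by
  classical
  induction t using Finset.induction_on with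
  | empty => simp [op_const]
  | insert i t hi ih =>
    simp only [Finset.sum_insert hi]
    rw [op_add A (hu i) (ContMDiff.sum fun i _ => hu i), ih]

/-- `A.grad2 u v` is the symmetric first-order form
`a^{ij} (∂_i u ∂_j v + ∂_i v ∂_j u)`. -/
noncomputable def grad2 (A : DiffOp n r S) (u v : S → ℝ) (p : S) : ℝ :=
  ∑ i, ∑ j, (A.coef p (ch n p p)).1 i j *
    (pd i (u ∘ (ch n p).symm) (ch n p p) *
      pd j (v ∘ (ch n p).symm) (ch n p p) +
    pd i (v ∘ (ch n p).symm) (ch n p p) *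
      pd j (u ∘ (ch n p).symm) (ch n p p))

theorem op_mul (A : DiffOp n r S) {u v : S → ℝ} (hu : SmoothFn[n] 2 u)
    (hv : SmoothFn[n] 2 v) (p : S) :
    A.op (fun q => u q * v q) p = u p * A.op v p + v p * A.op u p
      - A.op (fun _ => 1) p * (u p * v p) + A.grad2 u v p := by
  have h := (ch n p).map_source (mem_chart_source (Rn n) p)
  have := Coef.eval_mul (A.coef p (ch n p p))
    (contDiffAt_comp_chart_symm two_le_infty hu p h) (contDiffAt_comp_chart_symm two_le_infty hv p h)
  simp only [comp_apply,
    (ch n p).left_inv (mem_chart_source (Rn n) p)] at this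
  rw [op_const, mul_one]
  exact this

/-- `A.grad2` may be computed in any chart. -/
theorem grad2_symm_eq (A : DiffOp n r S) {u v : S → ℝ} (hu : SmoothFn[n] 2 u)
    (hv : SmoothFn[n] 2 v) (x : S) {y : Rn n} (hy : y ∈ (ch n x).target) :
    A.grad2 u v ((ch n x).symm y) = ∑ i, ∑ j, (A.coef x y).1 i j *
      (pd i (u ∘ (ch n x).symm) y * pd j (v ∘ (ch n x).symm) y +
        pd i (v ∘ (ch n x).symm) y * pd j (u ∘ (ch n x).symm) y) := by
  have h1 := A.op_mul hu hv ((ch n x).symm y)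
  have huv : SmoothFn[n] 2 (fun q => u q * v q) := hu.mul hv
  have h1c : SmoothFn[n] 2 (fun _ : S => (1 : ℝ)) := contMDiff_const
  rw [A.op_symm_eq huv x hy, A.op_symm_eq hu x hy, A.op_symm_eq hv x hy,
    A.op_symm_eq h1c x hy] at h1
  have h2 := Coef.eval_mul (A.coef x y) (contDiffAt_comp_chart_symm two_le_infty hu x hy)
    (contDiffAt_comp_chart_symm two_le_infty hv x hy)
  have h3 : (A.coef x y).eval ((fun _ : S => (1 : ℝ)) ∘ (ch n x).symm) y =
      (A.coef x y).2.2 := by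
    have := Coef.eval_const (A.coef x y) 1 y
    rw [mul_one] at this
    exact this
  rw [h3] at h1
  simp only [comp_apply] at h2
  have h4 : (fun q => u q * v q) ∘ (ch n x).symm = fun z =>
    u ((ch n x).symm z) * v ((ch n x).symm z) := rfl
  rw [h4] at h1
  linarith

theorem continuous_op (A : DiffOp n r S) {u : S → ℝ} (hu : SmoothFn[n] 2 u) :
    Continuous (A.op u) := by
  rw [continuous_iff_continuousAt]
  intro x
  have hx := mem_chart_source (Rn n) x
  have h := (A.continuousOn_eval (contDiffOn_comp_chart_symm two_le_infty hu x)).continuousAt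
    ((ch n x).open_target.mem_nhds ((ch n x).map_source hx))
  have := ContinuousAt.comp h ((ch n x).continuousAt hx)
  refine this.congr ?_
  filter_upwards [(ch n x).open_source.mem_nhds hx] with p hp
  exact (A.op_eq hu x hp).symm

/-- At a minimum of `u`, `A u ≥ c u`. -/
theorem op_ge_of_isMin (A : DiffOp n r S) (hA : A.IsElliptic) {u : S → ℝ}
    (hu : SmoothFn[n] 2 u) {p : S} (hp : ∀ q, u p ≤ u q) :
    A.op (fun _ => 1) p * u p ≤ A.op u p := by
  have hx := mem_chart_source (Rn n) p
  have ht := (ch n p).map_source hx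
  rw [op_const, mul_one]
  have := Coef.eval_ge_of_isLocalMin (A.coef p (ch n p p))
    (hA p _ ht).posSemidef (contDiffAt_comp_chart_symm two_le_infty hu p ht)
    (Filter.Eventually.of_forall fun y => by
      simp only [comp_apply, (ch n p).left_inv hx]; exact hp _)
  simpa [op, (ch n p).left_inv hx] using this

end DiffOp

section Norm
variable [CompactSpace S]

theorem DiffOp.norm_iteratedFDerivWithin_coef_le (A : DiffOp n r S) {z : S} (hz : z ∈ centers n S)
    {y : Rn n} (hy : y ∈ piece n S z) {i : ℕ} (hi : i ≤ r) :
    ‖iteratedFDerivWithin ℝ i (A.coef z) (ch n z).target y‖ ≤ ‖A‖ := by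
  have h1 : ‖DiffOp.jet n r S A‖ = ‖A‖ := rfl
  have h2 := norm_le_pi_norm (DiffOp.jet n r S A) ⟨z, hz⟩
  have h3 := norm_le_pi_norm (DiffOp.jet n r S A ⟨z, hz⟩) ⟨i, Nat.lt_succ_of_le hi⟩
  have h4 := ContinuousMap.norm_coe_le_norm (α := piece n S z)
    (E := ContinuousMultilinearMap ℝ (fun _ : Fin i => Rn n) (Coef n))
    (DiffOp.jet n r S A ⟨z, hz⟩ ⟨i, Nat.lt_succ_of_le hi⟩) ⟨y, hy⟩
  rw [← h1]
  exact (h4.trans h3).trans h2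

theorem DiffOp.norm_coef_le (A : DiffOp n r S) {z : S} (hz : z ∈ centers n S)
    {y : Rn n} (hy : y ∈ piece n S z) : ‖A.coef z y‖ ≤ ‖A‖ := by
  have := A.norm_iteratedFDerivWithin_coef_le hz hy (Nat.zero_le r)
  rwa [norm_iteratedFDerivWithin_zero] at this

theorem DiffOp.norm_fderiv_coef_le (A : DiffOp n r S) (hr : 1 ≤ r) {z : S} (hz : z ∈ centers n S)
    {y : Rn n} (hy : y ∈ piece n S z) : ‖fderiv ℝ (A.coef z) y‖ ≤ ‖A‖ := by
  have := A.norm_iteratedFDerivWithin_coef_le hz hy hr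
  have ho := (ch n z).open_target
  rwa [norm_iteratedFDerivWithin_one _ (ho.uniqueDiffOn _ (piece_subset z hy)),
    fderivWithin_of_isOpen ho (piece_subset z hy)] at this

theorem Coef.abs_eval_le (A : Coef n) (w : Rn n → ℝ) (y : Rn n) :
    |A.eval w y| ≤ ‖A‖ * ((∑ i, ∑ j, |pd i (pd j w) y|) + (∑ i, |pd i w y|) + |w y|) := by
  have h1 : ∀ i j, |A.1 i j| ≤ ‖A‖ := fun i j =>
    ((norm_le_pi_norm (A.1 i) j).trans (norm_le_pi_norm A.1 i)).trans (norm_fst_le A)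
  have h2 : ∀ i, |A.2.1 i| ≤ ‖A‖ := fun i =>
    ((norm_le_pi_norm A.2.1 i).trans (norm_fst_le A.2)).trans (norm_snd_le A)
  have h3 : |A.2.2| ≤ ‖A‖ := (norm_snd_le A.2).trans (norm_snd_le A)
  rw [eval, mul_add, mul_add]
  refine (abs_add_le _ _).trans (add_le_add ((abs_add_le _ _).trans (add_le_add ?_ ?_)) ?_)
  · rw [mul_sum]
    refine (abs_sum_le_sum_abs _ _).trans (sum_le_sum fun i _ => ?_)
    rw [mul_sum]
    refine (abs_sum_le_sum_abs _ _).trans (sum_le_sum fun j _ => ?_)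
    rw [abs_mul]
    exact mul_le_mul_of_nonneg_right (h1 i j) (abs_nonneg _)
  · rw [mul_sum]
    refine (abs_sum_le_sum_abs _ _).trans (sum_le_sum fun i _ => ?_)
    rw [abs_mul]
    exact mul_le_mul_of_nonneg_right (h2 i) (abs_nonneg _)
  · rw [abs_mul]
    exact mul_le_mul_of_nonneg_right h3 (abs_nonneg _)

theorem DiffOp.exists_abs_op_le [IsManifold (𝓡 n) ∞ S] {u : S → ℝ}
    (hu : SmoothFn[n] 2 u) :
    ∃ C, 0 ≤ C ∧ ∀ (A : DiffOp n r S) p, |A.op u p| ≤ C * ‖A‖ := by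
  let D : S → Rn n → ℝ := fun z y => (∑ i, ∑ j, |pd i (pd j (u ∘ (ch n z).symm)) y|)
    + (∑ i, |pd i (u ∘ (ch n z).symm) y|) + |(u ∘ (ch n z).symm) y|
  have hD : ∀ z, ContinuousOn (D z) (ch n z).target := by
    intro z
    have hΩ := (ch n z).open_target
    have hw := contDiffOn_comp_chart_symm two_le_infty hu z
    have h1 := fun i => (contDiffOn_pd (m := 1) hΩ i hw (by norm_num))
    have h2 := fun i j => (contDiffOn_pd (m := 0) hΩ i (h1 j) (by norm_num)).continuousOn
    exact ((continuousOn_finsetSum _ fun i _ => continuousOn_finsetSum _ fun j _ =>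
      (h2 i j).abs).add (continuousOn_finsetSum _ fun i _ => (h1 i).continuousOn.abs)).add
      hw.continuousOn.abs
  have hb : ∀ z : S, ∃ C, ∀ y ∈ piece n S z, ‖D z y‖ ≤ C := fun z =>
    (isCompact_piece z).exists_bound_of_continuousOn ((hD z).mono (piece_subset z))
  choose C hC using hb
  refine ⟨∑ z ∈ centers n S, |C z|, sum_nonneg fun _ _ => abs_nonneg _, fun A p => ?_⟩
  obtain ⟨z, hz, hp, hpz⟩ := exists_mem_piece n p
  rw [A.op_eq hu z hp, mul_comm]
  refine (Coef.abs_eval_le _ _ _).trans (mul_le_mul (A.norm_coef_le hz hpz) ?_ (by positivity)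
    (norm_nonneg _))
  have h1 : D z (ch n z p) ≤ |C z| :=
    ((le_abs_self _).trans (hC z _ hpz)).trans (le_abs_self _)
  exact h1.trans (single_le_sum (f := fun z => |C z|) (fun _ _ => abs_nonneg _) hz)

end Norm
end Charts

section Volume
variable [MeasurableSpace S] [BorelSpace S]

theorem restrict_source_eq_map {ν : Measure S} {x : S} {ρ : Rn n → ℝ}
    (h : ∀ s ⊆ (ch n x).source, MeasurableSet s →
      ν s = ∫⁻ y in ch n x '' s, ENNReal.ofReal (ρ y)) :
    ν.restrict (ch n x).source =
      ((volume.restrict (ch n x).target).withDensity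
        (fun y => ENNReal.ofReal (ρ y))).map (ch n x).symm := by
  classical
  set e := ch n x with he
  let g : Rn n → S := e.target.piecewise e.symm (fun _ => x)
  have hg : Measurable g := e.continuousOn_symm.measurable_piecewise
    continuousOn_const e.open_target.measurableSet
  have hgeq : g =ᵐ[(volume.restrict e.target).withDensity (fun y => ENNReal.ofReal (ρ y))]
      e.symm := by
    apply (withDensity_absolutelyContinuous _ _).ae_le
    filter_upwards [ae_restrict_mem e.open_target.measurableSet] with y hy
    exact Set.piecewise_eq_of_mem _ _ _ hy
  rw [← Measure.map_congr hgeq]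
  ext s hs
  rw [Measure.restrict_apply hs, Measure.map_apply hg hs, withDensity_apply _ (hg hs),
    Measure.restrict_restrict (hg hs), h _ Set.inter_subset_right
    (hs.inter e.open_source.measurableSet)]
  congr 2
  ext y
  constructor
  · rintro ⟨p, ⟨hp, hpe⟩, rfl⟩
    refine ⟨?_, e.map_source hpe⟩
    have hgp : g (e p) = p :=
      (Set.piecewise_eq_of_mem e.target e.symm _ (e.map_source hpe)).trans (e.left_inv hpe)
    rwa [Set.mem_preimage, hgp]
  · rintro ⟨hy, hye⟩
    have hgy : g y = e.symm y := Set.piecewise_eq_of_mem _ _ _ hye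
    rw [Set.mem_preimage, hgy] at hy
    exact ⟨e.symm y, ⟨hy, e.map_target hye⟩, e.right_inv hye⟩

theorem integral_eq_integral_chart {ν : Measure S} {x : S} {ρ : Rn n → ℝ}
    (hρ : ContinuousOn ρ (ch n x).target)
    (hpos : ∀ y ∈ (ch n x).target, 0 < ρ y)
    (h : ∀ s ⊆ (ch n x).source, MeasurableSet s →
      ν s = ∫⁻ y in ch n x '' s, ENNReal.ofReal (ρ y))
    {F : S → ℝ} (hF : Continuous F) (hF0 : ∀ p ∉ (ch n x).source, F p = 0) :
    ∫ p, F p ∂ν = ∫ y in (ch n x).target, ρ y * F ((ch n x).symm y) := by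
  have hρm : AEMeasurable ρ (volume.restrict (ch n x).target) :=
    hρ.aemeasurable (ch n x).open_target.measurableSet
  have hem : AEMeasurable (ch n x).symm
      (volume.restrict (ch n x).target) :=
    (ch n x).continuousOn_symm.aemeasurable
      (ch n x).open_target.measurableSet
  rw [← setIntegral_eq_integral_of_forall_compl_eq_zero hF0, restrict_source_eq_map h,
    integral_map (hem.mono_ac (withDensity_absolutelyContinuous _ _))
      hF.aestronglyMeasurable]
  have := integral_withDensity_eq_integral_smul₀ (μ := volume.restrict (ch n x).target)
    (f := fun y => Real.toNNReal (ρ y)) hρm.real_toNNReal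
    (fun y => F ((ch n x).symm y))
  refine this.trans (setIntegral_congr_fun (ch n x).open_target.measurableSet ?_)
  intro y hy
  simp only [NNReal.smul_def, smul_eq_mul, Real.coe_toNNReal _ (hpos y hy).le]

theorem IsVolumeMeasure.isFiniteMeasure [CompactSpace S] {ν : Measure S}
    (hν : IsVolumeMeasure n ν) : IsFiniteMeasure ν := by
  constructor
  have hcov : (Set.univ : Set S) ⊆ ⋃ z ∈ centers n S,
      (ch n z).source ∩ ch n z ⁻¹' piece n S z := by
    intro p _
    obtain ⟨z, hz, hp, hpz⟩ := exists_mem_piece n p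
    simp only [Set.mem_iUnion]
    exact ⟨z, hz, hp, hpz⟩
  refine (measure_mono hcov).trans_lt ((measure_biUnion_finset_le _ _).trans_lt ?_)
  rw [ENNReal.sum_lt_top]
  intro z _
  obtain ⟨ρ, hρ, hpos, h⟩ := hν z
  have hmeas : MeasurableSet ((ch n z).source ∩ ch n z ⁻¹' piece n S z) := by
    have hcl : IsClosed (piece n S z) := (isCompact_piece z).isClosed
    have h1 := (ch n z).isOpen_inter_preimage hcl.isOpen_compl
    have : (ch n z).source ∩ ch n z ⁻¹' piece n S z =
        (ch n z).source \
          ((ch n z).source ∩ ch n z ⁻¹' (piece n S z)ᶜ) := by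
      ext p; simp
    rw [this]
    exact (ch n z).open_source.measurableSet.diff h1.measurableSet
  rw [h _ Set.inter_subset_left hmeas]
  have hi : IntegrableOn ρ (piece n S z) :=
    (hρ.mono (piece_subset z)).integrableOn_compact (isCompact_piece z)
  refine (lintegral_mono_set ?_).trans_lt hi.lintegral_lt_top
  rintro _ ⟨p, ⟨_, hp⟩, rfl⟩
  exact hp

theorem IsVolumeMeasure.isOpenPosMeasure {ν : Measure S} (hν : IsVolumeMeasure n ν) :
    ν.IsOpenPosMeasure := by
  constructor
  rintro U hU ⟨p, hp⟩ h0
  obtain ⟨ρ, hρ, hpos, h⟩ := hν p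
  set e := ch n p
  have hs : IsOpen (e.source ∩ U) := e.open_source.inter hU
  have h1 := h (e.source ∩ U) Set.inter_subset_left hs.measurableSet
  have h2 : ν (e.source ∩ U) = 0 := measure_mono_null Set.inter_subset_right h0
  have himg : IsOpen (e '' (e.source ∩ U)) := e.isOpen_image_of_subset_source hs
    Set.inter_subset_left
  have hsub : e '' (e.source ∩ U) ⊆ e.target := by
    rintro _ ⟨q, hq, rfl⟩; exact e.map_source hq.1
  rw [h2] at h1
  have hρm : AEMeasurable (fun y => ENNReal.ofReal (ρ y))
      (volume.restrict (e '' (e.source ∩ U))) :=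
    ((hρ.mono hsub).aemeasurable himg.measurableSet).ennreal_ofReal
  rw [eq_comm, lintegral_eq_zero_iff' hρm] at h1
  have h4 : ∀ᵐ y ∂(volume.restrict (e '' (e.source ∩ U))), False := by
    filter_upwards [h1, ae_restrict_mem himg.measurableSet] with y hy hym
    have := hpos y (hsub hym)
    simp only [Pi.zero_apply, ENNReal.ofReal_eq_zero] at hy
    linarith
  rw [Filter.eventually_false_iff_eq_bot, ae_eq_bot, Measure.restrict_eq_zero] at h4
  exact (himg.measure_pos volume ⟨e p, p, ⟨mem_chart_source (Rn n) p, hp⟩, rfl⟩).ne' h4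

end Volume

theorem pd_scomp {i : Fin n} {w : Rn n → ℝ} {y : Rn n} {φ : ℝ → ℝ} {φ' : ℝ}
    (hφ : HasDerivAt φ φ' (w y)) (hw : DifferentiableAt ℝ w y) :
    pd i (fun z => φ (w z)) y = φ' * pd i w y := by
  have : HasFDerivAt (fun z => φ (w z)) (φ' • fderiv ℝ w y) y :=
    hφ.comp_hasFDerivAt y hw.hasFDerivAt
  simp [pd, this.fderiv]

/-- The quadratic form of a matrix. -/
def quad (B : Matrix (Fin n) (Fin n) ℝ) (z : Rn n) : ℝ := ∑ i, ∑ j, B i j * (z i * z j)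

/-- The components of `B z`. -/
def lin (B : Matrix (Fin n) (Fin n) ℝ) (j : Fin n) (z : Rn n) : ℝ := ∑ i, B j i * z i

/-- The integral of the Gaussian `exp (- ⟨B w, w⟩ / 4)`. -/
noncomputable def gaussMass (B : Matrix (Fin n) (Fin n) ℝ) : ℝ :=
  ∫ w : Rn n, exp (-(quad B w / 4))

/-- The normalized Gaussian of width `s` with covariance proportional to the inverse of `B`. -/
noncomputable def gauss (s : ℝ) (B : Matrix (Fin n) (Fin n) ℝ) (z : Rn n) : ℝ :=
  (s ^ n)⁻¹ * (gaussMass B)⁻¹ * exp (-(quad B z / (4 * s ^ 2)))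

theorem continuous_quad : Continuous fun p : Matrix (Fin n) (Fin n) ℝ × Rn n => quad p.1 p.2 := by
  unfold quad
  fun_prop

theorem continuous_lin (j : Fin n) :
    Continuous fun p : Matrix (Fin n) (Fin n) ℝ × Rn n => lin p.1 j p.2 := by
  unfold lin
  fun_prop

theorem contDiff_quad_sub (B : Matrix (Fin n) (Fin n) ℝ) (y : Rn n) {m : WithTop ℕ∞} :
    ContDiff ℝ m fun x : Rn n => quad B (x - y) := by
  unfold quad
  fun_prop

theorem contDiff_lin_sub (B : Matrix (Fin n) (Fin n) ℝ) (j : Fin n) (y : Rn n)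
    {m : WithTop ℕ∞} : ContDiff ℝ m fun x : Rn n => lin B j (x - y) := by
  unfold lin
  fun_prop

theorem contDiff_gauss_sub (s : ℝ) (B : Matrix (Fin n) (Fin n) ℝ) (y : Rn n) {m : WithTop ℕ∞} :
    ContDiff ℝ m fun x : Rn n => gauss s B (x - y) := by
  unfold gauss
  exact contDiff_const.mul (Real.contDiff_exp.comp ((contDiff_quad_sub B y).div_const _).neg)

theorem pd_coord_sub (i k : Fin n) (x y : Rn n) :
    pd i (fun x : Rn n => (x - y) k) x = if i = k then 1 else 0 := by
  have := pd_sub (i := i) (w := fun z : Rn n => z k) (v := fun _ => y k) (y := x)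
    (by fun_prop) (by fun_prop)
  rw [pd_coord, pd_const, sub_zero] at this
  exact this

theorem pd_lin_sub (B : Matrix (Fin n) (Fin n) ℝ) (i j : Fin n) (x y : Rn n) :
    pd i (fun x : Rn n => lin B j (x - y)) x = B j i := by
  unfold lin
  rw [pd_sum _ fun k _ => by fun_prop]
  simp_rw [fun k => pd_const_mul (i := i) (y := x) (B j k)
    (w := fun x : Rn n => (x - y) k) (by fun_prop), pd_coord_sub]
  simp

theorem pd_quad_sub {B : Matrix (Fin n) (Fin n) ℝ} (hB : B.IsSymm) (k : Fin n) (x y : Rn n) :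
    pd k (fun x : Rn n => quad B (x - y)) x = 2 * lin B k (x - y) := by
  unfold quad
  rw [pd_sum _ fun i _ => by fun_prop]
  have h1 : ∀ i, pd k (fun x : Rn n => ∑ j, B i j * ((x - y) i * (x - y) j)) x =
      ∑ j, B i j * ((x - y) i * (if k = j then 1 else 0)
        + (x - y) j * (if k = i then 1 else 0)) := by
    intro i
    rw [pd_sum _ fun i _ => by fun_prop]
    refine sum_congr rfl fun j _ => ?_
    rw [pd_const_mul (i := k) (y := x) (B i j)
      (w := fun x : Rn n => (x - y) i * (x - y) j) (by fun_prop),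
      pd_mul (w := fun x : Rn n => (x - y) i) (v := fun x : Rn n => (x - y) j)
      (by fun_prop) (by fun_prop), pd_coord_sub, pd_coord_sub]
  simp_rw [h1, mul_add, sum_add_distrib]
  have h2 : ∑ i, ∑ j, B i j * ((x - y) i * (if k = j then (1 : ℝ) else 0)) =
      lin B k (x - y) := by
    unfold lin
    refine sum_congr rfl fun i _ => ?_
    rw [Finset.sum_eq_single k (fun j _ hj => by rw [if_neg (Ne.symm hj)]; ring) (by simp),
      if_pos rfl, ← hB.apply i k]
    ring
  have h3 : ∑ i, ∑ j, B i j * ((x - y) j * (if k = i then (1 : ℝ) else 0)) =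
      lin B k (x - y) := by
    unfold lin
    rw [sum_comm]
    refine sum_congr rfl fun i _ => ?_
    rw [Finset.sum_eq_single k (fun j _ hj => by rw [if_neg (Ne.symm hj)]; ring) (by simp),
      if_pos rfl]
    ring
  rw [h2, h3]
  ring

theorem pd_gauss {B : Matrix (Fin n) (Fin n) ℝ} (hB : B.IsSymm) (s : ℝ) (j : Fin n)
    (y : Rn n) : pd j (fun x : Rn n => gauss s B (x - y)) =
      fun x => -(lin B j (x - y) / (2 * s ^ 2)) * gauss s B (x - y) := by
  funext x
  unfold gauss
  have hq := (contDiff_quad_sub B y (m := 1)).differentiable (by simp)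
  have h1 : HasDerivAt (fun t : ℝ => (s ^ n)⁻¹ * (gaussMass B)⁻¹ * exp (-(t / (4 * s ^ 2))))
      ((s ^ n)⁻¹ * (gaussMass B)⁻¹ * (exp (-(quad B (x - y) / (4 * s ^ 2))) *
        (-(1 / (4 * s ^ 2))))) (quad B (x - y)) :=
    (((hasDerivAt_id _).div_const _).neg.exp).const_mul _
  rw [pd_scomp (w := fun x : Rn n => quad B (x - y)) h1 (hq x), pd_quad_sub hB]
  by_cases hs : s = 0
  · simp [hs]
  · field_simp
    ring

theorem pd_pd_gauss {B : Matrix (Fin n) (Fin n) ℝ} (hB : B.IsSymm) (s : ℝ) (i j : Fin n)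
    (x y : Rn n) : pd i (pd j (fun x : Rn n => gauss s B (x - y))) x =
      (lin B i (x - y) * lin B j (x - y) / (4 * s ^ 4) - B j i / (2 * s ^ 2))
        * gauss s B (x - y) := by
  rw [pd_gauss hB]
  have h1 := ((contDiff_lin_sub B j y (m := 1)).differentiable (by simp)) x
  have h2 := ((contDiff_gauss_sub s B y (m := 1)).differentiable (by simp)) x
  have h3 : pd i (fun x : Rn n => -(lin B j (x - y) / (2 * s ^ 2))) x = -(B j i / (2 * s ^ 2)) := by
    have : (fun x : Rn n => -(lin B j (x - y) / (2 * s ^ 2))) =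
        fun x => (-(1 / (2 * s ^ 2))) * lin B j (x - y) := by
      funext x; ring
    rw [this, pd_const_mul _ h1, pd_lin_sub]
    ring
  have h4 : DifferentiableAt ℝ (fun x : Rn n => -(lin B j (x - y) / (2 * s ^ 2))) x := by
    simp only [div_eq_mul_inv]
    exact (h1.mul_const _).fun_neg
  rw [pd_mul h4 h2, h3, pd_gauss hB]
  by_cases hs : s = 0
  · simp [hs]
  · field_simp
    ring

theorem hasDerivAt_gauss (B : Matrix (Fin n) (Fin n) ℝ) {s : ℝ} (hs : s ≠ 0) (z : Rn n) :
    HasDerivAt (fun s => gauss s B z)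
      ((quad B z / (2 * s ^ 3) - n / s) * gauss s B z) s := by
  unfold gauss
  have h1 : HasDerivAt (fun s : ℝ => (s ^ n)⁻¹) (-(n * s ^ (n - 1)) / (s ^ n) ^ 2) s :=
    (hasDerivAt_pow n s).inv (pow_ne_zero n hs)
  have h2 : HasDerivAt (fun s : ℝ => -(quad B z / (4 * s ^ 2))) (quad B z / (2 * s ^ 3)) s := by
    have h3 : HasDerivAt (fun s : ℝ => 4 * s ^ 2) (4 * (2 * s)) s := by
      simpa using (hasDerivAt_pow 2 s).const_mul 4
    have h4 := ((hasDerivAt_const s (quad B z)).div h3 (by positivity)).neg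
    refine h4.congr_deriv ?_
    field_simp
    ring
  have h5 := (h1.mul_const (gaussMass B)⁻¹).mul h2.exp
  refine h5.congr_deriv ?_
  have h6 : -(n * s ^ (n - 1)) / (s ^ n) ^ 2 = -(n / s) * (s ^ n)⁻¹ := by
    rcases Nat.eq_zero_or_pos n with h0 | h0
    · simp [h0]
    · obtain ⟨m, hm⟩ : ∃ m, n = m + 1 := ⟨n - 1, by omega⟩
      rw [show n - 1 = m by omega]
      field_simp
      rw [hm]
      ring
  rw [h6]
  ring

/-- The heat equation satisfied by the Gaussian. -/
theorem heat_gauss {a B : Matrix (Fin n) (Fin n) ℝ} (hB : B.IsSymm) (hab : a * B = 1) {s : ℝ}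
    (hs : s ≠ 0) (x y : Rn n) :
    2 * s * ∑ i, ∑ j, a i j * pd i (pd j (fun x : Rn n => gauss s B (x - y))) x =
      (quad B (x - y) / (2 * s ^ 3) - n / s) * gauss s B (x - y) := by
  set z := x - y with hz
  have h1 : ∑ i, ∑ j, a i j * B j i = n := by
    have := congrArg Matrix.trace hab
    simpa [Matrix.trace, Matrix.mul_apply] using this
  have h2 : ∀ i, ∑ j, a i j * lin B j z = z i := by
    intro i
    unfold lin
    simp_rw [mul_sum]
    rw [sum_comm]
    have : ∀ k, ∑ j, a i j * (B j k * z k) = (1 : Matrix (Fin n) (Fin n) ℝ) i k * z k := by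
      intro k
      rw [← hab, Matrix.mul_apply, sum_mul]
      exact sum_congr rfl fun j _ => by ring
    simp_rw [this, Matrix.one_apply]
    simp
  have h3 : ∑ i, ∑ j, a i j * (lin B i z * lin B j z) = quad B z := by
    have : ∀ i, ∑ j, a i j * (lin B i z * lin B j z) = lin B i z * z i := by
      intro i
      rw [← h2 i, mul_sum]
      exact sum_congr rfl fun j _ => by ring
    simp_rw [this, lin, quad, sum_mul]
    exact sum_sum_congr fun i j => by ring
  simp_rw [pd_pd_gauss hB, ← hz]
  have h4 : ∑ i, ∑ j, a i j * ((lin B i z * lin B j z / (4 * s ^ 4) - B j i / (2 * s ^ 2))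
      * gauss s B z) = ((∑ i, ∑ j, a i j * (lin B i z * lin B j z)) / (4 * s ^ 4)
        - (∑ i, ∑ j, a i j * B j i) / (2 * s ^ 2)) * gauss s B z := by
    simp_rw [Finset.sum_div, ← sum_sub_distrib, sum_mul]
    exact sum_sum_congr fun i j => by ring
  rw [h4, h3, h1]
  field_simp
  ring

theorem integrable_exp_neg_mul_norm_sq {c : ℝ} (hc : 0 < c) :
    Integrable fun w : Rn n => exp (-(c * ‖w‖ ^ 2)) := by
  have h := GaussianFourier.integrable_cexp_neg_mul_sq_norm_add (V := Rn n) (b := (c : ℂ))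
    (by simpa using hc) 0 0
  have h2 := h.re
  refine h2.congr (Filter.Eventually.of_forall fun w => ?_)
  simp only [zero_mul, add_zero]
  rw [show (-(c : ℂ) * (‖w‖ : ℂ) ^ 2) = ((-(c * ‖w‖ ^ 2) : ℝ) : ℂ) by push_cast; ring]
  exact Complex.exp_ofReal_re _

theorem integral_exp_neg_mul_norm_sq_pos {c : ℝ} (hc : 0 < c) :
    0 < ∫ w : Rn n, exp (-(c * ‖w‖ ^ 2)) :=
  integral_exp_pos (integrable_exp_neg_mul_norm_sq hc)

theorem integral_scaled_gaussian (c : ℝ) {s : ℝ} (hs : 0 < s) (x : Rn n) :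
    ∫ y : Rn n, (s ^ n)⁻¹ * exp (-(c * ‖x - y‖ ^ 2 / s ^ 2)) =
      ∫ w : Rn n, exp (-(c * ‖w‖ ^ 2)) := by
  have h1 := integral_sub_left_eq_self
    (fun y : Rn n => (s ^ n)⁻¹ * exp (-(c * ‖y‖ ^ 2 / s ^ 2))) volume x
  rw [h1, integral_const_mul]
  have h2 := Measure.integral_comp_inv_smul volume
    (fun w : Rn n => exp (-(c * ‖w‖ ^ 2))) s
  have h3 : ∀ y : Rn n, exp (-(c * ‖s⁻¹ • y‖ ^ 2)) = exp (-(c * ‖y‖ ^ 2 / s ^ 2)) := by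
    intro y
    rw [norm_smul, norm_eq_abs, mul_pow, sq_abs]
    congr 1
    field_simp
  simp_rw [h3] at h2
  rw [h2, finrank_euclideanSpace_fin, abs_of_pos (pow_pos hs n), smul_eq_mul]
  field_simp

theorem abs_lin_le {B : Matrix (Fin n) (Fin n) ℝ} {M : ℝ} (hB : ∀ i j, |B i j| ≤ M) (j : Fin n)
    (z : Rn n) : |lin B j z| ≤ n * M * ‖z‖ := by
  unfold lin
  refine (abs_sum_le_sum_abs _ _).trans ?_
  have : ∀ i ∈ (univ : Finset (Fin n)), |B j i * z i| ≤ M * ‖z‖ := by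
    intro i _
    rw [abs_mul]
    exact mul_le_mul (hB j i) (PiLp.norm_apply_le z i) (abs_nonneg _)
      ((abs_nonneg _).trans (hB j i))
  refine (sum_le_sum this).trans ?_
  simp [mul_assoc]

theorem abs_quad_le {B : Matrix (Fin n) (Fin n) ℝ} {M : ℝ} (hB : ∀ i j, |B i j| ≤ M)
    (z : Rn n) : |quad B z| ≤ n * (n * M) * ‖z‖ ^ 2 := by
  unfold quad
  refine (abs_sum_le_sum_abs _ _).trans ?_
  have : ∀ i ∈ (univ : Finset (Fin n)), |∑ j, B i j * (z i * z j)| ≤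
      n * M * ‖z‖ ^ 2 := by
    intro i _
    refine (abs_sum_le_sum_abs _ _).trans ?_
    have : ∀ j ∈ (univ : Finset (Fin n)), |B i j * (z i * z j)| ≤ M * ‖z‖ ^ 2 := by
      intro j _
      rw [abs_mul, abs_mul, sq]
      exact mul_le_mul (hB i j) (mul_le_mul (PiLp.norm_apply_le z i) (PiLp.norm_apply_le z j)
        (abs_nonneg _) (norm_nonneg _)) (by positivity) ((abs_nonneg _).trans (hB i j))
    refine (sum_le_sum this).trans ?_
    simp [mul_assoc]
  refine (sum_le_sum this).trans ?_
  simp [mul_assoc]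

theorem exists_pow_mul_exp_le {c : ℝ} (hc : 0 < c) :
    ∃ C, 0 < C ∧ ∀ t : ℝ, 0 ≤ t →
      (1 + t + t ^ 3) * exp (-(2 * c * t ^ 2)) ≤ C * exp (-(c * t ^ 2)) := by
  refine ⟨3 * (1 + 1 / c + 1 / c ^ 2), by positivity, fun t ht => ?_⟩
  have h1 : 1 + c * t ^ 2 + (c * t ^ 2) ^ 2 / 2 ≤ exp (c * t ^ 2) :=
    Real.quadratic_le_exp_of_nonneg (by positivity)
  have h2 : exp (-(2 * c * t ^ 2)) = exp (-(c * t ^ 2)) * exp (-(c * t ^ 2)) := by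
    rw [← Real.exp_add]; congr 1; ring
  have h3 : (1 + t + t ^ 3) ≤ 3 * (1 + 1 / c + 1 / c ^ 2) * exp (c * t ^ 2) := by
    have h4 : 1 + t + t ^ 3 ≤ 2 + t ^ 2 + t ^ 4 := by
      nlinarith [sq_nonneg (t - 1), sq_nonneg (t ^ 2 - t), sq_nonneg (t^2 - 1), sq_nonneg (t^2-2*t)]
    have h5 : t ^ 2 ≤ 1 / c * exp (c * t ^ 2) := by
      rw [div_mul_eq_mul_div, one_mul, le_div_iff₀ hc]
      nlinarith [sq_nonneg (c * t ^ 2)]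
    have h6 : t ^ 4 ≤ 2 * (1 / c ^ 2) * exp (c * t ^ 2) := by
      rw [mul_assoc, div_mul_eq_mul_div, one_mul, ← mul_div_assoc, le_div_iff₀ (by positivity)]
      nlinarith [show 0 ≤ c * t ^ 2 by positivity]
    have h7 : (1 : ℝ) ≤ exp (c * t ^ 2) := Real.one_le_exp (by positivity)
    have h8 : 0 ≤ 1 / c * exp (c * t ^ 2) := by positivity
    have h9 : 0 ≤ 1 / c ^ 2 * exp (c * t ^ 2) := by positivity
    nlinarith
  rw [h2]
  have h7 := exp_pos (-(c * t ^ 2))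
  have h8 : exp (c * t ^ 2) * exp (-(c * t ^ 2)) = 1 := by
    rw [← Real.exp_add]; simp
  calc (1 + t + t ^ 3) * (exp (-(c * t ^ 2)) * exp (-(c * t ^ 2)))
      ≤ (3 * (1 + 1 / c + 1 / c ^ 2) * exp (c * t ^ 2)) *
        (exp (-(c * t ^ 2)) * exp (-(c * t ^ 2))) := by gcongr
    _ = 3 * (1 + 1 / c + 1 / c ^ 2) * (exp (c * t ^ 2) * exp (-(c * t ^ 2))) *
        exp (-(c * t ^ 2)) := by ring
    _ = _ := by rw [h8, mul_one]

section Kernel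

theorem exists_cutoff {Ω K : Set (Rn n)} (hΩ : IsOpen Ω) (hK : IsCompact K) (hKΩ : K ⊆ Ω) :
    ∃ χ : Rn n → ℝ, ContDiff ℝ ∞ χ ∧ HasCompactSupport χ ∧ tsupport χ ⊆ Ω ∧
      (∀ y, χ y ∈ Icc (0 : ℝ) 1) ∧ ∀ᶠ y in 𝓝ˢ K, χ y = 1 := by
  obtain ⟨L, hL, hKL, hLΩ⟩ := exists_compact_between hK hΩ hKΩ
  obtain ⟨f, h1, h0, h01⟩ := exists_contMDiffMap_one_nhds_of_subset_interior
    (I := modelWithCornersSelf ℝ (Rn n)) (n := (⊤ : ℕ∞)) hK.isClosed hKL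
  have hsub : tsupport (f : Rn n → ℝ) ⊆ L :=
    closure_minimal (fun y hy => by_contra fun hyL => hy (h0 y hyL)) hL.isClosed
  exact ⟨f, contMDiff_iff_contDiff.1 f.contMDiff, hL.of_isClosed_subset (isClosed_tsupport _) hsub,
    hsub.trans hLΩ, h01, h1⟩

theorem Coef.abs_fst_le {A : Coef n} {M : ℝ} (hA : ‖A‖ ≤ M) (i j : Fin n) : |A.1 i j| ≤ M :=
  (((norm_le_pi_norm (A.1 i) j).trans (norm_le_pi_norm A.1 i)).trans (norm_fst_le A)).trans hA

theorem Coef.abs_snd_le {A : Coef n} {M : ℝ} (hA : ‖A‖ ≤ M) (i : Fin n) : |A.2.1 i| ≤ M :=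
  (((norm_le_pi_norm A.2.1 i).trans (norm_fst_le A.2)).trans (norm_snd_le A)).trans hA

theorem abs_sum_sum_le {f : Fin n → Fin n → ℝ} {M : ℝ} (h : ∀ i j, |f i j| ≤ M) :
    |∑ i, ∑ j, f i j| ≤ n * (n * M) := by
  refine (abs_sum_le_sum_abs _ _).trans ?_
  refine (sum_le_sum fun i _ => (abs_sum_le_sum_abs _ _).trans
    (sum_le_sum fun j _ => h i j)).trans ?_
  simp

theorem abs_sum_le' {f : Fin n → ℝ} {M : ℝ} (h : ∀ i, |f i| ≤ M) :
    |∑ i, f i| ≤ n * M := by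
  refine (abs_sum_le_sum_abs _ _).trans ((sum_le_sum fun i _ => h i).trans ?_)
  simp

theorem gauss_nonneg {s : ℝ} (hs : 0 ≤ s) (B : Matrix (Fin n) (Fin n) ℝ) (z : Rn n) :
    0 ≤ gauss s B z := by
  have : 0 ≤ gaussMass B := integral_nonneg fun _ => (exp_pos _).le
  unfold gauss
  positivity

set_option maxHeartbeats 800000 in
/-- The error made by freezing the coefficients in the heat equation of the Gaussian kernel. -/
theorem exists_kernel_error_le (n : ℕ) {M : ℝ} (hM : 0 ≤ M) :
    ∃ C, 0 ≤ C ∧ ∀ (A : Coef n) (a B : Matrix (Fin n) (Fin n) ℝ) (χ : Rn n → ℝ) (x y : Rn n)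
      (s : ℝ), B.IsSymm → a * B = 1 → ‖A‖ ≤ M → (∀ i j, |A.1 i j - a i j| ≤ M * ‖x - y‖) →
      (∀ i j, |B i j| ≤ M) → ContDiffAt ℝ 2 χ x → |χ x| ≤ M → (∀ i, |pd i χ x| ≤ M) →
      (∀ i j, |pd i (pd j χ) x| ≤ M) → 0 < s → s ≤ 1 →
      |2 * s * A.eval (fun z => χ z * gauss s B (z - y)) x
        - χ x * ((quad B (x - y) / (2 * s ^ 3) - n / s) * gauss s B (x - y))| ≤
      C * (1 + ‖x - y‖ / s + (‖x - y‖ / s) ^ 3) * gauss s B (x - y) := by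
  set C1 : ℝ := n * (n * (M * (M * (n * M) ^ 2 / 2 + M * M))) with hC1
  set C2 : ℝ := n * (M * (M * (n * M))) with hC2
  set C3 : ℝ := 2 * (n * (n * (M * M)) + n * (M * M) + M * M) with hC3
  set C4 : ℝ := n * (n * (M * (2 * (M * (n * M))))) with hC4
  refine ⟨C1 + C2 + C3 + C4, by positivity, ?_⟩
  intro A a B χ x y s hB hab hA hd hBM hχ hχ0 hχ1 hχ2 hs hs1
  set E := gauss s B (x - y) with hE
  have hE0 : 0 ≤ E := gauss_nonneg hs.le _ _
  set t := ‖x - y‖ / s with ht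
  have ht0 : 0 ≤ t := by positivity
  have hz : ‖x - y‖ = s * t := by rw [ht]; field_simp
  set l := fun j => lin B j (x - y) with hl
  have hl1 : ∀ j, |l j| ≤ n * M * (s * t) := fun j => by
    rw [← hz]; exact abs_lin_le hBM j _
  have hgd : ContDiffAt ℝ 2 (fun z : Rn n => gauss s B (z - y)) x :=
    (contDiff_gauss_sub s B y).contDiffAt
  rw [Coef.eval_mul A hχ hgd, ← heat_gauss hB hab hs.ne' x y]
  have e1 : A.eval (fun z : Rn n => gauss s B (z - y)) x =
      (∑ i, ∑ j, A.1 i j * ((l i * l j / (4 * s ^ 4) - B j i / (2 * s ^ 2)) * E))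
      + (∑ i, A.2.1 i * (-(l i / (2 * s ^ 2)) * E)) + A.2.2 * E := by
    simp only [Coef.eval, pd_pd_gauss hB]
    simp only [pd_gauss hB, hl, hE]
  have e2 : ∑ i, ∑ j, a i j * pd i (pd j (fun x : Rn n => gauss s B (x - y))) x =
      ∑ i, ∑ j, a i j * ((l i * l j / (4 * s ^ 4) - B j i / (2 * s ^ 2)) * E) := by
    simp only [pd_pd_gauss hB, hl, hE]
  have e3 : ∑ i, ∑ j, A.1 i j * (pd i χ x * pd j (fun x : Rn n => gauss s B (x - y)) x +
      pd i (fun x : Rn n => gauss s B (x - y)) x * pd j χ x) =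
      ∑ i, ∑ j, A.1 i j * (pd i χ x * (-(l j / (2 * s ^ 2)) * E)
        + (-(l i / (2 * s ^ 2)) * E) * pd j χ x) := by
    simp only [pd_gauss hB, hl, hE]
  rw [e1, e2, e3]
  have hchi : |A.eval χ x| ≤ n * (n * (M * M)) + n * (M * M) + M * M := by
    have hc : |A.2.2| ≤ M := ((norm_snd_le A.2).trans (norm_snd_le A)).trans hA
    rw [Coef.eval]
    refine (abs_add_le _ _).trans (add_le_add ((abs_add_le _ _).trans (add_le_add ?_ ?_)) ?_)
    · refine abs_sum_sum_le fun i j => ?_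
      rw [abs_mul]
      exact mul_le_mul (Coef.abs_fst_le hA i j) (hχ2 i j) (abs_nonneg _) hM
    · refine abs_sum_le' fun i => ?_
      rw [abs_mul]
      exact mul_le_mul (Coef.abs_snd_le hA i) (hχ1 i) (abs_nonneg _) hM
    · rw [abs_mul]
      exact mul_le_mul hc hχ0 (abs_nonneg _) hM
  have hle1 : ∀ j, |-(l j / (2 * s ^ 2)) * E| * (2 * s) ≤ n * M * t * E := by
    intro j
    rw [abs_mul, abs_neg, abs_div, abs_of_nonneg hE0, abs_of_pos (show 0 < 2 * s ^ 2 by positivity)]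
    calc |l j| / (2 * s ^ 2) * E * (2 * s) = (|l j| / s) * E := by field_simp
      _ ≤ (n * M * t) * E := by
        refine mul_le_mul_of_nonneg_right ?_ hE0
        rw [div_le_iff₀ hs]
        exact (hl1 j).trans (le_of_eq (by ring))
  have p1 : |2 * s * (χ x * ∑ i, ∑ j, (A.1 i j - a i j) *
      ((l i * l j / (4 * s ^ 4) - B j i / (2 * s ^ 2)) * E))| ≤ C1 * (t + t ^ 3) * E := by
    have h1 : 2 * s * (χ x * ∑ i, ∑ j, (A.1 i j - a i j) *
      ((l i * l j / (4 * s ^ 4) - B j i / (2 * s ^ 2)) * E)) = ∑ i, ∑ j, χ x * ((A.1 i j - a i j) *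
      (2 * s * (l i * l j / (4 * s ^ 4) - B j i / (2 * s ^ 2)) * E)) := by
      simp_rw [mul_sum]
      exact sum_sum_congr fun i j => by ring
    rw [h1]
    have h2 : ∀ i j, |χ x * ((A.1 i j - a i j) *
      (2 * s * (l i * l j / (4 * s ^ 4) - B j i / (2 * s ^ 2)) * E))| ≤
        M * (M * (n * M) ^ 2 / 2 + M * M) * (t + t ^ 3) * E := by
      intro i j
      have h3 : |2 * s * (l i * l j / (4 * s ^ 4) - B j i / (2 * s ^ 2))| ≤
          (n * M) ^ 2 * t ^ 2 / (2 * s) + M / s := by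
        have : 2 * s * (l i * l j / (4 * s ^ 4) - B j i / (2 * s ^ 2)) =
          l i * l j / (2 * s ^ 3) - B j i / s := by
          field_simp
          ring
        rw [this]
        refine (abs_sub _ _).trans (add_le_add ?_ ?_)
        · rw [abs_div, abs_mul, abs_of_pos (show 0 < 2 * s ^ 3 by positivity),
            div_le_div_iff₀ (by positivity) (by positivity)]
          have h4 : |l i| * |l j| ≤ (n * M * (s * t)) * (n * M * (s * t)) :=
            mul_le_mul (hl1 i) (hl1 j) (abs_nonneg _) (by positivity)
          calc |l i| * |l j| * (2 * s) ≤ (n * M * (s * t)) * (n * M * (s * t)) * (2 * s) := by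
                gcongr
            _ = _ := by ring
        · rw [abs_div, abs_of_pos hs]
          gcongr
          exact hBM j i
      rw [abs_mul, abs_mul, abs_mul, abs_of_nonneg hE0]
      calc |χ x| * (|A.1 i j - a i j| *
            (|2 * s * (l i * l j / (4 * s ^ 4) - B j i / (2 * s ^ 2))| * E))
          ≤ M * ((M * ‖x - y‖) * (((n * M) ^ 2 * t ^ 2 / (2 * s) + M / s) * E)) := by
            gcongr
            exact hd i j
        _ = M * (M * (n * M) ^ 2 / 2 * t ^ 3 + M * M * t) * E := by
            rw [hz]; field_simp
        _ ≤ M * (M * (n * M) ^ 2 / 2 + M * M) * (t + t ^ 3) * E := by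
            refine mul_le_mul_of_nonneg_right ?_ hE0
            have q3 : 0 ≤ M * (M * (n * M) ^ 2 / 2 * t + M * M * t ^ 3) := by positivity
            linarith
    refine (abs_sum_sum_le h2).trans (le_of_eq ?_)
    rw [hC1]; ring
  have p2 : |2 * s * (χ x * ∑ i, A.2.1 i * (-(l i / (2 * s ^ 2)) * E))| ≤ C2 * t * E := by
    have h1 : 2 * s * (χ x * ∑ i, A.2.1 i * (-(l i / (2 * s ^ 2)) * E)) =
        ∑ i, χ x * (A.2.1 i * ((-(l i / (2 * s ^ 2)) * E) * (2 * s))) := by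
      simp_rw [mul_sum]
      exact sum_congr rfl fun i _ => by ring
    rw [h1]
    have h2 : ∀ i, |χ x * (A.2.1 i * ((-(l i / (2 * s ^ 2)) * E) * (2 * s)))| ≤
        M * (M * (n * M * t * E)) := by
      intro i
      rw [abs_mul, abs_mul, abs_mul _ (2 * s), abs_of_pos (show 0 < 2 * s by positivity)]
      have := hle1 i
      have h5 := Coef.abs_snd_le hA i
      gcongr
    refine (abs_sum_le' h2).trans (le_of_eq ?_)
    rw [hC2]; ring
  have p3 : |2 * s * (E * A.eval χ x)| ≤ C3 * E := by
    rw [abs_mul (2 * s), abs_mul E, abs_of_nonneg hE0, abs_of_pos (show 0 < 2 * s by positivity)]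
    calc 2 * s * (E * |A.eval χ x|) ≤ 2 * 1 * (E * (n * (n * (M * M)) + n * (M * M) + M * M)) := by
          gcongr
      _ = _ := by rw [hC3]; ring
  have p4 : |2 * s * ∑ i, ∑ j, A.1 i j * (pd i χ x * (-(l j / (2 * s ^ 2)) * E)
        + (-(l i / (2 * s ^ 2)) * E) * pd j χ x)| ≤ C4 * t * E := by
    have h1 : 2 * s * ∑ i, ∑ j, A.1 i j * (pd i χ x * (-(l j / (2 * s ^ 2)) * E)
        + (-(l i / (2 * s ^ 2)) * E) * pd j χ x) =
        ∑ i, ∑ j, A.1 i j * (pd i χ x * ((-(l j / (2 * s ^ 2)) * E) * (2 * s))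
        + pd j χ x * ((-(l i / (2 * s ^ 2)) * E) * (2 * s))) := by
      simp_rw [mul_sum]
      exact sum_sum_congr fun i j => by ring
    rw [h1]
    have h3 : ∀ i j, |pd i χ x * ((-(l j / (2 * s ^ 2)) * E) * (2 * s))| ≤
        M * (n * M * t * E) := by
      intro i j
      rw [abs_mul, abs_mul _ (2 * s), abs_of_pos (show 0 < 2 * s by positivity)]
      have := hle1 j
      have h5 := hχ1 i
      gcongr
    have h2 : ∀ i j, |A.1 i j * (pd i χ x * ((-(l j / (2 * s ^ 2)) * E) * (2 * s))
        + pd j χ x * ((-(l i / (2 * s ^ 2)) * E) * (2 * s)))| ≤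
        M * (M * (n * M * t * E) + M * (n * M * t * E)) := by
      intro i j
      rw [abs_mul]
      exact mul_le_mul (Coef.abs_fst_le hA i j)
        ((abs_add_le _ _).trans (add_le_add (h3 i j) (h3 j i))) (abs_nonneg _) hM
    refine (abs_sum_sum_le h2).trans (le_of_eq ?_)
    rw [hC4]; ring
  have key : 2 * s * (χ x * ((∑ i, ∑ j, A.1 i j *
        ((l i * l j / (4 * s ^ 4) - B j i / (2 * s ^ 2)) * E))
      + (∑ i, A.2.1 i * (-(l i / (2 * s ^ 2)) * E)) + A.2.2 * E)
      + gauss s B (x - y) * A.eval χ x - A.2.2 * (χ x * gauss s B (x - y))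
      + ∑ i, ∑ j, A.1 i j * (pd i χ x * (-(l j / (2 * s ^ 2)) * E)
        + (-(l i / (2 * s ^ 2)) * E) * pd j χ x))
      - χ x * (2 * s * ∑ i, ∑ j, a i j *
        ((l i * l j / (4 * s ^ 4) - B j i / (2 * s ^ 2)) * E)) =
      2 * s * (χ x * ∑ i, ∑ j, (A.1 i j - a i j) *
        ((l i * l j / (4 * s ^ 4) - B j i / (2 * s ^ 2)) * E))
      + 2 * s * (χ x * ∑ i, A.2.1 i * (-(l i / (2 * s ^ 2)) * E))
      + 2 * s * (E * A.eval χ x)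
      + 2 * s * ∑ i, ∑ j, A.1 i j * (pd i χ x * (-(l j / (2 * s ^ 2)) * E)
        + (-(l i / (2 * s ^ 2)) * E) * pd j χ x) := by
    simp_rw [sub_mul, sum_sub_distrib]
    rw [← hE]
    ring
  rw [key]
  refine (abs_add_le _ _).trans ((add_le_add ((abs_add_le _ _).trans (add_le_add
    ((abs_add_le _ _).trans (add_le_add p1 p2)) p3)) p4).trans ?_)
  have q1 : 0 ≤ C1 := by positivity
  have q2 : 0 ≤ C2 := by positivity
  have q3 : 0 ≤ C3 := by positivity
  have q4 : 0 ≤ C4 := by positivity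
  have q5 : 0 ≤ t ^ 3 := by positivity
  have : C1 * (t + t ^ 3) + C2 * t + C3 + C4 * t ≤ (C1 + C2 + C3 + C4) * (1 + t + t ^ 3) := by
    have q6 : 0 ≤ C1 + C2 * (1 + t ^ 3) + C3 * (t + t ^ 3) + C4 * (1 + t ^ 3) :=
      add_nonneg (add_nonneg (add_nonneg q1 (mul_nonneg q2 (by positivity)))
        (mul_nonneg q3 (by positivity))) (mul_nonneg q4 (by positivity))
    linarith
  calc _ = (C1 * (t + t ^ 3) + C2 * t + C3 + C4 * t) * E := by ring
    _ ≤ _ := mul_le_mul_of_nonneg_right this hE0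

theorem quad_smul (B : Matrix (Fin n) (Fin n) ℝ) (t : ℝ) (w : Rn n) :
    quad B (t • w) = t ^ 2 * quad B w := by
  unfold quad
  simp_rw [mul_sum, PiLp.smul_apply, smul_eq_mul]
  exact sum_sum_congr fun i j => by ring

theorem quad_one (w : Rn n) : quad (1 : Matrix (Fin n) (Fin n) ℝ) w = ‖w‖ ^ 2 := by
  unfold quad
  rw [EuclideanSpace.norm_sq_eq]
  refine sum_congr rfl fun i _ => ?_
  rw [Finset.sum_eq_single i (fun j _ hj => by rw [Matrix.one_apply_ne (Ne.symm hj)]; ring)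
    (by simp), Matrix.one_apply_eq, norm_eq_abs, sq_abs]
  ring

theorem quad_pos {B : Matrix (Fin n) (Fin n) ℝ} (hB : B.PosDef) {w : Rn n} (hw : w ≠ 0) :
    0 < quad B w := by
  have h := hB.dotProduct_mulVec_pos (x := (w : Fin n → ℝ)) (by
    intro h; apply hw; ext i; exact congrFun h i)
  have : quad B w = star (w : Fin n → ℝ) ⬝ᵥ B.mulVec (w : Fin n → ℝ) := by
    simp only [quad, dotProduct, Matrix.mulVec, mul_sum, star_trivial]
    exact sum_sum_congr fun i j => by ring
  rw [this]; exact h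

theorem exists_quad_lower_bound {X : Type*} [TopologicalSpace X] {K : Set X} (hK : IsCompact K)
    {g : X → Matrix (Fin n) (Fin n) ℝ} (hg : ContinuousOn g K) (hpos : ∀ y ∈ K, (g y).PosDef) :
    ∃ c, 0 < c ∧ ∀ y ∈ K, ∀ w : Rn n, c * ‖w‖ ^ 2 ≤ quad (g y) w := by
  have hcont : ContinuousOn (fun p : X × Rn n => quad (g p.1) p.2)
      (K ×ˢ Metric.sphere (0 : Rn n) 1) :=
    continuous_quad.comp_continuousOn (f := fun p : X × Rn n => (g p.1, p.2))
      (ContinuousOn.prodMk (hg.comp (f := Prod.fst) continuous_fst.continuousOn fun p hp => hp.1)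
        continuous_snd.continuousOn)
  have hcpt : IsCompact (K ×ˢ Metric.sphere (0 : Rn n) 1) := hK.prod (isCompact_sphere _ _)
  obtain ⟨c, hc, hcb⟩ : ∃ c, 0 < c ∧ ∀ p ∈ K ×ˢ Metric.sphere (0 : Rn n) 1,
      c ≤ quad (g p.1) p.2 := by
    rcases (K ×ˢ Metric.sphere (0 : Rn n) 1).eq_empty_or_nonempty with h | h
    · exact ⟨1, one_pos, by simp [h]⟩
    · obtain ⟨p, hp, hmin⟩ := hcpt.exists_isMinOn h hcont
      refine ⟨_, quad_pos (hpos p.1 hp.1) ?_, fun q hq => hmin hq⟩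
      intro h0
      have := hp.2
      simp [h0] at this
  refine ⟨c, hc, fun y hy w => ?_⟩
  by_cases hw : w = 0
  · subst hw; simp [quad]
  · have hn : 0 < ‖w‖ := norm_pos_iff.2 hw
    have h1 := hcb (y, ‖w‖⁻¹ • w) ⟨hy, by simp [norm_smul, hn.ne']⟩
    simp only [quad_smul] at h1
    calc c * ‖w‖ ^ 2 ≤ (‖w‖⁻¹ ^ 2 * quad (g y) w) * ‖w‖ ^ 2 := by gcongr
      _ = quad (g y) w := by field_simp

/-- A globally defined, uniformly positive definite continuous field of matrices, inverse to the
given one on a compact set. -/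
theorem exists_inverse_field {Ω K : Set (Rn n)} (hΩ : IsOpen Ω) (hK : IsCompact K) (hKΩ : K ⊆ Ω)
    {a : Rn n → Matrix (Fin n) (Fin n) ℝ} (ha : ContinuousOn a Ω)
    (hpos : ∀ y ∈ Ω, (a y).PosDef) :
    ∃ (g : Rn n → Matrix (Fin n) (Fin n) ℝ) (c M : ℝ), Continuous g ∧ 0 < c ∧ 0 ≤ M ∧
      (∀ y, (g y).IsSymm) ∧ (∀ y w, c * ‖w‖ ^ 2 ≤ quad (g y) w) ∧ (∀ y i j, |g y i j| ≤ M) ∧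
      ∀ y ∈ K, a y * g y = 1 := by
  obtain ⟨θ, hθ, hθc, hθs, hθ01, hθ1⟩ := exists_cutoff hΩ hK hKΩ
  set b : Rn n → Matrix (Fin n) (Fin n) ℝ := fun y => θ y • a y + (1 - θ y) • 1 with hb
  have hoff : ∀ y ∉ tsupport θ, b y = 1 := by
    intro y hy
    simp [hb, image_eq_zero_of_notMem_tsupport hy]
  have hbc : Continuous b := by
    rw [continuous_iff_continuousAt]
    intro y
    by_cases hy : y ∈ tsupport θ
    · exact (hθ.continuous.continuousAt.smul (ha.continuousAt (hΩ.mem_nhds (hθs hy)))).add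
        ((continuousAt_const.sub hθ.continuous.continuousAt).smul continuousAt_const)
    · refine (continuousAt_const (y := (1 : Matrix (Fin n) (Fin n) ℝ))).congr ?_
      filter_upwards [(isClosed_tsupport θ).isOpen_compl.mem_nhds hy] with z hz
      exact (hoff z hz).symm
  have hbpos : ∀ y, (b y).PosDef := by
    intro y
    by_cases hy : y ∈ tsupport θ
    · have h1 := hpos y (hθs hy)
      rcases eq_or_lt_of_le (hθ01 y).1 with h0 | h0
      · simp only [hb, ← h0]
        simpa using Matrix.PosDef.one
      · exact (h1.smul h0).add_posSemidef (Matrix.PosSemidef.one.smul (by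
          have := (hθ01 y).2; linarith))
    · rw [hoff y hy]; exact Matrix.PosDef.one
  have hdet : ∀ y, (b y).det ≠ 0 := fun y => (hbpos y).det_pos.ne'
  have hgc : Continuous fun y => (b y)⁻¹ := by
    have : (fun y => (b y)⁻¹) = fun y => ((b y).det)⁻¹ • (b y).adjugate := by
      funext y
      rw [Matrix.inv_def, Ring.inverse_eq_inv']
    rw [this]
    exact (hbc.matrix_det.inv₀ hdet).smul hbc.matrix_adjugate
  have hgpos : ∀ y, ((b y)⁻¹).PosDef := fun y => (hbpos y).inv
  obtain ⟨c, hc, hcb⟩ := exists_quad_lower_bound (K := tsupport θ) hθc hgc.continuousOn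
    fun y _ => hgpos y
  have hM : ∃ M, ∀ y ∈ tsupport θ, ∀ i j, |(b y)⁻¹ i j| ≤ M := by
    have h : ∀ i j, ∃ M, ∀ y ∈ tsupport θ, |(b y)⁻¹ i j| ≤ M := fun i j =>
      IsCompact.exists_bound_of_continuousOn (f := fun y => (b y)⁻¹ i j) hθc
        (hgc.matrix_elem i j).continuousOn
    choose M hM using h
    refine ⟨∑ i, ∑ j, |M i j|, fun y hy i j => (hM i j y hy).trans ((le_abs_self _).trans ?_)⟩
    refine (single_le_sum (f := fun j => |M i j|) (fun _ _ => abs_nonneg _)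
      (mem_univ j)).trans ?_
    exact single_le_sum (f := fun i => ∑ j, |M i j|)
      (fun _ _ => sum_nonneg fun _ _ => abs_nonneg _) (mem_univ i)
  obtain ⟨M, hM⟩ := hM
  refine ⟨fun y => (b y)⁻¹, min c 1, max M 1, hgc, lt_min hc one_pos, le_max_of_le_right zero_le_one,
    fun y => ?_, fun y w => ?_, fun y i j => ?_, fun y hy => ?_⟩
  · have := (hgpos y).isHermitian
    rwa [Matrix.IsHermitian, Matrix.conjTranspose_eq_transpose_of_trivial] at this
  · by_cases hy : y ∈ tsupport θ
    · exact (mul_le_mul_of_nonneg_right (min_le_left _ _) (by positivity)).trans (hcb y hy w)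
    · have h1 : (b y)⁻¹ = 1 := by rw [hoff y hy, inv_one]
      change min c 1 * ‖w‖ ^ 2 ≤ quad (b y)⁻¹ w
      rw [h1, quad_one]
      exact (mul_le_mul_of_nonneg_right (min_le_right _ _) (by positivity)).trans (one_mul _).le
  · by_cases hy : y ∈ tsupport θ
    · exact (hM y hy i j).trans (le_max_left _ _)
    · have h1 : (b y)⁻¹ = 1 := by rw [hoff y hy, inv_one]
      change |(b y)⁻¹ i j| ≤ max M 1
      rw [h1, Matrix.one_apply]
      split_ifs <;> simp
  · have h1 : θ y = 1 := hθ1.self_of_nhdsSet y hy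
    have h2 : b y = a y := by simp [hb, h1]
    change a y * (b y)⁻¹ = 1
    rw [← h2]
    exact Matrix.mul_nonsing_inv _ (isUnit_iff_ne_zero.2 (hdet y))

end Kernel

section HeatAverage

/-- The average of `F` over Gaussians frozen at the integration variable, in rescaled variables. -/
noncomputable def heatAvg (g : Rn n → Matrix (Fin n) (Fin n) ℝ) (F : Rn n → ℝ) (s : ℝ)
    (x : Rn n) : ℝ :=
  ∫ w : Rn n, F (x - s • w) * (gaussMass (g (x - s • w)))⁻¹ *
    exp (-(quad (g (x - s • w)) w / 4))

variable {g : Rn n → Matrix (Fin n) (Fin n) ℝ} {c M : ℝ}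

theorem integrable_exp_neg_quad (hc : 0 < c) {B : Matrix (Fin n) (Fin n) ℝ}
    (hB : ∀ w, c * ‖w‖ ^ 2 ≤ quad B w) : Integrable fun w : Rn n => exp (-(quad B w / 4)) := by
  refine (integrable_exp_neg_mul_norm_sq (n := n) (c := c / 4) (by positivity)).mono' ?_ ?_
  · have : Continuous fun w : Rn n => quad B w :=
      continuous_quad.comp (continuous_const.prodMk continuous_id)
    exact (Real.continuous_exp.comp (this.div_const 4).neg).aestronglyMeasurable
  · refine Filter.Eventually.of_forall fun w => ?_
    rw [norm_eq_abs, abs_of_pos (exp_pos _)]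
    exact Real.exp_le_exp.2 (by linarith [hB w])

theorem continuous_gaussMass (hg : Continuous g) (hc : 0 < c)
    (hlow : ∀ y w, c * ‖w‖ ^ 2 ≤ quad (g y) w) : Continuous fun y => gaussMass (g y) := by
  unfold gaussMass
  have hq : Continuous fun p : Rn n × Rn n => quad (g p.1) p.2 :=
    continuous_quad.comp ((hg.comp continuous_fst).prodMk continuous_snd)
  refine continuous_of_dominated (bound := fun w => exp (-(c / 4 * ‖w‖ ^ 2))) ?_ ?_ ?_ ?_
  · exact fun y => (integrable_exp_neg_quad hc (hlow y)).aestronglyMeasurable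
  · refine fun y => Filter.Eventually.of_forall fun w => ?_
    rw [norm_eq_abs, abs_of_pos (exp_pos _)]
    exact Real.exp_le_exp.2 (by linarith [hlow y w])
  · exact integrable_exp_neg_mul_norm_sq (by positivity)
  · refine Filter.Eventually.of_forall fun w => ?_
    have : Continuous fun y : Rn n => quad (g y) w :=
      hq.comp (continuous_id.prodMk continuous_const)
    exact Real.continuous_exp.comp (this.div_const 4).neg

theorem exists_le_gaussMass (hc : 0 < c) (hM : 0 ≤ M)
    (hlow : ∀ y w, c * ‖w‖ ^ 2 ≤ quad (g y) w) (hup : ∀ y i j, |g y i j| ≤ M) :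
    ∃ N, 0 < N ∧ ∀ y, N ≤ gaussMass (g y) := by
  have hp : 0 < n * (n * M) / 4 + 1 := by positivity
  refine ⟨_, integral_exp_neg_mul_norm_sq_pos (n := n) hp, fun y => ?_⟩
  refine integral_mono (integrable_exp_neg_mul_norm_sq hp) (integrable_exp_neg_quad hc (hlow y)) ?_
  intro w
  refine Real.exp_le_exp.2 ?_
  have := (le_abs_self _).trans (abs_quad_le (hup y) w)
  nlinarith [sq_nonneg ‖w‖]

theorem gauss_le (hlow : ∀ y w, c * ‖w‖ ^ 2 ≤ quad (g y) w)
    {N : ℝ} (hN : 0 < N) (hNg : ∀ y, N ≤ gaussMass (g y)) {s : ℝ} (hs : 0 < s) (y z : Rn n) :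
    gauss s (g y) z ≤ N⁻¹ * ((s ^ n)⁻¹ * exp (-(c / 4 * ‖z‖ ^ 2 / s ^ 2))) := by
  unfold gauss
  have h1 : (gaussMass (g y))⁻¹ ≤ N⁻¹ := inv_anti₀ hN (hNg y)
  have h2 : exp (-(quad (g y) z / (4 * s ^ 2))) ≤
      exp (-(c / 4 * ‖z‖ ^ 2 / s ^ 2)) := by
    refine Real.exp_le_exp.2 (neg_le_neg ?_)
    rw [div_le_div_iff₀ (by positivity) (by positivity)]
    have := hlow y z
    nlinarith [sq_nonneg s]
  calc _ ≤ (s ^ n)⁻¹ * N⁻¹ * exp (-(c / 4 * ‖z‖ ^ 2 / s ^ 2)) := by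
        have : 0 < gaussMass (g y) := hN.trans_le (hNg y)
        gcongr
    _ = _ := by ring

theorem continuous_gauss_max (hg : Continuous g) (hc : 0 < c)
    (hlow : ∀ y w, c * ‖w‖ ^ 2 ≤ quad (g y) w) {N : ℝ} (hN : 0 < N)
    (hNg : ∀ y, N ≤ gaussMass (g y)) {ε : ℝ} (hε : 0 < ε) :
    Continuous fun q : (ℝ × Rn n) × Rn n => gauss (max q.1.1 ε) (g q.1.2) (q.2 - q.1.2) := by
  have hm := continuous_gaussMass hg hc hlow
  have hpos : ∀ t : ℝ, 0 < max t ε := fun t => lt_max_of_lt_right hε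
  have hq : Continuous fun q : (ℝ × Rn n) × Rn n => quad (g q.1.2) (q.2 - q.1.2) :=
    continuous_quad.comp ((hg.comp (continuous_snd.comp continuous_fst)).prodMk
      (continuous_snd.sub (continuous_snd.comp continuous_fst)))
  have hmax : Continuous fun q : (ℝ × Rn n) × Rn n => max q.1.1 ε :=
    (continuous_fst.comp continuous_fst).max continuous_const
  unfold gauss
  refine Continuous.mul (Continuous.mul ?_ ?_) (Real.continuous_exp.comp (Continuous.neg ?_))
  · exact (hmax.pow n).inv₀ fun q => (pow_pos (hpos _) n).ne'
  · exact (hm.comp (continuous_snd.comp continuous_fst)).inv₀ fun q =>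
      (hN.trans_le (hNg _)).ne'
  · exact hq.div (continuous_const.mul (hmax.pow 2)) fun q => by have := hpos q.1.1; positivity

theorem continuous_heatAvg (hg : Continuous g) (hc : 0 < c)
    (hlow : ∀ y w, c * ‖w‖ ^ 2 ≤ quad (g y) w) {N : ℝ} (hN : 0 < N)
    (hNg : ∀ y, N ≤ gaussMass (g y)) {F : Rn n → ℝ} (hF : Continuous F) {m : ℝ}
    (hm : ∀ y, |F y| ≤ m) : Continuous fun p : ℝ × Rn n => heatAvg g F p.1 p.2 := by
  unfold heatAvg
  have hgm := continuous_gaussMass hg hc hlow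
  have hcont : Continuous fun q : (ℝ × Rn n) × Rn n =>
      F (q.1.2 - q.1.1 • q.2) * (gaussMass (g (q.1.2 - q.1.1 • q.2)))⁻¹ *
      exp (-(quad (g (q.1.2 - q.1.1 • q.2)) q.2 / 4)) := by
    have h1 : Continuous fun q : (ℝ × Rn n) × Rn n => q.1.2 - q.1.1 • q.2 := by fun_prop
    have h2 : Continuous fun q : (ℝ × Rn n) × Rn n => quad (g (q.1.2 - q.1.1 • q.2)) q.2 :=
      continuous_quad.comp ((hg.comp h1).prodMk continuous_snd)
    exact ((hF.comp h1).mul ((hgm.comp h1).inv₀ fun q => (hN.trans_le (hNg _)).ne')).mul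
      (Real.continuous_exp.comp (h2.div_const 4).neg)
  refine continuous_of_dominated (bound := fun w => m * N⁻¹ * exp (-(c / 4 * ‖w‖ ^ 2)))
    ?_ ?_ ?_ ?_
  · exact fun p => (hcont.comp (continuous_const.prodMk continuous_id)).aestronglyMeasurable
  · refine fun p => Filter.Eventually.of_forall fun w => ?_
    have hm0 : 0 ≤ m := (abs_nonneg _).trans (hm 0)
    have hpos := hN.trans_le (hNg (p.2 - p.1 • w))
    rw [norm_mul, norm_mul, norm_eq_abs, norm_eq_abs, norm_eq_abs,
      abs_of_pos (exp_pos _), abs_of_pos (inv_pos.2 hpos)]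
    have h1 : (gaussMass (g (p.2 - p.1 • w)))⁻¹ ≤ N⁻¹ := inv_anti₀ hN (hNg _)
    have h2 : exp (-(quad (g (p.2 - p.1 • w)) w / 4)) ≤ exp (-(c / 4 * ‖w‖ ^ 2)) :=
      Real.exp_le_exp.2 (by linarith [hlow (p.2 - p.1 • w) w])
    have h3 := hm (p.2 - p.1 • w)
    gcongr
  · exact (integrable_exp_neg_mul_norm_sq (by positivity)).const_mul _
  · exact Filter.Eventually.of_forall fun w =>
      hcont.comp (continuous_id.prodMk continuous_const)

theorem heatAvg_zero {N : ℝ} (hN : 0 < N) (hNg : ∀ y, N ≤ gaussMass (g y)) (F : Rn n → ℝ)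
    (x : Rn n) : heatAvg g F 0 x = F x := by
  have h : gaussMass (g x) ≠ 0 := (hN.trans_le (hNg x)).ne'
  have : heatAvg g F 0 x = F x * (gaussMass (g x))⁻¹ * gaussMass (g x) := by
    simp only [heatAvg, zero_smul, sub_zero]
    rw [integral_const_mul]
    rfl
  rw [this, mul_assoc, inv_mul_cancel₀ h, mul_one]

theorem integral_mul_gauss_eq_heatAvg (F : Rn n → ℝ) {s : ℝ} (hs : 0 < s) (x : Rn n) :
    ∫ y, F y * gauss s (g y) (x - y) = heatAvg g F s x := by
  have h1 := integral_sub_left_eq_self (fun y : Rn n => F y * gauss s (g y) (x - y)) volume x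
  have h2 := Measure.integral_comp_smul volume
    (fun y : Rn n => F (x - y) * gauss s (g (x - y)) (x - (x - y))) s
  rw [h1, finrank_euclideanSpace_fin, abs_of_pos (inv_pos.2 (pow_pos hs n)), smul_eq_mul] at h2
  have h3 : ∫ y, F y * gauss s (g y) (x - y) = s ^ n *
      ∫ w : Rn n, F (x - s • w) * gauss s (g (x - s • w)) (x - (x - s • w)) := by
    rw [h2, ← mul_assoc, mul_inv_cancel₀ (pow_pos hs n).ne', one_mul]
  rw [h3, heatAvg, ← integral_const_mul]
  congr 1
  funext w
  rw [sub_sub_cancel, gauss, quad_smul]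
  have : s ^ 2 * quad (g (x - s • w)) w / (4 * s ^ 2) = quad (g (x - s • w)) w / 4 := by
    field_simp
  rw [this]
  have := (pow_pos hs n).ne'
  field_simp

end HeatAverage

theorem totallyBounded_integrals {Q E : Type*} [TopologicalSpace Q] [MeasurableSpace Q]
    [NormedAddCommGroup E] [NormedSpace ℝ E] [CompleteSpace E] {R : Set Q} (hR : IsCompact R)
    (hRm : MeasurableSet R) {μ : Measure Q} (hμ : μ R ≠ ⊤) {h : Q → E} (hh : ContinuousOn h R)
    (C : ℝ) :
    TotallyBounded {v : E | ∃ φ : Q → ℝ, (∀ q ∈ R, |φ q| ≤ C) ∧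
      IntegrableOn (fun q => φ q • h q) R μ ∧ v = ∫ q in R, φ q • h q ∂μ} := by
  let D : Set E := closure (convexHull ℝ ((fun p : ℝ × Q => p.1 • h p.2) '' (Icc (-C) C ×ˢ R)))
  have hDt : TotallyBounded D := by
    refine (totallyBounded_convexHull.2 (IsCompact.totallyBounded ?_)).closure
    refine (isCompact_Icc.prod hR).image_of_continuousOn ?_
    exact continuous_fst.continuousOn.smul
      (hh.comp continuous_snd.continuousOn fun p hp => hp.2)
  have hDc : Convex ℝ D := (convex_convexHull ℝ _).closure
  refine (((hDt.image (f := fun v => μ.real R • v) (uniformContinuous_const_smul _))).insert 0).subset ?_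
  rintro v ⟨φ, hφ, hi, rfl⟩
  by_cases h0 : μ R = 0
  · left
    rw [Measure.restrict_eq_zero.2 h0, integral_zero_measure]
  · right
    refine ⟨⨍ q in R, φ q • h q ∂μ, ?_, ?_⟩
    · refine hDc.set_average_mem isClosed_closure h0 hμ ?_ hi
      filter_upwards [ae_restrict_mem hRm] with q hq
      exact subset_closure (subset_convexHull ℝ _ ⟨(φ q, q), ⟨abs_le.1 (hφ q hq), hq⟩, rfl⟩)
    · simp only [setAverage_eq]
      rw [smul_smul, mul_inv_cancel₀, one_smul]
      exact (ENNReal.toReal_pos h0 hμ).ne'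

theorem continuous_extendChart_param [T2Space S] {Q : Type*} [TopologicalSpace Q] {x : S}
    {W : Q → Rn n → ℝ} {K : Set (Rn n)} (hK : IsCompact K) (hKΩ : K ⊆ (ch n x).target)
    (hW : ContinuousOn (fun p : Q × Rn n => W p.1 p.2)
      (Set.univ ×ˢ (ch n x).target))
    (h0 : ∀ q, ∀ z ∉ K, W q z = 0) :
    Continuous fun p : Q × S => extendChart x (W p.1) p.2 := by
  rw [continuous_iff_continuousAt]
  rintro ⟨q, p⟩
  by_cases hp : p ∈ (ch n x).source
  · have h1 : ContinuousAt (fun p : Q × Rn n => W p.1 p.2) (q, ch n x p) :=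
      hW.continuousAt ((isOpen_univ.prod (ch n x).open_target).mem_nhds
        ⟨trivial, (ch n x).map_source hp⟩)
    have h2 : ContinuousAt (fun a : Q × S => (a.1, ch n x a.2)) (q, p) :=
      continuousAt_fst.prodMk (ContinuousAt.comp (f := Prod.snd)
        ((ch n x).continuousAt hp) continuousAt_snd)
    have h3 := ContinuousAt.comp (f := fun a : Q × S => (a.1, ch n x a.2))
      (x := (q, p)) h1 h2
    refine h3.congr ?_
    have : ∀ᶠ a : Q × S in 𝓝 (q, p), a.2 ∈ (ch n x).source :=
      continuousAt_snd.eventually ((ch n x).open_source.mem_nhds hp)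
    filter_upwards [this] with a ha
    exact (extendChart_of_mem _ ha).symm
  · have hc : IsClosed ((ch n x).symm '' K) :=
      (hK.image_of_continuousOn ((ch n x).continuousOn_symm.mono hKΩ)).isClosed
    have hpn : p ∉ (ch n x).symm '' K := by
      rintro ⟨y, hy, rfl⟩
      exact hp ((ch n x).map_target (hKΩ hy))
    refine (continuousAt_const (y := (0 : ℝ))).congr ?_
    have : ∀ᶠ a : Q × S in 𝓝 (q, p), a.2 ∈ ((ch n x).symm '' K)ᶜ :=
      continuousAt_snd.eventually (hc.isOpen_compl.mem_nhds hpn)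
    filter_upwards [this] with a ha
    by_cases has : a.2 ∈ (ch n x).source
    · rw [extendChart_of_mem _ has, h0]
      intro hK'
      exact ha ⟨_, hK', (ch n x).left_inv has⟩
    · rw [extendChart_of_notMem _ has]

theorem DiffOp.op_extendChart [IsManifold (𝓡 n) ∞ S] [T2Space S] (A : DiffOp n r S) {x : S}
    {w : Rn n → ℝ} (hw : ContDiffOn ℝ 2 w (ch n x).target) (hc : HasCompactSupport w)
    (hs : tsupport w ⊆ (ch n x).target) :
    A.op (extendChart x w) = extendChart x (fun z => (A.coef x z).eval w z) := by
  funext p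
  by_cases hp : p ∈ (ch n x).source
  · rw [A.op_eq (contMDiff_extendChart two_le_infty hw hc hs) x hp, extendChart_of_mem _ hp]
    apply Coef.eval_congr
    filter_upwards [(ch n x).open_target.mem_nhds
      ((ch n x).map_source hp)] with z hz
    exact extendChart_symm w hz
  · rw [extendChart_of_notMem _ hp, A.op_eq_zero_of_notMem_tsupport]
    exact fun h => hp (tsupport_extendChart_subset_source hc hs h)

section Graph
variable [IsManifold (𝓡 n) ∞ S]

/-- The pairs `(u, A u)` with `u` smooth. -/
def DiffOp.smoothGraph (A : DiffOp n r S) : Submodule ℝ (C(S, ℝ) × C(S, ℝ)) where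
  carrier := {p | SmoothFn[n] ∞ p.1 ∧ ∀ q, p.2 q = A.op p.1 q}
  zero_mem' := ⟨contMDiff_const, fun q => by
    have : ((0 : C(S, ℝ) × C(S, ℝ)).1 : S → ℝ) = fun _ => 0 := rfl
    rw [this, A.op_const, mul_zero]; rfl⟩
  add_mem' := by
    rintro p p' ⟨h1, h2⟩ ⟨h1', h2'⟩
    refine ⟨h1.add h1', fun q => ?_⟩
    have := A.op_add (h1.of_le two_le_infty) (h1'.of_le two_le_infty) q
    rw [← h2, ← h2'] at this
    exact this.symm
  smul_mem' := by
    rintro t p ⟨h1, h2⟩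
    have ht : SmoothFn[n] ∞ (fun q => t * p.1 q) := contMDiff_const.mul h1
    refine ⟨ht, fun q => ?_⟩
    have := A.op_const_mul t (h1.of_le two_le_infty) q
    rw [← h2] at this
    exact this.symm

variable [CompactSpace S]

/-- The closure of the operator in the space of continuous functions. -/
noncomputable def DiffOp.graph (A : DiffOp n r S) : Submodule ℝ (C(S, ℝ) × C(S, ℝ)) :=
  A.smoothGraph.topologicalClosure

theorem DiffOp.isClosed_graph (A : DiffOp n r S) :
    IsClosed (A.graph : Set (C(S, ℝ) × C(S, ℝ))) :=
  Submodule.isClosed_topologicalClosure _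

theorem DiffOp.exists_seq_of_mem_graph {A : DiffOp n r S} {p : C(S, ℝ) × C(S, ℝ)}
    (hp : p ∈ A.graph) : ∃ v : ℕ → C(S, ℝ) × C(S, ℝ), (∀ m, v m ∈ A.smoothGraph) ∧
      Tendsto v atTop (𝓝 p) :=
  mem_closure_iff_seq_limit.1 hp

end Graph

theorem integral_mem_submodule {Q E : Type*} [MeasurableSpace Q] [NormedAddCommGroup E]
    [NormedSpace ℝ E] [CompleteSpace E] (V : Submodule ℝ E) (hV : IsClosed (V : Set E))
    {μ : Measure Q} {f : Q → E} (hf : ∀ᵐ q ∂μ, f q ∈ V) : ∫ q, f q ∂μ ∈ V := by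
  by_cases hi : Integrable f μ
  · by_contra hn
    obtain ⟨φ, u, hφ, hu⟩ := geometric_hahn_banach_closed_point V.convex hV hn
    have h0 : ∀ v ∈ V, φ v = 0 := by
      intro v hv
      by_contra hne
      have h1 := hφ ((u / φ v) • v) (V.smul_mem _ hv)
      rw [map_smul, smul_eq_mul, div_mul_cancel₀ _ hne] at h1
      exact lt_irrefl _ h1
    have h1 : φ (∫ q, f q ∂μ) = 0 := by
      rw [← φ.integral_comp_comm hi]
      refine integral_eq_zero_of_ae ?_
      filter_upwards [hf] with q hq
      exact h0 _ hq
    have h2 := hφ 0 V.zero_mem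
    rw [map_zero] at h2
    rw [h1] at hu
    linarith
  · rw [integral_undef hi]
    exact V.zero_mem

theorem abs_setIntegral_rectangle_le {a b c : ℝ} (ha : 0 < a) (hc : 0 < c) {K : Set (Rn n)}
    (hK : IsCompact K) (z : Rn n) {ψ : ℝ → ℝ} (hψ : Continuous ψ) (hψ0 : ∀ s ∈ Icc a b, 0 ≤ ψ s)
    {G : ℝ × Rn n → ℝ} (hG : ∀ q ∈ Icc a b ×ˢ K,
      |G q| ≤ ψ q.1 * ((q.1 ^ n)⁻¹ * exp (-(c * ‖z - q.2‖ ^ 2 / q.1 ^ 2)))) :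
    |∫ q in Icc a b ×ˢ K, G q| ≤
      (∫ s in Icc a b, ψ s) * ∫ w : Rn n, exp (-(c * ‖w‖ ^ 2)) := by
  have hRm : MeasurableSet (Icc a b ×ˢ K) := measurableSet_Icc.prod hK.measurableSet
  have hRc : IsCompact (Icc a b ×ˢ K) := isCompact_Icc.prod hK
  have hs0 : ∀ s ∈ Icc a b, 0 < s := fun s hs => ha.trans_le hs.1
  have hcont : ContinuousOn (fun q : ℝ × Rn n =>
      ψ q.1 * ((q.1 ^ n)⁻¹ * exp (-(c * ‖z - q.2‖ ^ 2 / q.1 ^ 2)))) (Icc a b ×ˢ K) := by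
    refine (hψ.comp continuous_fst).continuousOn.mul (ContinuousOn.mul ?_ ?_)
    · exact ((continuous_fst.pow n).continuousOn).inv₀ fun q hq => (pow_pos (hs0 _ hq.1) n).ne'
    · refine Real.continuous_exp.comp_continuousOn (ContinuousOn.neg (ContinuousOn.div ?_ ?_ ?_))
      · fun_prop
      · fun_prop
      · exact fun q hq => (pow_pos (hs0 _ hq.1) 2).ne'
  have hint := hcont.integrableOn_compact (μ := volume) hRc
  have h1 : |∫ q in Icc a b ×ˢ K, G q| ≤ ∫ q in Icc a b ×ˢ K,
      ψ q.1 * ((q.1 ^ n)⁻¹ * exp (-(c * ‖z - q.2‖ ^ 2 / q.1 ^ 2))) := by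
    rw [← norm_eq_abs]
    refine norm_integral_le_of_norm_le hint ?_
    filter_upwards [ae_restrict_mem hRm] with q hq
    exact hG q hq
  refine h1.trans ?_
  rw [Measure.volume_eq_prod] at hint ⊢
  rw [setIntegral_prod _ hint, ← integral_mul_const]
  refine setIntegral_mono_on ?_ ?_ measurableSet_Icc ?_
  · rw [IntegrableOn, ← Measure.prod_restrict] at hint
    exact hint.integral_prod_left
  · exact (hψ.continuousOn.integrableOn_compact isCompact_Icc).mul_const _
  · intro s hs
    have hs' := hs0 s hs
    simp only
    rw [integral_const_mul]
    refine mul_le_mul_of_nonneg_left ?_ (hψ0 s hs)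
    rw [← integral_scaled_gaussian c hs' z]
    refine setIntegral_le_integral ?_ (Filter.Eventually.of_forall fun y => by positivity)
    have h2 := integrable_exp_neg_mul_norm_sq (n := n) hc
    have h3 := ((h2.comp_smul (R := s⁻¹) (inv_ne_zero hs'.ne')).comp_sub_left z).const_mul (s ^ n)⁻¹
    refine h3.congr (Filter.Eventually.of_forall fun y => ?_)
    simp only [norm_smul, norm_eq_abs, mul_pow, sq_abs]
    congr 3
    field_simp

section Kernel

/-- The cut-off Gaussian kernel in a chart, as a function on the manifold. -/
noncomputable def kernelFn (x : S) (χ : Rn n → ℝ) (g : Rn n → Matrix (Fin n) (Fin n) ℝ) (s : ℝ)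
    (y : Rn n) : S → ℝ :=
  extendChart x fun z => χ z * gauss s (g y) (z - y)

variable [IsManifold (𝓡 n) ∞ S] [T2Space S] {x : S} {χ : Rn n → ℝ}
  {g : Rn n → Matrix (Fin n) (Fin n) ℝ}

theorem contMDiff_kernelFn (hχ : ContDiff ℝ ∞ χ) (hχc : HasCompactSupport χ)
    (hχs : tsupport χ ⊆ (ch n x).target) (s : ℝ) (y : Rn n) :
    SmoothFn[n] ∞ (kernelFn x χ g s y) :=
  contMDiff_extendChart le_rfl (hχ.mul (contDiff_gauss_sub s (g y) y)).contDiffOn hχc.mul_right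
    (tsupport_mul_subset_left.trans hχs)

theorem op_kernelFn (A : DiffOp n r S) (hχ : ContDiff ℝ ∞ χ) (hχc : HasCompactSupport χ)
    (hχs : tsupport χ ⊆ (ch n x).target) (s : ℝ) (y : Rn n) :
    A.op (kernelFn x χ g s y) = extendChart x fun z =>
      (A.coef x z).eval (fun z' => χ z' * gauss s (g y) (z' - y)) z :=
  A.op_extendChart ((hχ.of_le two_le_infty).mul (contDiff_gauss_sub s (g y) y)).contDiffOn
    hχc.mul_right (tsupport_mul_subset_left.trans hχs)

theorem eval_kernel_eq_zero (A : Coef n) {s : ℝ} {y z : Rn n} (hz : z ∉ tsupport χ) :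
    A.eval (fun z' => χ z' * gauss s (g y) (z' - y)) z = 0 := by
  have : (fun z' => χ z' * gauss s (g y) (z' - y)) =ᶠ[𝓝 z] fun _ => 0 := by
    filter_upwards [notMem_tsupport_iff_eventuallyEq.1 hz] with z' hz'
    simp [hz']
  rw [A.eval_congr this, A.eval_const, mul_zero]

theorem continuous_kernelFn_param (hχ : ContDiff ℝ ∞ χ) (hχc : HasCompactSupport χ)
    (hχs : tsupport χ ⊆ (ch n x).target) (hg : Continuous g) {c : ℝ} (hc : 0 < c)
    (hlow : ∀ y w, c * ‖w‖ ^ 2 ≤ quad (g y) w) {N : ℝ} (hN : 0 < N)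
    (hNg : ∀ y, N ≤ gaussMass (g y)) {ε : ℝ} (hε : 0 < ε) :
    Continuous fun p : (ℝ × Rn n) × S => kernelFn x χ g (max p.1.1 ε) p.1.2 p.2 := by
  refine continuous_extendChart_param (Q := ℝ × Rn n)
    (W := fun q z => χ z * gauss (max q.1 ε) (g q.2) (z - q.2)) hχc hχs ?_ ?_
  · exact ((hχ.continuous.comp continuous_snd).mul
      (continuous_gauss_max hg hc hlow hN hNg hε)).continuousOn
  · intro q z hz
    rw [image_eq_zero_of_notMem_tsupport hz, zero_mul]

theorem continuous_op_kernelFn_param (A : DiffOp n r S) (hχ : ContDiff ℝ ∞ χ)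
    (hχc : HasCompactSupport χ)
    (hχs : tsupport χ ⊆ (ch n x).target) (hg : Continuous g)
    (hsymm : ∀ y, (g y).IsSymm) {c : ℝ} (hc : 0 < c)
    (hlow : ∀ y w, c * ‖w‖ ^ 2 ≤ quad (g y) w) {N : ℝ} (hN : 0 < N)
    (hNg : ∀ y, N ≤ gaussMass (g y)) {ε : ℝ} (hε : 0 < ε) :
    Continuous fun p : (ℝ × Rn n) × S => A.op (kernelFn x χ g (max p.1.1 ε) p.1.2) p.2 := by
  simp only [op_kernelFn A hχ hχc hχs]
  refine continuous_extendChart_param (Q := ℝ × Rn n)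
    (W := fun q z => (A.coef x z).eval (fun z' => χ z' * gauss (max q.1 ε) (g q.2) (z' - q.2)) z)
    hχc hχs ?_ ?_
  · set Ω := (ch n x).target with hΩdef
    have hΩ : IsOpen Ω := (ch n x).open_target
    have hE := continuous_gauss_max hg hc hlow hN hNg hε
    have hsn : ContinuousOn (fun p : (ℝ × Rn n) × Rn n => p.2) (Set.univ ×ˢ Ω) :=
      continuous_snd.continuousOn
    have hmap : Set.MapsTo (fun p : (ℝ × Rn n) × Rn n => p.2) (Set.univ ×ˢ Ω) Ω :=
      fun p hp => hp.2
    have hcoef : ContinuousOn (fun p : (ℝ × Rn n) × Rn n => A.coef x p.2) (Set.univ ×ˢ Ω) :=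
      (A.continuousOn_coef x).comp hsn hmap
    have ha : ∀ i j, ContinuousOn (fun p : (ℝ × Rn n) × Rn n => (A.coef x p.2).1 i j)
        (Set.univ ×ˢ Ω) :=
      fun i j => (continuous_apply_apply i j).comp_continuousOn
        (continuous_fst.comp_continuousOn hcoef)
    have hb : ∀ i, ContinuousOn (fun p : (ℝ × Rn n) × Rn n => (A.coef x p.2).2.1 i)
        (Set.univ ×ˢ Ω) :=
      fun i => (continuous_apply i).comp_continuousOn
        (continuous_fst.comp_continuousOn (continuous_snd.comp_continuousOn hcoef))
    have hcc : ContinuousOn (fun p : (ℝ × Rn n) × Rn n => (A.coef x p.2).2.2) (Set.univ ×ˢ Ω) :=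
      continuous_snd.comp_continuousOn (continuous_snd.comp_continuousOn hcoef)
    have hev : ContinuousOn (fun p : (ℝ × Rn n) × Rn n => (A.coef x p.2).eval χ p.2)
        (Set.univ ×ˢ Ω) :=
      (A.continuousOn_eval (hχ.of_le two_le_infty).contDiffOn).comp hsn hmap
    have hχ' : Continuous fun p : (ℝ × Rn n) × Rn n => χ p.2 := hχ.continuous.comp continuous_snd
    have hpχ : ∀ i, Continuous fun p : (ℝ × Rn n) × Rn n => pd i χ p.2 := fun i =>
      (contDiff_pd (m := 0) i hχ (by simp)).continuous.comp continuous_snd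
    have hl : ∀ j, Continuous fun p : (ℝ × Rn n) × Rn n => lin (g p.1.2) j (p.2 - p.1.2) :=
      fun j => (continuous_lin j).comp ((hg.comp (continuous_snd.comp continuous_fst)).prodMk
        (continuous_snd.sub (continuous_snd.comp continuous_fst)))
    have hgij : ∀ i j, Continuous fun p : (ℝ × Rn n) × Rn n => g p.1.2 i j := fun i j =>
      (hg.matrix_elem i j).comp (continuous_snd.comp continuous_fst)
    have hmax : Continuous fun p : (ℝ × Rn n) × Rn n => max p.1.1 ε :=
      (continuous_fst.comp continuous_fst).max continuous_const
    have hm0 : ∀ p : (ℝ × Rn n) × Rn n, 0 < max p.1.1 ε := fun p => lt_max_of_lt_right hε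
    have h1 : ∀ j, Continuous fun p : (ℝ × Rn n) × Rn n =>
        -(lin (g p.1.2) j (p.2 - p.1.2) / (2 * (max p.1.1 ε) ^ 2)) *
          gauss (max p.1.1 ε) (g p.1.2) (p.2 - p.1.2) := fun j =>
      ((hl j).div (continuous_const.mul (hmax.pow 2)) fun p =>
        (mul_pos two_pos (pow_pos (hm0 p) 2)).ne').neg.mul hE
    have h2 : ∀ i j, Continuous fun p : (ℝ × Rn n) × Rn n =>
        (lin (g p.1.2) i (p.2 - p.1.2) * lin (g p.1.2) j (p.2 - p.1.2) / (4 * (max p.1.1 ε) ^ 4)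
          - g p.1.2 j i / (2 * (max p.1.1 ε) ^ 2)) *
          gauss (max p.1.1 ε) (g p.1.2) (p.2 - p.1.2) := fun i j =>
      ((((hl i).mul (hl j)).div (continuous_const.mul (hmax.pow 4)) fun p =>
        (mul_pos four_pos (pow_pos (hm0 p) 4)).ne').sub ((hgij j i).div (continuous_const.mul (hmax.pow 2))
          fun p => (mul_pos two_pos (pow_pos (hm0 p) 2)).ne')).mul hE
    have hform : ∀ p : (ℝ × Rn n) × Rn n, (A.coef x p.2).eval
        (fun z' => χ z' * gauss (max p.1.1 ε) (g p.1.2) (z' - p.1.2)) p.2 =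
        χ p.2 * ((∑ i, ∑ j, (A.coef x p.2).1 i j *
          ((lin (g p.1.2) i (p.2 - p.1.2) * lin (g p.1.2) j (p.2 - p.1.2) / (4 * (max p.1.1 ε) ^ 4)
          - g p.1.2 j i / (2 * (max p.1.1 ε) ^ 2)) *
          gauss (max p.1.1 ε) (g p.1.2) (p.2 - p.1.2)))
        + (∑ i, (A.coef x p.2).2.1 i * (-(lin (g p.1.2) i (p.2 - p.1.2) /
          (2 * (max p.1.1 ε) ^ 2)) * gauss (max p.1.1 ε) (g p.1.2) (p.2 - p.1.2)))
        + (A.coef x p.2).2.2 * gauss (max p.1.1 ε) (g p.1.2) (p.2 - p.1.2))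
        + gauss (max p.1.1 ε) (g p.1.2) (p.2 - p.1.2) * (A.coef x p.2).eval χ p.2
        - (A.coef x p.2).2.2 * (χ p.2 * gauss (max p.1.1 ε) (g p.1.2) (p.2 - p.1.2))
        + ∑ i, ∑ j, (A.coef x p.2).1 i j * (pd i χ p.2 *
          (-(lin (g p.1.2) j (p.2 - p.1.2) / (2 * (max p.1.1 ε) ^ 2)) *
          gauss (max p.1.1 ε) (g p.1.2) (p.2 - p.1.2)) +
          (-(lin (g p.1.2) i (p.2 - p.1.2) / (2 * (max p.1.1 ε) ^ 2)) *
          gauss (max p.1.1 ε) (g p.1.2) (p.2 - p.1.2)) * pd j χ p.2) := by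
      intro p
      rw [Coef.eval_mul _ (hχ.of_le two_le_infty).contDiffAt
        (contDiff_gauss_sub _ _ _).contDiffAt]
      have e1 : (A.coef x p.2).eval (fun z : Rn n => gauss (max p.1.1 ε) (g p.1.2) (z - p.1.2)) p.2 =
          (∑ i, ∑ j, (A.coef x p.2).1 i j *
          ((lin (g p.1.2) i (p.2 - p.1.2) * lin (g p.1.2) j (p.2 - p.1.2) / (4 * (max p.1.1 ε) ^ 4)
          - g p.1.2 j i / (2 * (max p.1.1 ε) ^ 2)) *
          gauss (max p.1.1 ε) (g p.1.2) (p.2 - p.1.2)))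
        + (∑ i, (A.coef x p.2).2.1 i * (-(lin (g p.1.2) i (p.2 - p.1.2) /
          (2 * (max p.1.1 ε) ^ 2)) * gauss (max p.1.1 ε) (g p.1.2) (p.2 - p.1.2)))
        + (A.coef x p.2).2.2 * gauss (max p.1.1 ε) (g p.1.2) (p.2 - p.1.2) := by
        simp only [Coef.eval, pd_pd_gauss (hsymm _)]
        simp only [pd_gauss (hsymm _)]
      rw [e1]
      simp only [pd_gauss (hsymm _)]
    refine ContinuousOn.congr ?_ fun p _ => hform p
    refine ((((hχ'.continuousOn.mul (((continuousOn_finsetSum _ fun i _ =>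
      continuousOn_finsetSum _ fun j _ => (ha i j).mul (h2 i j).continuousOn).add
      (continuousOn_finsetSum _ fun i _ => (hb i).mul (h1 i).continuousOn)).add
      (hcc.mul hE.continuousOn))).add (hE.continuousOn.mul hev)).sub
      (hcc.mul (hχ'.mul hE).continuousOn))).add ?_
    exact continuousOn_finsetSum _ fun i _ => continuousOn_finsetSum _ fun j _ =>
      (ha i j).mul (((hpχ i).mul (h1 j)).add ((h1 i).mul (hpχ j))).continuousOn
  · intro q z hz
    exact eval_kernel_eq_zero _ hz

theorem exists_bounds_on_compact (A : DiffOp n r S) (hr : 1 ≤ r) {K : Set (Rn n)} (hK : IsCompact K)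
    (hKΩ : K ⊆ (ch n x).target) (hχ : ContDiff ℝ ∞ χ) (hχc : HasCompactSupport χ) :
    ∃ M, 0 ≤ M ∧ (∀ z ∈ K, ‖A.coef x z‖ ≤ M) ∧
      (∀ z ∈ K, ∀ y ∈ K, ∀ i j, |(A.coef x z).1 i j - (A.coef x y).1 i j| ≤ M * ‖z - y‖) ∧
      (∀ z, |χ z| ≤ M) ∧ (∀ z i, |pd i χ z| ≤ M) ∧ (∀ z i j, |pd i (pd j χ) z| ≤ M) := by
  obtain ⟨M1, hM1⟩ := hK.exists_bound_of_continuousOn ((A.continuousOn_coef x).mono hKΩ)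
  obtain ⟨θ, hθ, hθc, hθs, hθ01, hθ1⟩ := exists_cutoff (ch n x).open_target hK hKΩ
  have hsm : ContDiff ℝ 1 (fun z => θ z • A.coef x z) := by
    refine contDiff_of_tsupport_subset (ch n x).open_target ?_
      ((tsupport_smul_subset_left _ _).trans hθs)
    exact (hθ.of_le one_le_infty).contDiffOn.smul ((A.contDiffOn_coef x).of_le
      (by exact_mod_cast hr))
  obtain ⟨L, hL⟩ := hsm.lipschitzWith_of_hasCompactSupport (hθc.smul_right) (by simp)
  obtain ⟨M2, hM2⟩ := hχc.exists_bound_of_continuous hχ.continuous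
  have hp1 : ∀ i, ∃ M, ∀ z, ‖pd i χ z‖ ≤ M := fun i =>
    (hχc.mono' ((subset_tsupport _).trans (tsupport_pd_subset i χ))).exists_bound_of_continuous
      (contDiff_pd (m := 0) i hχ (by simp)).continuous
  have hp2 : ∀ i j, ∃ M, ∀ z, ‖pd i (pd j χ) z‖ ≤ M := fun i j =>
    (hχc.mono' ((subset_tsupport _).trans ((tsupport_pd_subset i _).trans
      (tsupport_pd_subset j χ)))).exists_bound_of_continuous
      (contDiff_pd (m := 0) i (contDiff_pd (m := 1) j (hχ.of_le two_le_infty) (by norm_num))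
        (by simp)).continuous
  choose M3 hM3 using hp1
  choose M4 hM4 using hp2
  have hle3 : ∀ i, M3 i ≤ ∑ i, |M3 i| := fun i => (le_abs_self _).trans
    (single_le_sum (f := fun i => |M3 i|) (fun _ _ => abs_nonneg _) (mem_univ i))
  have hle4 : ∀ i j, M4 i j ≤ ∑ i, ∑ j, |M4 i j| := fun i j => (le_abs_self _).trans
    ((single_le_sum (f := fun j => |M4 i j|) (fun _ _ => abs_nonneg _)
      (mem_univ j)).trans (single_le_sum (f := fun i => ∑ j, |M4 i j|)
      (fun _ _ => sum_nonneg fun _ _ => abs_nonneg _) (mem_univ i)))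
  have n3 : 0 ≤ ∑ i, |M3 i| := sum_nonneg fun _ _ => abs_nonneg _
  have n4 : 0 ≤ ∑ i, ∑ j, |M4 i j| :=
    sum_nonneg fun _ _ => sum_nonneg fun _ _ => abs_nonneg _
  have a1 := abs_nonneg M1
  have a2 := abs_nonneg M2
  have l1 := le_abs_self M1
  have l2 := le_abs_self M2
  have hL0 := L.coe_nonneg
  refine ⟨|M1| + L + |M2| + (∑ i, |M3 i|) + ∑ i, ∑ j, |M4 i j|, by positivity,
    fun z hz => (hM1 z hz).trans (by linarith), fun z hz y hy i j => ?_,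
    fun z => (hM2 z).trans (by linarith), fun z i => (hM3 i z).trans (by linarith [hle3 i]),
    fun z i j => (hM4 i j z).trans (by linarith [hle4 i j])⟩
  have h1 : dist (θ z • A.coef x z) (θ y • A.coef x y) ≤ L * dist z y := hL.dist_le_mul z y
  have hz1 : θ z = 1 := hθ1.self_of_nhdsSet z hz
  have hy1 : θ y = 1 := hθ1.self_of_nhdsSet y hy
  rw [hz1, hy1, one_smul, one_smul, dist_eq_norm, dist_eq_norm] at h1
  have h2 : |(A.coef x z).1 i j - (A.coef x y).1 i j| ≤ ‖A.coef x z - A.coef x y‖ :=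
    Coef.abs_fst_le (A := A.coef x z - A.coef x y) le_rfl i j
  refine h2.trans (h1.trans ?_)
  gcongr
  linarith

end Kernel

/-- A cut-off function, a matrix field inverse to the principal part, and the constants which
control the Gaussian kernels built from them, near a compact subset of a chart. -/
structure LocalKernel (A : DiffOp n r S) (x : S) (K : Set (Rn n)) where
  χ : Rn n → ℝ
  g : Rn n → Matrix (Fin n) (Fin n) ℝ
  c : ℝ
  N : ℝ
  c' : ℝ
  D : ℝ
  contDiff_χ : ContDiff ℝ ∞ χ
  hasCompactSupport_χ : HasCompactSupport χ
  tsupport_χ : tsupport χ ⊆ (ch n x).target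
  abs_χ_le : ∀ y, |χ y| ≤ 1
  χ_eq_one : ∀ y ∈ K, χ y = 1
  continuous_g : Continuous g
  c_pos : 0 < c
  low : ∀ y w, c * ‖w‖ ^ 2 ≤ quad (g y) w
  N_pos : 0 < N
  le_gaussMass : ∀ y, N ≤ gaussMass (g y)
  symm : ∀ y, (g y).IsSymm
  c'_pos : 0 < c'
  D_nonneg : 0 ≤ D
  error_le : ∀ z ∈ tsupport χ, ∀ y ∈ K, ∀ s, 0 < s → s ≤ 1 →
    |2 * s * (A.coef x z).eval (fun z' => χ z' * gauss s (g y) (z' - y)) z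
      - χ z * ((quad (g y) (z - y) / (2 * s ^ 3) - n / s) * gauss s (g y) (z - y))| ≤
    D * ((s ^ n)⁻¹ * exp (-(c' * ‖z - y‖ ^ 2 / s ^ 2)))

theorem DiffOp.exists_localKernel [IsManifold (𝓡 n) ∞ S] [T2Space S] (A : DiffOp n r S) (hr : 1 ≤ r) (hA : A.IsElliptic) (x : S)
    {K : Set (Rn n)} (hK : IsCompact K) (hKΩ : K ⊆ (ch n x).target) :
    Nonempty (LocalKernel A x K) := by
  have hΩ : IsOpen (ch n x).target := (ch n x).open_target
  obtain ⟨χ, hχ, hχc, hχs, hχ01, hχ1⟩ := exists_cutoff hΩ hK hKΩ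
  have hχK : ∀ y ∈ K, χ y = 1 := fun y hy => hχ1.self_of_nhdsSet y hy
  have hKsub : K ⊆ tsupport χ := fun y hy => subset_tsupport _ (by simp [hχK y hy])
  have ha : ContinuousOn (fun y => Matrix.of (A.coef x y).1) (ch n x).target :=
    continuous_fst.comp_continuousOn (A.continuousOn_coef x)
  obtain ⟨g, c, M0, hg, hc, hM0, hsymm, hlow, hup, hinv⟩ :=
    exists_inverse_field hΩ hχc hχs ha (hA x)
  obtain ⟨N, hN, hNg⟩ := exists_le_gaussMass hc hM0 hlow hup
  obtain ⟨M1, hM1, hb1, hb2, hb3, hb4, hb5⟩ := exists_bounds_on_compact A hr hχc hχs hχ hχc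
  obtain ⟨C, hC, herr⟩ := exists_kernel_error_le n (M := max M0 M1) (hM0.trans (le_max_left _ _))
  obtain ⟨C', hC', hexp⟩ := exists_pow_mul_exp_le (c := c / 8) (by positivity)
  have hl := le_max_left M0 M1
  have hr' := le_max_right M0 M1
  refine ⟨⟨χ, g, c, N, c / 8, C * (N⁻¹ * C'), hχ, hχc, hχs, fun y => ?_, hχK, hg, hc, hlow, hN, hNg,
    hsymm, by positivity, by positivity, fun z hz y hy s hs hs1 => ?_⟩⟩
  · rw [abs_of_nonneg (hχ01 y).1]; exact (hχ01 y).2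
  · refine (herr (A.coef x z) (Matrix.of (A.coef x y).1) (g y) χ z y s (hsymm y)
      (hinv y (hKsub hy)) ((hb1 z hz).trans hr') (fun i j => (hb2 z hz y (hKsub hy) i j).trans
      (mul_le_mul_of_nonneg_right hr' (norm_nonneg _))) (fun i j => (hup y i j).trans hl)
      (hχ.of_le two_le_infty).contDiffAt ((hb3 z).trans hr') (fun i => (hb4 z i).trans hr')
      (fun i j => (hb5 z i j).trans hr') hs hs1).trans ?_
    have h1 := gauss_le hlow hN hNg hs y (z - y)
    set t := ‖z - y‖ / s with ht
    have ht0 : 0 ≤ t := by positivity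
    have h2 := hexp t ht0
    have e1 : c / 4 * ‖z - y‖ ^ 2 / s ^ 2 = 2 * (c / 8) * t ^ 2 := by
      rw [ht, div_pow]; ring
    have e2 : c / 8 * ‖z - y‖ ^ 2 / s ^ 2 = c / 8 * t ^ 2 := by
      rw [ht, div_pow]; ring
    rw [e1] at h1
    rw [e2]
    calc C * (1 + t + t ^ 3) * gauss s (g y) (z - y)
        ≤ C * (1 + t + t ^ 3) * (N⁻¹ * ((s ^ n)⁻¹ * exp (-(2 * (c / 8) * t ^ 2)))) := by
          gcongr
      _ = C * N⁻¹ * (s ^ n)⁻¹ * ((1 + t + t ^ 3) * exp (-(2 * (c / 8) * t ^ 2))) := by ring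
      _ ≤ C * N⁻¹ * (s ^ n)⁻¹ * (C' * exp (-(c / 8 * t ^ 2))) := by gcongr
      _ = _ := by ring

namespace LocalKernel
variable [IsManifold (𝓡 n) ∞ S] [T2Space S] {A : DiffOp n r S} {x : S} {K : Set (Rn n)}
  (P : LocalKernel A x K)

/-- The kernel and its image under the operator. -/
noncomputable def pair (q : ℝ × Rn n) : C(S, ℝ) × C(S, ℝ) :=
  have h := contMDiff_kernelFn (x := x) (g := P.g) P.contDiff_χ P.hasCompactSupport_χ
    P.tsupport_χ q.1 q.2
  (⟨kernelFn x P.χ P.g q.1 q.2, h.continuous⟩,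
    ⟨A.op (kernelFn x P.χ P.g q.1 q.2), A.continuous_op (h.of_le two_le_infty)⟩)

theorem pair_mem (q : ℝ × Rn n) : P.pair q ∈ A.smoothGraph :=
  ⟨contMDiff_kernelFn P.contDiff_χ P.hasCompactSupport_χ P.tsupport_χ q.1 q.2, fun _ => rfl⟩

theorem continuousOn_pair {ε : ℝ} (hε : 0 < ε) :
    ContinuousOn P.pair (Set.Ici ε ×ˢ Set.univ) := by
  have h1 := continuous_kernelFn_param (S := S) P.contDiff_χ P.hasCompactSupport_χ P.tsupport_χ
    P.continuous_g P.c_pos P.low P.N_pos P.le_gaussMass hε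
  have h2 := continuous_op_kernelFn_param (S := S) A P.contDiff_χ P.hasCompactSupport_χ
    P.tsupport_χ P.continuous_g P.symm P.c_pos P.low P.N_pos P.le_gaussMass hε
  have h3 := ((ContinuousMap.curry ⟨_, h1⟩).continuous.prodMk
    (ContinuousMap.curry ⟨_, h2⟩).continuous)
  refine h3.continuousOn.congr fun q hq => ?_
  have hm : max q.1 ε = q.1 := max_eq_left hq.1
  refine Prod.ext (ContinuousMap.ext fun p => ?_) (ContinuousMap.ext fun p => ?_)
  · change _ = kernelFn x P.χ P.g (max q.1 ε) q.2 p
    rw [hm]; rfl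
  · change _ = A.op (kernelFn x P.χ P.g (max q.1 ε) q.2) p
    rw [hm]; rfl

variable [CompactSpace S]

/-- The parametrix applied to a function in the chart. -/
noncomputable def param (κ : ℝ) (F : Rn n → ℝ) (ε : ℝ) : C(S, ℝ) × C(S, ℝ) :=
  ∫ q in Icc ε 1 ×ˢ K, (F q.2 * (2 * q.1 * exp (-(κ * q.1 ^ 2)))) • P.pair q

theorem continuousOn_integrand (κ : ℝ) {F : Rn n → ℝ} (hF : Continuous F) {ε : ℝ} (hε : 0 < ε) :
    ContinuousOn (fun q : ℝ × Rn n =>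
      (F q.2 * (2 * q.1 * exp (-(κ * q.1 ^ 2)))) • P.pair q) (Icc ε 1 ×ˢ K) := by
  have hc : Continuous fun q : ℝ × Rn n => F q.2 * (2 * q.1 * exp (-(κ * q.1 ^ 2))) := by
    fun_prop
  refine hc.continuousOn.smul ?_
  exact (P.continuousOn_pair hε).mono (Set.prod_mono (fun s hs => hs.1) (Set.subset_univ _))

theorem param_mem_graph (κ : ℝ) (F : Rn n → ℝ) (ε : ℝ) : P.param κ F ε ∈ A.graph :=
  integral_mem_submodule _ A.isClosed_graph (Filter.Eventually.of_forall fun q =>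
    A.graph.smul_mem _ (Submodule.le_topologicalClosure _ (P.pair_mem q)))

theorem integrableOn_integrand (hK : IsCompact K) (κ : ℝ) {F : Rn n → ℝ} (hF : Continuous F)
    {ε : ℝ} (hε : 0 < ε) : IntegrableOn (fun q : ℝ × Rn n =>
      (F q.2 * (2 * q.1 * exp (-(κ * q.1 ^ 2)))) • P.pair q) (Icc ε 1 ×ˢ K) :=
  (P.continuousOn_integrand κ hF hε).integrableOn_compact (isCompact_Icc.prod hK)

/-- Evaluation of the first component. -/
noncomputable def evalFst (p : S) : C(S, ℝ) × C(S, ℝ) →L[ℝ] ℝ :=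
  (evalCLM ℝ p).comp (ContinuousLinearMap.fst ℝ _ _)

/-- Evaluation of the second component. -/
noncomputable def evalSnd (p : S) : C(S, ℝ) × C(S, ℝ) →L[ℝ] ℝ :=
  (evalCLM ℝ p).comp (ContinuousLinearMap.snd ℝ _ _)

theorem param_fst_apply (hK : IsCompact K) (κ : ℝ) {F : Rn n → ℝ} (hF : Continuous F)
    {ε : ℝ} (hε : 0 < ε) (p : S) : (P.param κ F ε).1 p = ∫ q in Icc ε 1 ×ˢ K,
      F q.2 * (2 * q.1 * exp (-(κ * q.1 ^ 2))) * kernelFn x P.χ P.g q.1 q.2 p := by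
  have h := (evalFst p).integral_comp_comm (P.integrableOn_integrand hK κ hF hε)
  exact h.symm

theorem param_snd_apply (hK : IsCompact K) (κ : ℝ) {F : Rn n → ℝ} (hF : Continuous F)
    {ε : ℝ} (hε : 0 < ε) (p : S) : (P.param κ F ε).2 p = ∫ q in Icc ε 1 ×ˢ K,
      F q.2 * (2 * q.1 * exp (-(κ * q.1 ^ 2))) * A.op (kernelFn x P.χ P.g q.1 q.2) p := by
  have h := (evalSnd p).integral_comp_comm (P.integrableOn_integrand hK κ hF hε)
  exact h.symm

/-- The integral of the Gaussian weight used in the estimates. -/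
noncomputable def mass (P : LocalKernel A x K) : ℝ :=
  P.N⁻¹ * ∫ w : Rn n, exp (-(P.c / 4 * ‖w‖ ^ 2))

end LocalKernel

theorem totallyBounded_of_forall_close {E : Type*} [PseudoMetricSpace E] {s : Set E}
    (h : ∀ δ > 0, ∃ T, TotallyBounded T ∧ ∀ v ∈ s, ∃ t ∈ T, dist v t ≤ δ) : TotallyBounded s := by
  refine Metric.totallyBounded_iff.2 fun ε hε => ?_
  obtain ⟨T, hT, hs⟩ := h (ε / 2) (half_pos hε)
  obtain ⟨t, ht, hTt⟩ := Metric.totallyBounded_iff.1 hT (ε / 2) (half_pos hε)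
  refine ⟨t, ht, fun v hv => ?_⟩
  obtain ⟨w, hw, hvw⟩ := hs v hv
  have h1 := hTt hw
  simp only [Set.mem_iUnion, Metric.mem_ball] at h1 ⊢
  obtain ⟨y, hy, hwy⟩ := h1
  exact ⟨y, hy, by linarith [dist_triangle v w y]⟩

theorem setIntegral_exp_neg_mul_sq_le {κ : ℝ} (hκ : 0 < κ) (s : Set ℝ) :
    ∫ t in s, exp (-(κ * t ^ 2)) ≤ √(Real.pi / κ) := by
  have h := integral_gaussian κ
  rw [← h]
  have hi := integrable_exp_neg_mul_sq hκ
  simp only [neg_mul] at hi ⊢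
  exact setIntegral_le_integral hi (Eventually.of_forall fun _ => (exp_pos _).le)

namespace LocalKernel
variable [IsManifold (𝓡 n) ∞ S] [T2Space S] {A : DiffOp n r S} {x : S} {K : Set (Rn n)}
  (P : LocalKernel A x K)

section Heat
omit [IsManifold (𝓡 n) ∞ S] [T2Space S]

theorem continuous_gauss_field {s : ℝ} (hs : 0 < s) (z : Rn n) :
    Continuous fun y => gauss s (P.g y) (z - y) := by
  have h := (continuous_gauss_max P.continuous_g P.c_pos P.low P.N_pos P.le_gaussMass hs).comp
    (f := fun y : Rn n => ((s, y), z)) (by fun_prop)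
  simpa [comp_def] using h

theorem continuousOn_gauss_field {ε : ℝ} (hε : 0 < ε) (z : Rn n) (s : Set (Rn n)) :
    ContinuousOn (fun q : ℝ × Rn n => gauss q.1 (P.g q.2) (z - q.2)) (Icc ε 1 ×ˢ s) := by
  have h := (continuous_gauss_max P.continuous_g P.c_pos P.low P.N_pos P.le_gaussMass hε).comp
    (f := fun q : ℝ × Rn n => (q, z)) (by fun_prop)
  refine h.continuousOn.congr fun q hq => ?_
  simp [max_eq_left hq.1.1]

theorem continuous_heat {F : Rn n → ℝ} (hF : Continuous F) {m : ℝ} (hm : ∀ y, |F y| ≤ m) :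
    Continuous fun p : ℝ × Rn n => heatAvg P.g F p.1 p.2 :=
  continuous_heatAvg P.continuous_g P.c_pos P.low P.N_pos P.le_gaussMass hF hm

theorem abs_heatAvg_le {F : Rn n → ℝ} {m : ℝ} (hm : ∀ y, |F y| ≤ m) (s : ℝ) (z : Rn n) :
    |heatAvg P.g F s z| ≤ m * P.mass := by
  have hint := (integrable_exp_neg_mul_norm_sq (n := n) (c := P.c / 4)
    (by have := P.c_pos; positivity)).const_mul (m * P.N⁻¹)
  have h0 : 0 ≤ m := (abs_nonneg _).trans (hm 0)
  have := norm_integral_le_of_norm_le hint (f := fun w : Rn n => F (z - s • w) *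
    (gaussMass (P.g (z - s • w)))⁻¹ * exp (-(quad (P.g (z - s • w)) w / 4)))
    (Eventually.of_forall fun w => by
      have hpos := P.N_pos.trans_le (P.le_gaussMass (z - s • w))
      rw [norm_mul, norm_mul, norm_eq_abs, norm_eq_abs, norm_eq_abs,
        abs_of_pos (exp_pos _), abs_of_pos (inv_pos.2 hpos)]
      have h1 := inv_anti₀ P.N_pos (P.le_gaussMass (z - s • w))
      have h2 : exp (-(quad (P.g (z - s • w)) w / 4)) ≤ exp (-(P.c / 4 * ‖w‖ ^ 2)) :=
        Real.exp_le_exp.2 (by linarith [P.low (z - s • w) w])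
      have h3 := hm (z - s • w)
      have := P.N_pos
      gcongr)
  rw [integral_const_mul, mul_assoc] at this
  exact this

theorem integrable_mul_gauss (hK : IsCompact K) {F : Rn n → ℝ} (hF : Continuous F)
    (hF0 : ∀ y ∉ K, F y = 0) {s : ℝ} (hs : 0 < s) (z : Rn n) :
    Integrable fun y => F y * gauss s (P.g y) (z - y) :=
  (hF.mul (P.continuous_gauss_field hs z)).integrable_of_hasCompactSupport
    (HasCompactSupport.intro hK fun y hy => by
      show F y * _ = 0
      rw [hF0 y hy, zero_mul])

theorem setIntegral_heat (hK : IsCompact K) (κ : ℝ) {F : Rn n → ℝ} (hF : Continuous F)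
    (hF0 : ∀ y ∉ K, F y = 0) {ε : ℝ} (hε : 0 < ε) (hε1 : ε ≤ 1) (z : Rn n) :
    IntegrableOn (fun q : ℝ × Rn n => F q.2 * (exp (-(κ * q.1 ^ 2)) *
      (2 * κ * q.1 - (quad (P.g q.2) (z - q.2) / (2 * q.1 ^ 3) - n / q.1)) *
        gauss q.1 (P.g q.2) (z - q.2))) (Icc ε 1 ×ˢ K) ∧
    ∫ q in Icc ε 1 ×ˢ K, F q.2 * (exp (-(κ * q.1 ^ 2)) *
      (2 * κ * q.1 - (quad (P.g q.2) (z - q.2) / (2 * q.1 ^ 3) - n / q.1)) *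
        gauss q.1 (P.g q.2) (z - q.2)) =
    exp (-(κ * ε ^ 2)) * heatAvg P.g F ε z - exp (-κ) * heatAvg P.g F 1 z := by
  set G : ℝ × Rn n → ℝ := fun q => F q.2 * (exp (-(κ * q.1 ^ 2)) *
      (2 * κ * q.1 - (quad (P.g q.2) (z - q.2) / (2 * q.1 ^ 3) - n / q.1)) *
        gauss q.1 (P.g q.2) (z - q.2)) with hG
  have hs0 : ∀ q ∈ Icc ε 1 ×ˢ K, q.1 ≠ 0 := fun q hq => (hε.trans_le hq.1.1).ne'
  have hq : Continuous fun q : ℝ × Rn n => quad (P.g q.2) (z - q.2) :=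
    continuous_quad.comp ((P.continuous_g.comp continuous_snd).prodMk (by fun_prop))
  have hcont : ContinuousOn G (Icc ε 1 ×ˢ K) := by
    refine (hF.comp continuous_snd).continuousOn.mul (ContinuousOn.mul (ContinuousOn.mul
      (Continuous.continuousOn (by fun_prop)) ?_) (P.continuousOn_gauss_field hε z K))
    refine ContinuousOn.sub (Continuous.continuousOn (by fun_prop)) (ContinuousOn.sub
      (hq.continuousOn.div (Continuous.continuousOn (by fun_prop)) fun q h =>
        mul_ne_zero two_ne_zero (pow_ne_zero 3 (hs0 q h)))
      (continuousOn_const.div continuousOn_fst hs0))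
  have hint : IntegrableOn G (Icc ε 1 ×ˢ K) :=
    hcont.integrableOn_compact (isCompact_Icc.prod hK)
  refine ⟨hint, ?_⟩
  have hint' := hint
  rw [IntegrableOn, Measure.volume_eq_prod, ← Measure.prod_restrict] at hint'
  rw [Measure.volume_eq_prod, ← Measure.prod_restrict, integral_prod_symm _ hint']
  have hin : ∀ y : Rn n, ∫ s in Icc ε 1, G (s, y) =
      exp (-(κ * ε ^ 2)) * (F y * gauss ε (P.g y) (z - y)) -
        exp (-κ) * (F y * gauss 1 (P.g y) (z - y)) := by
    intro y
    rw [integral_Icc_eq_integral_Ioc, ← intervalIntegral.integral_of_le hε1]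
    have hd : ∀ s ∈ Set.uIcc ε 1, HasDerivAt
        (fun s : ℝ => -(F y * (exp (-(κ * s ^ 2)) * gauss s (P.g y) (z - y)))) (G (s, y)) s := by
      intro s hs
      rw [Set.uIcc_of_le hε1] at hs
      have h1 := hasDerivAt_gauss (P.g y) (hε.trans_le hs.1).ne' (z - y)
      have h2 : HasDerivAt (fun s : ℝ => exp (-(κ * s ^ 2)))
          (exp (-(κ * s ^ 2)) * (-(κ * (2 * s)))) s := by
        have h3 : HasDerivAt (fun s : ℝ => -(κ * s ^ 2)) (-(κ * (2 * s))) s := by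
          simpa using ((hasDerivAt_pow 2 s).const_mul κ).fun_neg
        exact h3.exp
      refine ((h2.fun_mul h1).const_mul (F y)).fun_neg.congr_deriv ?_
      simp only [hG]
      ring
    have hci : ContinuousOn (fun s => G (s, y)) (Set.uIcc ε 1) := by
      rw [Set.uIcc_of_le hε1]
      by_cases hy : y ∈ K
      · exact hcont.comp (f := fun s : ℝ => (s, y)) (by fun_prop) fun s hs => ⟨hs, hy⟩
      · have h0 : (fun s => G (s, y)) = fun _ => 0 := by
          funext s
          simp [hG, hF0 y hy]
        rw [h0]
        exact continuousOn_const
    rw [intervalIntegral.integral_eq_sub_of_hasDerivAt hd hci.intervalIntegrable]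
    rw [one_pow, mul_one]
    ring
  simp only [hin]
  rw [setIntegral_eq_integral_of_forall_compl_eq_zero fun y hy => by simp [hF0 y hy],
    integral_sub ((P.integrable_mul_gauss hK hF hF0 hε z).const_mul _)
      ((P.integrable_mul_gauss hK hF hF0 one_pos z).const_mul _), integral_const_mul,
    integral_const_mul, integral_mul_gauss_eq_heatAvg F hε, integral_mul_gauss_eq_heatAvg F one_pos]

end Heat

theorem kernelFn_apply {p : S} (hp : p ∈ (ch n x).source) (s : ℝ) (y : Rn n) :
    kernelFn x P.χ P.g s y p =
      P.χ (ch n x p) * gauss s (P.g y) (ch n x p - y) :=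
  extendChart_of_mem _ hp

theorem op_kernelFn_apply {p : S} (hp : p ∈ (ch n x).source) (s : ℝ) (y : Rn n) :
    A.op (kernelFn x P.χ P.g s y) p = (A.coef x (ch n x p)).eval
      (fun z' => P.χ z' * gauss s (P.g y) (z' - y)) (ch n x p) := by
  rw [op_kernelFn A P.contDiff_χ P.hasCompactSupport_χ P.tsupport_χ, extendChart_of_mem _ hp]

variable [CompactSpace S]

/-- The constant in the error estimate of the parametrix. -/
noncomputable def errConst (P : LocalKernel A x K) : ℝ :=
  P.mass + P.D * ∫ w : Rn n, exp (-(P.c' * ‖w‖ ^ 2))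

omit [IsManifold (𝓡 n) ∞ S] [T2Space S] [CompactSpace S] in
theorem mass_nonneg : 0 ≤ P.mass :=
  mul_nonneg (inv_nonneg.2 P.N_pos.le) (integral_nonneg fun _ => (exp_pos _).le)

omit [IsManifold (𝓡 n) ∞ S] [T2Space S] [CompactSpace S] in
theorem errConst_nonneg : 0 ≤ P.errConst :=
  add_nonneg P.mass_nonneg (mul_nonneg P.D_nonneg (integral_nonneg fun _ => (exp_pos _).le))

theorem abs_param_sub_le (hK : IsCompact K) {κ : ℝ} (hκ : 0 < κ) {F : Rn n → ℝ}
    (hF : Continuous F) (hF0 : ∀ y ∉ K, F y = 0) {m : ℝ} (hm : ∀ y, |F y| ≤ m) {ε : ℝ}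
    (hε : 0 < ε) (hε1 : ε ≤ 1) (p : S) :
    |κ * (P.param κ F ε).1 p - (P.param κ F ε).2 p - extendChart x (fun z => P.χ z *
      (exp (-(κ * ε ^ 2)) * heatAvg P.g F ε z)) p| ≤
      P.errConst * (exp (-κ) + √(Real.pi / κ)) * m := by
  have hm0 : 0 ≤ m := (abs_nonneg _).trans (hm 0)
  have hE := P.errConst_nonneg
  have hrhs : 0 ≤ P.errConst * (exp (-κ) + √(Real.pi / κ)) * m := by positivity
  have hi1 : IntegrableOn (fun q : ℝ × Rn n => F q.2 * (2 * q.1 * exp (-(κ * q.1 ^ 2))) *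
      kernelFn x P.χ P.g q.1 q.2 p) (Icc ε 1 ×ˢ K) :=
    (evalFst p).integrable_comp (P.integrableOn_integrand hK κ hF hε)
  have hi2 : IntegrableOn (fun q : ℝ × Rn n => F q.2 * (2 * q.1 * exp (-(κ * q.1 ^ 2))) *
      A.op (kernelFn x P.χ P.g q.1 q.2) p) (Icc ε 1 ×ˢ K) :=
    (evalSnd p).integrable_comp (P.integrableOn_integrand hK κ hF hε)
  rw [P.param_fst_apply hK κ hF hε, P.param_snd_apply hK κ hF hε]
  by_cases hp : p ∈ (ch n x).source
  swap
  · have h1 : ∀ s y, kernelFn x P.χ P.g s y p = 0 := fun s y => extendChart_of_notMem _ hp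
    have h2 : ∀ s y, A.op (kernelFn x P.χ P.g s y) p = 0 := fun s y => by
      rw [op_kernelFn A P.contDiff_χ P.hasCompactSupport_χ P.tsupport_χ, extendChart_of_notMem _ hp]
    simp only [h1, h2, mul_zero, integral_zero, extendChart_of_notMem _ hp, sub_zero, abs_zero]
    exact hrhs
  rw [extendChart_of_mem _ hp]
  simp only [P.kernelFn_apply hp, P.op_kernelFn_apply hp] at hi1 hi2 ⊢
  set z := ch n x p with hz
  by_cases hzχ : z ∈ tsupport P.χ
  swap
  · simp only [image_eq_zero_of_notMem_tsupport hzχ, eval_kernel_eq_zero _ hzχ, zero_mul, mul_zero,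
      integral_zero, sub_zero, abs_zero]
    exact hrhs
  obtain ⟨hi3, h3⟩ := P.setIntegral_heat hK κ hF hF0 hε hε1 z
  set Err : ℝ × Rn n → ℝ := fun q => F q.2 * exp (-(κ * q.1 ^ 2)) *
    (2 * q.1 * (A.coef x z).eval (fun z' => P.χ z' * gauss q.1 (P.g q.2) (z' - q.2)) z
      - P.χ z * ((quad (P.g q.2) (z - q.2) / (2 * q.1 ^ 3) - n / q.1) *
        gauss q.1 (P.g q.2) (z - q.2))) with hErr
  have hsplit : κ * (∫ q in Icc ε 1 ×ˢ K, F q.2 * (2 * q.1 * exp (-(κ * q.1 ^ 2))) *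
      (P.χ z * gauss q.1 (P.g q.2) (z - q.2))) - (∫ q in Icc ε 1 ×ˢ K, F q.2 *
      (2 * q.1 * exp (-(κ * q.1 ^ 2))) * (A.coef x z).eval
        (fun z' => P.χ z' * gauss q.1 (P.g q.2) (z' - q.2)) z)
      - P.χ z * (exp (-(κ * ε ^ 2)) * heatAvg P.g F ε z - exp (-κ) * heatAvg P.g F 1 z)
      = - ∫ q in Icc ε 1 ×ˢ K, Err q := by
    have h12 := (hi1.const_mul κ).sub hi2
    simp only [Pi.sub_def] at h12
    rw [← h3, ← integral_const_mul, ← integral_const_mul, ← integral_sub (hi1.const_mul κ) hi2,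
      ← integral_sub h12 (hi3.const_mul _), ← integral_neg]
    congr 1
    funext q
    simp only [hErr]
    ring
  have hbd : |∫ q in Icc ε 1 ×ˢ K, Err q| ≤
      (∫ s in Icc ε 1, m * P.D * exp (-(κ * s ^ 2))) *
        ∫ w : Rn n, exp (-(P.c' * ‖w‖ ^ 2)) := by
    have hD := P.D_nonneg
    refine abs_setIntegral_rectangle_le hε P.c'_pos hK z (by fun_prop)
      (fun s _ => by positivity) fun q hq => ?_
    have h4 := P.error_le z hzχ q.2 hq.2 q.1 (hε.trans_le hq.1.1) hq.1.2
    simp only [hErr]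
    rw [abs_mul, abs_mul, abs_of_pos (exp_pos _)]
    calc _ ≤ m * exp (-(κ * q.1 ^ 2)) *
        (P.D * ((q.1 ^ n)⁻¹ * exp (-(P.c' * ‖z - q.2‖ ^ 2 / q.1 ^ 2)))) := by
          have := hm q.2
          gcongr
      _ = _ := by ring
  rw [integral_const_mul] at hbd
  set J := ∫ w : Rn n, exp (-(P.c' * ‖w‖ ^ 2)) with hJ
  have hJ0 : 0 ≤ J := integral_nonneg fun _ => (exp_pos _).le
  have hbd2 : |∫ q in Icc ε 1 ×ˢ K, Err q| ≤ m * (P.D * J) * √(Real.pi / κ) := by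
    refine hbd.trans ?_
    have hD := P.D_nonneg
    calc _ ≤ m * P.D * √(Real.pi / κ) * J := by
          gcongr
          exact setIntegral_exp_neg_mul_sq_le hκ _
      _ = _ := by ring
  have h5 : |P.χ z * (exp (-κ) * heatAvg P.g F 1 z)| ≤ m * P.mass * exp (-κ) := by
    rw [abs_mul, abs_mul, abs_of_pos (exp_pos _)]
    have h6 := P.abs_heatAvg_le hm 1 z
    have h7 := P.abs_χ_le z
    have := P.mass_nonneg
    calc _ ≤ 1 * (exp (-κ) * (m * P.mass)) := by gcongr
      _ = _ := by ring
  have hrew : κ * (∫ q in Icc ε 1 ×ˢ K, F q.2 * (2 * q.1 * exp (-(κ * q.1 ^ 2))) *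
      (P.χ z * gauss q.1 (P.g q.2) (z - q.2))) - (∫ q in Icc ε 1 ×ˢ K, F q.2 *
      (2 * q.1 * exp (-(κ * q.1 ^ 2))) * (A.coef x z).eval
        (fun z' => P.χ z' * gauss q.1 (P.g q.2) (z' - q.2)) z)
      - P.χ z * (exp (-(κ * ε ^ 2)) * heatAvg P.g F ε z) =
      -(∫ q in Icc ε 1 ×ˢ K, Err q) - P.χ z * (exp (-κ) * heatAvg P.g F 1 z) := by
    rw [← hsplit]; ring
  rw [hrew]
  refine (abs_sub _ _).trans ?_
  rw [abs_neg]
  have hsq : 0 ≤ √(Real.pi / κ) := Real.sqrt_nonneg _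
  have hee := exp_pos (-κ)
  have hmass := P.mass_nonneg
  have hDJ : 0 ≤ P.D * J := mul_nonneg P.D_nonneg hJ0
  have : P.errConst = P.mass + P.D * J := rfl
  rw [this]
  nlinarith [mul_nonneg (mul_nonneg hmass hsq) hm0, mul_nonneg (mul_nonneg hDJ hee.le) hm0]

end LocalKernel

theorem totallyBounded_sum {ι E : Type*} [Fintype ι] [NormedAddCommGroup E] [CompleteSpace E]
    {T : ι → Set E} (h : ∀ i, TotallyBounded (T i)) :
    TotallyBounded {v : E | ∃ k : ι → E, (∀ i, k i ∈ T i) ∧ v = ∑ i, k i} := by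
  have hc : ∀ i, IsCompact (closure (T i)) := fun i =>
    (h i).closure.isCompact_of_isClosed isClosed_closure
  have h2 := (isCompact_univ_pi hc).image (f := fun k : ι → E => ∑ i, k i)
    (continuous_finsetSum _ fun i _ => continuous_apply i)
  refine h2.totallyBounded.subset ?_
  rintro v ⟨k, hk, rfl⟩
  exact ⟨k, fun i _ => subset_closure (hk i), rfl⟩

theorem integrable_indicator_of_integrableOn {Q E : Type*} [MeasurableSpace Q]
    [NormedAddCommGroup E] {f : Q → E} {s : Set Q} {μ : Measure Q} (h : IntegrableOn f s μ)
    (hs : MeasurableSet s) : Integrable (s.indicator f) μ :=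
  h.integrable_indicator hs

namespace LocalKernel
variable {A : DiffOp n r S} {x : S} {K : Set (Rn n)} (P : LocalKernel A x K)

theorem eventually_abs_heat_sub_le (κ : ℝ) {F : Rn n → ℝ}
    (hF : Continuous F) (hF0 : ∀ y ∉ K, F y = 0) {m : ℝ} (hm : ∀ y, |F y| ≤ m) {η : ℝ}
    (hη : 0 < η) : ∀ᶠ ε in 𝓝 (0 : ℝ), ∀ z ∈ tsupport P.χ,
      |P.χ z * (exp (-(κ * ε ^ 2)) * heatAvg P.g F ε z) - F z| ≤ η := by
  refine P.hasCompactSupport_χ.isCompact.eventually_forall_of_forall_eventually fun z _ => ?_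
  have hχF : P.χ z * F z = F z := by
    by_cases hz : z ∈ K
    · rw [P.χ_eq_one z hz, one_mul]
    · rw [hF0 z hz, mul_zero]
  have hc : Continuous fun q : ℝ × Rn n =>
      |P.χ q.2 * (exp (-(κ * q.1 ^ 2)) * heatAvg P.g F q.1 q.2) - F q.2| := by
    have h1 := P.continuous_heat hF hm
    have h2 := P.contDiff_χ.continuous
    fun_prop
  have h0 : |P.χ z * (exp (-(κ * (0 : ℝ) ^ 2)) * heatAvg P.g F 0 z) - F z| = 0 := by
    rw [heatAvg_zero P.N_pos P.le_gaussMass]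
    simp [hχF]
  have := hc.tendsto ((0 : ℝ), z)
  simp only [h0] at this
  filter_upwards [this.eventually (gt_mem_nhds hη)] with q hq using hq.le

variable [IsManifold (𝓡 n) ∞ S] [T2Space S] [CompactSpace S]

theorem abs_param_fst_sub_le (hK : IsCompact K) {κ : ℝ} (hκ : 0 ≤ κ) {F : Rn n → ℝ}
    (hF : Continuous F) (hm : ∀ y, |F y| ≤ 1) {ε δ : ℝ} (hε : 0 < ε) (hεδ : ε ≤ δ) (hδ : δ ≤ 1)
    (p : S) : |(P.param κ F ε).1 p - (P.param κ F δ).1 p| ≤ 2 * P.mass * δ := by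
  have hmass := P.mass_nonneg
  have hi : IntegrableOn (fun q : ℝ × Rn n => F q.2 * (2 * q.1 * exp (-(κ * q.1 ^ 2))) *
      kernelFn x P.χ P.g q.1 q.2 p) (Icc ε 1 ×ˢ K) :=
    (evalFst p).integrable_comp (P.integrableOn_integrand hK κ hF hε)
  rw [P.param_fst_apply hK κ hF hε, P.param_fst_apply hK κ hF (hε.trans_le hεδ)]
  have hun : Icc ε 1 ×ˢ K = (Set.Ico ε δ ×ˢ K) ∪ (Icc δ 1 ×ˢ K) := by
    rw [← Set.union_prod, Set.Ico_union_Icc_eq_Icc hεδ hδ]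
  have hdis : Disjoint (Set.Ico ε δ ×ˢ K) (Icc δ 1 ×ˢ K) := by
    rw [Set.disjoint_left]
    rintro q ⟨h1, _⟩ ⟨h2, _⟩
    exact absurd h1.2 (not_lt.2 h2.1)
  rw [hun] at hi ⊢
  rw [setIntegral_union hdis (measurableSet_Icc.prod hK.measurableSet) hi.left_of_union
    hi.right_of_union, add_sub_cancel_right]
  have hae : (Set.Ico ε δ ×ˢ K : Set (ℝ × Rn n)) =ᵐ[volume] Icc ε δ ×ˢ K :=
    Measure.set_prod_ae_eq Ico_ae_eq_Icc (ae_eq_refl _)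
  rw [setIntegral_congr_set hae]
  by_cases hp : p ∈ (ch n x).source
  swap
  · have h1 : ∀ s y, kernelFn x P.χ P.g s y p = 0 := fun s y => extendChart_of_notMem _ hp
    simp only [h1, mul_zero, integral_zero, abs_zero]
    have : 0 ≤ δ := hε.le.trans hεδ
    positivity
  simp only [P.kernelFn_apply hp]
  set z := ch n x p
  have hc := P.c_pos
  have hN := P.N_pos
  have h := abs_setIntegral_rectangle_le (a := ε) (b := δ) (c := P.c / 4) hε (by positivity) hK z
    (ψ := fun _ => 2 * P.N⁻¹) continuous_const (fun _ _ => by positivity)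
    (G := fun q => F q.2 * (2 * q.1 * exp (-(κ * q.1 ^ 2))) *
      (P.χ z * gauss q.1 (P.g q.2) (z - q.2))) ?_
  · refine h.trans ?_
    rw [setIntegral_const, Real.volume_real_Icc_of_le hεδ, smul_eq_mul]
    have : P.mass = P.N⁻¹ * ∫ w : Rn n, exp (-(P.c / 4 * ‖w‖ ^ 2)) := rfl
    rw [show (δ - ε) * (2 * P.N⁻¹) * (∫ w : Rn n, exp (-(P.c / 4 * ‖w‖ ^ 2))) =
      2 * P.mass * (δ - ε) by rw [this]; ring]
    gcongr
    linarith
  · rintro q ⟨h1, _⟩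
    have hs : 0 < q.1 := hε.trans_le h1.1
    have hs1 : q.1 ≤ 1 := h1.2.trans hδ
    have hg := gauss_le P.low P.N_pos P.le_gaussMass hs q.2 (z - q.2)
    have hg0 := gauss_nonneg hs.le (P.g q.2) (z - q.2)
    have he : exp (-(κ * q.1 ^ 2)) ≤ 1 :=
      Real.exp_le_one_iff.2 (neg_nonpos.2 (by positivity))
    rw [abs_mul, abs_mul, abs_mul, abs_mul, abs_mul, abs_of_pos hs, abs_of_pos (exp_pos _),
      abs_two, abs_of_nonneg hg0]
    have h3 := P.abs_χ_le z
    have h4 := hm q.2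
    calc _ ≤ 1 * (2 * 1 * 1) * (1 * (P.N⁻¹ * ((q.1 ^ n)⁻¹ *
          exp (-(P.c / 4 * ‖z - q.2‖ ^ 2 / q.1 ^ 2))))) := by gcongr
      _ = _ := by ring

theorem totallyBounded_param (hK : IsCompact K) {κ : ℝ} (hκ : 0 ≤ κ) :
    TotallyBounded {u : C(S, ℝ) | ∃ F ε, Continuous F ∧ (∀ y, |F y| ≤ 1) ∧ 0 < ε ∧ ε ≤ 1 ∧
      u = (P.param κ F ε).1} := by
  have hmass := P.mass_nonneg
  refine totallyBounded_of_forall_close fun η hη => ?_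
  obtain ⟨δ, hδ, hδ1, hδη⟩ : ∃ δ : ℝ, 0 < δ ∧ δ ≤ 1 ∧ 2 * P.mass * δ ≤ η := by
    refine ⟨min 1 (η / (2 * P.mass + 1)), by positivity, min_le_left _ _, ?_⟩
    have h1 : min 1 (η / (2 * P.mass + 1)) ≤ η / (2 * P.mass + 1) := min_le_right _ _
    have h2 : (2 * P.mass + 1) * (η / (2 * P.mass + 1)) = η := by field_simp
    have h3 : 0 ≤ η / (2 * P.mass + 1) := by positivity
    nlinarith
  have hT := totallyBounded_integrals (isCompact_Icc.prod hK : IsCompact (Icc δ 1 ×ˢ K))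
    (measurableSet_Icc.prod hK.measurableSet) (μ := volume)
    (isCompact_Icc.prod hK).measure_lt_top.ne ((P.continuousOn_pair hδ).mono
      (Set.prod_mono (fun s hs => hs.1) (Set.subset_univ _))) 2
  refine ⟨_, hT.image uniformContinuous_fst, ?_⟩
  have key : ∀ F ε, Continuous F → (∀ y, |F y| ≤ 1) → δ ≤ ε → ε ≤ 1 →
      P.param κ F ε ∈ {v : C(S, ℝ) × C(S, ℝ) | ∃ φ : ℝ × Rn n → ℝ,
      (∀ q ∈ Icc δ 1 ×ˢ K, |φ q| ≤ 2) ∧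
      IntegrableOn (fun q => φ q • P.pair q) (Icc δ 1 ×ˢ K) volume ∧
      v = ∫ q in Icc δ 1 ×ˢ K, φ q • P.pair q} := by
    intro F ε hF hm hδε hε1
    have hsub : Icc ε 1 ×ˢ K ⊆ Icc δ 1 ×ˢ K :=
      Set.prod_mono (Set.Icc_subset_Icc_left hδε) subset_rfl
    have hme : MeasurableSet (Icc ε 1 ×ˢ K) := measurableSet_Icc.prod hK.measurableSet
    have heq : (fun q => (Icc ε 1 ×ˢ K).indicator (fun q : ℝ × Rn n =>
        F q.2 * (2 * q.1 * exp (-(κ * q.1 ^ 2)))) q • P.pair q) =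
        (Icc ε 1 ×ˢ K).indicator (fun q : ℝ × Rn n =>
        (F q.2 * (2 * q.1 * exp (-(κ * q.1 ^ 2)))) • P.pair q) := by
      funext q
      by_cases hq : q ∈ Icc ε 1 ×ˢ K
      · simp only [Set.indicator_of_mem hq]
      · simp only [Set.indicator_of_notMem hq, zero_smul]
    refine ⟨(Icc ε 1 ×ˢ K).indicator fun q =>
      F q.2 * (2 * q.1 * exp (-(κ * q.1 ^ 2))), fun q hq => ?_, ?_, ?_⟩
    · by_cases hq' : q ∈ Icc ε 1 ×ˢ K
      · rw [Set.indicator_of_mem hq']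
        have hs : 0 < q.1 := hδ.trans_le hq.1.1
        have hs1 : q.1 ≤ 1 := hq.1.2
        have he : exp (-(κ * q.1 ^ 2)) ≤ 1 :=
          Real.exp_le_one_iff.2 (neg_nonpos.2 (by positivity))
        rw [abs_mul, abs_mul, abs_mul, abs_of_pos hs, abs_of_pos (exp_pos _), abs_two]
        have h4 := hm q.2
        calc _ ≤ 1 * (2 * 1 * 1 : ℝ) := by gcongr
          _ = 2 := by norm_num
      · rw [Set.indicator_of_notMem hq', abs_zero]
        norm_num
    · rw [heq]
      exact (integrable_indicator_of_integrableOn (P.integrableOn_integrand hK κ hF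
        (hδ.trans_le hδε)) hme).integrableOn
    · rw [heq, setIntegral_indicator hme, Set.inter_eq_right.2 hsub, param]
  rintro u ⟨F, ε, hF, hm, hε, hε1, rfl⟩
  rcases le_total δ ε with h | h
  · exact ⟨_, ⟨_, key F ε hF hm h hε1, rfl⟩, by rw [dist_self]; exact hη.le⟩
  · refine ⟨_, ⟨_, key F δ hF hm le_rfl hδ1, rfl⟩, ?_⟩
    rw [ContinuousMap.dist_le hη.le]
    intro p
    rw [Real.dist_eq]
    exact (P.abs_param_fst_sub_le hK hκ hF hm hε h hδ1 p).trans hδη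

end LocalKernel

section Pullback

/-- The expression in a chart of a function supported in the domain of the chart. -/
noncomputable def pullChart (x : S) (u : S → ℝ) : Rn n → ℝ :=
  (ch n x).target.indicator (u ∘ (ch n x).symm)

theorem pullChart_eq_zero {x : S} {u : S → ℝ} {y : Rn n}
    (hy : y ∉ ch n x '' tsupport u) : pullChart x u y = 0 := by
  by_cases h : y ∈ (ch n x).target
  · rw [pullChart, Set.indicator_of_mem h, comp_apply]
    refine image_eq_zero_of_notMem_tsupport fun h' => hy ⟨_, h', ?_⟩
    exact (ch n x).right_inv h
  · exact Set.indicator_of_notMem h _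

theorem isCompact_image_tsupport [CompactSpace S] {x : S} {u : S → ℝ}
    (hs : tsupport u ⊆ (ch n x).source) : IsCompact (ch n x '' tsupport u) :=
  (isClosed_tsupport u).isCompact.image_of_continuousOn
    ((ch n x).continuousOn.mono hs)

theorem image_tsupport_subset {x : S} {u : S → ℝ}
    (hs : tsupport u ⊆ (ch n x).source) :
    ch n x '' tsupport u ⊆ (ch n x).target := by
  rintro _ ⟨p, hp, rfl⟩
  exact (ch n x).map_source (hs hp)

theorem continuous_pullChart [CompactSpace S] {x : S} {u : S → ℝ} (hu : Continuous u)
    (hs : tsupport u ⊆ (ch n x).source) : Continuous (pullChart (n := n) x u) := by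
  rw [continuous_iff_continuousAt]
  intro y
  by_cases hy : y ∈ (ch n x).target
  · have h1 : ContinuousAt (u ∘ (ch n x).symm) y :=
      ContinuousAt.comp hu.continuousAt ((ch n x).continuousAt_symm hy)
    refine h1.congr ?_
    filter_upwards [(ch n x).open_target.mem_nhds hy] with z hz
    exact (Set.indicator_of_mem hz _).symm
  · refine (continuousAt_const (y := (0 : ℝ))).congr ?_
    have hc := (isCompact_image_tsupport hs).isClosed.isOpen_compl
    filter_upwards [hc.mem_nhds fun h => hy (image_tsupport_subset hs h)] with z hz
    exact (pullChart_eq_zero hz).symm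

theorem pullChart_apply {x p : S} (u : S → ℝ) (hp : p ∈ (ch n x).source) :
    pullChart x u (ch n x p) = u p := by
  rw [pullChart, Set.indicator_of_mem ((ch n x).map_source hp), comp_apply,
    (ch n x).left_inv hp]

variable [IsManifold (𝓡 n) ∞ S] [T2Space S] [CompactSpace S]

theorem DiffOp.exists_local_parametrix (A : DiffOp n r S) (hr : 1 ≤ r) (hA : A.IsElliptic) (x : S)
    {χ : S → ℝ} (hχ : Continuous χ) (hχs : tsupport χ ⊆ (ch n x).source)
    (hχ1 : ∀ p, |χ p| ≤ 1) :
    ∃ C, 0 ≤ C ∧ ∀ κ > 0, ∃ T : Set C(S, ℝ), TotallyBounded T ∧ ∀ f : C(S, ℝ), ‖f‖ ≤ 1 →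
      ∀ η > 0, ∃ v ∈ A.graph, v.1 ∈ T ∧ ∀ p, |κ * v.1 p - v.2 p - χ p * f p| ≤
        C * (exp (-κ) + √(Real.pi / κ)) + η := by
  set K := ch n x '' tsupport χ with hKdef
  have hK : IsCompact K := isCompact_image_tsupport hχs
  obtain ⟨P⟩ := A.exists_localKernel hr hA x hK (image_tsupport_subset hχs)
  refine ⟨P.errConst, P.errConst_nonneg, fun κ hκ => ⟨_, P.totallyBounded_param hK hκ.le, ?_⟩⟩
  intro f hf η hη
  have hts : tsupport (fun p => χ p * f p) ⊆ tsupport χ := tsupport_mul_subset_left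
  set F : Rn n → ℝ := pullChart x fun p => χ p * f p with hFdef
  have hF : Continuous F := continuous_pullChart (hχ.mul f.continuous) (hts.trans hχs)
  have hF0 : ∀ y ∉ K, F y = 0 := fun y hy =>
    pullChart_eq_zero fun h => hy (Set.image_mono hts h)
  have hm : ∀ y, |F y| ≤ 1 := by
    intro y
    by_cases hy : y ∈ (ch n x).target
    · rw [hFdef, pullChart, Set.indicator_of_mem hy, comp_apply, abs_mul]
      exact mul_le_one₀ (hχ1 _) (abs_nonneg _) ((f.norm_coe_le_norm _).trans hf)
    · rw [hFdef, pullChart, Set.indicator_of_notMem hy, abs_zero]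
      exact zero_le_one
  have hev := P.eventually_abs_heat_sub_le κ hF hF0 hm hη
  obtain ⟨d, hd, hball⟩ := Metric.eventually_nhds_iff.1 hev
  set ε := min 1 (d / 2) with hε
  have hε0 : 0 < ε := by positivity
  have hεd : ε < d := (min_le_right _ _).trans_lt (half_lt_self hd)
  have hh := hball (y := ε) (by rwa [Real.dist_eq, sub_zero, abs_of_pos hε0])
  refine ⟨P.param κ F ε, P.param_mem_graph κ F ε, ⟨F, ε, hF, hm, hε0, min_le_left _ _, rfl⟩,
    fun p => ?_⟩
  have h1 := P.abs_param_sub_le hK hκ hF hF0 hm hε0 (min_le_left _ _) p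
  rw [mul_one] at h1
  have h2 : |extendChart x (fun z => P.χ z *
      (exp (-(κ * ε ^ 2)) * heatAvg P.g F ε z)) p - χ p * f p| ≤ η := by
    by_cases hp : p ∈ (ch n x).source
    · rw [extendChart_of_mem _ hp, ← pullChart_apply (fun p => χ p * f p) hp]
      by_cases hz : ch n x p ∈ tsupport P.χ
      · exact hh _ hz
      · have hzK : ch n x p ∉ K := fun h => hz (subset_tsupport _ (by
          simp [P.χ_eq_one _ h]))
        have := hF0 _ hzK
        rw [hFdef] at this
        rw [image_eq_zero_of_notMem_tsupport hz, this]
        simpa using hη.le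
    · rw [extendChart_of_notMem _ hp, image_eq_zero_of_notMem_tsupport fun h => hp (hχs h)]
      simpa using hη.le
  calc _ = |(κ * (P.param κ F ε).1 p - (P.param κ F ε).2 p - extendChart x (fun z => P.χ z *
      (exp (-(κ * ε ^ 2)) * heatAvg P.g F ε z)) p) + (extendChart x (fun z => P.χ z *
      (exp (-(κ * ε ^ 2)) * heatAvg P.g F ε z)) p - χ p * f p)| := by
        rw [sub_add_sub_cancel]
    _ ≤ _ := (abs_add_le _ _).trans (add_le_add h1 h2)

theorem DiffOp.exists_parametrix (A : DiffOp n r S) (hr : 1 ≤ r) (hA : A.IsElliptic) :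
    ∃ κ₀ : ℝ, 0 < κ₀ ∧ ∀ κ : ℝ, κ₀ ≤ κ → ∃ T : Set C(S, ℝ), TotallyBounded T ∧ ∀ f : C(S, ℝ), ‖f‖ ≤ 1 →
      ∃ v ∈ A.graph, v.1 ∈ T ∧ ‖κ • v.1 - v.2 - f‖ ≤ 1 / 2 := by
  obtain ⟨χ, hχ⟩ := SmoothPartitionOfUnity.exists_isSubordinate (𝓡 n) (M := S)
    (ι := centers n S) isClosed_univ (fun i => (ch n i.1).source)
    (fun i => (ch n i.1).open_source) (fun p _ => by
      obtain ⟨z, hz, hp, _⟩ := exists_mem_piece n p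
      exact Set.mem_iUnion.2 ⟨⟨z, hz⟩, hp⟩)
  have hsum : ∀ p, ∑ i, χ i p = 1 := fun p => by
    rw [← finsum_eq_sum_of_fintype]
    exact χ.sum_eq_one (Set.mem_univ p)
  have hloc := fun i : centers n S => A.exists_local_parametrix hr hA i.1 (χ := χ i)
    (χ i).contMDiff.continuous (hχ i) fun p => by
      rw [abs_of_nonneg (χ.nonneg i p)]; exact χ.le_one i p
  choose C hC hpar using hloc
  set N : ℝ := (Fintype.card (centers n S) : ℝ) with hN
  have hlim : Tendsto (fun κ : ℝ => (∑ i, C i) * (exp (-κ) + √(Real.pi / κ))) atTop (𝓝 0) := by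
    have h1 : Tendsto (fun κ : ℝ => Real.pi / κ) atTop (𝓝 0) :=
      tendsto_const_nhds.div_atTop tendsto_id
    have h2 : Tendsto (fun κ : ℝ => √(Real.pi / κ)) atTop (𝓝 0) := by
      have h3 := (Real.continuous_sqrt.tendsto 0).comp h1
      rwa [Real.sqrt_zero] at h3
    simpa using (Real.tendsto_exp_neg_atTop_nhds_zero.add h2).const_mul (∑ i, C i)
  obtain ⟨κ₀, hκ₀⟩ := eventually_atTop.1
    ((hlim.eventually (gt_mem_nhds (show (0 : ℝ) < 1 / 4 by norm_num))))
  refine ⟨max κ₀ 1, by positivity, fun κ hκ => ?_⟩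
  have hκ1 : 0 < κ := one_pos.trans_le ((le_max_right _ _).trans hκ)
  have hκ2 := hκ₀ κ ((le_max_left _ _).trans hκ)
  choose T hT hTf using fun i => hpar i κ hκ1
  refine ⟨_, totallyBounded_sum hT, fun f hf => ?_⟩
  have hη : 0 < 1 / (4 * (N + 1)) := by positivity
  choose v hv hvT hve using fun i => hTf i f hf _ hη
  refine ⟨∑ i, v i, A.graph.sum_mem fun i _ => hv i, ⟨fun i => (v i).1, hvT, Prod.fst_sum⟩, ?_⟩
  rw [ContinuousMap.norm_le _ (by norm_num)]
  intro p
  have e1 : (κ • (∑ i, v i).1 - (∑ i, v i).2 - f) p =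
      ∑ i, (κ * (v i).1 p - (v i).2 p - χ i p * f p) := by
    rw [sum_sub_distrib, sum_sub_distrib, ← mul_sum, ← sum_mul, hsum,
      Prod.fst_sum, Prod.snd_sum]
    simp [ContinuousMap.sum_apply]
  rw [e1, norm_eq_abs]
  refine (abs_sum_le_sum_abs _ _).trans ((sum_le_sum fun i _ => hve i p).trans ?_)
  rw [sum_add_distrib, ← sum_mul, Finset.sum_const, Finset.card_univ, nsmul_eq_mul,
    ← hN]
  have : N * (1 / (4 * (N + 1))) ≤ 1 / 4 := by
    rw [mul_one_div, div_le_div_iff₀ (by positivity) (by norm_num)]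
    linarith
  linarith

end Pullback

section Resolvent
variable [IsManifold (𝓡 n) ∞ S] [CompactSpace S]

theorem DiffOp.neg_le_of_smooth {A : DiffOp n r S} (hA : A.IsElliptic) {κ : ℝ}
    (hκ : ∀ p, A.op (fun _ => 1) p + 1 ≤ κ) {u : S → ℝ} (hu : SmoothFn[n] 2 u) {η : ℝ}
    (hη : 0 ≤ η) (h : ∀ p, -η ≤ κ * u p - A.op u p) (q : S) : -η ≤ u q := by
  obtain ⟨p, -, hp⟩ := isCompact_univ.exists_isMinOn ⟨q, Set.mem_univ q⟩ hu.continuous.continuousOn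
  have hmin : ∀ q, u p ≤ u q := fun q => hp (Set.mem_univ q)
  refine le_trans ?_ (hmin q)
  have h1 := A.op_ge_of_isMin hA hu hmin
  have h2 := h p
  have h3 := hκ p
  by_contra hlt
  push Not at hlt
  nlinarith

theorem DiffOp.neg_le_of_mem_graph {A : DiffOp n r S} (hA : A.IsElliptic) {κ : ℝ}
    (hκ : ∀ p, A.op (fun _ => 1) p + 1 ≤ κ) {v : C(S, ℝ) × C(S, ℝ)} (hv : v ∈ A.graph) {η : ℝ}
    (hη : 0 ≤ η) (h : ∀ p, -η ≤ κ * v.1 p - v.2 p) (q : S) : -η ≤ v.1 q := by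
  obtain ⟨w, hw, hlim⟩ := DiffOp.exists_seq_of_mem_graph hv
  have h1 : Tendsto (fun m => ‖κ • (w m).1 - (w m).2 - (κ • v.1 - v.2)‖) atTop (𝓝 0) := by
    have hc : Continuous fun z : C(S, ℝ) × C(S, ℝ) => ‖κ • z.1 - z.2 - (κ • v.1 - v.2)‖ := by
      fun_prop
    have := (hc.tendsto v).comp hlim
    simpa [comp_def] using this
  have h2 : Tendsto (fun m => (w m).1 q) atTop (𝓝 (v.1 q)) :=
    (((evalCLM ℝ q).continuous.comp continuous_fst).tendsto v).comp hlim
  have h3 : ∀ m, -(η + ‖κ • (w m).1 - (w m).2 - (κ • v.1 - v.2)‖) ≤ (w m).1 q := by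
    intro m
    refine DiffOp.neg_le_of_smooth hA hκ ((hw m).1.of_le two_le_infty) (by positivity)
      (fun p => ?_) q
    have h4 := (κ • (w m).1 - (w m).2 - (κ • v.1 - v.2)).norm_coe_le_norm p
    have h5 := abs_le.1 h4
    have h6 := h p
    rw [← (hw m).2 p]
    simp only [sub_at, smul_at, smul_eq_mul] at h5
    linarith [h5.1]
  have h7 := ((h1.const_add η).neg)
  rw [add_zero] at h7
  exact le_of_tendsto_of_tendsto' h7 h2 h3

theorem DiffOp.norm_le_of_mem_graph {A : DiffOp n r S} (hA : A.IsElliptic) {κ : ℝ}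
    (hκ : ∀ p, A.op (fun _ => 1) p + 1 ≤ κ) {v : C(S, ℝ) × C(S, ℝ)} (hv : v ∈ A.graph) :
    ‖v.1‖ ≤ ‖κ • v.1 - v.2‖ := by
  rw [ContinuousMap.norm_le _ (norm_nonneg _)]
  intro q
  have hb := fun p => abs_le.1 ((κ • v.1 - v.2).norm_coe_le_norm p)
  simp only [sub_at, smul_at, smul_eq_mul] at hb
  have h1 := DiffOp.neg_le_of_mem_graph hA hκ hv (norm_nonneg _) (fun p => (hb p).1) q
  have h2 := DiffOp.neg_le_of_mem_graph hA hκ (A.graph.neg_mem hv) (norm_nonneg (κ • v.1 - v.2))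
    (fun p => by
      have := (hb p).2
      simp only [Prod.fst_neg, Prod.snd_neg, neg_at]
      linarith) q
  simp only [Prod.fst_neg, neg_at] at h2
  exact abs_le.2 ⟨h1, by linarith⟩

/-- `T` is the inverse of `κ - A`, in the space of continuous functions. -/
structure DiffOp.IsResolvent (A : DiffOp n r S) (κ : ℝ) (T : C(S, ℝ) →L[ℝ] C(S, ℝ)) : Prop where
  mem_graph : ∀ f, (T f, κ • T f - f) ∈ A.graph
  apply_of_mem : ∀ v ∈ A.graph, T (κ • v.1 - v.2) = v.1
  totallyBounded : TotallyBounded (T '' Metric.closedBall 0 1)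

/-- `κ - A` on the graph of the closure of `A`. -/
noncomputable def DiffOp.shift (A : DiffOp n r S) (κ : ℝ) : A.graph →L[ℝ] C(S, ℝ) :=
  ContinuousLinearMap.comp (κ • ContinuousLinearMap.fst ℝ C(S, ℝ) C(S, ℝ) -
    ContinuousLinearMap.snd ℝ C(S, ℝ) C(S, ℝ)) A.graph.subtypeL

theorem DiffOp.shift_apply (A : DiffOp n r S) (κ : ℝ) (v : A.graph) :
    A.shift κ v = κ • v.1.1 - v.1.2 := rfl

theorem DiffOp.isClosed_range_shift {A : DiffOp n r S} (hA : A.IsElliptic) {κ : ℝ}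
    (hκ : ∀ p, A.op (fun _ => 1) p + 1 ≤ κ) : IsClosed (Set.range (A.shift κ)) := by
  have hcomp : CompleteSpace A.graph := A.isClosed_graph.completeSpace_coe
  have hbound : ∀ v : A.graph, ‖v‖ ≤ ((|κ| + 1).toNNReal : ℝ) * ‖A.shift κ v‖ := by
    intro v
    rw [Real.coe_toNNReal _ (by positivity), A.shift_apply]
    have h1 := DiffOp.norm_le_of_mem_graph hA hκ v.2
    have h2 : ‖v.1.2‖ ≤ |κ| * ‖v.1.1‖ + ‖κ • v.1.1 - v.1.2‖ := by
      calc ‖v.1.2‖ = ‖κ • v.1.1 - (κ • v.1.1 - v.1.2)‖ := by rw [sub_sub_cancel]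
        _ ≤ ‖κ • v.1.1‖ + ‖κ • v.1.1 - v.1.2‖ := norm_sub_le _ _
        _ = _ := by rw [norm_smul, norm_eq_abs]
    have h3 := abs_nonneg κ
    have h4 := norm_nonneg (κ • v.1.1 - v.1.2)
    change ‖v.1‖ ≤ _
    rw [Prod.norm_def]
    refine max_le (by nlinarith) (by nlinarith)
  exact ((A.shift κ).antilipschitz_of_bound hbound).isClosed_range
    (A.shift κ).uniformContinuous

theorem DiffOp.exists_resolvent [T2Space S] (A : DiffOp n r S) (hr : 1 ≤ r) (hA : A.IsElliptic) :
    ∃ κ₀ : ℝ, ∀ κ, κ₀ ≤ κ → (∀ p, A.op (fun _ => 1) p + 1 ≤ κ) ∧ ∃ T, A.IsResolvent κ T := by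
  obtain ⟨κ₁, -, hpar⟩ := A.exists_parametrix hr hA
  obtain ⟨M, hM⟩ := isCompact_univ.exists_bound_of_continuousOn
    (A.continuous_op (u := fun _ => 1) contMDiff_const).continuousOn
  refine ⟨max κ₁ (M + 1), fun κ hκ => ?_⟩
  have hκA : ∀ p, A.op (fun _ => 1) p + 1 ≤ κ := fun p => by
    have h1 := (le_abs_self _).trans (hM p (Set.mem_univ p))
    linarith [(le_max_right _ _).trans hκ]
  refine ⟨hκA, ?_⟩
  obtain ⟨K, hK, hKf⟩ := hpar κ ((le_max_left _ _).trans hκ)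
  have hsurj : LinearMap.range (A.shift κ : A.graph →ₗ[ℝ] C(S, ℝ)) = ⊤ := by
    by_contra hne
    have hcl : IsClosed ((LinearMap.range (A.shift κ : A.graph →ₗ[ℝ] C(S, ℝ)) :
        Submodule ℝ C(S, ℝ)) : Set C(S, ℝ)) := DiffOp.isClosed_range_shift hA hκA
    obtain ⟨f, -, hf1, hf⟩ := riesz_lemma_of_lt_one (𝕜 := ℝ) hcl
      (by simpa [Submodule.eq_top_iff'] using hne) (r := 3 / 4) (by norm_num)
    obtain ⟨v, hv, -, hve⟩ := hKf f hf1.le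
    have h1 := hf _ ⟨⟨v, hv⟩, rfl⟩
    have h2 : ‖f - (κ • v.1 - v.2)‖ ≤ 1 / 2 := by rwa [norm_sub_rev]
    have h3 : (A.shift κ : A.graph →ₗ[ℝ] C(S, ℝ)) ⟨v, hv⟩ = κ • v.1 - v.2 := rfl
    rw [h3] at h1
    linarith
  have hinj : Function.Injective (A.shift κ : A.graph →ₗ[ℝ] C(S, ℝ)) := by
    rw [← LinearMap.ker_eq_bot, LinearMap.ker_eq_bot']
    intro v hv
    have h0 : κ • v.1.1 - v.1.2 = 0 := hv
    have h1 := DiffOp.norm_le_of_mem_graph hA hκA v.2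
    rw [h0, norm_zero] at h1
    have h2 : v.1.1 = 0 := norm_le_zero_iff.1 h1
    rw [h2, smul_zero, zero_sub, neg_eq_zero] at h0
    exact Subtype.ext (Prod.ext h2 h0)
  let e := LinearEquiv.ofBijective (A.shift κ : A.graph →ₗ[ℝ] C(S, ℝ))
    ⟨hinj, LinearMap.range_eq_top.1 hsurj⟩
  let T₀ : C(S, ℝ) →ₗ[ℝ] C(S, ℝ) :=
    (LinearMap.fst ℝ _ _).comp (A.graph.subtype.comp e.symm.toLinearMap)
  have he : ∀ f, κ • (e.symm f).1.1 - (e.symm f).1.2 = f := fun f => e.apply_symm_apply f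
  have hbound : ∀ f, ‖T₀ f‖ ≤ 1 * ‖f‖ := by
    intro f
    have := DiffOp.norm_le_of_mem_graph hA hκA (e.symm f).2
    rw [he] at this
    rwa [one_mul]
  have hTf : ∀ f, T₀.mkContinuous 1 hbound f = (e.symm f).1.1 := fun f => rfl
  have hinv : ∀ v ∈ A.graph, T₀.mkContinuous 1 hbound (κ • v.1 - v.2) = v.1 := by
    intro v hv
    rw [hTf]
    have : e.symm (κ • v.1 - v.2) = ⟨v, hv⟩ := e.symm_apply_apply ⟨v, hv⟩
    rw [this]
  have hnorm : ∀ f, ‖T₀.mkContinuous 1 hbound f‖ ≤ ‖f‖ := fun f => by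
    have := hbound f
    rwa [one_mul] at this
  set T := T₀.mkContinuous 1 hbound with hT
  refine ⟨T, fun f => ?_, hinv, ?_⟩
  · have h1 : ((T f, κ • T f - f) : C(S, ℝ) × C(S, ℝ)) = (e.symm f).1 := by
      refine Prod.ext rfl ?_
      change κ • (e.symm f).1.1 - f = _
      nth_rewrite 2 [← he f]
      rw [sub_sub_cancel]
    rw [h1]
    exact (e.symm f).2
  · have key : ∀ k : ℕ, ∃ Q : Set C(S, ℝ), TotallyBounded Q ∧
        ∀ f : C(S, ℝ), ‖f‖ ≤ 1 → ∃ t ∈ Q, ‖T f - t‖ ≤ (1 / 2) ^ k := by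
      intro k
      induction k with
      | zero => exact ⟨{0}, totallyBounded_singleton _, fun f hf => ⟨0, rfl, by
          rw [sub_zero, pow_zero]; exact (hnorm f).trans hf⟩⟩
      | succ k ih =>
        obtain ⟨Q, hQ, hQf⟩ := ih
        refine ⟨_, totallyBounded_sum (ι := Bool) (T := fun b => if b then K else
          (fun t : C(S, ℝ) => (1 / 2 : ℝ) • t) '' Q) (fun b => ?_), fun f hf => ?_⟩
        · cases b
          · exact hQ.image (uniformContinuous_const_smul _)
          · exact hK
        · obtain ⟨v, hv, hvK, hve⟩ := hKf f hf
          obtain ⟨t, ht, hft⟩ := hQf ((2 : ℝ) • (f - (κ • v.1 - v.2))) (by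
            rw [norm_smul, norm_sub_rev]
            norm_num
            linarith)
          refine ⟨v.1 + (1 / 2 : ℝ) • t, ⟨fun b => if b then v.1 else (1 / 2 : ℝ) • t,
            fun b => ?_, by simp⟩, ?_⟩
          · cases b
            · exact ⟨t, ht, rfl⟩
            · exact hvK
          · have e1 : T f - (v.1 + (1 / 2 : ℝ) • t) =
                (1 / 2 : ℝ) • (T ((2 : ℝ) • (f - (κ • v.1 - v.2))) - t) := by
              rw [map_smul, map_sub, hinv v hv, smul_sub, smul_smul]
              norm_num
              abel
            rw [e1, norm_smul, pow_succ']
            norm_num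
            norm_num at hft
            exact hft
    refine totallyBounded_of_forall_close fun δ hδ => ?_
    obtain ⟨k, hk⟩ := exists_pow_lt_of_lt_one hδ (show (1 / 2 : ℝ) < 1 by norm_num)
    obtain ⟨Q, hQ, hQf⟩ := key k
    refine ⟨Q, hQ, ?_⟩
    rintro _ ⟨f, hf, rfl⟩
    obtain ⟨t, ht, hft⟩ := hQf f (by simpa using hf)
    exact ⟨t, ht, by rw [dist_eq_norm]; exact hft.trans hk.le⟩

end Resolvent

theorem lin_one (j : Fin n) (z : Rn n) : lin (1 : Matrix (Fin n) (Fin n) ℝ) j z = z j := by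
  unfold lin
  rw [Finset.sum_eq_single j (fun i _ hi => by rw [Matrix.one_apply_ne (Ne.symm hi), zero_mul])
    (by simp), Matrix.one_apply_eq, one_mul]

theorem gauss_one (s : ℝ) (z : Rn n) : gauss s (1 : Matrix (Fin n) (Fin n) ℝ) z =
    (s ^ n)⁻¹ * (gaussMass (1 : Matrix (Fin n) (Fin n) ℝ))⁻¹ *
      exp (-(‖z‖ ^ 2 / (4 * s ^ 2))) := by
  rw [gauss, quad_one]

theorem gaussMass_one_pos : 0 < gaussMass (1 : Matrix (Fin n) (Fin n) ℝ) :=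
  integral_exp_pos (integrable_exp_neg_quad one_pos fun w => by rw [one_mul, quad_one])

theorem eval_gauss_one (A : Coef n) (s : ℝ) (y₁ y : Rn n) :
    A.eval (fun z => gauss s 1 (z - y₁)) y =
      (quad (Matrix.of A.1) (y - y₁) / (4 * s ^ 4) - ((∑ i, A.1 i i) +
        ∑ i, A.2.1 i * (y - y₁) i) / (2 * s ^ 2) + A.2.2) * gauss s 1 (y - y₁) := by
  have h1 : (1 : Matrix (Fin n) (Fin n) ℝ).IsSymm := Matrix.transpose_one
  set z := y - y₁ with hz
  set G := gauss s (1 : Matrix (Fin n) (Fin n) ℝ) z with hG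
  simp only [Coef.eval, pd_pd_gauss h1]
  simp only [pd_gauss h1, lin_one, ← hz, ← hG]
  have e1 : ∑ i, ∑ j, A.1 i j * ((z i * z j / (4 * s ^ 4) -
      (1 : Matrix (Fin n) (Fin n) ℝ) j i / (2 * s ^ 2)) * G) =
      (quad (Matrix.of A.1) z / (4 * s ^ 4)) * G - ((∑ i, A.1 i i) / (2 * s ^ 2)) * G := by
    have e2 : ∑ i, A.1 i i = ∑ i, ∑ j, A.1 i j * (1 : Matrix (Fin n) (Fin n) ℝ) j i := by
      refine sum_congr rfl fun i _ => ?_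
      rw [Finset.sum_eq_single i (fun j _ hj => by rw [Matrix.one_apply_ne hj, mul_zero])
        (by simp), Matrix.one_apply_eq, mul_one]
    rw [e2, quad]
    simp only [Finset.sum_div, sum_mul, ← sum_sub_distrib, Matrix.of_apply]
    refine sum_sum_congr fun i j => ?_
    ring
  have e3 : ∑ i, A.2.1 i * (-(z i / (2 * s ^ 2)) * G) =
      -((∑ i, A.2.1 i * z i) / (2 * s ^ 2)) * G := by
    simp only [Finset.sum_div, sum_mul, neg_mul, ← sum_neg_distrib]
    refine sum_congr rfl fun i _ => ?_
    ring
  rw [e1, e3]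
  ring

theorem abs_coord_le (z : Rn n) (i : Fin n) : |z i| ≤ ‖z‖ :=
  PiLp.norm_apply_le z i

theorem exists_barrier {A : DiffOp n r S} (hA : A.IsElliptic) {x : S} {κ : ℝ}
    (hκ : ∀ y ∈ (ch n x).target, (A.coef x y).2.2 + 1 ≤ κ) {y₁ : Rn n} {ρ R : ℝ}
    (hρ : 0 < ρ) (hR : Metric.closedBall y₁ R ⊆ (ch n x).target) :
    ∃ (h : Rn n → ℝ) (σ : ℝ), ContDiff ℝ 2 h ∧ 0 < σ ∧
      (∀ y ∈ Metric.closedBall y₁ R, ρ ≤ ‖y - y₁‖ → σ ≤ (A.coef x y).eval h y - κ * h y) ∧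
      (∀ y, ‖y - y₁‖ = R → h y = 0) ∧ (∀ y, ‖y - y₁‖ < R → 0 < h y) := by
  have hK := isCompact_closedBall y₁ R
  obtain ⟨M₀, hM₀⟩ := hK.exists_bound_of_continuousOn ((A.continuousOn_coef x).mono hR)
  obtain ⟨c₀, hc₀, hlow⟩ := exists_quad_lower_bound hK
    (g := fun y => Matrix.of (A.coef x y).1)
    (continuous_fst.comp_continuousOn ((A.continuousOn_coef x).mono hR)) fun y hy => hA x y (hR hy)
  set M := |M₀| with hMdef
  have hM : ∀ y ∈ Metric.closedBall y₁ R, ‖A.coef x y‖ ≤ M := fun y hy =>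
    (hM₀ y hy).trans (le_abs_self _)
  have hM0 : 0 ≤ M := abs_nonneg _
  set D := 2 * (n * M + n * (M * |R|)) + 4 * (M + |κ|) + 1 with hD
  have hD0 : 0 < D := by positivity
  set t := min 1 (c₀ * ρ ^ 2 / D) with ht
  have ht0 : 0 < t := by positivity
  have ht1 : t ≤ 1 := min_le_left _ _
  have htD : t * D ≤ c₀ * ρ ^ 2 := by
    have := min_le_right 1 (c₀ * ρ ^ 2 / D)
    rwa [← ht, le_div_iff₀ hD0] at this
  set s := √t with hs
  have hs0 : 0 < s := Real.sqrt_pos.2 ht0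
  have hst : s ^ 2 = t := Real.sq_sqrt ht0.le
  have hst4 : s ^ 4 = t ^ 2 := by rw [← hst]; ring
  set b := (s ^ n)⁻¹ * (gaussMass (1 : Matrix (Fin n) (Fin n) ℝ))⁻¹ with hb
  have hb0 : 0 < b := mul_pos (inv_pos.2 (pow_pos hs0 n)) (inv_pos.2 gaussMass_one_pos)
  set σ := b * exp (-(R ^ 2 / (4 * s ^ 2))) with hσ
  have hσ0 : 0 < σ := mul_pos hb0 (exp_pos _)
  refine ⟨fun y => gauss s 1 (y - y₁) + -σ, σ, (contDiff_gauss_sub s 1 y₁).add contDiff_const,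
    hσ0, fun y hy hyρ => ?_, fun y hy => ?_, fun y hy => ?_⟩
  · rw [Coef.eval_add _ (contDiff_gauss_sub s 1 y₁).contDiffAt contDiffAt_const, Coef.eval_const,
      eval_gauss_one, hst, hst4]
    set z := y - y₁ with hz
    have hzR : ‖z‖ ≤ |R| := by
      have := mem_closedBall_iff_norm.1 hy
      exact this.trans (le_abs_self R)
    have hc := hκ y (hR hy)
    have hquad : c₀ * ρ ^ 2 ≤ quad (Matrix.of (A.coef x y).1) z := by
      refine le_trans ?_ (hlow y hy z)
      gcongr
    have htr : |∑ i, (A.coef x y).1 i i| ≤ n * M :=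
      abs_sum_le' fun i => Coef.abs_fst_le (hM y hy) i i
    have hbz : |∑ i, (A.coef x y).2.1 i * z i| ≤ n * (M * |R|) :=
      abs_sum_le' fun i => by
        rw [abs_mul]
        exact mul_le_mul (Coef.abs_snd_le (hM y hy) i) ((abs_coord_le z i).trans hzR)
          (abs_nonneg _) hM0
    have hcM : |(A.coef x y).2.2| ≤ M := ((norm_snd_le (A.coef x y).2).trans
      (norm_snd_le (A.coef x y))).trans (hM y hy)
    have hG : 0 ≤ gauss s 1 z := gauss_nonneg hs0.le _ _
    clear_value σ b s t D M
    set a₁ := quad (Matrix.of (A.coef x y).1) z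
    set a₂ := ∑ i, (A.coef x y).1 i i
    set a₃ := ∑ i, (A.coef x y).2.1 i * z i
    set c := (A.coef x y).2.2
    have hbr : 0 ≤ a₁ / (4 * t ^ 2) - (a₂ + a₃) / (2 * t) + c - κ := by
      have e : a₁ / (4 * t ^ 2) - (a₂ + a₃) / (2 * t) + c - κ =
          (a₁ - 2 * t * (a₂ + a₃) + 4 * t ^ 2 * (c - κ)) / (4 * t ^ 2) := by
        field_simp
        ring
      rw [e]
      refine div_nonneg ?_ (by positivity)
      have h1 : 2 * t * (a₂ + a₃) ≤ 2 * t * (n * M + n * (M * |R|)) := by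
        gcongr
        · exact (le_abs_self _).trans htr
        · exact (le_abs_self _).trans hbz
      have h2 : -(4 * t * (M + |κ|)) ≤ 4 * t ^ 2 * (c - κ) := by
        have h3 : κ - c ≤ M + |κ| := by
          linarith [neg_abs_le c, le_abs_self κ]
        have h4 : t ^ 2 ≤ t := by nlinarith
        have h5 : 0 ≤ κ - c := by linarith
        nlinarith [mul_le_mul h4 h3 h5 ht0.le]
      have h6 : t * D = 2 * t * (n * M + n * (M * |R|)) + 4 * t * (M + |κ|) + t := by
        rw [hD]; ring
      linarith
    have hfin : ∀ G : ℝ, 0 ≤ G → σ ≤ (a₁ / (4 * t ^ 2) - (a₂ + a₃) / (2 * t) + c) * G + c * -σ -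
        κ * (G + -σ) := by
      intro G hG
      have e : (a₁ / (4 * t ^ 2) - (a₂ + a₃) / (2 * t) + c) * G + c * -σ - κ * (G + -σ) =
        (a₁ / (4 * t ^ 2) - (a₂ + a₃) / (2 * t) + c - κ) * G + (κ - c) * σ := by ring
      rw [e]
      have h7 := mul_nonneg hbr hG
      have h8 : 1 * σ ≤ (κ - c) * σ := mul_le_mul_of_nonneg_right (by linarith) hσ0.le
      linarith
    exact hfin _ hG
  · simp only [gauss_one, hy]
    rw [hσ, hb]
    ring
  · simp only [gauss_one]
    have h1 : ‖y - y₁‖ ^ 2 < R ^ 2 := by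
      have := norm_nonneg (y - y₁)
      nlinarith
    have h2 : exp (-(R ^ 2 / (4 * s ^ 2))) < exp (-(‖y - y₁‖ ^ 2 / (4 * s ^ 2))) := by
      refine Real.exp_lt_exp.2 (neg_lt_neg ?_)
      gcongr
    have := mul_lt_mul_of_pos_left h2 hb0
    linarith

section Strong
variable [IsManifold (𝓡 n) ∞ S] [CompactSpace S]

theorem DiffOp.pos_on_ball {A : DiffOp n r S} (hA : A.IsElliptic) {κ : ℝ}
    (hκ : ∀ p, A.op (fun _ => 1) p + 1 ≤ κ) {v : C(S, ℝ) × C(S, ℝ)} (hv : v ∈ A.graph)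
    (h : ∀ p, 0 ≤ κ * v.1 p - v.2 p) {x : S} {y₁ : Rn n} {R : ℝ} (hR0 : 0 < R)
    (hR : Metric.closedBall y₁ R ⊆ (ch n x).target)
    (hy₁ : 0 < v.1 ((ch n x).symm y₁)) {y : Rn n} (hy : ‖y - y₁‖ < R) :
    0 < v.1 ((ch n x).symm y) := by
  set Ω := (ch n x).target with hΩ
  set e := (ch n x).symm with he
  have hnc : Continuous fun z : Rn n => ‖z - y₁‖ := by fun_prop
  have hΩo : IsOpen Ω := (ch n x).open_target
  have hU : ContinuousOn (fun z => v.1 (e z)) Ω :=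
    v.1.continuous.comp_continuousOn (ch n x).continuousOn_symm
  have hv0 : ∀ p, 0 ≤ v.1 p := fun p => by
    have := DiffOp.neg_le_of_mem_graph hA hκ hv le_rfl (by simpa using h) p
    rwa [neg_zero] at this
  have hκ' : ∀ y ∈ Ω, (A.coef x y).2.2 + 1 ≤ κ := by
    intro z hz
    have h1 := hκ (e z)
    rw [A.op_symm_eq contMDiff_const x hz] at h1
    have h2 : ((fun _ => (1 : ℝ)) ∘ (ch n x).symm : Rn n → ℝ) = fun _ => 1 := rfl
    rwa [h2, Coef.eval_const, mul_one] at h1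
  obtain ⟨ρ, hρ, hρR, a, ha, hUa⟩ : ∃ ρ > 0, ρ < R ∧ ∃ a > 0, ∀ z, ‖z - y₁‖ ≤ ρ → a ≤ v.1 (e z) := by
    have hc : ContinuousAt (fun z => v.1 (e z)) y₁ :=
      hU.continuousAt (hΩo.mem_nhds (hR (Metric.mem_closedBall_self hR0.le)))
    obtain ⟨d, hd, hball⟩ := Metric.eventually_nhds_iff.1
      (hc.eventually (lt_mem_nhds (half_lt_self hy₁)))
    refine ⟨min (d / 2) (R / 2), by positivity, (min_le_right _ _).trans_lt (half_lt_self hR0), _,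
      half_pos hy₁, fun z hz => (hball ?_).le⟩
    rw [dist_eq_norm]
    exact (hz.trans (min_le_left _ _)).trans_lt (half_lt_self hd)
  obtain ⟨b, σ, hb, hσ, hbσ, hb0, hbpos⟩ := exists_barrier hA hκ' hρ hR
  obtain ⟨H, hH⟩ := (isCompact_closedBall y₁ R).exists_bound_of_continuousOn hb.continuous.continuousOn
  set ε := a / (|H| + 1) with hε
  have hε0 : 0 < ε := by positivity
  have hεH : ∀ z ∈ Metric.closedBall y₁ R, ε * b z ≤ a := by
    intro z hz
    have h1 : b z ≤ |H| + 1 := ((le_abs_self _).trans ((hH z hz).trans (le_abs_self _))).trans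
      (by linarith)
    calc ε * b z ≤ ε * (|H| + 1) := by gcongr
      _ = a := by rw [hε]; field_simp
  by_cases hyρ : ‖y - y₁‖ ≤ ρ
  · exact ha.trans_le (hUa y hyρ)
  push Not at hyρ
  refine (mul_pos hε0 (hbpos y hy)).trans_le ?_
  obtain ⟨w, hw, hlim⟩ := DiffOp.exists_seq_of_mem_graph hv
  have h1 : Tendsto (fun m => ‖κ • (w m).1 - (w m).2 - (κ • v.1 - v.2)‖) atTop (𝓝 0) := by
    have hc : Continuous fun z : C(S, ℝ) × C(S, ℝ) => ‖κ • z.1 - z.2 - (κ • v.1 - v.2)‖ := by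
      fun_prop
    have := (hc.tendsto v).comp hlim
    simpa [comp_def] using this
  have h2 : Tendsto (fun m => ‖(w m).1 - v.1‖) atTop (𝓝 0) := by
    have hc : Continuous fun z : C(S, ℝ) × C(S, ℝ) => ‖z.1 - v.1‖ := by fun_prop
    have := (hc.tendsto v).comp hlim
    simpa [comp_def] using this
  have h3 : Tendsto (fun m => (w m).1 (e y)) atTop (𝓝 (v.1 (e y))) :=
    (((evalCLM ℝ (e y)).continuous.comp continuous_fst).tendsto v).comp hlim
  have hev : ∀ᶠ m in atTop, -‖(w m).1 - v.1‖ ≤ (w m).1 (e y) - ε * b y := by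
    filter_upwards [h1.eventually (gt_mem_nhds (mul_pos hε0 hσ))] with m hm
    set wm : Rn n → ℝ := fun z => (w m).1 (e z) - ε * b z with hwm
    set Ann : Set (Rn n) := {z | ρ ≤ ‖z - y₁‖ ∧ ‖z - y₁‖ ≤ R} with hAnn
    have hAnnsub : Ann ⊆ Metric.closedBall y₁ R := fun z hz => mem_closedBall_iff_norm.2 hz.2
    have hAnnc : IsCompact Ann := by
      refine (isCompact_closedBall y₁ R).of_isClosed_subset ?_ hAnnsub
      exact (isClosed_le continuous_const hnc).inter (isClosed_le hnc continuous_const)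
    have hu2 := (hw m).1.of_le two_le_infty
    have hwmc : ContDiffOn ℝ 2 wm Ω :=
      (contDiffOn_comp_chart_symm two_le_infty hu2 x).sub (contDiff_const.mul hb).contDiffOn
    obtain ⟨q, hq, hmin⟩ := hAnnc.exists_isMinOn ⟨y, hyρ.le, hy.le⟩
      (hwmc.continuousOn.mono (hAnnsub.trans hR))
    refine le_trans ?_ (hmin ⟨hyρ.le, hy.le⟩)
    change _ ≤ (w m).1 (e q) - ε * b q
    have hqb := hAnnsub hq
    have hclose := abs_le.1 (((w m).1 - v.1).norm_coe_le_norm (e q))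
    simp only [sub_at] at hclose
    have hpos : ρ < ‖q - y₁‖ → ‖q - y₁‖ < R → 0 < wm q := by
      intro hq1 hq2
      have hloc : IsLocalMin wm q := by
        have hopen : IsOpen {z : Rn n | ρ < ‖z - y₁‖ ∧ ‖z - y₁‖ < R} :=
          (isOpen_lt continuous_const hnc).inter (isOpen_lt hnc continuous_const)
        filter_upwards [hopen.mem_nhds ⟨hq1, hq2⟩] with z hz
        exact hmin ⟨hz.1.le, hz.2.le⟩
      have hqΩ := hR hqb
      have h4 := Coef.eval_ge_of_isLocalMin (A.coef x q) (hA x q hqΩ).posSemidef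
        (hwmc.contDiffAt (hΩo.mem_nhds hqΩ)) hloc
      have e1 : (A.coef x q).eval wm q = A.op (w m).1 (e q) - ε * (A.coef x q).eval b q := by
        have e2 : wm = fun z => ((w m).1 ∘ (ch n x).symm) z + (-ε) * b z := by
          funext z
          simp only [hwm, comp_apply]
          ring
        rw [e2, Coef.eval_add _ (contDiffAt_comp_chart_symm two_le_infty hu2 x hqΩ)
          (contDiff_const.mul hb).contDiffAt, Coef.eval_const_mul _ _ hb.contDiffAt,
          A.op_symm_eq hu2 x hqΩ]
        ring
      have h5 := hbσ q hqb hq.1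
      have h6 := abs_le.1 ((κ • (w m).1 - (w m).2 - (κ • v.1 - v.2)).norm_coe_le_norm (e q))
      simp only [sub_at, smul_at, smul_eq_mul] at h6
      have h7 := h (e q)
      have h8 := hκ' q hqΩ
      have h9 := (hw m).2 (e q)
      have h10 : ε * σ ≤ ε * ((A.coef x q).eval b q - κ * b q) := by gcongr
      have h11 : wm q = (w m).1 (e q) - ε * b q := rfl
      by_contra hneg
      push Not at hneg
      have h12 : 0 < κ * wm q - (A.coef x q).eval wm q := by
        rw [e1, ← h9, h11]
        linarith [h6.1]
      nlinarith
    rcases eq_or_lt_of_le hq.1 with hq1 | hq1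
    · linarith [hUa q hq1.symm.le, hεH q hqb, hclose.1]
    · rcases eq_or_lt_of_le hq.2 with hq2 | hq2
      · rw [hb0 q hq2, mul_zero, sub_zero]
        linarith [hv0 (e q), hclose.1]
      · have := hpos hq1 hq2
        simp only [hwm] at this
        linarith [norm_nonneg ((w m).1 - v.1)]
  have h4 := le_of_tendsto_of_tendsto h2.neg (h3.sub_const (ε * b y)) hev
  linarith

theorem DiffOp.pos_of_mem_graph [ConnectedSpace S] {A : DiffOp n r S} (hA : A.IsElliptic) {κ : ℝ}
    (hκ : ∀ p, A.op (fun _ => 1) p + 1 ≤ κ) {v : C(S, ℝ) × C(S, ℝ)} (hv : v ∈ A.graph)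
    (h : ∀ p, 0 ≤ κ * v.1 p - v.2 p) (hne : v.1 ≠ 0) (p : S) : 0 < v.1 p := by
  have hv0 : ∀ p, 0 ≤ v.1 p := fun p => by
    have := DiffOp.neg_le_of_mem_graph hA hκ hv le_rfl (by simpa using h) p
    rwa [neg_zero] at this
  have hclosed : IsClosed {p | v.1 p = 0} := isClosed_eq v.1.continuous continuous_const
  have hopen : IsOpen {p | v.1 p = 0} := by
    rw [isOpen_iff_mem_nhds]
    intro x hx
    set e := ch n x
    have hxs := mem_chart_source (Rn n) x
    obtain ⟨d, hd, hball⟩ := Metric.isOpen_iff.1 e.open_target (e x) (e.map_source hxs)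
    have hcont : ∀ᶠ q in 𝓝 x, q ∈ e.source ∧ dist (e q) (e x) < d / 4 :=
      (e.open_source.mem_nhds hxs |> fun h => eventually_of_mem h fun q hq => hq).and
        ((e.continuousAt hxs).eventually (Metric.ball_mem_nhds _ (by positivity)))
    filter_upwards [hcont] with q hq
    by_contra hne
    have hpos : 0 < v.1 q := lt_of_le_of_ne (hv0 q) (Ne.symm hne)
    have h1 := DiffOp.pos_on_ball hA hκ hv h (x := x) (y₁ := e q) (R := d / 2) (by positivity)
      (fun z hz => hball (by
        rw [Metric.mem_closedBall] at hz
        rw [Metric.mem_ball]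
        linarith [dist_triangle z (e q) (e x), hq.2]))
      (by rwa [e.left_inv hq.1]) (y := e x) (by
        rw [← dist_eq_norm, dist_comm]; linarith [hq.2])
    rw [e.left_inv hxs] at h1
    exact h1.ne' hx
  refine lt_of_le_of_ne (hv0 p) fun hp => hne ?_
  have := IsClopen.eq_univ ⟨hclosed, hopen⟩ ⟨p, hp.symm⟩
  refine ContinuousMap.ext fun q => ?_
  have hq : q ∈ {p | v.1 p = 0} := by rw [this]; trivial
  exact hq

end Strong

section PositiveOperator
variable {X : Type*} [TopologicalSpace X] [CompactSpace X] [Nonempty X]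

theorem exists_pos_le_of_pos {f : C(X, ℝ)} (hf : ∀ p, 0 < f p) : ∃ c > 0, ∀ p, c ≤ f p := by
  obtain ⟨p, -, hp⟩ := isCompact_univ.exists_isMinOn Set.univ_nonempty f.continuous.continuousOn
  exact ⟨f p, hf p, fun q => hp (Set.mem_univ q)⟩

theorem isCompact_closure_image {T : C(X, ℝ) →L[ℝ] C(X, ℝ)}
    (hc : TotallyBounded (T '' Metric.closedBall 0 1)) :
    IsCompact (closure (T '' Metric.closedBall 0 1)) :=
  hc.closure.isCompact_of_isClosed isClosed_closure

/-- A compact strongly positive operator has a positive eigenfunction. -/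
theorem exists_positive_eigenfunction {T : C(X, ℝ) →L[ℝ] C(X, ℝ)}
    (hc : TotallyBounded (T '' Metric.closedBall 0 1))
    (hp : ∀ f : C(X, ℝ), (∀ p, 0 ≤ f p) → f ≠ 0 → ∀ p, 0 < T f p) :
    ∃ (μ : ℝ) (φ : C(X, ℝ)), 0 < μ ∧ (∀ p, 0 < φ p) ∧ T φ = μ • φ := by
  have hp' : ∀ f : C(X, ℝ), (∀ p, 0 ≤ f p) → ∀ p, 0 ≤ T f p := by
    intro f hf p
    by_cases h0 : f = 0
    · rw [h0, map_zero]; rfl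
    · exact (hp f hf h0 p).le
  set Λ : Set ℝ := {t | 0 ≤ t ∧ ∃ f : C(X, ℝ), ‖f‖ = 1 ∧ (∀ p, 0 ≤ f p) ∧
    ∀ p, t * f p ≤ T f p} with hΛ
  have hbdd : ∀ t ∈ Λ, t ≤ ‖T‖ := by
    rintro t ⟨ht, f, hf1, hf0, hf⟩
    have h1 : ‖t • f‖ ≤ ‖T f‖ := by
      rw [ContinuousMap.norm_le _ (norm_nonneg _)]
      intro p
      rw [smul_at, smul_eq_mul, norm_eq_abs,
        abs_of_nonneg (mul_nonneg ht (hf0 p))]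
      exact (hf p).trans ((le_abs_self _).trans ((T f).norm_coe_le_norm p))
    rw [norm_smul, hf1, mul_one, norm_eq_abs, abs_of_nonneg ht] at h1
    have h2 := T.le_opNorm f
    rw [hf1, mul_one] at h2
    exact h1.trans h2
  have hB : BddAbove Λ := ⟨_, hbdd⟩
  have hscale : ∀ (f : C(X, ℝ)) (t : ℝ), 0 ≤ t → (∀ p, 0 ≤ f p) → f ≠ 0 →
      (∀ p, t * f p ≤ T f p) → t ∈ Λ := by
    intro f t ht hf0 hne hf
    have hn : 0 < ‖f‖ := norm_pos_iff.2 hne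
    refine ⟨ht, ‖f‖⁻¹ • f, ?_, fun p => ?_, fun p => ?_⟩
    · rw [norm_smul, norm_inv, norm_norm, inv_mul_cancel₀ hn.ne']
    · exact mul_nonneg (inv_nonneg.2 hn.le) (hf0 p)
    · rw [map_smul, smul_at, smul_at, smul_eq_mul, smul_eq_mul]
      have := mul_le_mul_of_nonneg_left (hf p) (inv_nonneg.2 hn.le)
      linarith
  have hone : (1 : C(X, ℝ)) ≠ 0 := one_ne_zero
  obtain ⟨c, hc0, hcT⟩ := exists_pos_le_of_pos (hp 1 (fun _ => zero_le_one) hone)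
  have hcΛ : c ∈ Λ := hscale 1 c hc0.le (fun _ => zero_le_one) hone fun p => by
    rw [one_at, mul_one]; exact hcT p
  set μ := sSup Λ with hμ
  have hμ0 : 0 < μ := hc0.trans_le (le_csSup hB hcΛ)
  obtain ⟨t, -, htlim, htΛ⟩ := exists_seq_tendsto_sSup ⟨c, hcΛ⟩ hB
  choose ht0 f hf1 hf0 hf using htΛ
  obtain ⟨g, -, ψ, hψ, hg⟩ := (isCompact_closure_image hc).tendsto_subseq
    (x := fun m => T (f m)) fun m => subset_closure ⟨f m, by simp [hf1 m], rfl⟩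
  have hev : ∀ (u : ℕ → C(X, ℝ)) (w : C(X, ℝ)), Tendsto u atTop (𝓝 w) → ∀ p,
      Tendsto (fun m => u m p) atTop (𝓝 (w p)) := fun u w hu p =>
    ((evalCLM ℝ p).continuous.tendsto w).comp hu
  have htψ : Tendsto (fun m => t (ψ m)) atTop (𝓝 μ) := htlim.comp hψ.tendsto_atTop
  have hg0 : ∀ p, 0 ≤ g p := fun p => ge_of_tendsto' (hev _ _ hg p) fun m => hp' _ (hf0 _) p
  have hgT : ∀ p, μ * g p ≤ T g p := by
    intro p
    refine le_of_tendsto_of_tendsto' (htψ.mul (hev _ _ hg p))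
      (hev _ _ ((T.continuous.tendsto g).comp hg) p) fun m => ?_
    have := hp' (T (f (ψ m)) - t (ψ m) • f (ψ m)) (fun q => by
      simp only [sub_at, smul_at, smul_eq_mul]
      linarith [hf (ψ m) q]) p
    rw [map_sub, map_smul] at this
    simp only [sub_at, smul_at, smul_eq_mul] at this
    simp only [comp_apply]
    linarith
  have hgne : g ≠ 0 := by
    intro h0
    have h1 : Tendsto (fun m => ‖T (f (ψ m))‖) atTop (𝓝 0) := by
      have := hg.norm
      rwa [h0, norm_zero] at this
    have h2 : ∀ m, t (ψ m) ≤ ‖T (f (ψ m))‖ := by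
      intro m
      have h3 : ‖t (ψ m) • f (ψ m)‖ ≤ ‖T (f (ψ m))‖ := by
        rw [ContinuousMap.norm_le _ (norm_nonneg _)]
        intro p
        rw [smul_at, smul_eq_mul, norm_eq_abs,
          abs_of_nonneg (mul_nonneg (ht0 _) (hf0 _ p))]
        exact (hf _ p).trans ((le_abs_self _).trans ((T (f (ψ m))).norm_coe_le_norm p))
      rwa [norm_smul, hf1, mul_one, norm_eq_abs, abs_of_nonneg (ht0 _)] at h3
    exact absurd (le_of_tendsto_of_tendsto' htψ h1 h2) (not_le.2 hμ0)
  have hTg := hp g hg0 hgne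
  have heq : T g = μ • g := by
    by_contra hne
    have hd0 : T g - μ • g ≠ 0 := sub_ne_zero.2 hne
    have hd := hp (T g - μ • g) (fun p => by
      simp only [sub_at, smul_at, smul_eq_mul]
      linarith [hgT p]) hd0
    obtain ⟨a, ha, hda⟩ := exists_pos_le_of_pos hd
    have hn : 0 < ‖T g‖ + 1 := by positivity
    have hmem : μ + a / (‖T g‖ + 1) ∈ Λ := by
      refine hscale (T g) _ (by positivity) (fun p => (hTg p).le) (fun h0 => ?_) fun p => ?_
      · have := hTg (Classical.arbitrary X)
        rw [h0] at this
        exact lt_irrefl _ this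
      · have h1 := hda p
        rw [map_sub, map_smul] at h1
        simp only [sub_at, smul_at, smul_eq_mul] at h1
        have h2 : a / (‖T g‖ + 1) * T g p ≤ a := by
          have h3 : T g p ≤ ‖T g‖ + 1 :=
            ((le_abs_self _).trans ((T g).norm_coe_le_norm p)).trans (by linarith)
          calc _ ≤ a / (‖T g‖ + 1) * (‖T g‖ + 1) := by gcongr
            _ = a := by field_simp
        linarith
    have := le_csSup hB hmem
    have h3 : 0 < a / (‖T g‖ + 1) := by positivity
    linarith
  refine ⟨μ, g, hμ0, fun p => ?_, heq⟩
  have := hTg p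
  rw [heq, smul_at, smul_eq_mul] at this
  exact pos_of_mul_pos_right this hμ0.le

/-- A compact strongly positive operator fixing the constants contracts oscillations, after two
steps. -/
theorem exists_osc_le {Q : C(X, ℝ) →L[ℝ] C(X, ℝ)}
    (hc : TotallyBounded (Q '' Metric.closedBall 0 1))
    (hp : ∀ f : C(X, ℝ), (∀ p, 0 ≤ f p) → f ≠ 0 → ∀ p, 0 < Q f p) (hQ1 : Q 1 = 1) :
    ∃ q : ℝ, 0 < q ∧ q < 1 ∧ ∀ (h : C(X, ℝ)) (d : ℝ), (∀ p p', h p - h p' ≤ d) →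
      ∀ p p', Q (Q h) p - Q (Q h) p' ≤ q * d := by
  have hp' : ∀ f : C(X, ℝ), (∀ p, 0 ≤ f p) → ∀ p, 0 ≤ Q f p := by
    intro f hf p
    by_cases h0 : f = 0
    · rw [h0, map_zero]; rfl
    · exact (hp f hf h0 p).le
  have hconst : ∀ (s : ℝ) (f : C(X, ℝ)) p, Q (s • 1 - f) p = s - Q f p := fun s f p => by
    rw [map_sub, map_smul, hQ1]
    simp
  have hconst' : ∀ (s : ℝ) (f : C(X, ℝ)) p, Q (f - s • 1) p = Q f p - s := fun s f p => by
    rw [map_sub, map_smul, hQ1]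
    simp
  set K : Set C(X, ℝ) := closure (Q '' Metric.closedBall 0 1) ∩ {k | ∀ p, 0 ≤ k p ∧ k p ≤ 1}
    with hK
  have hKc : IsCompact K := by
    refine (isCompact_closure_image hc).inter_right ?_
    have : {k : C(X, ℝ) | ∀ p, 0 ≤ k p ∧ k p ≤ 1} = ⋂ p, {k : C(X, ℝ) | 0 ≤ k p ∧ k p ≤ 1} := by
      ext; simp
    rw [this]
    refine isClosed_iInter fun p => ?_
    have he := (evalCLM ℝ p : C(X, ℝ) →L[ℝ] ℝ).continuous
    exact (isClosed_le continuous_const he).inter (isClosed_le he continuous_const)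
  have hcont : Continuous fun z : C(X, ℝ) × (X × X) => Q z.1 z.2.1 - Q z.1 z.2.2 := by
    have h1 : Continuous fun z : C(X, ℝ) × (X × X) => Q z.1 := Q.continuous.comp continuous_fst
    exact (h1.eval (continuous_fst.comp continuous_snd)).sub
      (h1.eval (continuous_snd.comp continuous_snd))
  have h0K : (0 : C(X, ℝ)) ∈ K :=
    ⟨subset_closure ⟨0, by simp, map_zero _⟩, fun p => ⟨le_rfl, zero_le_one⟩⟩
  obtain ⟨⟨k, p₁, p₂⟩, hk, hmax⟩ := (hKc.prod (isCompact_univ (X := X × X))).exists_isMaxOn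
    ⟨(0, Classical.arbitrary X, Classical.arbitrary X), h0K, trivial⟩ hcont.continuousOn
  have hlt : Q k p₁ - Q k p₂ < 1 := by
    obtain ⟨a, -, ha⟩ := isCompact_univ.exists_isMinOn (Set.univ_nonempty (α := X))
      k.continuous.continuousOn
    obtain ⟨b, -, hb⟩ := isCompact_univ.exists_isMaxOn (Set.univ_nonempty (α := X))
      k.continuous.continuousOn
    have ha' : ∀ p, k a ≤ k p := fun p => ha (Set.mem_univ p)
    have hb' : ∀ p, k p ≤ k b := fun p => hb (Set.mem_univ p)
    by_cases hab : k a = k b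
    · have hkc : k = k a • (1 : C(X, ℝ)) := by
        ext p
        simp only [smul_at, one_at, smul_eq_mul, mul_one]
        exact le_antisymm ((hb' p).trans hab.symm.le) (ha' p)
      rw [hkc, map_smul, hQ1]
      simp
    · have h1 := hp (k b • 1 - k) (fun p => by
        simp only [sub_at, smul_at, one_at,
          smul_eq_mul, mul_one]
        linarith [hb' p]) (fun h0 => hab (by
          have := congrArg (fun f : C(X, ℝ) => f a) h0
          simp only [sub_at, smul_at, one_at,
            smul_eq_mul, mul_one, ContinuousMap.zero_apply] at this
          linarith)) p₁
      have h2 := hp' (k - k a • 1) (fun p => by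
        simp only [sub_at, smul_at, one_at,
          smul_eq_mul, mul_one]
        linarith [ha' p]) p₂
      rw [hconst] at h1
      rw [hconst'] at h2
      have h3 := (hk.1.2 a).1
      have h4 := (hk.1.2 b).2
      linarith
  refine ⟨max (Q k p₁ - Q k p₂) (1 / 2), by positivity, max_lt hlt (by norm_num), ?_⟩
  intro h d hd p p'
  have hd0 : 0 ≤ d := by have := hd p p; rwa [sub_self] at this
  rcases hd0.eq_or_lt with rfl | hd0
  · have hcst : h = h p • (1 : C(X, ℝ)) := by
      ext z
      simp only [smul_at, one_at, smul_eq_mul, mul_one]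
      linarith [hd z p, hd p z]
    rw [hcst, map_smul, hQ1, map_smul, hQ1]
    simp
  · obtain ⟨a, -, ha⟩ := isCompact_univ.exists_isMinOn (Set.univ_nonempty (α := X))
      h.continuous.continuousOn
    have ha' : ∀ p, h a ≤ h p := fun p => ha (Set.mem_univ p)
    set h' : C(X, ℝ) := d⁻¹ • (h - h a • 1) with hh'
    have hh0 : ∀ p, 0 ≤ h' p := fun p => by
      simp only [hh', sub_at, smul_at, one_at,
        smul_eq_mul, mul_one]
      exact mul_nonneg (inv_nonneg.2 hd0.le) (by linarith [ha' p])
    have hh1 : ∀ p, h' p ≤ 1 := fun p => by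
      simp only [hh', sub_at, smul_at, one_at,
        smul_eq_mul, mul_one]
      rw [inv_mul_le_iff₀ hd0, mul_one]
      exact hd p a
    have hmem : Q h' ∈ K := by
      refine ⟨subset_closure ⟨h', ?_, rfl⟩, fun z => ⟨hp' h' hh0 z, ?_⟩⟩
      · rw [mem_closedBall_zero_iff, ContinuousMap.norm_le _ zero_le_one]
        intro z
        rw [norm_eq_abs, abs_of_nonneg (hh0 z)]
        exact hh1 z
      · have := hp' ((1 : ℝ) • 1 - h') (fun w => by
          simp only [sub_at, smul_at, one_at,
            smul_eq_mul, mul_one]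
          linarith [hh1 w]) z
        rw [hconst] at this
        linarith
    have h1 : Q (Q h') p - Q (Q h') p' ≤ Q k p₁ - Q k p₂ :=
      hmax (a := (Q h', p, p')) ⟨hmem, trivial⟩
    have e1 : ∀ z, Q (Q h') z = d⁻¹ * (Q (Q h) z - h a) := by
      intro z
      simp only [hh', map_smul, map_sub, hQ1, sub_at, smul_at,
        one_at, smul_eq_mul, mul_one]
    rw [e1, e1] at h1
    have h2 : d⁻¹ * (Q (Q h) p - Q (Q h) p') ≤ max (Q k p₁ - Q k p₂) (1 / 2) := by
      refine le_trans ?_ (le_max_left _ _)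
      linarith
    rw [inv_mul_le_iff₀ hd0] at h2
    linarith

end PositiveOperator

theorem le_mul_of_log_convex {N : ℕ → ℝ} (h0 : ∀ j, 0 ≤ N j)
    (hlog : ∀ j, N (j + 1) ^ 2 ≤ N j * N (j + 2)) {C q : ℝ} (hq : 0 < q)
    (hN : ∀ j, N (2 * j) ≤ C * q ^ (2 * j)) : N 1 ≤ q * N 0 := by
  by_contra hlt
  push Not at hlt
  have hN0 : 0 < N 0 := by
    rcases (h0 0).eq_or_lt with h | h
    · have := hlog 0
      rw [← h, zero_mul] at this
      rw [← h, mul_zero] at hlt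
      nlinarith [sq_nonneg (N (0 + 1)), hlt]
    · exact h
  set x := N 1 / N 0 with hx
  have hxq : q < x := by rwa [hx, lt_div_iff₀ hN0]
  have hx0 : 0 < x := hq.trans hxq
  have hstep : ∀ j, x * N j ≤ N (j + 1) := by
    intro j
    induction j with
    | zero => rw [hx, div_mul_cancel₀ _ hN0.ne']
    | succ j ih =>
      rcases (h0 j).eq_or_lt with h | h
      · have h1 := hlog j
        rw [← h, zero_mul] at h1
        have h2 : N (j + 1) = 0 := by nlinarith [h0 (j + 1)]
        rw [h2, mul_zero]
        exact h0 _
      · have h1 := hlog j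
        have h2 : x * N j * N (j + 1) ≤ N (j + 1) * N (j + 1) :=
          mul_le_mul_of_nonneg_right ih (h0 _)
        have h3 : N j * (x * N (j + 1)) ≤ N j * N (j + 2) := by nlinarith
        exact le_of_mul_le_mul_left h3 h
  have hpow : ∀ j, x ^ j * N 0 ≤ N j := by
    intro j
    induction j with
    | zero => simp
    | succ j ih =>
      calc x ^ (j + 1) * N 0 = x * (x ^ j * N 0) := by ring
        _ ≤ x * N j := by gcongr
        _ ≤ _ := hstep j
  have h1 : 1 < (x / q) ^ 2 := one_lt_pow₀ ((one_lt_div hq).2 hxq) two_ne_zero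
  obtain ⟨j, hj⟩ := ((tendsto_pow_atTop_atTop_of_one_lt h1).eventually_gt_atTop (C / N 0)).exists
  rw [← pow_mul, div_pow, div_lt_div_iff₀ hN0 (pow_pos hq _)] at hj
  have := (hpow (2 * j)).trans (hN j)
  linarith

theorem sq_le_mul_of_forall_nonneg {a b c : ℝ} (h : ∀ t : ℝ, 0 ≤ a + 2 * t * b + t ^ 2 * c) :
    b ^ 2 ≤ a * c := by
  have := discrim_le_zero (a := c) (b := 2 * b) (c := a) fun t => by
    have := h t
    nlinarith
  rw [discrim] at this
  nlinarith

section Gap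
variable {X : Type*} [TopologicalSpace X] [CompactSpace X] [MeasurableSpace X] [BorelSpace X]
  {ν : Measure X} [IsFiniteMeasure ν]

theorem integrable_of_compact {f : X → ℝ} (hf : Continuous f) : Integrable f ν :=
  hf.integrable_of_hasCompactSupport (HasCompactSupport.of_compactSpace f)

theorem integral_mul_sq_le {f g : X → ℝ} (hf : Continuous f) (hg : Continuous g) :
    (∫ p, f p * g p ∂ν) ^ 2 ≤ (∫ p, f p ^ 2 ∂ν) * ∫ p, g p ^ 2 ∂ν := by
  refine sq_le_mul_of_forall_nonneg fun t => ?_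
  have h : ∫ p, (f p + t * g p) ^ 2 ∂ν = (∫ p, f p ^ 2 ∂ν) + 2 * t * (∫ p, f p * g p ∂ν) +
      t ^ 2 * ∫ p, g p ^ 2 ∂ν := by
    rw [← integral_const_mul, ← integral_const_mul, ← integral_add, ← integral_add]
    · congr 1; funext p; ring
    all_goals exact integrable_of_compact (by fun_prop)
  rw [← h]
  exact integral_nonneg fun p => sq_nonneg _

variable [ν.IsOpenPosMeasure] [Nonempty X]

theorem integral_pos_of_continuous {f : X → ℝ} (hf : Continuous f) (h0 : ∀ p, 0 ≤ f p) {p : X}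
    (hp : f p ≠ 0) : 0 < ∫ p, f p ∂ν :=
  hf.integral_pos_of_hasCompactSupport_nonneg_nonzero (HasCompactSupport.of_compactSpace f) h0 hp

/-- The spectral gap of a symmetric compact strongly positive operator. -/
theorem exists_spectral_gap {T : C(X, ℝ) →L[ℝ] C(X, ℝ)}
    (hc : TotallyBounded (T '' Metric.closedBall 0 1))
    (hp : ∀ f : C(X, ℝ), (∀ p, 0 ≤ f p) → f ≠ 0 → ∀ p, 0 < T f p)
    (hsym : ∀ f g : C(X, ℝ), ∫ p, T f p * g p ∂ν = ∫ p, f p * T g p ∂ν)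
    {μ : ℝ} {φ : C(X, ℝ)} (hμ : 0 < μ) (hφ : ∀ p, 0 < φ p) (hTφ : T φ = μ • φ) :
    ∃ q : ℝ, 0 < q ∧ q < 1 ∧ ∀ f : C(X, ℝ), ∫ p, f p * φ p ∂ν = 0 →
      ∫ p, T f p ^ 2 ∂ν ≤ q * μ ^ 2 * ∫ p, f p ^ 2 ∂ν := by
  set ψ : C(X, ℝ) := ⟨fun p => (φ p)⁻¹, φ.continuous.inv₀ fun p => (hφ p).ne'⟩ with hψ
  have hψφ : ∀ p, ψ p * φ p = 1 := fun p => inv_mul_cancel₀ (hφ p).ne'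
  have hψ0 : ∀ p, 0 < ψ p := fun p => inv_pos.2 (hφ p)
  set Q : C(X, ℝ) →L[ℝ] C(X, ℝ) := (μ⁻¹ • ContinuousLinearMap.mul ℝ C(X, ℝ) ψ).comp
    (T.comp (ContinuousLinearMap.mul ℝ C(X, ℝ) φ)) with hQ
  have hQa : ∀ f p, Q f p = μ⁻¹ * (ψ p * T (φ * f) p) := fun f p => rfl
  have hQφ : ∀ f p, φ p * Q f p = μ⁻¹ * T (φ * f) p := fun f p => by
    rw [hQa]
    have := hψφ p
    linear_combination (μ⁻¹ * T (φ * f) p) * this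
  have hQ1 : Q 1 = 1 := by
    ext p
    rw [hQa, mul_one, hTφ, smul_at, smul_eq_mul, one_at]
    have := hψφ p
    field_simp
    linarith
  have hQp : ∀ f : C(X, ℝ), (∀ p, 0 ≤ f p) → f ≠ 0 → ∀ p, 0 < Q f p := by
    intro f hf hne p
    rw [hQa]
    refine mul_pos (inv_pos.2 hμ) (mul_pos (hψ0 p) (hp _ (fun q => mul_nonneg (hφ q).le (hf q))
      (fun h0 => hne ?_) p))
    ext q
    have := congrArg (fun g : C(X, ℝ) => g q) h0
    simp only [mul_at, ContinuousMap.zero_apply, mul_eq_zero] at this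
    exact this.resolve_left (hφ q).ne'
  have hQc : TotallyBounded (Q '' Metric.closedBall 0 1) := by
    have hR : 0 < ‖φ‖ + 1 := by positivity
    refine (hc.image (f := fun u => ((‖φ‖ + 1) • (μ⁻¹ • ContinuousLinearMap.mul ℝ C(X, ℝ) ψ)) u)
      (ContinuousLinearMap.uniformContinuous _)).subset ?_
    rintro _ ⟨f, hf, rfl⟩
    rw [mem_closedBall_zero_iff] at hf
    refine ⟨_, ⟨(‖φ‖ + 1)⁻¹ • (φ * f), ?_, rfl⟩, ?_⟩
    · rw [mem_closedBall_zero_iff, norm_smul, norm_inv, Real.norm_of_nonneg hR.le,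
        inv_mul_le_iff₀ hR]
      have h1 := norm_mul_le φ f
      nlinarith [norm_nonneg φ]
    · ext p
      rw [map_smul]
      change (‖φ‖ + 1) * (μ⁻¹ * (ψ p * ((‖φ‖ + 1)⁻¹ * T (φ * f) p))) = _
      rw [hQa]
      field_simp
  obtain ⟨q, hq0, hq1, hosc⟩ := exists_osc_le hQc hQp hQ1
  refine ⟨q, hq0, hq1, fun f hf => ?_⟩
  have hφ2 : 0 < ∫ p, φ p ^ 2 ∂ν := by
    obtain ⟨p⟩ := ‹Nonempty X›
    exact integral_pos_of_continuous (by fun_prop) (fun p => sq_nonneg _)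
      (p := p) (pow_ne_zero 2 (hφ p).ne')
  have hsymQ : ∀ g k : C(X, ℝ), ∫ p, (φ p * Q g p) * (φ p * k p) ∂ν =
      ∫ p, (φ p * g p) * (φ p * Q k p) ∂ν := by
    intro g k
    simp only [hQφ]
    have h1 := hsym (φ * g) (φ * k)
    simp only [mul_at] at h1
    have e1 : (fun p => μ⁻¹ * T (φ * g) p * (φ p * k p)) =
        fun p => μ⁻¹ * (T (φ * g) p * (φ p * k p)) := by funext p; ring
    have e2 : (fun p => φ p * g p * (μ⁻¹ * T (φ * k) p)) =
        fun p => μ⁻¹ * (φ p * g p * T (φ * k) p) := by funext p; ring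
    rw [e1, e2, integral_const_mul, integral_const_mul, h1]
  set h : C(X, ℝ) := ψ * f with hh
  have hφh : φ * h = f := by
    ext p
    simp only [hh, mul_at]
    have := hψφ p
    linear_combination (f p) * this
  have hiter : ∀ j, Q^[j + 1] h = Q (Q^[j] h) := fun j => Function.iterate_succ_apply' Q j h
  have hmean : ∀ j, ∫ p, φ p ^ 2 * (Q^[j] h) p ∂ν = 0 := by
    intro j
    induction j with
    | zero =>
      rw [← hf]
      congr 1
      funext p
      have := congrArg (fun g : C(X, ℝ) => g p) hφh
      simp only [mul_at] at this
      rw [Function.iterate_zero_apply, ← this]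
      ring
    | succ j ih =>
      have h1 := hsymQ (Q^[j] h) 1
      rw [hQ1] at h1
      simp only [one_at, mul_one] at h1
      rw [hiter]
      calc _ = ∫ p, φ p * Q (Q^[j] h) p * φ p ∂ν := by congr 1; funext p; ring
        _ = ∫ p, φ p * (Q^[j] h) p * φ p ∂ν := h1
        _ = ∫ p, φ p ^ 2 * (Q^[j] h) p ∂ν := by congr 1; funext p; ring
        _ = 0 := ih
  obtain ⟨d, hd⟩ : ∃ d, ∀ p p', h p - h p' ≤ d := ⟨‖h‖ + ‖h‖, fun p p' => by
    have h1 := abs_le.1 (h.norm_coe_le_norm p)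
    have h2 := abs_le.1 (h.norm_coe_le_norm p')
    linarith [h1.2, h2.1]⟩
  have hosc' : ∀ j p p', (Q^[2 * j] h) p - (Q^[2 * j] h) p' ≤ q ^ j * d := by
    intro j
    induction j with
    | zero => simpa using hd
    | succ j ih =>
      intro p p'
      have := hosc _ _ ih p p'
      rw [← hiter, ← hiter] at this
      calc _ ≤ q * (q ^ j * d) := this
        _ = _ := by ring
  have habs : ∀ j p, |(Q^[2 * j] h) p| ≤ q ^ j * d := by
    intro j p
    set k := Q^[2 * j] h with hk
    have hi1 : Integrable (fun p' => φ p' ^ 2 * k p') ν := integrable_of_compact (by fun_prop)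
    have hi2 : Integrable (fun p' => φ p' ^ 2) ν := integrable_of_compact (by fun_prop)
    have hm : ∫ p', φ p' ^ 2 * k p' ∂ν = 0 := hmean _
    have key : ∀ s : ℝ, ∫ p', φ p' ^ 2 * (s - k p') ∂ν = (∫ p', φ p' ^ 2 ∂ν) * s := by
      intro s
      have : (fun p' => φ p' ^ 2 * (s - k p')) = fun p' => φ p' ^ 2 * s - φ p' ^ 2 * k p' := by
        funext p'; ring
      rw [this, integral_sub (hi2.mul_const s) hi1, hm, integral_mul_const, sub_zero]
    rw [abs_le]
    constructor
    · have h1 : 0 ≤ ∫ p', φ p' ^ 2 * ((k p + q ^ j * d) - k p') ∂ν :=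
        integral_nonneg fun p' => mul_nonneg (sq_nonneg _) (by linarith [hosc' j p' p])
      rw [key] at h1
      have := nonneg_of_mul_nonneg_right h1 hφ2
      linarith
    · have h1 : ∫ p', φ p' ^ 2 * ((k p - q ^ j * d) - k p') ∂ν ≤ 0 :=
        integral_nonpos fun p' => mul_nonpos_of_nonneg_of_nonpos (sq_nonneg _)
          (by linarith [hosc' j p p'])
      rw [key] at h1
      by_contra hlt
      push Not at hlt
      have := mul_pos hφ2 (sub_pos.2 hlt)
      linarith
  set N : ℕ → ℝ := fun j => ∫ p, (φ p * (Q^[j] h) p) ^ 2 ∂ν with hN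
  have hlog : ∀ j, N (j + 1) ^ 2 ≤ N j * N (j + 2) := by
    intro j
    have h1 : N (j + 1) = ∫ p, (φ p * (Q^[j] h) p) * (φ p * (Q^[j + 2] h) p) ∂ν := by
      rw [hiter (j + 1), hiter j, ← hsymQ]
      simp only [hN, hiter j]
      congr 1; funext p; ring
    rw [h1]
    exact integral_mul_sq_le (by fun_prop) (by fun_prop)
  have hbound : ∀ j, N (2 * j) ≤ (d ^ 2 * ∫ p, φ p ^ 2 ∂ν) * q ^ (2 * j) := by
    intro j
    have h1 : N (2 * j) ≤ ∫ p, (q ^ j * d) ^ 2 * φ p ^ 2 ∂ν := by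
      refine integral_mono (integrable_of_compact (by fun_prop))
        (integrable_of_compact (by fun_prop)) fun p => ?_
      simp only
      rw [mul_pow, mul_comm]
      have := sq_le_sq' (abs_le.1 (habs j p)).1 (abs_le.1 (habs j p)).2
      gcongr
    rw [integral_const_mul] at h1
    calc _ ≤ _ := h1
      _ = _ := by ring
  have hfin := le_mul_of_log_convex (N := N) (fun j => integral_nonneg fun p => sq_nonneg _) hlog
    hq0 hbound
  have hconv : N 0 = ∫ p, f p ^ 2 ∂ν := by
    simp only [hN, Function.iterate_zero_apply]
    congr 1; funext p
    rw [← mul_at, hφh]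
  have hN1 : N 1 = (μ ^ 2)⁻¹ * ∫ p, T f p ^ 2 ∂ν := by
    rw [← integral_const_mul]
    simp only [hN, Function.iterate_one, hQφ, hφh]
    congr 1; funext p
    rw [mul_pow, inv_pow]
  have hμ2 : 0 < μ ^ 2 := by positivity
  rw [hN1, hconv] at hfin
  rw [inv_mul_le_iff₀ hμ2] at hfin
  linarith

end Gap

section IntegralCLM
variable {X : Type*} [TopologicalSpace X] [CompactSpace X] [MeasurableSpace X] [BorelSpace X]

/-- Integration of continuous functions against a finite measure. -/
noncomputable def integralCLM (ν : Measure X) [IsFiniteMeasure ν] : C(X, ℝ) →L[ℝ] ℝ :=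
  LinearMap.mkContinuous
    { toFun := fun f => ∫ p, f p ∂ν
      map_add' := fun f g => integral_add (integrable_of_compact f.continuous)
        (integrable_of_compact g.continuous)
      map_smul' := fun s f => integral_const_mul s _ } (ν.real Set.univ) fun f => by
    have := norm_integral_le_of_norm_le_const (μ := ν) (f := fun p => f p) (C := ‖f‖)
      (Eventually.of_forall fun p => f.norm_coe_le_norm p)
    rwa [mul_comm] at this

theorem integralCLM_apply (ν : Measure X) [IsFiniteMeasure ν] (f : C(X, ℝ)) :
    integralCLM ν f = ∫ p, f p ∂ν := rfl

theorem continuous_integral_mul (ν : Measure X) [IsFiniteMeasure ν] :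
    Continuous fun z : C(X, ℝ) × C(X, ℝ) => ∫ p, z.1 p * z.2 p ∂ν :=
  (integralCLM ν).continuous.comp (continuous_fst.mul continuous_snd)

theorem tendsto_integral_mul (ν : Measure X) [IsFiniteMeasure ν] {ι : Type*} {l : Filter ι}
    {u v : ι → C(X, ℝ)} {f g : C(X, ℝ)} (hu : Tendsto u l (𝓝 f)) (hv : Tendsto v l (𝓝 g)) :
    Tendsto (fun m => ∫ p, u m p * v m p ∂ν) l (𝓝 (∫ p, f p * g p ∂ν)) :=
  ((continuous_integral_mul ν).tendsto (f, g)).comp (hu.prodMk_nhds hv)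

end IntegralCLM

section Eigen
variable [IsManifold (𝓡 n) ∞ S] [CompactSpace S] [MeasurableSpace S] [BorelSpace S]

theorem DiffOp.integral_mul_symm_of_mem_graph {A : DiffOp n r S} {ν : Measure S}
    [IsFiniteMeasure ν] (hA : A.IsSelfAdjointWrt ν) {v w : C(S, ℝ) × C(S, ℝ)} (hv : v ∈ A.graph)
    (hw : w ∈ A.graph) : ∫ p, v.2 p * w.1 p ∂ν = ∫ p, v.1 p * w.2 p ∂ν := by
  obtain ⟨a, ha, hav⟩ := DiffOp.exists_seq_of_mem_graph hv
  obtain ⟨b, hb, hbw⟩ := DiffOp.exists_seq_of_mem_graph hw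
  have hav1 := (continuous_fst.tendsto v).comp hav
  have hav2 := (continuous_snd.tendsto v).comp hav
  have hbw1 := (continuous_fst.tendsto w).comp hbw
  have hbw2 := (continuous_snd.tendsto w).comp hbw
  refine tendsto_nhds_unique (tendsto_integral_mul ν hav2 hbw1)
    ((tendsto_integral_mul ν hav1 hbw2).congr fun m => ?_)
  have h := hA (a m).1 (b m).1 ((ha m).1.of_le two_le_infty) ((hb m).1.of_le two_le_infty)
  simp only [← (ha m).2, ← (hb m).2] at h
  exact h.symm

theorem DiffOp.mk_mem_smoothGraph (A : DiffOp n r S) {u : C(S, ℝ)}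
    (hu : SmoothFn[n] ∞ u) :
    (u, (⟨A.op u, A.continuous_op (hu.of_le two_le_infty)⟩ : C(S, ℝ))) ∈ A.smoothGraph :=
  ⟨hu, fun _ => rfl⟩

theorem DiffOp.smoothGraph_le_graph (A : DiffOp n r S) : A.smoothGraph ≤ A.graph :=
  Submodule.le_topologicalClosure _

theorem DiffOp.grad2_self_nonneg {A : DiffOp n r S} (hA : A.IsElliptic) (u : S → ℝ) (p : S) :
    0 ≤ A.grad2 u u p := by
  have h := (hA p _ ((ch n p).map_source (mem_chart_source (Rn n) p))).posSemidef
  have h2 := h.dotProduct_mulVec_nonneg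
    fun i => pd i (u ∘ (ch n p).symm) (ch n p p)
  have e : A.grad2 u u p = 2 * (star (fun i => pd i (u ∘ (ch n p).symm)
      (ch n p p)) ⬝ᵥ (Matrix.of (A.coef p (ch n p p)).1).mulVec
      fun i => pd i (u ∘ (ch n p).symm) (ch n p p)) := by
    simp only [DiffOp.grad2, dotProduct, Matrix.mulVec, mul_sum, Pi.star_apply, star_trivial,
      Matrix.of_apply]
    refine sum_sum_congr fun i j => ?_
    ring
  rw [e]
  positivity

theorem DiffOp.continuous_grad2 (A : DiffOp n r S) {u v : S → ℝ}
    (hu : SmoothFn[n] 2 u) (hv : SmoothFn[n] 2 v) :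
    Continuous (A.grad2 u v) := by
  have e : A.grad2 u v = fun p => A.op (fun q => u q * v q) p - u p * A.op v p - v p * A.op u p
      + A.op (fun _ => 1) p * (u p * v p) := by
    funext p
    rw [A.op_mul hu hv]
    ring
  rw [e]
  have h1 := A.continuous_op (hu.mul hv)
  have h2 := A.continuous_op hu
  have h3 := A.continuous_op hv
  have h4 := A.continuous_op (u := fun _ => 1) contMDiff_const
  have h5 := hu.continuous
  have h6 := hv.continuous
  exact (((h1.sub (h5.mul h3)).sub (h6.mul h2)).add (h4.mul (h5.mul h6)))

theorem DiffOp.integral_grad2 {A : DiffOp n r S} {ν : Measure S} [IsFiniteMeasure ν]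
    (hA : A.IsSelfAdjointWrt ν) {u : S → ℝ} (hu : SmoothFn[n] 2 u) :
    ∫ p, A.grad2 u u p ∂ν = 2 * (∫ p, A.op (fun _ => 1) p * u p ^ 2 ∂ν)
      - 2 * ∫ p, A.op u p * u p ∂ν := by
  have h1 : ∫ p, A.op (fun q => u q * u q) p * 1 ∂ν = ∫ p, u p * u p * A.op (fun _ => 1) p ∂ν :=
    hA _ _ (hu.mul hu) contMDiff_const
  have hcu := hu.continuous
  have hcA := A.continuous_op hu
  have hc1 := A.continuous_op (u := fun _ => 1) contMDiff_const
  have hcg := A.continuous_grad2 hu hu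
  have h2 : ∫ p, A.op (fun q => u q * u q) p * 1 ∂ν = 2 * (∫ p, A.op u p * u p ∂ν)
      - (∫ p, A.op (fun _ => 1) p * u p ^ 2 ∂ν) + ∫ p, A.grad2 u u p ∂ν := by
    rw [← integral_const_mul, ← integral_sub, ← integral_add]
    · congr 1
      funext p
      rw [A.op_mul hu hu]
      ring
    all_goals exact integrable_of_compact (by fun_prop)
  have h3 : ∫ p, u p * u p * A.op (fun _ => 1) p ∂ν = ∫ p, A.op (fun _ => 1) p * u p ^ 2 ∂ν := by
    congr 1
    funext p
    ring
  linarith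

theorem DiffOp.integral_sq_le_of_smooth {A : DiffOp n r S} {ν : Measure S}
    [IsFiniteMeasure ν] (hA : A.IsSelfAdjointWrt ν) {κ : ℝ}
    (hκ : ∀ p, A.op (fun _ => 1) p + 1 ≤ κ) {u : S → ℝ} (hu : SmoothFn[n] 2 u) :
    (1 / 2) * (∫ p, A.grad2 u u p ∂ν) + ∫ p, u p ^ 2 ∂ν ≤ ∫ p, (κ * u p - A.op u p) * u p ∂ν := by
  have hcu := hu.continuous
  have hcA := A.continuous_op hu
  have hc1 := A.continuous_op (u := fun _ => 1) contMDiff_const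
  have h1 := DiffOp.integral_grad2 hA hu
  have h2 : ∫ p, (κ * u p - A.op u p) * u p ∂ν = (∫ p, κ * u p ^ 2 ∂ν)
      - ∫ p, A.op u p * u p ∂ν := by
    rw [← integral_sub]
    · congr 1; funext p; ring
    all_goals exact integrable_of_compact (by fun_prop)
  have h3 : (∫ p, A.op (fun _ => 1) p * u p ^ 2 ∂ν) + ∫ p, u p ^ 2 ∂ν ≤ ∫ p, κ * u p ^ 2 ∂ν := by
    rw [← integral_add]
    · refine integral_mono (integrable_of_compact (by fun_prop))
        (integrable_of_compact (by fun_prop)) fun p => ?_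
      have := mul_le_mul_of_nonneg_right (hκ p) (sq_nonneg (u p))
      simp only
      linarith
    all_goals exact integrable_of_compact (by fun_prop)
  linarith

theorem DiffOp.integral_sq_le_of_mem_graph {A : DiffOp n r S} (hell : A.IsElliptic) {ν : Measure S}
    [IsFiniteMeasure ν] (hA : A.IsSelfAdjointWrt ν) {κ : ℝ}
    (hκ : ∀ p, A.op (fun _ => 1) p + 1 ≤ κ) {v : C(S, ℝ) × C(S, ℝ)} (hv : v ∈ A.graph) :
    ∫ p, v.1 p * v.1 p ∂ν ≤ ∫ p, (κ • v.1 - v.2) p * v.1 p ∂ν := by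
  obtain ⟨a, ha, hav⟩ := DiffOp.exists_seq_of_mem_graph hv
  have h1 : Tendsto (fun m => (a m).1) atTop (𝓝 v.1) := (continuous_fst.tendsto v).comp hav
  have h2 : Tendsto (fun m => (a m).2) atTop (𝓝 v.2) := (continuous_snd.tendsto v).comp hav
  refine le_of_tendsto_of_tendsto' (tendsto_integral_mul ν h1 h1)
    (tendsto_integral_mul ν ((h1.const_smul κ).sub h2) h1) fun m => ?_
  have h3 := DiffOp.integral_sq_le_of_smooth hA hκ ((ha m).1.of_le two_le_infty)
  have h4 : 0 ≤ ∫ p, A.grad2 (a m).1 (a m).1 p ∂ν :=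
    integral_nonneg fun p => DiffOp.grad2_self_nonneg hell _ p
  simp only [← (ha m).2] at h3
  have e : ∀ p, (a m).1 p * (a m).1 p = (a m).1 p ^ 2 := fun p => (sq _).symm
  simp only [e, sub_at, smul_at, smul_eq_mul]
  linarith

/-- `φ > 0` is an eigenfunction, with eigenvalue `-lam`, of the closure of `A` in the space of
continuous functions. -/
def DiffOp.IsEigenpair (A : DiffOp n r S) (lam : ℝ) (φ : C(S, ℝ)) : Prop :=
  (φ, -(lam • φ)) ∈ A.graph ∧ ∀ p, 0 < φ p

variable [ConnectedSpace S]

theorem DiffOp.IsResolvent.pos {A : DiffOp n r S} (hell : A.IsElliptic) {ν : Measure S}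
    [IsFiniteMeasure ν] [ν.IsOpenPosMeasure] (hA : A.IsSelfAdjointWrt ν) {κ : ℝ}
    (hκ : ∀ p, A.op (fun _ => 1) p + 1 ≤ κ) {T : C(S, ℝ) →L[ℝ] C(S, ℝ)} (hT : A.IsResolvent κ T)
    (f : C(S, ℝ)) (hf : ∀ p, 0 ≤ f p) (hne : f ≠ 0) (p : S) : 0 < T f p := by
  have hmem := hT.mem_graph f
  refine DiffOp.pos_of_mem_graph hell hκ hmem (fun q => ?_) (fun h0 => ?_) p
  · simpa using hf q
  · have h0' : T f = 0 := h0
    rw [h0', smul_zero, zero_sub] at hmem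
    have h1 := A.smoothGraph_le_graph (A.mk_mem_smoothGraph (u := 1) contMDiff_const)
    have h2 := DiffOp.integral_mul_symm_of_mem_graph hA hmem h1
    simp only [neg_at, one_at, mul_one, ContinuousMap.zero_apply,
      zero_mul, integral_zero, integral_neg, neg_eq_zero] at h2
    obtain ⟨q, hq⟩ : ∃ q, f q ≠ 0 := by
      by_contra hall
      push Not at hall
      exact hne (ContinuousMap.ext hall)
    exact (integral_pos_of_continuous f.continuous hf hq).ne' h2

theorem DiffOp.IsResolvent.symm {A : DiffOp n r S} {ν : Measure S}
    [IsFiniteMeasure ν] (hA : A.IsSelfAdjointWrt ν) {κ : ℝ} {T : C(S, ℝ) →L[ℝ] C(S, ℝ)}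
    (hT : A.IsResolvent κ T) (f g : C(S, ℝ)) : ∫ p, T f p * g p ∂ν = ∫ p, f p * T g p ∂ν := by
  have h := DiffOp.integral_mul_symm_of_mem_graph hA (hT.mem_graph f) (hT.mem_graph g)
  simp only [sub_at, smul_at, smul_eq_mul] at h
  have e1 : ∫ p, (κ * T f p - f p) * T g p ∂ν = (∫ p, κ * (T f p * T g p) ∂ν)
      - ∫ p, f p * T g p ∂ν := by
    rw [← integral_sub]
    · congr 1; funext p; ring
    all_goals exact integrable_of_compact (by fun_prop)
  have e2 : ∫ p, T f p * (κ * T g p - g p) ∂ν = (∫ p, κ * (T f p * T g p) ∂ν)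
      - ∫ p, T f p * g p ∂ν := by
    rw [← integral_sub]
    · congr 1; funext p; ring
    all_goals exact integrable_of_compact (by fun_prop)
  linarith

/-- The lowest eigenvalue: existence of a normalized positive eigenfunction, and the coercivity of
the quadratic form of the operator off the eigenfunction. -/
theorem DiffOp.exists_eigenpair [T2Space S] (A : DiffOp n r S) (hr : 1 ≤ r) (hell : A.IsElliptic)
    {ν : Measure S} [IsFiniteMeasure ν] [ν.IsOpenPosMeasure] (hA : A.IsSelfAdjointWrt ν) :
    ∃ (κ lam : ℝ) (φ : C(S, ℝ)), (∀ p, A.op (fun _ => 1) p + 1 ≤ κ) ∧ A.IsEigenpair lam φ ∧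
      ∫ p, φ p * φ p ∂ν = 1 ∧ ∃ c > 0, ∀ v ∈ A.graph,
        c * ∫ p, (κ • v.1 - v.2) p * v.1 p ∂ν ≤ (∫ p, (κ • v.1 - v.2) p * v.1 p ∂ν)
          - (κ + lam) * (∫ p, v.1 p * v.1 p ∂ν) + (∫ p, v.1 p * φ p ∂ν) ^ 2 := by
  obtain ⟨κ, hκres⟩ := A.exists_resolvent hr hell
  obtain ⟨hκ, T, hT⟩ := hκres κ le_rfl
  have hpos := hT.pos hell hA hκ
  have hsym := hT.symm hA
  obtain ⟨μ, φ₀, hμ, hφ₀, hTφ₀⟩ := exists_positive_eigenfunction hT.totallyBounded hpos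
  have hI : 0 < ∫ p, φ₀ p * φ₀ p ∂ν := by
    obtain ⟨p⟩ := (inferInstance : Nonempty S)
    exact integral_pos_of_continuous (by fun_prop) (fun p => mul_self_nonneg _) (p := p)
      (mul_self_pos.2 (hφ₀ p).ne').ne'
  set a := (√(∫ p, φ₀ p * φ₀ p ∂ν))⁻¹ with ha
  have ha0 : 0 < a := inv_pos.2 (Real.sqrt_pos.2 hI)
  have ha2 : a * a * (∫ p, φ₀ p * φ₀ p ∂ν) = 1 := by
    rw [ha, ← mul_inv, Real.mul_self_sqrt hI.le, inv_mul_cancel₀ hI.ne']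
  set φ := a • φ₀ with hφdef
  have hφ : ∀ p, 0 < φ p := fun p => mul_pos ha0 (hφ₀ p)
  have hTφ : T φ = μ • φ := by rw [hφdef, map_smul, hTφ₀, smul_comm]
  have hφ1 : ∫ p, φ p * φ p ∂ν = 1 := by
    rw [← ha2, ← integral_const_mul]
    congr 1; funext p
    simp only [hφdef, smul_at, smul_eq_mul]
    ring
  obtain ⟨q, hq0, hq1, hgap⟩ := exists_spectral_gap hT.totallyBounded hpos hsym hμ hφ hTφ
  refine ⟨κ, μ⁻¹ - κ, φ, hκ, ⟨?_, hφ⟩, hφ1, ?_⟩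
  · have h1 := A.graph.smul_mem μ⁻¹ (hT.mem_graph φ)
    rw [hTφ] at h1
    have e : μ⁻¹ • ((μ • φ, κ • μ • φ - φ) : C(S, ℝ) × C(S, ℝ)) = (φ, -((μ⁻¹ - κ) • φ)) := by
      refine Prod.ext ?_ ?_
      · change μ⁻¹ • μ • φ = φ
        rw [smul_smul, inv_mul_cancel₀ hμ.ne', one_smul]
      · change μ⁻¹ • (κ • μ • φ - φ) = -((μ⁻¹ - κ) • φ)
        rw [smul_sub, smul_comm κ μ, smul_smul, inv_mul_cancel₀ hμ.ne', one_smul]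
        module
    rwa [e] at h1
  set s' := √q with hs'
  have hs'1 : s' < 1 := by rw [hs', Real.sqrt_lt' one_pos]; simpa using hq1
  have hs'0 : 0 < s' := Real.sqrt_pos.2 hq0
  refine ⟨min (1 - s') μ, lt_min (by linarith) hμ, fun v hv => ?_⟩
  set f := κ • v.1 - v.2 with hf
  have hTf : T f = v.1 := hT.apply_of_mem v hv
  set s := ∫ p, f p * φ p ∂ν with hs
  set g := f - s • φ with hg
  have hB : ∀ a b : C(S, ℝ), Integrable (fun p => a p * b p) ν := fun a b =>
    integrable_of_compact (by fun_prop)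
  have hgφ : ∫ p, g p * φ p ∂ν = 0 := by
    have : (fun p => g p * φ p) = fun p => f p * φ p - s * (φ p * φ p) := by
      funext p
      simp only [hg, sub_at, smul_at, smul_eq_mul]
      ring
    rw [this, integral_sub (hB f φ) ((hB φ φ).const_mul s), integral_const_mul, hφ1, ← hs]
    ring
  have hTgφ : ∫ p, T g p * φ p ∂ν = 0 := by
    rw [hsym, hTφ]
    have : (fun p => g p * (μ • φ) p) = fun p => μ * (g p * φ p) := by
      funext p
      simp only [smul_at, smul_eq_mul]
      ring
    rw [this, integral_const_mul, hgφ, mul_zero]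
  have hu : ∀ p, v.1 p = s * μ * φ p + T g p := by
    intro p
    have : T f = s • μ • φ + T g := by
      have h1 : T g = T f - s • T φ := by rw [show g = f - s • φ from hg, map_sub T f, map_smul]
      rw [h1, hTφ]
      abel
    rw [← hTf, this]
    simp only [ContinuousMap.add_apply, smul_at, smul_eq_mul]
    ring
  have hfg : ∀ p, f p = s * φ p + g p := fun p => by
    simp only [hg, sub_at, smul_at, smul_eq_mul]
    ring
  set P := ∫ p, g p * T g p ∂ν with hP
  set R := ∫ p, T g p * T g p ∂ν with hR
  have e1 : ∫ p, f p * v.1 p ∂ν = s ^ 2 * μ + P := by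
    have : (fun p => f p * v.1 p) = fun p => s ^ 2 * μ * (φ p * φ p) + s * (T g p * φ p) +
        s * μ * (g p * φ p) + g p * T g p := by
      funext p
      rw [hfg, hu]
      ring
    rw [this, integral_add, integral_add, integral_add, integral_const_mul, integral_const_mul,
      integral_const_mul, hφ1, hTgφ, hgφ]
    · ring
    all_goals exact integrable_of_compact (by fun_prop)
  have e2 : ∫ p, v.1 p * v.1 p ∂ν = s ^ 2 * μ ^ 2 + R := by
    have : (fun p => v.1 p * v.1 p) = fun p => s ^ 2 * μ ^ 2 * (φ p * φ p) +
        2 * s * μ * (T g p * φ p) + T g p * T g p := by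
      funext p
      rw [hu]
      ring
    rw [this, integral_add, integral_add, integral_const_mul, integral_const_mul, hφ1, hTgφ]
    · ring
    all_goals exact integrable_of_compact (by fun_prop)
  have e3 : ∫ p, v.1 p * φ p ∂ν = s * μ := by
    have : (fun p => v.1 p * φ p) = fun p => s * μ * (φ p * φ p) + T g p * φ p := by
      funext p
      rw [hu]
      ring
    rw [this, integral_add, integral_const_mul, hφ1, hTgφ]
    · ring
    all_goals exact integrable_of_compact (by fun_prop)
  have hquad : ∀ h : C(S, ℝ), 0 ≤ ∫ p, h p * T h p ∂ν := by
    intro h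
    have h1 := DiffOp.integral_sq_le_of_mem_graph hell hA hκ (hT.mem_graph h)
    have h2 : κ • T h - (κ • T h - h) = h := sub_sub_cancel _ _
    simp only [h2] at h1
    exact (integral_nonneg fun p => mul_self_nonneg _).trans h1
  have hP0 : 0 ≤ P := hquad g
  have hR0 : 0 ≤ R := integral_nonneg fun p => mul_self_nonneg _
  have hCS : R ^ 2 ≤ P * ∫ p, T g p * T (T g) p ∂ν := by
    refine sq_le_mul_of_forall_nonneg fun t => ?_
    have h1 := hquad (g + t • T g)
    have : (fun p => (g + t • T g) p * T (g + t • T g) p) = fun p => g p * T g p +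
        t * (g p * T (T g) p) + t * (T g p * T g p) + t ^ 2 * (T g p * T (T g) p) := by
      funext p
      simp only [map_add, map_smul, ContinuousMap.add_apply, smul_at, smul_eq_mul]
      ring
    rw [this, integral_add, integral_add, integral_add, integral_const_mul, integral_const_mul,
      integral_const_mul, ← hsym g (T g)] at h1
    · linarith
    all_goals exact integrable_of_compact (by fun_prop)
  have hTT : (∫ p, T g p * T (T g) p ∂ν) ^ 2 ≤ R * (q * μ ^ 2 * R) := by
    have h1 := integral_mul_sq_le (ν := ν) (T g).continuous (T (T g)).continuous
    have h2 := hgap (T g) hTgφ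
    have h3 : ∫ p, T g p ^ 2 ∂ν = R := by simp only [hR, sq]
    rw [h3] at h1 h2
    exact h1.trans (by gcongr)
  have hTT' : ∫ p, T g p * T (T g) p ∂ν ≤ s' * μ * R := by
    refine abs_le_of_sq_le_sq' ?_ (by positivity) |>.2
    have : s' ^ 2 = q := Real.sq_sqrt hq0.le
    calc _ ≤ R * (q * μ ^ 2 * R) := hTT
      _ = _ := by rw [← this]; ring
  have hRP : R ≤ s' * μ * P := by
    rcases hR0.eq_or_lt with h | h
    · rw [← h]; positivity
    · have h1 : R * R ≤ (s' * μ * P) * R := by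
        calc R * R = R ^ 2 := (sq R).symm
          _ ≤ P * (s' * μ * R) := hCS.trans (by gcongr)
          _ = _ := by ring
      exact le_of_mul_le_mul_right h1 h
  rw [e1, e2, e3]
  have hm1 := min_le_left (1 - s') μ
  have hm2 := min_le_right (1 - s') μ
  have hκμ : (κ + (μ⁻¹ - κ)) = μ⁻¹ := by ring
  rw [hκμ]
  have h5 : μ⁻¹ * (s ^ 2 * μ ^ 2 + R) = s ^ 2 * μ + μ⁻¹ * R := by field_simp
  have h6 : μ⁻¹ * R ≤ s' * P := by
    rw [inv_mul_le_iff₀ hμ]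
    linarith
  rw [h5]
  have h7 : min (1 - s') μ * P ≤ (1 - s') * P := by gcongr
  have h8 : min (1 - s') μ * (s ^ 2 * μ) ≤ μ * (s ^ 2 * μ) := by gcongr
  nlinarith

end Eigen

open scoped Convolution

theorem exists_mollification {F : Rn n → ℝ} (hF : Continuous F) (hFc : HasCompactSupport F)
    {h : Fin n → Rn n → ℝ} (hh : ∀ i, Continuous (h i)) (hhc : ∀ i, HasCompactSupport (h i))
    (hw : ∀ i, ∀ ψ : Rn n → ℝ, ContDiff ℝ ∞ ψ → HasCompactSupport ψ →
      ∫ y, F y * pd i ψ y = - ∫ y, h i y * ψ y) {ε δ : ℝ} (hε : 0 < ε) (hδ : 0 < δ) :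
    ∃ G : Rn n → ℝ, ContDiff ℝ ∞ G ∧ tsupport G ⊆ Metric.cthickening δ (tsupport F) ∧
      (∀ y, |G y - F y| ≤ ε) ∧ ∀ i y, |pd i G y - h i y| ≤ ε := by
  have hmod : ∃ δ' > 0, ∀ y z, dist y z < δ' → |F y - F z| ≤ ε ∧ ∀ i, |h i y - h i z| ≤ ε := by
    obtain ⟨d₀, hd₀, H₀⟩ := Metric.uniformContinuous_iff.1
      (hFc.uniformContinuous_of_continuous hF) ε hε
    have H : ∀ i, ∃ d > 0, ∀ y z, dist y z < d → |h i y - h i z| ≤ ε := fun i => by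
      obtain ⟨d, hd, H⟩ := Metric.uniformContinuous_iff.1
        ((hhc i).uniformContinuous_of_continuous (hh i)) ε hε
      exact ⟨d, hd, fun y z hyz => (Real.dist_eq (h i y) (h i z)) ▸ (H hyz).le⟩
    choose d hd H using H
    have hev : ∀ᶠ t in 𝓝[>] (0 : ℝ), t < d₀ ∧ ∀ i, t < d i := by
      rw [eventually_and, eventually_all]
      exact ⟨Filter.Eventually.mono (Ioo_mem_nhdsGT hd₀) fun t ht => ht.2, fun i =>
        Filter.Eventually.mono (Ioo_mem_nhdsGT (hd i)) fun t ht => ht.2⟩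
    obtain ⟨t, ⟨ht1, ht2⟩, ht3⟩ := (hev.and self_mem_nhdsWithin).exists
    exact ⟨t, ht3, fun y z hyz => ⟨(Real.dist_eq (F y) (F z)) ▸ (H₀ (hyz.trans ht1)).le,
      fun i => H i y z (hyz.trans (ht2 i))⟩⟩
  obtain ⟨δ', hδ', hmod⟩ := hmod
  set R := min δ δ' with hR
  have hR0 : 0 < R := lt_min hδ hδ'
  let φ : ContDiffBump (0 : Rn n) := ⟨R / 2, R, by positivity, by linarith⟩
  set q := φ.normed (volume : Measure (Rn n)) with hq
  have hqs : ContDiff ℝ ∞ q := φ.contDiff_normed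
  have hqc : HasCompactSupport q := φ.hasCompactSupport_normed
  have hflip : ∀ (f : Rn n → ℝ) y, (f ⋆[ContinuousLinearMap.mul ℝ ℝ, volume] q) y =
      (q ⋆[ContinuousLinearMap.lsmul ℝ ℝ, volume] f) y := by
    intro f y
    rw [convolution_lsmul_swap, convolution_def]
    simp only [smul_eq_mul, ContinuousLinearMap.mul_apply']
    congr 1; funext t; ring
  have hclose : ∀ f : Rn n → ℝ, Continuous f → (∀ y z, dist y z < δ' → |f y - f z| ≤ ε) →
      ∀ y, |(f ⋆[ContinuousLinearMap.mul ℝ ℝ, volume] q) y - f y| ≤ ε := by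
    intro f hf hm y
    rw [hflip, ← Real.dist_eq]
    refine φ.dist_normed_convolution_le hf.aestronglyMeasurable fun z hz => ?_
    rw [Real.dist_eq]
    exact hm z y ((Metric.mem_ball.1 hz).trans_le (min_le_right _ _))
  refine ⟨F ⋆[ContinuousLinearMap.mul ℝ ℝ, volume] q,
    hqc.contDiff_convolution_right _ hF.locallyIntegrable hqs, ?_,
    hclose F hF fun y z hyz => (hmod y z hyz).1, fun i y => ?_⟩
  · refine closure_minimal ?_ Metric.isClosed_cthickening
    intro y hy
    obtain ⟨a, ha, b, hb, rfl⟩ := (support_convolution_subset _) hy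
    have hb' : ‖b‖ < R := by
      have : b ∈ Metric.ball (0 : Rn n) φ.rOut := φ.support_normed_eq.subset hb
      simpa using this
    refine Metric.mem_cthickening_of_dist_le _ a _ _ (subset_tsupport _ ha) ?_
    rw [dist_eq_norm]
    simp only [add_sub_cancel_left]
    exact hb'.le.trans (min_le_left _ _)
  · have e : pd i (F ⋆[ContinuousLinearMap.mul ℝ ℝ, volume] q) y =
        (h i ⋆[ContinuousLinearMap.mul ℝ ℝ, volume] q) y := by
      have hd := hqc.hasFDerivAt_convolution_right (ContinuousLinearMap.mul ℝ ℝ)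
        (hF.locallyIntegrable (μ := volume)) (hqs.of_le one_le_infty) y
      have hc1 : Continuous (fderiv ℝ q) := (hqs.of_le one_le_infty).continuous_fderiv one_ne_zero
      rw [pd, hd.fderiv, convolution_precompR_apply _ hF.locallyIntegrable (hqc.fderiv ℝ) hc1,
        convolution_def, convolution_def]
      simp only [ContinuousLinearMap.mul_apply']
      set ψ : Rn n → ℝ := fun t => q (y - t) with hψ
      have hψs : ContDiff ℝ ∞ ψ := hqs.comp (contDiff_const.sub contDiff_id)
      have hψc : HasCompactSupport ψ := hqc.comp_homeomorph (Homeomorph.subLeft y)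
      have hpd : ∀ t, pd i ψ t = - (fderiv ℝ q (y - t)) (EuclideanSpace.single i 1) := by
        intro t
        have h1 : HasFDerivAt q (fderiv ℝ q (y - t)) (y - t) :=
          ((hqs.of_le one_le_infty).differentiable one_ne_zero _).hasFDerivAt
        have h2 := h1.comp t ((hasFDerivAt_const y t).sub (hasFDerivAt_id t))
        rw [pd, show ψ = q ∘ (fun t => y - t) from rfl]
        erw [h2.fderiv]
        simp
      have hw' := hw i ψ hψs hψc
      simp only [hpd, mul_neg, integral_neg, neg_inj] at hw'
      exact hw'
    rw [e]
    exact hclose (h i) (hh i) (fun y z hyz => (hmod y z hyz).2 i) y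

/-- A continuous function with continuous weak derivatives is continuously differentiable. -/
theorem contDiff_one_of_weak {F : Rn n → ℝ} (hF : Continuous F) (hFc : HasCompactSupport F)
    {h : Fin n → Rn n → ℝ} (hh : ∀ i, Continuous (h i)) (hhc : ∀ i, HasCompactSupport (h i))
    (hw : ∀ i, ∀ ψ : Rn n → ℝ, ContDiff ℝ ∞ ψ → HasCompactSupport ψ →
      ∫ y, F y * pd i ψ y = - ∫ y, h i y * ψ y) :
    ContDiff ℝ 1 F ∧ ∀ i y, pd i F y = h i y := by
  choose G hG _ hG1 hG2 using fun m : ℕ => exists_mollification hF hFc hh hhc hw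
    (ε := 1 / ((m : ℝ) + 1)) (δ := 1) (by positivity) one_pos
  set g' : Rn n → Rn n →L[ℝ] ℝ := fun y => ∑ i, h i y • EuclideanSpace.proj i with hg'
  have hg'c : Continuous g' := by fun_prop
  have hfd : ∀ (w : Rn n → ℝ) y, fderiv ℝ w y = ∑ i, pd i w y • EuclideanSpace.proj (𝕜 := ℝ) i := by
    intro w y
    ext v
    rw [fderiv_apply_eq_sum]
    simp [mul_comm]
  have hlim : Tendsto (fun m : ℕ => 1 / ((m : ℝ) + 1)) atTop (𝓝 0) :=
    tendsto_one_div_add_atTop_nhds_zero_nat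
  have hunif : TendstoUniformly (fun m => fderiv ℝ (G m)) g' atTop := by
    rw [Metric.tendstoUniformly_iff]
    intro ε hε
    set C := ∑ i : Fin n, ‖(EuclideanSpace.proj (𝕜 := ℝ) i : Rn n →L[ℝ] ℝ)‖ with hC
    have h1 : Tendsto (fun m : ℕ => 1 / ((m : ℝ) + 1) * C) atTop (𝓝 0) := by
      simpa using hlim.mul_const C
    filter_upwards [h1.eventually_lt_const hε] with m hm y
    refine lt_of_le_of_lt ?_ hm
    rw [dist_comm, dist_eq_norm, hfd, hg', ← sum_sub_distrib, hC, mul_sum]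
    refine (norm_sum_le _ _).trans (sum_le_sum fun i _ => ?_)
    rw [← sub_smul, norm_smul]
    gcongr
    exact hG2 m i y
  have hpt : ∀ y, Tendsto (fun m => G m y) atTop (𝓝 (F y)) := by
    intro y
    rw [tendsto_iff_dist_tendsto_zero]
    exact squeeze_zero (fun _ => dist_nonneg) (fun m => (Real.dist_eq _ _).trans_le (hG1 m y)) hlim
  have hder : ∀ y, HasFDerivAt F (g' y) y := hasFDerivAt_of_tendstoUniformly hunif
    (fun m y => ((hG m).differentiable (by simp) y).hasFDerivAt) hpt
  refine ⟨?_, fun i y => ?_⟩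
  · rw [contDiff_one_iff_fderiv]
    refine ⟨fun y => (hder y).differentiableAt, ?_⟩
    rwa [show fderiv ℝ F = g' from funext fun y => (hder y).fderiv]
  · rw [pd, (hder y).fderiv, hg']
    simp

theorem hasCompactSupport_pd {F : Rn n → ℝ} (hFc : HasCompactSupport F) (i : Fin n) :
    HasCompactSupport (pd i F) :=
  hFc.mono' ((subset_tsupport _).trans (tsupport_pd_subset i F))

theorem continuous_mul_of_tsupport_subset {Ω : Set (Rn n)} (hΩ : IsOpen Ω)
    {f ζ : Rn n → ℝ} (hf : ContinuousOn f Ω) (hζ : Continuous ζ) (hs : tsupport ζ ⊆ Ω) :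
    Continuous (fun y => f y * ζ y) :=
  continuous_iff_continuousAt.2 fun z => by
    by_cases hz : z ∈ tsupport ζ
    · exact (hf.continuousAt (hΩ.mem_nhds (hs hz))).mul hζ.continuousAt
    · refine (continuousAt_const (y := (0 : ℝ))).congr ?_
      filter_upwards [notMem_tsupport_iff_eventuallyEq.1 hz] with t ht
      simp [ht]

theorem contDiffOn_one_of_weak {Ω : Set (Rn n)} (hΩ : IsOpen Ω) {F : Rn n → ℝ}
    (hF : ContinuousOn F Ω) {h : Fin n → Rn n → ℝ} (hh : ∀ i, ContinuousOn (h i) Ω)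
    (hw : ∀ i, ∀ ψ : Rn n → ℝ, IsTest Ω ψ →
      ∫ y, F y * pd i ψ y = - ∫ y, h i y * ψ y) :
    ContDiffOn ℝ 1 F Ω ∧ ∀ i, ∀ y ∈ Ω, pd i F y = h i y := by
  have key : ∀ y ∈ Ω, ContDiffAt ℝ 1 F y ∧ ∀ i, pd i F y = h i y := by
    intro y hy
    obtain ⟨χ, hχ, hχc, hχs, -, hχ1⟩ := exists_cutoff hΩ (isCompact_singleton (x := y))
      (Set.singleton_subset_iff.2 hy)
    rw [nhdsSet_singleton] at hχ1
    have hpc : ∀ i, Continuous (pd i χ) := fun i =>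
      (contDiff_pd (m := 0) i (hχ.of_le one_le_infty) (by simp)).continuous
    have hps : ∀ i, tsupport (pd i χ) ⊆ Ω := fun i => (tsupport_pd_subset i χ).trans hχs
    have hpcs : ∀ i, HasCompactSupport (pd i χ) := fun i => hasCompactSupport_pd hχc i
    have c1 := continuous_mul_of_tsupport_subset hΩ hF hχ.continuous hχs
    have c2 := fun i => continuous_mul_of_tsupport_subset hΩ (hh i) hχ.continuous hχs
    have c3 := fun i => continuous_mul_of_tsupport_subset hΩ hF (hpc i) (hps i)
    obtain ⟨h1, h2⟩ := contDiff_one_of_weak (F := fun y => F y * χ y)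
      (h := fun i y => h i y * χ y + F y * pd i χ y) c1 hχc.mul_left
      (fun i => (c2 i).add (c3 i)) (fun i => hχc.mul_left.add (hpcs i).mul_left) (by
        intro i ψ hψ hψc
        have ht : IsTest Ω (fun y => χ y * ψ y) :=
          ⟨hχ.mul hψ, hχc.mul_right, (tsupport_mul_subset_left).trans hχs⟩
        have h1 := hw i _ ht
        have e : ∀ y, pd i (fun y => χ y * ψ y) y = χ y * pd i ψ y + pd i χ y * ψ y := fun y => by
          rw [pd_mul (hχ.differentiable (by simp) y) (hψ.differentiable (by simp) y)]
          try ring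
        simp only [e] at h1
        have hpψ : Continuous (pd i ψ) :=
          (contDiff_pd (m := 0) i (hψ.of_le one_le_infty) (by simp)).continuous
        have i1 : Integrable (fun y => F y * χ y * pd i ψ y) :=
          (c1.mul hpψ).integrable_of_hasCompactSupport hχc.mul_left.mul_right
        have i2 : Integrable (fun y => F y * pd i χ y * ψ y) :=
          ((c3 i).mul hψ.continuous).integrable_of_hasCompactSupport (hpcs i).mul_left.mul_right
        have i3 : Integrable (fun y => h i y * χ y * ψ y) :=
          ((c2 i).mul hψ.continuous).integrable_of_hasCompactSupport hχc.mul_left.mul_right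
        have e1 : ∫ y, F y * (χ y * pd i ψ y + pd i χ y * ψ y) =
            (∫ y, F y * χ y * pd i ψ y) + ∫ y, F y * pd i χ y * ψ y := by
          rw [← integral_add i1 i2]
          congr 1; funext y; ring
        have e2 : ∫ y, (h i y * χ y + F y * pd i χ y) * ψ y =
            (∫ y, h i y * χ y * ψ y) + ∫ y, F y * pd i χ y * ψ y := by
          rw [← integral_add i3 i2]
          congr 1; funext y; ring
        have e3 : ∫ y, h i y * (χ y * ψ y) = ∫ y, h i y * χ y * ψ y := by
          congr 1; funext y; ring
        rw [e1, e3] at h1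
        rw [e2]
        linarith)
    have heq : (fun y => F y * χ y) =ᶠ[𝓝 y] F := hχ1.mono fun z hz => by simp [hz]
    refine ⟨h1.contDiffAt.congr_of_eventuallyEq heq.symm, fun i => ?_⟩
    rw [← pd_congr heq, h2 i y, hχ1.self_of_nhds]
    have : pd i χ y = 0 := by
      rw [pd_congr (v := fun _ => 1) hχ1, pd_const]
    rw [this]
    ring
  exact ⟨fun y hy => (key y hy).1.contDiffWithinAt, fun i y hy => (key y hy).2 i⟩

theorem integrable_mul_of_tsupport_subset {n : ℕ} {Ω : Set (Rn n)} (hΩ : IsOpen Ω)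
    {f ζ : Rn n → ℝ} (hf : ContinuousOn f Ω) (hζ : Continuous ζ) (hc : HasCompactSupport ζ)
    (hs : tsupport ζ ⊆ Ω) : Integrable (fun y => f y * ζ y) :=
  (continuous_mul_of_tsupport_subset hΩ hf hζ hs).integrable_of_hasCompactSupport hc.mul_left

section Inverse
variable {Ω : Set (Rn n)} {m : WithTop ℕ∞}

theorem contDiffOn_det {a : Rn n → Matrix (Fin n) (Fin n) ℝ}
    (ha : ∀ i j, ContDiffOn ℝ m (fun y => a y i j) Ω) : ContDiffOn ℝ m (fun y => (a y).det) Ω := by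
  simp only [Matrix.det_apply']
  exact ContDiffOn.sum fun σ _ => contDiffOn_const.mul (contDiffOn_prod fun i _ => ha _ _)

theorem contDiffOn_inv {a : Rn n → Matrix (Fin n) (Fin n) ℝ}
    (ha : ∀ i j, ContDiffOn ℝ m (fun y => a y i j) Ω) (h0 : ∀ y ∈ Ω, (a y).det ≠ 0) (i j : Fin n) :
    ContDiffOn ℝ m (fun y => (a y)⁻¹ i j) Ω := by
  have e : ∀ y, (a y)⁻¹ i j = (a y).det⁻¹ * ((a y).updateRow j (Pi.single i 1)).det := fun y => by
    rw [Matrix.inv_def, Ring.inverse_eq_inv', Matrix.smul_apply, Matrix.adjugate_apply, smul_eq_mul]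
  simp only [e]
  refine ((contDiffOn_det ha).inv h0).mul (contDiffOn_det fun k l => ?_)
  simp only [Matrix.updateRow_apply]
  by_cases hk : k = j
  · simp only [hk, if_true]; exact contDiffOn_const
  · simp only [hk, if_false]; exact ha k l

end Inverse

/-- `ρ` is the density, in the chart at `x`, of the measure `ν`. -/
structure IsChartDensity {n : ℕ} {S : Type*} [TopologicalSpace S] [ChartedSpace (Rn n) S]
    [MeasurableSpace S] (ν : Measure S) (x : S) (ρ : Rn n → ℝ) : Prop where
  continuousOn : ContinuousOn ρ (ch n x).target
  pos : ∀ y ∈ (ch n x).target, 0 < ρ y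
  apply_eq : ∀ s ⊆ (ch n x).source, MeasurableSet s →
    ν s = ∫⁻ y in ch n x '' s, ENNReal.ofReal (ρ y)

theorem IsVolumeMeasure.exists_isChartDensity {n : ℕ} {S : Type*} [TopologicalSpace S]
    [ChartedSpace (Rn n) S] [MeasurableSpace S] {ν : Measure S} (hν : IsVolumeMeasure n ν) (x : S) :
    ∃ ρ, IsChartDensity (n := n) ν x ρ := by
  obtain ⟨ρ, h1, h2, h3⟩ := hν x
  exact ⟨ρ, h1, h2, h3⟩

section Density
variable [IsManifold (𝓡 n) ∞ S] [CompactSpace S] [MeasurableSpace S] [BorelSpace S]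

theorem IsChartDensity.integral_mul_extendChart [T2Space S] {ν : Measure S} {x : S} {ρ : Rn n → ℝ}
    (hρ : IsChartDensity ν x ρ) {G : S → ℝ} (hG : Continuous G) {w : Rn n → ℝ}
    (hw : ContinuousOn w (ch n x).target) (hc : HasCompactSupport w)
    (hs : tsupport w ⊆ (ch n x).target) :
    ∫ p, G p * extendChart x w p ∂ν = ∫ y, ρ y * (G ((ch n x).symm y) * w y) := by
  rw [integral_eq_integral_chart (F := fun p => G p * extendChart x w p) hρ.continuousOn hρ.pos
    hρ.apply_eq (hG.mul (continuous_extendChart hw hc hs))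
    fun p hp => by rw [extendChart_of_notMem w hp, mul_zero],
    ← setIntegral_eq_integral_of_forall_compl_eq_zero (μ := volume)
      (s := (ch n x).target)
      (f := fun y => ρ y * (G ((ch n x).symm y) * w y))]
  · refine setIntegral_congr_fun (ch n x).open_target.measurableSet fun y hy => ?_
    simp only [extendChart_symm w hy]
  · intro y hy
    rw [image_eq_zero_of_notMem_tsupport fun h => hy (hs h)]
    ring

theorem DiffOp.op_extendChart_symm [T2Space S] (A : DiffOp n r S) {x : S} {w : Rn n → ℝ}
    (hw : ContDiffOn ℝ 2 w (ch n x).target) (hc : HasCompactSupport w)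
    (hs : tsupport w ⊆ (ch n x).target) {y : Rn n} (hy : y ∈ (ch n x).target) :
    A.op (extendChart x w) ((ch n x).symm y) = (A.coef x y).eval w y := by
  rw [A.op_symm_eq (contMDiff_extendChart two_le_infty hw hc hs) x hy]
  refine Coef.eval_congr _ ?_
  filter_upwards [(ch n x).open_target.mem_nhds hy] with z hz
  exact extendChart_symm w hz

theorem DiffOp.IsElliptic.symm {A : DiffOp n r S} (hA : A.IsElliptic) {x : S} {y : Rn n}
    (hy : y ∈ (ch n x).target) (i j : Fin n) :
    (A.coef x y).1 i j = (A.coef x y).1 j i := by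
  have := (hA x y hy).isHermitian.apply i j
  simpa using this.symm

theorem Coef.eval_coord (A : Coef n) (k : Fin n) (y : Rn n) :
    A.eval (fun z => z k) y = A.2.1 k + A.2.2 * y k := by
  have h : ∀ i : Fin n, pd i (fun z : Rn n => z k) = fun _ => if i = k then (1 : ℝ) else 0 :=
    fun i => funext fun y => pd_coord i k y
  simp [Coef.eval, h, pd_const]

theorem DiffOp.integral_density_flux [T2Space S] {A : DiffOp n r S} (hell : A.IsElliptic)
    {ν : Measure S} [IsFiniteMeasure ν] (hA : A.IsSelfAdjointWrt ν) {x : S} {ρ : Rn n → ℝ}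
    (hρ : IsChartDensity ν x ρ) {w : Rn n → ℝ} (hw : ContDiffOn ℝ 2 w (ch n x).target)
    (hc : HasCompactSupport w) (hs : tsupport w ⊆ (ch n x).target) (k : Fin n) :
    ∫ y in (ch n x).target,
      ρ y * ((A.coef x y).2.1 k * w y + ∑ j, (A.coef x y).1 k j * pd j w y) = 0 := by
  set Ω := (ch n x).target with hΩdef
  have hΩ : IsOpen Ω := (ch n x).open_target
  obtain ⟨χ, hχ, hχc, hχs, -, hχ1⟩ := exists_cutoff hΩ hc.isCompact hs
  have hk : ContDiff ℝ ∞ (fun z : Rn n => z k) :=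
    (EuclideanSpace.proj (𝕜 := ℝ) k : Rn n →L[ℝ] ℝ).contDiff
  have hχ2 : ContDiffOn ℝ 2 χ Ω := (hχ.of_le two_le_infty).contDiffOn
  have hk2 : ContDiffOn ℝ 2 (fun z : Rn n => z k) Ω := (hk.of_le two_le_infty).contDiffOn
  have hwk : ContDiffOn ℝ 2 (fun z => w z * z k) Ω := hw.mul hk2
  have hχk : ContDiffOn ℝ 2 (fun z => χ z * z k) Ω := hχ2.mul hk2
  have hwkc : HasCompactSupport (fun z => w z * z k) := hc.mul_right
  have hχkc : HasCompactSupport (fun z => χ z * z k) := hχc.mul_right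
  have hwks : tsupport (fun z => w z * z k) ⊆ Ω := tsupport_mul_subset_left.trans hs
  have hχks : tsupport (fun z => χ z * z k) ⊆ Ω := tsupport_mul_subset_left.trans hχs
  have m1 := contMDiff_extendChart two_le_infty hw hc hs
  have m2 := contMDiff_extendChart two_le_infty hwk hwkc hwks
  have m3 := contMDiff_extendChart two_le_infty hχ2 hχc hχs
  have m4 := contMDiff_extendChart two_le_infty hχk hχkc hχks
  have s1 := hA _ _ m2 m3
  have s2 := hA _ _ m1 m4
  have c1 := A.continuous_op m1
  have c2 := A.continuous_op m2
  have c3 := A.continuous_op m3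
  have c4 := A.continuous_op m4
  have d1 := m1.continuous
  have d2 := m2.continuous
  have d3 := m3.continuous
  have d4 := m4.continuous
  set F : S → ℝ := fun p =>
    (A.op (extendChart x fun z => w z * z k) p * extendChart x χ p -
      extendChart x (fun z => w z * z k) p * A.op (extendChart x χ) p) -
    (A.op (extendChart x w) p * extendChart x (fun z => χ z * z k) p -
      extendChart x w p * A.op (extendChart x fun z => χ z * z k) p) with hF
  have hFc : Continuous F := by fun_prop
  have hF0 : ∀ p ∉ (ch n x).source, F p = 0 := fun p hp => by
    simp only [hF, extendChart_of_notMem _ hp]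
    ring
  have hFint : ∫ p, F p ∂ν = 0 := by
    simp only [hF]
    rw [integral_sub, integral_sub, integral_sub, s1, s2]
    · ring
    all_goals exact integrable_of_compact (by fun_prop)
  rw [integral_eq_integral_chart hρ.continuousOn hρ.pos hρ.apply_eq hFc hF0] at hFint
  have e : ∀ y ∈ Ω, ρ y * F ((ch n x).symm y) =
      2 * (ρ y * ((A.coef x y).2.1 k * w y + ∑ j, (A.coef x y).1 k j * pd j w y)) := by
    intro y hy
    simp only [hF, A.op_extendChart_symm hw hc hs hy, A.op_extendChart_symm hwk hwkc hwks hy,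
      A.op_extendChart_symm hχ2 hχc hχs hy, A.op_extendChart_symm hχk hχkc hχks hy,
      extendChart_symm _ hy]
    by_cases hyw : y ∈ tsupport w
    · have hev : ∀ᶠ z in 𝓝 y, χ z = 1 := hχ1.filter_mono (nhds_le_nhdsSet hyw)
      have e1 : (A.coef x y).eval χ y = (A.coef x y).2.2 := by
        rw [Coef.eval_congr _ (v := fun _ => 1) hev, Coef.eval_const, mul_one]
      have e2 : (A.coef x y).eval (fun z => χ z * z k) y =
          (A.coef x y).2.1 k + (A.coef x y).2.2 * y k := by
        rw [Coef.eval_congr _ (v := fun z => z k) (hev.mono fun z hz => by simp [hz]),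
          Coef.eval_coord]
      have e3 := Coef.eval_mul (A.coef x y) (hw.contDiffAt (hΩ.mem_nhds hy))
        (hk2.contDiffAt (hΩ.mem_nhds hy))
      have e4 : ∑ i, ∑ j, (A.coef x y).1 i j * (pd i w y * pd j (fun z : Rn n => z k) y +
          pd i (fun z : Rn n => z k) y * pd j w y) = 2 * ∑ j, (A.coef x y).1 k j * pd j w y := by
        simp only [pd_coord, mul_add, sum_add_distrib, mul_ite, ite_mul, mul_one, mul_zero,
          one_mul, zero_mul, Finset.sum_ite_eq', mem_univ, if_true]
        have : ∑ i, ∑ j, (if i = k then (A.coef x y).1 i j * pd j w y else 0) =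
            ∑ j, (A.coef x y).1 k j * pd j w y := by
          rw [sum_comm]
          simp
        rw [this, two_mul]
        congr 1
        exact sum_congr rfl fun i _ => by rw [hell.symm hy]
      rw [e1, e2, e3, e4, Coef.eval_coord, hev.self_of_nhds]
      ring
    · have hev := notMem_tsupport_iff_eventuallyEq.1 hyw
      have hev2 : (fun z => w z * z k) =ᶠ[𝓝 y] fun _ => 0 := hev.mono fun z hz => by simp [hz]
      rw [Coef.eval_congr _ (v := fun _ => 0) hev, Coef.eval_congr _ hev2, Coef.eval_const]
      have e5 : ∀ j, pd j w y = 0 := fun j => by rw [pd_congr hev]; exact pd_const j 0 y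
      simp [e5, hev.self_of_nhds]
  rw [setIntegral_congr_fun hΩ.measurableSet e, integral_const_mul] at hFint
  linarith

/-- The density of a measure with respect to which an elliptic operator is self-adjoint is
continuously differentiable, and the flux `ρ a^{kj}` has divergence `ρ b^k`. -/
theorem DiffOp.contDiffOn_density [T2Space S] {A : DiffOp n r S} (hr : 2 ≤ r) (hell : A.IsElliptic)
    {ν : Measure S} [IsFiniteMeasure ν] (hA : A.IsSelfAdjointWrt ν) {x : S} {ρ : Rn n → ℝ}
    (hρ : IsChartDensity ν x ρ) : ContDiffOn ℝ 1 ρ (ch n x).target ∧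
    ∀ k, ∀ y ∈ (ch n x).target,
      ∑ j, pd j (fun z => ρ z * (A.coef x z).1 k j) y = ρ y * (A.coef x y).2.1 k := by
  set Ω := (ch n x).target with hΩdef
  have hΩ : IsOpen Ω := (ch n x).open_target
  have hcoef : ContDiffOn ℝ 2 (A.coef x) Ω := (A.contDiffOn_coef x).of_le (by exact_mod_cast hr)
  have ha : ∀ i j, ContDiffOn ℝ 2 (fun y => (A.coef x y).1 i j) Ω := fun i j => by
    have h1 := contDiffOn_pi.1 (contDiffOn_pi.1 hcoef.fst i) j
    exact h1
  have hb : ∀ i, ContinuousOn (fun y => (A.coef x y).2.1 i) Ω := fun i =>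
    (contDiffOn_pi.1 hcoef.snd.fst i).continuousOn
  have hdet : ∀ y ∈ Ω, (Matrix.of (A.coef x y).1).det ≠ 0 := fun y hy => (hell x y hy).det_pos.ne'
  set g : Fin n → Fin n → Rn n → ℝ := fun l k y => (Matrix.of (A.coef x y).1)⁻¹ l k with hg
  have hgd : ∀ l k, ContDiffOn ℝ 2 (g l k) Ω := fun l k =>
    contDiffOn_inv (a := fun y => Matrix.of (A.coef x y).1) ha hdet l k
  have hgpd : ∀ j l k, ContinuousOn (pd j (g l k)) Ω := fun j l k =>
    (contDiffOn_pd (m := 1) hΩ j (hgd l k) (by norm_num)).continuousOn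
  have hga : ∀ y ∈ Ω, ∀ l j, ∑ k, g l k y * (A.coef x y).1 k j = if l = j then 1 else 0 := by
    intro y hy l j
    have h1 := Matrix.nonsing_inv_mul _ (isUnit_iff_ne_zero.2 (hdet y hy))
    have h2 := congrFun (congrFun h1 l) j
    rw [Matrix.mul_apply, Matrix.one_apply] at h2
    exact h2
  have hρc := hρ.continuousOn
  set h : Fin n → Rn n → ℝ := fun l y => ∑ k, ρ y * ((A.coef x y).2.1 k * g l k y +
    ∑ j, (A.coef x y).1 k j * pd j (g l k) y) with hh
  have hhc : ∀ l, ContinuousOn (h l) Ω := fun l => by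
    refine continuousOn_finsetSum _ fun k _ => hρc.mul (((hb k).mul (hgd l k).continuousOn).add ?_)
    exact continuousOn_finsetSum _ fun j _ => (ha k j).continuousOn.mul (hgpd j l k)
  have hweak : ∀ l, ∀ ψ : Rn n → ℝ, IsTest Ω ψ →
      ∫ y, ρ y * pd l ψ y = - ∫ y, h l y * ψ y := by
    rintro l ψ ⟨hψ, hψc, hψs⟩
    have hψp : ∀ j, Continuous (pd j ψ) := fun j =>
      (contDiff_pd (m := 0) j (hψ.of_le one_le_infty) (by simp)).continuous
    have i1 : Integrable fun y => ρ y * pd l ψ y := integrable_mul_of_tsupport_subset hΩ hρc (hψp l)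
      (hasCompactSupport_pd hψc l) ((tsupport_pd_subset l ψ).trans hψs)
    have i2 : Integrable fun y => h l y * ψ y :=
      integrable_mul_of_tsupport_subset hΩ (hhc l) hψ.continuous hψc hψs
    have hz : ∀ k, ∫ y in Ω, ρ y * ((A.coef x y).2.1 k * (g l k y * ψ y) +
        ∑ j, (A.coef x y).1 k j * pd j (fun z => g l k z * ψ z) y) = 0 := fun k =>
      DiffOp.integral_density_flux hell hA hρ ((hgd l k).mul (hψ.of_le two_le_infty).contDiffOn)
        hψc.mul_left (tsupport_mul_subset_right.trans hψs) k
    have e : ∀ k, ∀ y ∈ Ω, ρ y * ((A.coef x y).2.1 k * (g l k y * ψ y) +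
        ∑ j, (A.coef x y).1 k j * pd j (fun z => g l k z * ψ z) y) =
        (ρ y * ((A.coef x y).2.1 k * g l k y + ∑ j, (A.coef x y).1 k j * pd j (g l k) y)) * ψ y +
        ∑ j, ρ y * (g l k y * (A.coef x y).1 k j) * pd j ψ y := by
      intro k y hy
      have h1 : ∀ j, pd j (fun z => g l k z * ψ z) y = g l k y * pd j ψ y + ψ y * pd j (g l k) y :=
        fun j => pd_mul (((hgd l k).contDiffAt (hΩ.mem_nhds hy)).differentiableAt (by simp))
          (hψ.differentiable (by simp) y)
      simp only [h1, mul_add, add_mul, sum_add_distrib, mul_sum, sum_mul]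
      have e1 : ∑ j, ρ y * ((A.coef x y).1 k j * (g l k y * pd j ψ y)) =
        ∑ j, ρ y * (g l k y * (A.coef x y).1 k j) * pd j ψ y :=
          sum_congr rfl fun j _ => by ring
      have e2 : ∑ j, ρ y * ((A.coef x y).1 k j * (ψ y * pd j (g l k) y)) =
        ∑ j, ρ y * ((A.coef x y).1 k j * pd j (g l k) y) * ψ y :=
          sum_congr rfl fun j _ => by ring
      rw [e1, e2]
      ring
    have j1 : ∀ k, IntegrableOn (fun y =>
        (ρ y * ((A.coef x y).2.1 k * g l k y + ∑ j, (A.coef x y).1 k j * pd j (g l k) y)) * ψ y +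
        ∑ j, ρ y * (g l k y * (A.coef x y).1 k j) * pd j ψ y) Ω := fun k => by
      refine (Integrable.add ?_ (integrable_finsetSum _ fun j _ => ?_)).integrableOn
      · exact integrable_mul_of_tsupport_subset hΩ (hρc.mul (((hb k).mul (hgd l k).continuousOn).add
          (continuousOn_finsetSum _ fun j _ => (ha k j).continuousOn.mul (hgpd j l k))))
          hψ.continuous hψc hψs
      · exact integrable_mul_of_tsupport_subset hΩ
          (hρc.mul ((hgd l k).continuousOn.mul (ha k j).continuousOn))
          (hψp j) (hasCompactSupport_pd hψc j) ((tsupport_pd_subset j ψ).trans hψs)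
    have hsum : ∫ y in Ω, (h l y * ψ y + ρ y * pd l ψ y) = 0 := by
      have e3 : ∀ y ∈ Ω, h l y * ψ y + ρ y * pd l ψ y = ∑ k,
          ((ρ y * ((A.coef x y).2.1 k * g l k y + ∑ j, (A.coef x y).1 k j * pd j (g l k) y)) * ψ y +
          ∑ j, ρ y * (g l k y * (A.coef x y).1 k j) * pd j ψ y) := by
        intro y hy
        rw [sum_add_distrib, hh, sum_mul]
        congr 1
        rw [sum_comm]
        have : ∀ j, ∑ k, ρ y * (g l k y * (A.coef x y).1 k j) * pd j ψ y =
            if l = j then ρ y * pd j ψ y else 0 := fun j => by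
          rw [← sum_mul, ← mul_sum, hga y hy]
          split_ifs <;> ring
        simp [this]
      rw [setIntegral_congr_fun hΩ.measurableSet e3, integral_finsetSum _ fun k _ => j1 k]
      refine Finset.sum_eq_zero fun k _ => ?_
      rw [← hz k]
      exact setIntegral_congr_fun hΩ.measurableSet fun y hy => (e k y hy).symm
    rw [setIntegral_eq_integral_of_forall_compl_eq_zero, integral_add i2 i1] at hsum
    · linarith
    · intro y hy
      have h1 : ψ y = 0 := image_eq_zero_of_notMem_tsupport fun h => hy (hψs h)
      have h2 : pd l ψ y = 0 :=
        image_eq_zero_of_notMem_tsupport fun h => hy (hψs (tsupport_pd_subset l ψ h))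
      rw [h1, h2]; ring
  obtain ⟨hρ1, -⟩ := contDiffOn_one_of_weak hΩ hρc hhc hweak
  refine ⟨hρ1, fun k => ?_⟩
  have hρa : ∀ j, ContDiffOn ℝ 1 (fun z => ρ z * (A.coef x z).1 k j) Ω := fun j =>
    hρ1.mul ((ha k j).of_le (by norm_num))
  have hpc : ∀ j, ContinuousOn (pd j (fun z => ρ z * (A.coef x z).1 k j)) Ω := fun j =>
    (contDiffOn_pd (m := 0) hΩ j (hρa j) (by simp)).continuousOn
  have hDc : ContinuousOn (fun y => ρ y * (A.coef x y).2.1 k -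
      ∑ j, pd j (fun z => ρ z * (A.coef x z).1 k j) y) Ω :=
    (hρc.mul (hb k)).sub (continuousOn_finsetSum _ fun j _ => hpc j)
  have hae := hΩ.ae_eq_zero_of_integral_contDiff_smul_eq_zero (μ := volume)
    (hDc.locallyIntegrableOn hΩ.measurableSet) (fun ψ hψ hψc hψs => by
      have hψp : ∀ j, Continuous (pd j ψ) := fun j =>
        (contDiff_pd (m := 0) j (hψ.of_le one_le_infty) (by simp)).continuous
      have h1 := DiffOp.integral_density_flux hell hA hρ
        (hψ.of_le two_le_infty).contDiffOn hψc hψs k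
      rw [setIntegral_eq_integral_of_forall_compl_eq_zero] at h1
      · have i1 : Integrable fun y => ρ y * (A.coef x y).2.1 k * ψ y :=
          integrable_mul_of_tsupport_subset hΩ (hρc.mul (hb k)) hψ.continuous hψc hψs
        have i2 : ∀ j, Integrable fun y => ρ y * (A.coef x y).1 k j * pd j ψ y := fun j =>
          integrable_mul_of_tsupport_subset hΩ (hρa j).continuousOn (hψp j)
            (hasCompactSupport_pd hψc j) ((tsupport_pd_subset j ψ).trans hψs)
        have i3 : ∀ j, Integrable fun y => pd j (fun z => ρ z * (A.coef x z).1 k j) y * ψ y :=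
          fun j => integrable_mul_of_tsupport_subset hΩ (hpc j) hψ.continuous hψc hψs
        have h2 : ∀ j, ∫ y, pd j (fun z => ρ z * (A.coef x z).1 k j) y * ψ y =
            - ∫ y, ρ y * (A.coef x y).1 k j * pd j ψ y := fun j =>
          integral_pd_mul hΩ (hρa j) (hψ.of_le one_le_infty).contDiffOn hψc hψs j
        have e1 : ∀ y, ρ y * ((A.coef x y).2.1 k * ψ y + ∑ j, (A.coef x y).1 k j * pd j ψ y) =
            ρ y * (A.coef x y).2.1 k * ψ y + ∑ j, ρ y * (A.coef x y).1 k j * pd j ψ y := fun y => by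
          rw [mul_add, mul_sum]
          simp only [mul_assoc]
        have e2 : ∀ y, ψ y • (ρ y * (A.coef x y).2.1 k -
            ∑ j, pd j (fun z => ρ z * (A.coef x z).1 k j) y) = ρ y * (A.coef x y).2.1 k * ψ y -
            ∑ j, pd j (fun z => ρ z * (A.coef x z).1 k j) y * ψ y := fun y => by
          rw [smul_eq_mul, mul_sub, ← sum_mul]
          ring
        simp only [e1] at h1
        simp only [e2]
        rw [integral_add i1 (integrable_finsetSum _ fun j _ => i2 j),
          integral_finsetSum _ fun j _ => i2 j] at h1
        rw [integral_sub i1 (integrable_finsetSum _ fun j _ => i3 j),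
          integral_finsetSum _ fun j _ => i3 j]
        simp only [h2, sum_neg_distrib]
        linarith
      · intro y hy
        have h1 : ψ y = 0 := image_eq_zero_of_notMem_tsupport fun h => hy (hψs h)
        have h2 : ∀ l, pd l ψ y = 0 := fun l =>
          image_eq_zero_of_notMem_tsupport fun h => hy (hψs (tsupport_pd_subset l ψ h))
        simp [h1, h2])
  have hEq := Measure.eqOn_open_of_ae_eq (μ := (volume : Measure (Rn n))) (U := Ω)
    (g := fun _ => (0 : ℝ)) ((ae_restrict_iff' hΩ.measurableSet).2 hae) hΩ hDc continuousOn_const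
  intro y hy
  have := hEq hy
  simp only at this
  linarith

end Density

theorem cauchySeq_of_dist_sq_le {X E : Type*} [NormedAddCommGroup X] [PseudoMetricSpace E]
    {a : ℕ → X} {v : X} (ha : Tendsto a atTop (𝓝 v)) {Q : X → ℝ} (hQ : ContinuousAt Q 0)
    (hQ0 : Q 0 = 0) {F : ℕ → E} (hF : ∀ m l, dist (F m) (F l) ^ 2 ≤ Q (a m - a l)) :
    CauchySeq F := by
  rw [cauchySeq_iff_tendsto_dist_atTop_0]
  have h1 : Tendsto (fun z : ℕ × ℕ => a z.1 - a z.2) atTop (𝓝 0) := by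
    rw [← prod_atTop_atTop_eq, ← sub_self v]
    exact (ha.comp tendsto_fst).sub (ha.comp tendsto_snd)
  have h2 : Tendsto (fun z : ℕ × ℕ => √(Q (a z.1 - a z.2))) atTop (𝓝 0) := by
    have := (hQ.tendsto.comp h1).sqrt
    rwa [hQ0, Real.sqrt_zero] at this
  exact squeeze_zero (fun _ => dist_nonneg) (fun z => Real.le_sqrt_of_sq_le (hF z.1 z.2)) h2

theorem sq_le_inv_mul_quadForm {n : ℕ} {a : Matrix (Fin n) (Fin n) ℝ} (ha : a.PosDef) (ξ : Fin n → ℝ)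
    (i : Fin n) : 0 < a⁻¹ i i ∧ ξ i ^ 2 ≤ a⁻¹ i i * (ξ ⬝ᵥ a.mulVec ξ) := by
  have hpos : 0 < a⁻¹ i i := ha.inv.diag_pos
  refine ⟨hpos, ?_⟩
  set η : Fin n → ℝ := a⁻¹.mulVec (Pi.single i 1) with hη
  have hai : a.mulVec η = Pi.single i 1 := by
    rw [hη, Matrix.mulVec_mulVec, Matrix.mul_nonsing_inv _ (isUnit_iff_ne_zero.2 ha.det_pos.ne'),
      Matrix.one_mulVec]
  have hηi : η i = a⁻¹ i i := by simp [hη]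
  have hsym : η ⬝ᵥ a.mulVec ξ = ξ i := by
    rw [Matrix.dotProduct_mulVec, ← Matrix.mulVec_transpose]
    have : a.transpose = a := by simpa using ha.isHermitian.eq
    rw [this, hai]
    simp
  have h := ha.posSemidef.dotProduct_mulVec_nonneg (ξ - (ξ i / a⁻¹ i i) • η)
  simp only [star_trivial, Matrix.mulVec_sub, Matrix.mulVec_smul, hai, sub_dotProduct,
    dotProduct_sub, smul_dotProduct, dotProduct_smul, hsym, smul_eq_mul, dotProduct_single,
    mul_one] at h
  have e : ξ ⬝ᵥ a.mulVec ξ - ξ i / a⁻¹ i i * ξ i -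
      (ξ i / a⁻¹ i i * ξ i - ξ i / a⁻¹ i i * (ξ i / a⁻¹ i i * a⁻¹ i i)) =
      ξ ⬝ᵥ a.mulVec ξ - ξ i ^ 2 / a⁻¹ i i := by
    field_simp
    ring
  have h' : 0 ≤ ξ ⬝ᵥ a.mulVec ξ - ξ i ^ 2 / a⁻¹ i i := by
    rw [← e]
    refine le_of_le_of_eq h ?_
    simp only [Pi.sub_apply, Pi.smul_apply, smul_eq_mul, hηi]
    ring
  rw [sub_nonneg, div_le_iff₀ hpos] at h'
  linarith

section Energy
variable [IsManifold (𝓡 n) ∞ S] [CompactSpace S] [MeasurableSpace S] [BorelSpace S]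

theorem IsChartDensity.integrableOn {ν : Measure S} [IsFiniteMeasure ν] {x : S} {ρ : Rn n → ℝ}
    (hρ : IsChartDensity ν x ρ) {F : S → ℝ} (hF : Continuous F) :
    IntegrableOn (fun y => ρ y * F ((ch n x).symm y)) (ch n x).target ∧
    ∫ y in (ch n x).target, ρ y * F ((ch n x).symm y) =
      ∫ p in (ch n x).source, F p ∂ν := by
  have hρm : AEMeasurable ρ (volume.restrict (ch n x).target) :=
    hρ.continuousOn.aemeasurable (ch n x).open_target.measurableSet
  have hem : AEMeasurable (ch n x).symm
      (volume.restrict (ch n x).target) :=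
    (ch n x).continuousOn_symm.aemeasurable
      (ch n x).open_target.measurableSet
  have hcongr : ∀ y ∈ (ch n x).target,
      Real.toNNReal (ρ y) • F ((ch n x).symm y) =
      ρ y * F ((ch n x).symm y) := fun y hy => by
    simp only [NNReal.smul_def, smul_eq_mul, Real.coe_toNNReal _ (hρ.pos y hy).le]
  have hint : IntegrableOn F (ch n x).source ν :=
    (integrable_of_compact hF).integrableOn
  rw [IntegrableOn, restrict_source_eq_map hρ.apply_eq, integrable_map_measure
    hF.aestronglyMeasurable (hem.mono_ac (withDensity_absolutelyContinuous _ _))] at hint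
  have h1 := (integrable_withDensity_iff_integrable_smul₀ hρm.real_toNNReal).1 hint
  refine ⟨h1.congr ((ae_restrict_iff' (ch n x).open_target.measurableSet).2
    (Eventually.of_forall hcongr)), ?_⟩
  rw [restrict_source_eq_map hρ.apply_eq,
    integral_map (hem.mono_ac (withDensity_absolutelyContinuous _ _)) hF.aestronglyMeasurable]
  have := integral_withDensity_eq_integral_smul₀ (μ := volume.restrict (ch n x).target)
    (f := fun y => Real.toNNReal (ρ y)) hρm.real_toNNReal
    (fun y => F ((ch n x).symm y))
  exact (this.trans (setIntegral_congr_fun (ch n x).open_target.measurableSet hcongr)).symm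

/-- The Dirichlet energy controls the derivatives in charts. -/
theorem DiffOp.exists_weight {A : DiffOp n r S} (hell : A.IsElliptic) {ν : Measure S}
    [IsFiniteMeasure ν] {x : S} {ρ : Rn n → ℝ} (hρ : IsChartDensity ν x ρ) (i : Fin n) :
    ∃ θ : Rn n → ℝ, ContinuousOn θ (ch n x).target ∧
      (∀ y ∈ (ch n x).target, 0 < θ y) ∧
      ∀ u : S → ℝ, SmoothFn[n] 2 u →
        IntegrableOn (fun y => θ y * pd i (u ∘ (ch n x).symm) y ^ 2)
          (ch n x).target ∧
        ∫ y in (ch n x).target, θ y * pd i (u ∘ (ch n x).symm) y ^ 2 ≤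
          ∫ p, A.grad2 u u p ∂ν := by
  set Ω := (ch n x).target with hΩdef
  have hΩ : IsOpen Ω := (ch n x).open_target
  have hg : ContinuousOn (fun y => (Matrix.of (A.coef x y).1)⁻¹ i i) Ω := by
    refine (contDiffOn_inv (m := 0) (a := fun y => Matrix.of (A.coef x y).1) (fun k l => ?_)
      (fun y hy => (hell x y hy).det_pos.ne') i i).continuousOn
    exact contDiffOn_pi.1 (contDiffOn_pi.1 (((A.contDiffOn_coef x).of_le (by simp)).fst) k) l
  have hgpos : ∀ y ∈ Ω, 0 < (Matrix.of (A.coef x y).1)⁻¹ i i := fun y hy =>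
    (hell x y hy).inv.diag_pos
  refine ⟨fun y => 2 * ρ y / (Matrix.of (A.coef x y).1)⁻¹ i i,
    (hρ.continuousOn.const_smul (2 : ℝ)).div hg fun y hy => (hgpos y hy).ne',
    fun y hy => div_pos (mul_pos two_pos (hρ.pos y hy)) (hgpos y hy), fun u hu => ?_⟩
  obtain ⟨h1, h2⟩ := hρ.integrableOn (A.continuous_grad2 hu hu)
  have hle : ∀ y ∈ Ω, 2 * ρ y / (Matrix.of (A.coef x y).1)⁻¹ i i *
      pd i (u ∘ (ch n x).symm) y ^ 2 ≤
      ρ y * A.grad2 u u ((ch n x).symm y) := by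
    intro y hy
    have h3 := (sq_le_inv_mul_quadForm (hell x y hy)
      (fun k => pd k (u ∘ (ch n x).symm) y) i).2
    have e : A.grad2 u u ((ch n x).symm y) =
        2 * ((fun k => pd k (u ∘ (ch n x).symm) y) ⬝ᵥ (Matrix.of (A.coef x y).1).mulVec
          fun k => pd k (u ∘ (ch n x).symm) y) := by
      rw [A.grad2_symm_eq hu hu x hy]
      simp only [dotProduct, Matrix.mulVec, mul_sum, Matrix.of_apply]
      refine sum_sum_congr fun i j => ?_
      ring
    rw [e, div_mul_eq_mul_div, div_le_iff₀ (hgpos y hy)]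
    have h4 := mul_le_mul_of_nonneg_left h3 (mul_pos two_pos (hρ.pos y hy)).le
    linarith
  have hud : ContDiffOn ℝ 2 (u ∘ (ch n x).symm) Ω :=
    contDiffOn_comp_chart_symm two_le_infty hu x
  have hpc : ContinuousOn (pd i (u ∘ (ch n x).symm)) Ω :=
    (contDiffOn_pd (m := 1) hΩ i hud (by norm_num)).continuousOn
  have hint : IntegrableOn (fun y => 2 * ρ y / (Matrix.of (A.coef x y).1)⁻¹ i i *
      pd i (u ∘ (ch n x).symm) y ^ 2) Ω := by
    refine Integrable.mono' h1 ?_ ((ae_restrict_iff' hΩ.measurableSet).2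
      (Eventually.of_forall fun y hy => ?_))
    · refine ContinuousOn.aestronglyMeasurable ?_ hΩ.measurableSet
      exact ((hρ.continuousOn.const_smul (2 : ℝ)).div hg fun y hy => (hgpos y hy).ne').mul
        (hpc.pow 2)
    · rw [Real.norm_of_nonneg]
      · exact hle y hy
      · have := div_pos (mul_pos two_pos (hρ.pos y hy)) (hgpos y hy)
        positivity
  refine ⟨hint, (setIntegral_mono_on hint h1 hΩ.measurableSet hle).trans ?_⟩
  rw [h2]
  exact setIntegral_le_integral (integrable_of_compact (A.continuous_grad2 hu hu))
    (Eventually.of_forall fun p => DiffOp.grad2_self_nonneg hell u p)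

end Energy

/-- Continuous functions with compact support in `Ω`. -/
structure IsContTest {n : ℕ} (Ω : Set (Rn n)) (η : Rn n → ℝ) : Prop where
  continuous : Continuous η
  hasCompactSupport : HasCompactSupport η
  tsupport_subset : tsupport η ⊆ Ω

theorem inner_real_eq_mul (s t : ℝ) : inner ℝ s t = s * t := by simp [mul_comm]

section ContTest
variable {Ω : Set (Rn n)} {η : Rn n → ℝ}

theorem IsContTest.mul_left (hη : IsContTest Ω η) (hΩ : IsOpen Ω) {f : Rn n → ℝ}
    (hf : ContinuousOn f Ω) : IsContTest Ω (fun y => f y * η y) :=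
  ⟨continuous_mul_of_tsupport_subset hΩ hf hη.continuous hη.tsupport_subset,
    hη.hasCompactSupport.mul_left, tsupport_mul_subset_right.trans hη.tsupport_subset⟩

theorem IsContTest.eq_zero (hη : IsContTest Ω η) {y : Rn n} (hy : y ∉ Ω) : η y = 0 :=
  image_eq_zero_of_notMem_tsupport fun h => hy (hη.tsupport_subset h)

theorem IsContTest.integrable_mul (hη : IsContTest Ω η) (hΩ : IsOpen Ω) {f : Rn n → ℝ}
    (hf : ContinuousOn f Ω) : Integrable (fun y => f y * η y) :=
  integrable_mul_of_tsupport_subset hΩ hf hη.continuous hη.hasCompactSupport hη.tsupport_subset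

/-- A sequence of functions which is Cauchy in a weighted `L²` space has a limit in `L²_loc`. -/
theorem exists_limit_of_cauchy (hΩ : IsOpen Ω) {θ : Rn n → ℝ} (hθ : ContinuousOn θ Ω)
    (hθ0 : ∀ y ∈ Ω, 0 < θ y) {F : ℕ → Rn n → ℝ} (hF : ∀ m, ContinuousOn (F m) Ω)
    (hFi : ∀ m, IntegrableOn (fun y => θ y * F m y ^ 2) Ω)
    {X : Type*} [NormedAddCommGroup X] {a : ℕ → X} {v : X} (ha : Tendsto a atTop (𝓝 v))
    {Q : X → ℝ} (hQ : ContinuousAt Q 0) (hQ0 : Q 0 = 0)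
    (hle : ∀ m l, ∫ y in Ω, θ y * (F m y - F l y) ^ 2 ≤ Q (a m - a l)) :
    ∃ g : Rn n → ℝ, MemL2Loc Ω g ∧ (∀ η, IsContTest Ω η → Integrable (fun y => g y * η y)) ∧
      ∀ η, IsContTest Ω η →
        Tendsto (fun m => ∫ y, F m y * η y) atTop (𝓝 (∫ y, g y * η y)) := by
  have hs : ContinuousOn (fun y => √(θ y)) Ω := hθ.sqrt
  have hs0 : ∀ y ∈ Ω, 0 < √(θ y) := fun y hy => Real.sqrt_pos.2 (hθ0 y hy)
  have hsq : ∀ y ∈ Ω, √(θ y) ^ 2 = θ y := fun y hy => Real.sq_sqrt (hθ0 y hy).le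
  have hG : ∀ m, MemLp (fun y => √(θ y) * F m y) 2 (volume.restrict Ω) := fun m => by
    refine (memLp_two_iff_integrable_sq (f := fun y => √(θ y) * F m y)
      ((hs.mul (hF m)).aestronglyMeasurable hΩ.measurableSet)).2 ?_
    refine (hFi m).congr_fun (fun y hy => ?_) hΩ.measurableSet
    simp only [mul_pow, hsq y hy]
  set f : ℕ → Lp ℝ 2 (volume.restrict Ω) := fun m => (hG m).toLp _ with hf
  have hfe : ∀ m, f m =ᵐ[volume.restrict Ω] fun y => √(θ y) * F m y := fun m => (hG m).coeFn_toLp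
  have hcau : CauchySeq f := by
    refine cauchySeq_of_dist_sq_le ha hQ hQ0 fun m l => le_trans (le_of_eq ?_) (hle m l)
    rw [dist_eq_norm, ← real_inner_self_eq_norm_sq, L2.inner_def]
    refine integral_congr_ae ?_
    filter_upwards [hfe m, hfe l, Lp.coeFn_sub (f m) (f l),
      (ae_restrict_iff' hΩ.measurableSet).2 (Eventually.of_forall hsq)] with y h1 h2 h3 h4
    rw [h3, Pi.sub_apply, h1, h2]
    rw [inner_real_eq_mul]
    linear_combination (F m y - F l y) ^ 2 * h4
  obtain ⟨G, hGlim⟩ := cauchySeq_tendsto_of_complete hcau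
  have hker : ∀ η, IsContTest Ω η → MemLp (fun y => (√(θ y))⁻¹ * η y) 2 (volume.restrict Ω) :=
    fun η hη => by
      have := hη.mul_left hΩ (hs.inv₀ fun y hy => (hs0 y hy).ne')
      exact this.continuous.memLp_of_hasCompactSupport this.hasCompactSupport
  refine ⟨fun y => G y * (√(θ y))⁻¹, fun K hK hKc => ?_, fun η hη => ?_, fun η hη => ?_⟩
  · have hinv : ContinuousOn (fun y => (√(θ y))⁻¹) K :=
      (hs.inv₀ fun y hy => (hs0 y hy).ne').mono hK
    obtain ⟨c, hc⟩ := hKc.exists_bound_of_continuousOn hinv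
    have hGK : MemLp G 2 (volume.restrict K) :=
      (Lp.memLp G).mono_measure (Measure.restrict_mono hK le_rfl)
    refine hGK.of_le_mul (c := c)
      (hGK.aestronglyMeasurable.mul (hinv.aestronglyMeasurable hKc.measurableSet))
      ((ae_restrict_iff' hKc.measurableSet).2 (Eventually.of_forall fun y hy => ?_))
    rw [norm_mul, mul_comm]
    gcongr
    exact hc y hy
  · rw [← integrableOn_iff_integrable_of_support_subset (s := Ω)]
    · have h := (Lp.memLp G).integrable_mul (hker η hη)
      refine h.congr (Eventually.of_forall fun y => ?_)
      simp only [Pi.mul_apply]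
      ring
    · intro y hy
      by_contra h
      exact hy (by simp [hη.eq_zero h])
  · have e1 : ∀ m, ∫ y, F m y * η y = inner ℝ (f m) ((hker η hη).toLp _) := fun m => by
      rw [L2.inner_def, ← setIntegral_eq_integral_of_forall_compl_eq_zero (s := Ω)
        fun y hy => by rw [hη.eq_zero hy, mul_zero]]
      refine integral_congr_ae ?_
      filter_upwards [hfe m, (hker η hη).coeFn_toLp,
        (ae_restrict_iff' hΩ.measurableSet).2 (Eventually.of_forall hs0)] with y h1 h2 h3
      rw [h1, h2]
      rw [inner_real_eq_mul]
      field_simp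
    have e2 : ∫ y, G y * (√(θ y))⁻¹ * η y = inner ℝ G ((hker η hη).toLp _) := by
      rw [L2.inner_def, ← setIntegral_eq_integral_of_forall_compl_eq_zero (s := Ω)
        fun y hy => by rw [hη.eq_zero hy, mul_zero]]
      refine integral_congr_ae ?_
      filter_upwards [(hker η hη).coeFn_toLp] with y h2
      rw [h2]
      rw [inner_real_eq_mul]
      ring
    simp only [e1, e2]
    exact hGlim.inner tendsto_const_nhds

end ContTest

theorem IsTest.isContTest {n : ℕ} {Ω : Set (Rn n)} {ψ : Rn n → ℝ} (h : IsTest Ω ψ) :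
    IsContTest Ω ψ := ⟨h.1.continuous, h.2.1, h.2.2⟩

theorem isContTest_pd {n : ℕ} {Ω : Set (Rn n)} {ψ : Rn n → ℝ} (h : ContDiff ℝ 1 ψ)
    (hc : HasCompactSupport ψ) (hs : tsupport ψ ⊆ Ω) (i : Fin n) : IsContTest Ω (pd i ψ) :=
  ⟨(contDiff_pd (m := 0) i h (by simp)).continuous, hasCompactSupport_pd hc i,
    (tsupport_pd_subset i ψ).trans hs⟩

theorem IsTest.pd {n : ℕ} {Ω : Set (Rn n)} {ψ : Rn n → ℝ} (h : IsTest Ω ψ) (i : Fin n) :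
    IsContTest Ω (pd i ψ) := isContTest_pd (h.1.of_le one_le_infty) h.2.1 h.2.2 i

/-- The left-hand side of the weak equation, term by term. -/
theorem Coef.integral_weak_form {n : ℕ} {Ω : Set (Rn n)} (hΩ : IsOpen Ω) {q : Rn n → Coef n}
    (hq : ContDiffOn ℝ 1 q Ω) {g : Fin n → Rn n → ℝ}
    (hg : ∀ i, ∀ η, IsContTest Ω η → Integrable (fun y => g i y * η y)) {f : Rn n → ℝ}
    (hf : ContinuousOn f Ω) {ψ : Rn n → ℝ} (hψ : ContDiff ℝ 1 ψ) (hψc : HasCompactSupport ψ)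
    (hψs : tsupport ψ ⊆ Ω) :
    ∫ y, (-(∑ i, ∑ j, g i y * pd j (fun z => (q z).1 i j * ψ z) y)
          + (∑ i, (q y).2.1 i * g i y * ψ y) + (q y).2.2 * f y * ψ y) =
      -(∑ i, ∑ j, ∫ y, g i y * pd j (fun z => (q z).1 i j * ψ z) y)
          + (∑ i, ∫ y, g i y * ((q y).2.1 i * ψ y)) + ∫ y, f y * ((q y).2.2 * ψ y) := by
  have hψt : IsContTest Ω ψ := ⟨hψ.continuous, hψc, hψs⟩
  have ha : ∀ i j, ContDiffOn ℝ 1 (fun y => (q y).1 i j) Ω := fun i j =>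
    contDiffOn_pi.1 (contDiffOn_pi.1 hq.fst i) j
  have hb : ∀ i, ContinuousOn (fun y => (q y).2.1 i) Ω := fun i =>
    (contDiffOn_pi.1 hq.snd.fst i).continuousOn
  have hc : ContinuousOn (fun y => (q y).2.2) Ω := hq.snd.snd.continuousOn
  have i1 : ∀ i j, Integrable fun y => g i y * pd j (fun z => (q z).1 i j * ψ z) y := fun i j =>
    hg i _ (isContTest_pd (contDiff_of_tsupport_subset hΩ ((ha i j).mul hψ.contDiffOn)
      (tsupport_mul_subset_right.trans hψs)) hψc.mul_left (tsupport_mul_subset_right.trans hψs) j)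
  have i2 : ∀ i, Integrable fun y => g i y * ((q y).2.1 i * ψ y) := fun i =>
    hg i _ (hψt.mul_left hΩ (hb i))
  have i3 : Integrable fun y => f y * ((q y).2.2 * ψ y) :=
    (hψt.mul_left hΩ hc).integrable_mul hΩ hf
  have e : ∀ y, (-(∑ i, ∑ j, g i y * pd j (fun z => (q z).1 i j * ψ z) y)
          + (∑ i, (q y).2.1 i * g i y * ψ y) + (q y).2.2 * f y * ψ y) =
      (-(∑ i, ∑ j, g i y * pd j (fun z => (q z).1 i j * ψ z) y)
          + (∑ i, g i y * ((q y).2.1 i * ψ y)) + f y * ((q y).2.2 * ψ y)) := fun y => by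
    congr 1
    · congr 1
      exact sum_congr rfl fun i _ => by ring
    · ring
  simp only [e]
  have j1 : ∀ i, Integrable fun y => ∑ j, g i y * pd j (fun z => (q z).1 i j * ψ z) y := fun i =>
    integrable_finsetSum _ fun j _ => i1 i j
  have j2 : Integrable fun y => ∑ i, ∑ j, g i y * pd j (fun z => (q z).1 i j * ψ z) y :=
    integrable_finsetSum _ fun i _ => j1 i
  have j3 : Integrable fun y => ∑ i, g i y * ((q y).2.1 i * ψ y) :=
    integrable_finsetSum _ fun i _ => i2 i
  have j4 : Integrable fun y => -∑ i, ∑ j, g i y * pd j (fun z => (q z).1 i j * ψ z) y := j2.neg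
  have j5 : Integrable fun y => -(∑ i, ∑ j, g i y * pd j (fun z => (q z).1 i j * ψ z) y) +
    ∑ i, g i y * ((q y).2.1 i * ψ y) := j4.add j3
  rw [integral_add j5 i3, integral_add j4 j3, integral_neg,
    integral_finsetSum _ fun i _ => j1 i, integral_finsetSum _ fun i _ => i2 i]
  congr 3
  exact sum_congr rfl fun i _ => integral_finsetSum _ fun j _ => i1 i j

section Weak
variable [IsManifold (𝓡 n) ∞ S] [CompactSpace S] [MeasurableSpace S] [BorelSpace S]

theorem tendsto_integral_chart_mul {x : S} {u : ℕ → C(S, ℝ)} {f : C(S, ℝ)}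
    (hu : Tendsto u atTop (𝓝 f)) {η : Rn n → ℝ} (hη : IsContTest (ch n x).target η) :
    Tendsto (fun m => ∫ y, u m ((ch n x).symm y) * η y) atTop
      (𝓝 (∫ y, f ((ch n x).symm y) * η y)) := by
  have hc : ∀ w : C(S, ℝ), Integrable fun y => w ((ch n x).symm y) * η y := fun w =>
    hη.integrable_mul (ch n x).open_target
      (w.continuous.comp_continuousOn (ch n x).continuousOn_symm)
  rw [tendsto_iff_norm_sub_tendsto_zero]
  have h1 : Tendsto (fun m => ‖u m - f‖ * ∫ y, |η y|) atTop (𝓝 0) := by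
    simpa using (tendsto_iff_norm_sub_tendsto_zero.1 hu).mul_const (∫ y, |η y|)
  refine squeeze_zero (fun _ => norm_nonneg _) (fun m => ?_) h1
  rw [← integral_sub (hc _) (hc _), ← integral_const_mul]
  refine norm_integral_le_of_norm_le (((hη.continuous.integrable_of_hasCompactSupport
    hη.hasCompactSupport).abs).const_mul _) (Eventually.of_forall fun y => ?_)
  rw [← sub_mul, norm_mul]
  exact mul_le_mul_of_nonneg_right ((u m - f).norm_coe_le_norm _) (norm_nonneg _)

/-- Elements of the domain of the closed operator have derivatives in `L²_loc`, which are limits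
of those of smooth approximations. -/
theorem DiffOp.exists_derivatives_of_mem_graph {A : DiffOp n r S} (hell : A.IsElliptic)
    {ν : Measure S} [IsFiniteMeasure ν] (hν : IsVolumeMeasure n ν) (hA : A.IsSelfAdjointWrt ν)
    {v : C(S, ℝ) × C(S, ℝ)} {a : ℕ → C(S, ℝ) × C(S, ℝ)} (ha : ∀ m, a m ∈ A.smoothGraph)
    (hav : Tendsto a atTop (𝓝 v)) (x : S) :
    ∃ g : Fin n → Rn n → ℝ, (∀ i, MemL2Loc (ch n x).target (g i)) ∧
      (∀ i η, IsContTest (ch n x).target η → Integrable (fun y => g i y * η y)) ∧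
      ∀ i η, IsContTest (ch n x).target η → Tendsto (fun m =>
        ∫ y, pd i ((a m).1 ∘ (ch n x).symm) y * η y) atTop (𝓝 (∫ y, g i y * η y)) := by
  obtain ⟨ρ, hρ⟩ := hν.exists_isChartDensity x
  have hΩ := (ch n x).open_target
  have key : ∀ i : Fin n, ∃ g : Rn n → ℝ, MemL2Loc (ch n x).target g ∧
      (∀ η, IsContTest (ch n x).target η → Integrable (fun y => g y * η y)) ∧
      ∀ η, IsContTest (ch n x).target η → Tendsto (fun m =>
        ∫ y, pd i ((a m).1 ∘ (ch n x).symm) y * η y) atTop (𝓝 (∫ y, g y * η y)) := by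
    intro i
    obtain ⟨θ, hθc, hθ0, hθ⟩ := DiffOp.exists_weight hell hρ i
    have hd : ∀ m, ContDiffOn ℝ 2 ((a m).1 ∘ (ch n x).symm) (ch n x).target :=
      fun m => contDiffOn_comp_chart_symm two_le_infty ((ha m).1.of_le two_le_infty) x
    have hc1 : Continuous (A.op fun _ => 1) := A.continuous_op contMDiff_const
    set Q : C(S, ℝ) × C(S, ℝ) → ℝ := fun z =>
      2 * integralCLM ν ((⟨A.op fun _ => 1, hc1⟩ : C(S, ℝ)) * (z.1 * z.1))
        - 2 * integralCLM ν (z.2 * z.1) with hQ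
    have hQc : Continuous Q := by
      have c1 := (integralCLM ν).continuous
      fun_prop
    refine exists_limit_of_cauchy hΩ hθc hθ0 (F := fun m => pd i ((a m).1 ∘ (ch n x).symm))
      (fun m => (contDiffOn_pd (m := 1) hΩ i (hd m) (by norm_num)).continuousOn)
      (fun m => (hθ _ ((ha m).1.of_le two_le_infty)).1) hav (Q := Q) hQc.continuousAt
      (by simp [hQ]) fun m l => ?_
    have hw := A.smoothGraph.sub_mem (ha m) (ha l)
    have hw1 : SmoothFn[n] 2 (a m - a l).1 := hw.1.of_le two_le_infty
    have h1 := (hθ _ hw1).2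
    rw [DiffOp.integral_grad2 hA hw1] at h1
    have e : Q (a m - a l) = 2 * (∫ p, A.op (fun _ => 1) p * (a m - a l).1 p ^ 2 ∂ν)
        - 2 * ∫ p, A.op (a m - a l).1 p * (a m - a l).1 p ∂ν := by
      simp only [hQ, integralCLM_apply]
      congr 2
      · congr 1; funext p
        simp only [mul_at, ContinuousMap.coe_mk]
        ring
      · congr 1; funext p
        simp only [mul_at, hw.2 p]
    rw [e]
    refine le_trans (le_of_eq (setIntegral_congr_fun hΩ.measurableSet fun y hy => ?_)) h1
    have : pd i ((a m - a l).1 ∘ (ch n x).symm) y =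
        pd i ((a m).1 ∘ (ch n x).symm) y - pd i ((a l).1 ∘ (ch n x).symm) y :=
      pd_sub (((hd m).contDiffAt (hΩ.mem_nhds hy)).differentiableAt (by simp))
        (((hd l).contDiffAt (hΩ.mem_nhds hy)).differentiableAt (by simp))
    simp only [this]
  choose g h1 h2 h3 using key
  exact ⟨g, h1, h2, h3⟩

/-- The weak form of a classical equation. -/
theorem DiffOp.integral_weak_form_of_smooth (A : DiffOp n r S) (hr : 1 ≤ r)
    {x : S} {u : S → ℝ} (hu : SmoothFn[n] 2 u) {ψ : Rn n → ℝ}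
    (hψ : ContDiff ℝ 1 ψ) (hψt : IsContTest (ch n x).target ψ) :
    -(∑ i, ∑ j, ∫ y, pd i (u ∘ (ch n x).symm) y *
          pd j (fun z => (A.coef x z).1 j i * ψ z) y)
      + (∑ i, ∫ y, pd i (u ∘ (ch n x).symm) y * ((A.coef x y).2.1 i * ψ y))
      + ∫ y, u ((ch n x).symm y) * ((A.coef x y).2.2 * ψ y) =
    ∫ y, A.op u ((ch n x).symm y) * ψ y := by
  set Ω := (ch n x).target with hΩdef
  have hΩ : IsOpen Ω := (ch n x).open_target
  set w := u ∘ (ch n x).symm with hwdef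
  have hw : ContDiffOn ℝ 2 w Ω := contDiffOn_comp_chart_symm two_le_infty hu x
  have hw1 : ∀ i, ContDiffOn ℝ 1 (pd i w) Ω := fun i => contDiffOn_pd hΩ i hw (by norm_num)
  have hw2 : ∀ i j, ContinuousOn (pd i (pd j w)) Ω := fun i j =>
    (contDiffOn_pd (m := 0) hΩ i (hw1 j) (by simp)).continuousOn
  have hq : ContDiffOn ℝ 1 (A.coef x) Ω := (A.contDiffOn_coef x).of_le (by exact_mod_cast hr)
  have ha : ∀ i j, ContDiffOn ℝ 1 (fun y => (A.coef x y).1 i j) Ω := fun i j =>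
    contDiffOn_pi.1 (contDiffOn_pi.1 hq.fst i) j
  have hb : ∀ i, ContinuousOn (fun y => (A.coef x y).2.1 i) Ω := fun i =>
    (contDiffOn_pi.1 hq.snd.fst i).continuousOn
  have hc : ContinuousOn (fun y => (A.coef x y).2.2) Ω := hq.snd.snd.continuousOn
  have e1 : ∀ i j, ∫ y, pd i w y * pd j (fun z => (A.coef x z).1 j i * ψ z) y =
      - ∫ y, pd j (pd i w) y * ((A.coef x y).1 j i * ψ y) := fun i j => by
    rw [integral_pd_mul hΩ (hw1 i) ((ha j i).mul hψ.contDiffOn)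
      hψt.2.mul_left (tsupport_mul_subset_right.trans hψt.3), neg_neg]
  have e2 : ∀ y, A.op u ((ch n x).symm y) * ψ y =
      (∑ i, ∑ j, pd j (pd i w) y * ((A.coef x y).1 j i * ψ y)) +
      (∑ i, pd i w y * ((A.coef x y).2.1 i * ψ y)) +
      u ((ch n x).symm y) * ((A.coef x y).2.2 * ψ y) := by
    intro y
    by_cases hy : y ∈ Ω
    · rw [A.op_symm_eq hu x hy, Coef.eval, sum_comm]
      simp only [add_mul, sum_mul]
      congr 1
      · congr 1
        · exact sum_sum_congr fun i j => by ring
        · exact sum_congr rfl fun i _ => by ring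
      · simp only [comp_apply]; ring
    · simp [hψt.eq_zero hy]
  have i1 : ∀ i j, Integrable fun y => pd j (pd i w) y * ((A.coef x y).1 j i * ψ y) := fun i j =>
    (hψt.mul_left hΩ (ha j i).continuousOn).integrable_mul hΩ (hw2 j i)
  have i2 : ∀ i, Integrable fun y => pd i w y * ((A.coef x y).2.1 i * ψ y) := fun i =>
    (hψt.mul_left hΩ (hb i)).integrable_mul hΩ (hw1 i).continuousOn
  have i3 : Integrable fun y => u ((ch n x).symm y) * ((A.coef x y).2.2 * ψ y) :=
    (hψt.mul_left hΩ hc).integrable_mul hΩ hw.continuousOn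
  have j1 : ∀ i, Integrable fun y => ∑ j, pd j (pd i w) y * ((A.coef x y).1 j i * ψ y) := fun i =>
    integrable_finsetSum _ fun j _ => i1 i j
  have j2 : Integrable fun y => ∑ i, ∑ j, pd j (pd i w) y * ((A.coef x y).1 j i * ψ y) :=
    integrable_finsetSum _ fun i _ => j1 i
  have j3 : Integrable fun y => ∑ i, pd i w y * ((A.coef x y).2.1 i * ψ y) :=
    integrable_finsetSum _ fun i _ => i2 i
  have j4 : Integrable fun y => (∑ i, ∑ j, pd j (pd i w) y * ((A.coef x y).1 j i * ψ y)) +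
    ∑ i, pd i w y * ((A.coef x y).2.1 i * ψ y) := j2.add j3
  simp only [e2, e1]
  rw [integral_add j4 i3, integral_add j2 j3,
    integral_finsetSum _ fun i _ => j1 i, integral_finsetSum _ fun i _ => i2 i]
  congr 2
  simp only [sum_neg_distrib, neg_neg]
  exact sum_congr rfl fun i _ => (integral_finsetSum _ fun j _ => i1 i j).symm

theorem DiffOp.IsEigenpair.isFirstEigenvalue {A : DiffOp n r S} (hr : 1 ≤ r) (hell : A.IsElliptic)
    {ν : Measure S} [IsFiniteMeasure ν] (hν : IsVolumeMeasure n ν) (hA : A.IsSelfAdjointWrt ν)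
    {lam : ℝ} {φ : C(S, ℝ)} (h : A.IsEigenpair lam φ) : A.IsFirstEigenvalue lam := by
  obtain ⟨a, ha, hav⟩ := DiffOp.exists_seq_of_mem_graph h.1
  have ha1 : Tendsto (fun m => (a m).1) atTop (𝓝 φ) := (continuous_fst.tendsto _).comp hav
  have ha2 : Tendsto (fun m => (a m).2) atTop (𝓝 (-(lam • φ))) := (continuous_snd.tendsto _).comp hav
  have key : ∀ x : S, ∃ g, IsWeakGradient (ch n x).target
      (φ ∘ (ch n x).symm) g ∧ ∀ ψ, IsTest (ch n x).target ψ →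
      ∫ y, (-(∑ i, ∑ j, g i y * pd j (fun z => (A.coef x z).1 i j * ψ z) y)
          + (∑ i, (A.coef x y).2.1 i * g i y * ψ y)
          + (A.coef x y).2.2 * φ ((ch n x).symm y) * ψ y)
        = ∫ y, (-lam * φ ((ch n x).symm y)) * ψ y := by
    intro x
    have hΩ := (ch n x).open_target
    obtain ⟨g, hg1, hg2, hg3⟩ := DiffOp.exists_derivatives_of_mem_graph hell hν hA ha hav x
    have hq : ContDiffOn ℝ 1 (A.coef x) (ch n x).target :=
      (A.contDiffOn_coef x).of_le (by exact_mod_cast hr)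
    have hd : ∀ m, ContDiffOn ℝ 1 ((a m).1 ∘ (ch n x).symm) (ch n x).target :=
      fun m => contDiffOn_comp_chart_symm one_le_infty ((ha m).1.of_le one_le_infty) x
    refine ⟨g, fun i => ⟨hg1 i, fun ψ hψ => ?_⟩, fun ψ hψ => ?_⟩
    · have h1 := tendsto_integral_chart_mul ha1 (hψ.pd i)
      refine tendsto_nhds_unique h1 ((hg3 i ψ hψ.isContTest).neg.congr fun m => ?_)
      rw [integral_pd_mul hΩ (hd m) (hψ.1.of_le one_le_infty).contDiffOn hψ.2.1 hψ.2.2 i, neg_neg]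
      rfl
    · have hψ1 := hψ.1.of_le one_le_infty
      have ht1 : ∀ i j, IsContTest (ch n x).target
          (pd j (fun z => (A.coef x z).1 i j * ψ z)) := fun i j =>
        isContTest_pd (contDiff_of_tsupport_subset hΩ
          ((contDiffOn_pi.1 (contDiffOn_pi.1 hq.fst i) j).mul hψ1.contDiffOn)
          (tsupport_mul_subset_right.trans hψ.2.2)) hψ.2.1.mul_left
          (tsupport_mul_subset_right.trans hψ.2.2) j
      have ht2 : ∀ i, IsContTest (ch n x).target (fun y => (A.coef x y).2.1 i * ψ y) :=
        fun i => hψ.isContTest.mul_left hΩ (contDiffOn_pi.1 hq.snd.fst i).continuousOn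
      have ht3 : IsContTest (ch n x).target (fun y => (A.coef x y).2.2 * ψ y) :=
        hψ.isContTest.mul_left hΩ hq.snd.snd.continuousOn
      rw [Coef.integral_weak_form hΩ hq hg2 (f := fun y => φ ((ch n x).symm y))
        (φ.continuous.comp_continuousOn (ch n x).continuousOn_symm) hψ1 hψ.2.1 hψ.2.2]
      have hlim1 := ((tendsto_finsetSum univ fun i _ =>
        tendsto_finsetSum univ fun j _ => hg3 i _ (ht1 i j)).neg.add
        (tendsto_finsetSum univ fun i _ => hg3 i _ (ht2 i))).add
        (tendsto_integral_chart_mul ha1 ht3)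
      have hlim2 := tendsto_integral_chart_mul ha2 hψ.isContTest
      refine tendsto_nhds_unique hlim1 (Tendsto.congr (fun m => ?_) (hlim2.trans (le_of_eq ?_)))
      · have hsym : ∀ i j, (fun z => (A.coef x z).1 j i * ψ z) =
            fun z => (A.coef x z).1 i j * ψ z := fun i j => funext fun z => by
          by_cases hz : z ∈ (ch n x).target
          · rw [hell.symm hz]
          · rw [hψ.isContTest.eq_zero hz, mul_zero, mul_zero]
        have := A.integral_weak_form_of_smooth hr ((ha m).1.of_le two_le_infty) hψ1 hψ.isContTest
        simp only [hsym] at this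
        rw [this]
        congr 1
        funext y
        rw [(ha m).2]
      · congr 2
        funext y
        simp
  refine ⟨φ, fun x => ⟨fun K hK hKc => ?_, ?_⟩, φ.continuous, h.2, key⟩
  · have hcK : ContinuousOn (φ ∘ (ch n x).symm) K :=
      (φ.continuous.comp_continuousOn (ch n x).continuousOn_symm).mono hK
    have : IsFiniteMeasure ((volume : Measure (Rn n)).restrict K) :=
      isFiniteMeasure_restrict.2 hKc.measure_lt_top.ne
    exact MemLp.of_bound (hcK.aestronglyMeasurable hKc.measurableSet) ‖φ‖
      (Eventually.of_forall fun y => φ.norm_coe_le_norm _)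
  · obtain ⟨g, hg, -⟩ := key x
    exact ⟨g, hg⟩

end Weak

section Extend
variable {Ω : Set (Rn n)}

theorem exists_test_approx (hΩ : IsOpen Ω) {ψ : Rn n → ℝ} (hψ : ContDiff ℝ 1 ψ)
    (hc : HasCompactSupport ψ) (hs : tsupport ψ ⊆ Ω) :
    ∃ K ⊆ Ω, IsCompact K ∧ tsupport ψ ⊆ K ∧ ∃ ζ : ℕ → Rn n → ℝ, (∀ m, IsTest Ω (ζ m)) ∧
      (∀ m, tsupport (ζ m) ⊆ K) ∧ (∀ m y, |ζ m y - ψ y| ≤ 1 / ((m : ℝ) + 1)) ∧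
      ∀ m i y, |pd i (ζ m) y - pd i ψ y| ≤ 1 / ((m : ℝ) + 1) := by
  obtain ⟨δ, hδ, hδΩ⟩ := hc.isCompact.exists_cthickening_subset_open hΩ hs
  have hK : IsCompact (Metric.cthickening δ (tsupport ψ)) := hc.isCompact.cthickening
  choose ζ h1 h2 h3 h4 using fun m : ℕ => exists_mollification hψ.continuous hc
    (h := fun i => pd i ψ) (fun i => (contDiff_pd (m := 0) i hψ (by simp)).continuous)
    (fun i => hasCompactSupport_pd hc i) (fun i η hη hηc => by
      have := integral_pd_mul isOpen_univ (hη.of_le one_le_infty).contDiffOn hψ.contDiffOn hc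
        (Set.subset_univ _) i
      simp only [mul_comm (ψ _), mul_comm (pd i ψ _)]
      rw [this]) (ε := 1 / ((m : ℝ) + 1)) (by positivity) hδ
  refine ⟨_, hδΩ, hK, Metric.self_subset_cthickening _, ζ, fun m => ⟨h1 m, ?_, (h2 m).trans hδΩ⟩,
    h2, h3, fun m i y => h4 m i y⟩
  exact hK.of_isClosed_subset (isClosed_tsupport _) (h2 m)

theorem tendsto_integral_mul_of_uniform {K : Set (Rn n)} {h : Rn n → ℝ}
    (hh : IntegrableOn h K) {η : Rn n → ℝ} {ζ : ℕ → Rn n → ℝ} (hη : Continuous η)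
    (hηK : tsupport η ⊆ K) (hζ : ∀ m, Continuous (ζ m)) (hζK : ∀ m, tsupport (ζ m) ⊆ K)
    (hηc : HasCompactSupport η) (hζc : ∀ m, HasCompactSupport (ζ m))
    (hle : ∀ m y, |ζ m y - η y| ≤ 1 / ((m : ℝ) + 1)) :
    Integrable (fun y => h y * η y) ∧ (∀ m, Integrable (fun y => h y * ζ m y)) ∧
      Tendsto (fun m => ∫ y, h y * ζ m y) atTop (𝓝 (∫ y, h y * η y)) := by
  have key : ∀ w : Rn n → ℝ, Continuous w → tsupport w ⊆ K → HasCompactSupport w →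
      Integrable (fun y => h y * w y) := by
    intro w hw hwK hwc
    obtain ⟨C, hC⟩ := hwc.exists_bound_of_continuous hw
    rw [← integrableOn_iff_integrable_of_support_subset (s := K)]
    · exact (hh.mul_bdd hw.aestronglyMeasurable (Eventually.of_forall hC))
    · intro y hy
      exact hwK (subset_tsupport _ (right_ne_zero_of_mul hy))
  refine ⟨key η hη hηK hηc, fun m => key _ (hζ m) (hζK m) (hζc m), ?_⟩
  rw [tendsto_iff_norm_sub_tendsto_zero]
  have h1 : Tendsto (fun m : ℕ => 1 / ((m : ℝ) + 1) * ∫ y in K, |h y|) atTop (𝓝 0) := by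
    simpa using tendsto_one_div_add_atTop_nhds_zero_nat.mul_const (∫ y in K, |h y|)
  refine squeeze_zero (fun _ => norm_nonneg _) (fun m => ?_) h1
  rw [← integral_sub (key _ (hζ m) (hζK m) (hζc m)) (key η hη hηK hηc),
    ← setIntegral_eq_integral_of_forall_compl_eq_zero (s := K), ← integral_const_mul]
  · refine norm_integral_le_of_norm_le (hh.abs.const_mul _) (Eventually.of_forall fun y => ?_)
    rw [← mul_sub, norm_mul, mul_comm]
    exact mul_le_mul_of_nonneg_right (hle m y) (norm_nonneg _)
  · intro y hy
    rw [image_eq_zero_of_notMem_tsupport fun h => hy (hζK m h),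
      image_eq_zero_of_notMem_tsupport fun h => hy (hηK h)]
    ring

/-- A first-order distribution with integrable coefficients which vanishes on smooth functions
vanishes on continuously differentiable functions. -/
theorem integral_eq_zero_of_forall_test (hΩ : IsOpen Ω) {H : Fin n → Rn n → ℝ} {H₀ : Rn n → ℝ}
    (hH : ∀ i, ∀ K ⊆ Ω, IsCompact K → IntegrableOn (H i) K)
    (hH₀ : ∀ K ⊆ Ω, IsCompact K → IntegrableOn H₀ K)
    (h : ∀ ψ, IsTest Ω ψ → ∫ y, ((∑ i, H i y * pd i ψ y) + H₀ y * ψ y) = 0) {ψ : Rn n → ℝ}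
    (hψ : ContDiff ℝ 1 ψ) (hc : HasCompactSupport ψ) (hs : tsupport ψ ⊆ Ω) :
    Integrable (fun y => (∑ i, H i y * pd i ψ y) + H₀ y * ψ y) ∧
      ∫ y, ((∑ i, H i y * pd i ψ y) + H₀ y * ψ y) = 0 := by
  obtain ⟨K, hKΩ, hK, hψK, ζ, hζ, hζK, hζ1, hζ2⟩ := exists_test_approx hΩ hψ hc hs
  have hpd : ∀ {w : Rn n → ℝ} i, ContDiff ℝ 1 w → Continuous (pd i w) := fun i hw =>
    (contDiff_pd (m := 0) i hw (by simp)).continuous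
  obtain ⟨i1, i2, i3⟩ := tendsto_integral_mul_of_uniform (hH₀ K hKΩ hK)
    hψ.continuous hψK (fun m => (hζ m).1.continuous) hζK hc (fun m => (hζ m).2.1) hζ1
  have key := fun i => tendsto_integral_mul_of_uniform (hH i K hKΩ hK)
    (hpd i hψ) ((tsupport_pd_subset i ψ).trans hψK)
    (fun m => hpd i ((hζ m).1.of_le one_le_infty)) (fun m => (tsupport_pd_subset i _).trans (hζK m))
    (hasCompactSupport_pd hc i) (fun m => hasCompactSupport_pd (hζ m).2.1 i) (fun m y => hζ2 m i y)
  have j1 : Integrable (fun y => ∑ i, H i y * pd i ψ y) :=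
    integrable_finsetSum _ fun i _ => (key i).1
  refine ⟨j1.add i1, ?_⟩
  rw [integral_add j1 i1, integral_finsetSum _ fun i _ => (key i).1]
  refine tendsto_nhds_unique ((tendsto_finsetSum univ fun i _ => (key i).2.2).add i3)
    (tendsto_const_nhds.congr fun m => ?_)
  have := h _ (hζ m)
  rw [integral_add (integrable_finsetSum _ fun i _ => (key i).2.1 m) (i2 m),
    integral_finsetSum _ fun i _ => (key i).2.1 m] at this
  exact this.symm

theorem MemL2Loc.integrableOn {w : Rn n → ℝ} (hw : MemL2Loc Ω w) {K : Set (Rn n)} (hK : K ⊆ Ω)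
    (hKc : IsCompact K) : IntegrableOn w K := by
  have : IsFiniteMeasure ((volume : Measure (Rn n)).restrict K) :=
    isFiniteMeasure_restrict.2 hKc.measure_lt_top.ne
  exact (hw K hK hKc).integrable (by norm_num)

end Extend

section PullChart
variable [CompactSpace S]

theorem tsupport_pullChart {x : S} {u : S → ℝ} (hs : tsupport u ⊆ (ch n x).source) :
    tsupport (pullChart (n := n) x u) ⊆ ch n x '' tsupport u := by
  refine closure_minimal (fun y hy => ?_) (isCompact_image_tsupport hs).isClosed
  by_contra h
  exact hy (pullChart_eq_zero h)

theorem hasCompactSupport_pullChart {x : S} {u : S → ℝ}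
    (hs : tsupport u ⊆ (ch n x).source) : HasCompactSupport (pullChart (n := n) x u) :=
  (isCompact_image_tsupport hs).of_isClosed_subset (isClosed_tsupport _) (tsupport_pullChart hs)

theorem extendChart_pullChart {x : S} {u : S → ℝ} (hs : tsupport u ⊆ (ch n x).source) :
    extendChart x (pullChart (n := n) x u) = u := by
  funext p
  by_cases hp : p ∈ (ch n x).source
  · rw [extendChart_of_mem _ hp, pullChart_apply u hp]
  · rw [extendChart_of_notMem _ hp, image_eq_zero_of_notMem_tsupport fun h => hp (hs h)]

theorem contDiffOn_pullChart [IsManifold (𝓡 n) ∞ S] {m : WithTop ℕ∞} (hm : m ≤ ∞) {x : S}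
    {u : S → ℝ} (hu : SmoothFn[n] m u) :
    ContDiffOn ℝ m (pullChart (n := n) x u) (ch n x).target :=
  (contDiffOn_comp_chart_symm hm hu x).congr fun _ hy => Set.indicator_of_mem hy _

/-- A smooth partition of unity subordinate to the finitely many chosen charts. -/
theorem exists_partition (n : ℕ) (S : Type*) [TopologicalSpace S] [ChartedSpace (Rn n) S]
    [CompactSpace S] [IsManifold (𝓡 n) ∞ S] [T2Space S] :
    ∃ χ : centers n S → S → ℝ, (∀ z, SmoothFn[n] ∞ (χ z)) ∧
      (∀ z, tsupport (χ z) ⊆ (ch n z.1).source) ∧ ∀ p, ∑ z, χ z p = 1 := by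
  obtain ⟨χ, hχ⟩ := SmoothPartitionOfUnity.exists_isSubordinate (𝓡 n) (M := S)
    (ι := centers n S) isClosed_univ (fun i => (ch n i.1).source)
    (fun i => (ch n i.1).open_source) (fun p _ => by
      obtain ⟨z, hz, hp, _⟩ := exists_mem_piece n p
      exact Set.mem_iUnion.2 ⟨⟨z, hz⟩, hp⟩)
  refine ⟨fun z => χ z, fun z => (χ z).contMDiff, hχ, fun p => ?_⟩
  rw [← finsum_eq_sum_of_fintype]
  exact χ.sum_eq_one (Set.mem_univ p)

end PullChart

section Adjoint
variable [IsManifold (𝓡 n) ∞ S] [T2Space S] [CompactSpace S] [MeasurableSpace S] [BorelSpace S]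

theorem DiffOp.integral_mul_extendChart_of_isWeakSolution {A : DiffOp n r S} (hr : 2 ≤ r)
    (hell : A.IsElliptic) {ν : Measure S} [IsFiniteMeasure ν] (hν : IsVolumeMeasure n ν)
    (hA : A.IsSelfAdjointWrt ν) {φ : S → ℝ} (hφ : Continuous φ) {μ : ℝ}
    (h : A.IsWeakSolution φ (fun p => -μ * φ p)) {x : S} {w : Rn n → ℝ}
    (hw : ContDiffOn ℝ 2 w (ch n x).target) (hc : HasCompactSupport w)
    (hs : tsupport w ⊆ (ch n x).target) :
    ∫ p, φ p * (A.op (extendChart x w) p + μ * extendChart x w p) ∂ν = 0 := by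
  obtain ⟨ρ, hρ⟩ := hν.exists_isChartDensity x
  obtain ⟨hρ1, hρdiv⟩ := DiffOp.contDiffOn_density hr hell hA hρ
  obtain ⟨g, hg, hweak⟩ := h x
  set Ω := (ch n x).target with hΩdef
  have hΩ : IsOpen Ω := (ch n x).open_target
  have hum := contMDiff_extendChart two_le_infty hw hc hs
  set f : Rn n → ℝ := fun y => φ ((ch n x).symm y) with hf
  have hfc : ContinuousOn f Ω := hφ.comp_continuousOn (ch n x).continuousOn_symm
  have hcoef : ContDiffOn ℝ 1 (A.coef x) Ω :=
    (A.contDiffOn_coef x).of_le (by exact_mod_cast one_le_two.trans hr)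
  have ha : ∀ i j, ContDiffOn ℝ 1 (fun y => (A.coef x y).1 i j) Ω := fun i j =>
    contDiffOn_pi.1 (contDiffOn_pi.1 hcoef.fst i) j
  have had : ∀ i j, ∀ y ∈ Ω, DifferentiableAt ℝ (fun y => (A.coef x y).1 i j) y := fun i j y hy =>
    ((ha i j).contDiffAt (hΩ.mem_nhds hy)).differentiableAt (by simp)
  have hb : ∀ i, ContinuousOn (fun y => (A.coef x y).2.1 i) Ω := fun i =>
    (contDiffOn_pi.1 hcoef.snd.fst i).continuousOn
  have hcc : ContinuousOn (fun y => (A.coef x y).2.2) Ω := hcoef.snd.snd.continuousOn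
  have hpa : ∀ k i j, ContinuousOn (pd k fun y => (A.coef x y).1 i j) Ω := fun k i j =>
    (contDiffOn_pd (m := 0) hΩ k (ha i j) (by simp)).continuousOn
  have hgK : ∀ i, ∀ q : Rn n → ℝ, ContinuousOn q Ω → ∀ K ⊆ Ω, IsCompact K →
      IntegrableOn (fun y => g i y * q y) K := fun i q hq K hK hKc =>
    ((hg i).1.integrableOn hK hKc).mul_continuousOn (hq.mono hK) hKc
  have hcK : ∀ q : Rn n → ℝ, ContinuousOn q Ω → ∀ K ⊆ Ω, IsCompact K → IntegrableOn q K :=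
    fun q hq K hK hKc => (hq.mono hK).integrableOn_compact hKc
  set H : Fin n → Rn n → ℝ := fun j y => - ∑ i, g i y * (A.coef x y).1 i j with hH
  set H₀ : Rn n → ℝ := fun y =>
    (- ∑ i, ∑ j, g i y * pd j (fun z => (A.coef x z).1 i j) y) + (∑ i, g i y * (A.coef x y).2.1 i)
      + ((A.coef x y).2.2 + μ) * f y with hH₀
  have hHK : ∀ j, ∀ K ⊆ Ω, IsCompact K → IntegrableOn (H j) K := fun j K hK hKc =>
    (integrable_finsetSum _ fun i _ => hgK i _ (ha i j).continuousOn K hK hKc).neg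
  have hH₀K : ∀ K ⊆ Ω, IsCompact K → IntegrableOn H₀ K := fun K hK hKc =>
    ((integrable_finsetSum _ fun i _ => integrable_finsetSum _ fun j _ =>
      hgK i _ (hpa j i j) K hK hKc).neg.add (integrable_finsetSum _ fun i _ =>
      hgK i _ (hb i) K hK hKc)).add (hcK _ ((hcc.add continuousOn_const).mul hfc) K hK hKc)
  have hzero : ∀ {ζ : Rn n → ℝ} {y : Rn n}, tsupport ζ ⊆ Ω → y ∉ Ω → ζ y = 0 ∧ ∀ j, pd j ζ y = 0 :=
    fun hζ hy => ⟨image_eq_zero_of_notMem_tsupport fun h => hy (hζ h), fun j =>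
      image_eq_zero_of_notMem_tsupport fun h => hy (hζ (tsupport_pd_subset j _ h))⟩
  have hweak' : ∀ ψ, IsTest Ω ψ → ∫ y, ((∑ j, H j y * pd j ψ y) + H₀ y * ψ y) = 0 := by
    intro ψ hψ
    have h1 := hweak ψ hψ
    have e : ∀ y, (-(∑ i, ∑ j, g i y * pd j (fun z => (A.coef x z).1 i j * ψ z) y)
          + (∑ i, (A.coef x y).2.1 i * g i y * ψ y)
          + (A.coef x y).2.2 * φ ((ch n x).symm y) * ψ y) =
        ((∑ j, H j y * pd j ψ y) + H₀ y * ψ y) - μ * f y * ψ y := by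
      intro y
      by_cases hy : y ∈ Ω
      · have h2 : ∀ i j, pd j (fun z => (A.coef x z).1 i j * ψ z) y =
            (A.coef x y).1 i j * pd j ψ y + ψ y * pd j (fun z => (A.coef x z).1 i j) y :=
          fun i j => pd_mul (had i j y hy) (hψ.1.differentiable (by simp) y)
        have h3 : ∑ j, H j y * pd j ψ y = -∑ i, ∑ j, g i y * ((A.coef x y).1 i j * pd j ψ y) := by
          rw [sum_comm, ← sum_neg_distrib]
          refine sum_congr rfl fun j _ => ?_
          rw [hH, neg_mul, sum_mul]
          congr 1
          exact sum_congr rfl fun i _ => by ring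
        have h4 : ∑ i, ∑ j, g i y * (ψ y * pd j (fun z => (A.coef x z).1 i j) y) =
            (∑ i, ∑ j, g i y * pd j (fun z => (A.coef x z).1 i j) y) * ψ y := by
          simp only [sum_mul]
          exact sum_sum_congr fun i j => by ring
        have h5 : ∑ i, (A.coef x y).2.1 i * g i y * ψ y =
            (∑ i, g i y * (A.coef x y).2.1 i) * ψ y := by
          rw [sum_mul]
          exact sum_congr rfl fun i _ => by ring
        simp only [h2, mul_add, sum_add_distrib]
        rw [h3, h4, h5, hH₀]
        simp only [hf]
        ring
      · obtain ⟨z1, z2⟩ := hzero hψ.2.2 hy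
        have z3 : ∀ i j, pd j (fun z => (A.coef x z).1 i j * ψ z) y = 0 := fun i j =>
          (hzero (tsupport_mul_subset_right.trans hψ.2.2) hy).2 j
        simp [z1, z2, z3]
    simp only [e] at h1
    have i2 : Integrable fun y => μ * f y * ψ y :=
      hψ.isContTest.integrable_mul hΩ (continuousOn_const.mul hfc)
    have i1 : Integrable fun y => ((∑ j, H j y * pd j ψ y) + H₀ y * ψ y) := by
      have hk := hψ.2.1.isCompact
      have a1 := fun j => tendsto_integral_mul_of_uniform (hHK j _ hψ.2.2 hk)
        (hψ.pd j).continuous (tsupport_pd_subset j ψ) (ζ := fun _ => pd j ψ)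
        (fun _ => (hψ.pd j).continuous) (fun _ => tsupport_pd_subset j ψ)
        (hψ.pd j).hasCompactSupport (fun _ => (hψ.pd j).hasCompactSupport)
        (fun m y => by simp only [sub_self, abs_zero]; positivity)
      have a2 := tendsto_integral_mul_of_uniform (hH₀K _ hψ.2.2 hk)
        hψ.1.continuous subset_rfl (ζ := fun _ => ψ)
        (fun _ => hψ.1.continuous) (fun _ => subset_rfl) hψ.2.1 (fun _ => hψ.2.1)
        (fun m y => by simp only [sub_self, abs_zero]; positivity)
      exact (integrable_finsetSum _ fun j _ => (a1 j).1).add a2.1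
    rw [integral_sub i1 i2] at h1
    have h6 : ∫ y, μ * f y * ψ y = - ∫ y, (-μ * φ ((ch n x).symm y)) * ψ y := by
      rw [← integral_neg]
      congr 1; funext y
      simp only [hf]
      ring
    rw [h6] at h1
    linarith
  -- the test function `ρ w`
  have hψ1 : ContDiff ℝ 1 (fun y => ρ y * w y) := contDiff_of_tsupport_subset hΩ
    (hρ1.mul (hw.of_le (by norm_num))) (tsupport_mul_subset_right.trans hs)
  obtain ⟨I1, J1⟩ := integral_eq_zero_of_forall_test hΩ hHK hH₀K hweak' hψ1 hc.mul_left
    (tsupport_mul_subset_right.trans hs)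
  have hwp : ∀ j, ContDiffOn ℝ 1 (pd j w) Ω := fun j => contDiffOn_pd hΩ j hw (by norm_num)
  have hws : ∀ j, tsupport (pd j w) ⊆ Ω := fun j => (tsupport_pd_subset j w).trans hs
  set F : Fin n → Rn n → ℝ := fun i y => ∑ j, ρ y * (A.coef x y).1 i j * pd j w y with hF
  have hρa : ∀ i j, ContDiffOn ℝ 1 (fun y => ρ y * (A.coef x y).1 i j) Ω := fun i j =>
    hρ1.mul (ha i j)
  have hFs : ∀ i, tsupport (F i) ⊆ tsupport w := fun i => by
    refine closure_minimal (fun y hy => ?_) (isClosed_tsupport _)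
    by_contra hyw
    refine hy (Finset.sum_eq_zero fun j _ => ?_)
    rw [image_eq_zero_of_notMem_tsupport fun h => hyw (tsupport_pd_subset j w h), mul_zero]
  have hFcs : ∀ i, HasCompactSupport (F i) := fun i =>
    hc.isCompact.of_isClosed_subset (isClosed_tsupport _) (hFs i)
  have hF1 : ∀ i, ContDiff ℝ 1 (F i) := fun i => contDiff_of_tsupport_subset hΩ
    (ContDiffOn.sum fun j _ => (hρa i j).mul (hwp j)) ((hFs i).trans hs)
  have hIJ : ∀ i, Integrable (fun y => f y * pd i (F i) y + g i y * F i y) ∧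
      ∫ y, (f y * pd i (F i) y + g i y * F i y) = 0 := by
    intro i
    have hconv : ∀ (ψ : Rn n → ℝ) y, (∑ k, (if k = i then f y else 0) * pd k ψ y) + g i y * ψ y =
        f y * pd i ψ y + g i y * ψ y := fun ψ y => by simp
    have := integral_eq_zero_of_forall_test hΩ (H := fun k y => if k = i then f y else 0)
      (H₀ := g i) (fun k K hK hKc => by
        by_cases hk : k = i
        · simp only [hk, if_true]; exact hcK f hfc K hK hKc
        · simp only [hk, if_false]; exact integrableOn_zero)
      (fun K hK hKc => (hg i).1.integrableOn hK hKc) (fun ψ hψ => by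
        simp only [hconv]
        have hgi : ∫ y, f y * pd i ψ y = - ∫ y, g i y * ψ y := (hg i).2 ψ hψ
        rw [integral_add, hgi]
        · ring
        · exact (hψ.pd i).integrable_mul hΩ hfc
        · have hk := hψ.2.1.isCompact
          exact (tendsto_integral_mul_of_uniform
            ((hg i).1.integrableOn hψ.2.2 hk) hψ.1.continuous subset_rfl (ζ := fun _ => ψ)
            (fun _ => hψ.1.continuous) (fun _ => subset_rfl) hψ.2.1 (fun _ => hψ.2.1)
            (fun m y => by simp only [sub_self, abs_zero]; positivity)).1)
      (hF1 i) (hFcs i) ((hFs i).trans hs)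
    simpa only [hconv] using this
  have hop : Continuous fun p => φ p * (A.op (extendChart x w) p + μ * extendChart x w p) :=
    hφ.mul ((A.continuous_op hum).add (continuous_const.mul hum.continuous))
  rw [integral_eq_integral_chart
    (F := fun p => φ p * (A.op (extendChart x w) p + μ * extendChart x w p))
    hρ.continuousOn hρ.pos hρ.apply_eq hop fun p hp => by
      have hp' : p ∉ tsupport (extendChart x w) := fun h =>
        hp (tsupport_extendChart_subset_source hc hs h)
      rw [A.op_eq_zero_of_notMem_tsupport hp', image_eq_zero_of_notMem_tsupport hp']
      ring]
  have hsum0 : ∫ y, (((∑ j, H j y * pd j (fun y => ρ y * w y) y) + H₀ y * (ρ y * w y)) +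
      ∑ i, (f y * pd i (F i) y + g i y * F i y)) = 0 := by
    rw [integral_add I1 (integrable_finsetSum _ fun i _ => (hIJ i).1), J1,
      integral_finsetSum _ fun i _ => (hIJ i).1]
    simp [(hIJ _).2]
  rw [← hsum0, ← setIntegral_eq_integral_of_forall_compl_eq_zero (μ := volume) (s := Ω)
    (f := fun y => (((∑ j, H j y * pd j (fun y => ρ y * w y) y) + H₀ y * (ρ y * w y)) +
      ∑ i, (f y * pd i (F i) y + g i y * F i y)))]
  · refine setIntegral_congr_fun hΩ.measurableSet fun y hy => ?_
    simp only [A.op_extendChart_symm hw hc hs hy, extendChart_symm w hy]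
    have hwd : DifferentiableAt ℝ w y :=
      (hw.contDiffAt (hΩ.mem_nhds hy)).differentiableAt (by simp)
    have hρd : DifferentiableAt ℝ ρ y :=
      (hρ1.contDiffAt (hΩ.mem_nhds hy)).differentiableAt (by simp)
    have hρad : ∀ i j, DifferentiableAt ℝ (fun y => ρ y * (A.coef x y).1 i j) y := fun i j =>
      ((hρa i j).contDiffAt (hΩ.mem_nhds hy)).differentiableAt (by simp)
    have hwpd : ∀ j, DifferentiableAt ℝ (pd j w) y := fun j =>
      ((hwp j).contDiffAt (hΩ.mem_nhds hy)).differentiableAt (by simp)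
    have d1 : ∀ j, pd j (fun y => ρ y * w y) y = ρ y * pd j w y + w y * pd j ρ y := fun j =>
      pd_mul hρd hwd
    have d2 : ∀ i j k, pd k (fun y => ρ y * (A.coef x y).1 i j) y =
        ρ y * pd k (fun z => (A.coef x z).1 i j) y + (A.coef x y).1 i j * pd k ρ y := fun i j k =>
      pd_mul hρd (had i j y hy)
    have d3 : ∀ i, pd i (F i) y = ∑ j, (ρ y * (A.coef x y).1 i j * pd i (pd j w) y +
        pd j w y * pd i (fun z => ρ z * (A.coef x z).1 j i) y) := fun i => by
      have hd : ∀ j ∈ univ,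
          DifferentiableAt ℝ (fun z => ρ z * (A.coef x z).1 i j * pd j w z) y := fun j _ =>
        (hρad i j).mul (hwpd j)
      refine (pd_sum univ hd).trans ?_
      refine sum_congr rfl fun j _ => ?_
      rw [pd_mul (hρad i j) (hwpd j)]
      congr 2
      refine pd_congr ?_
      filter_upwards [hΩ.mem_nhds hy] with z hz
      rw [hell.symm hz]
    have s1 : ∑ i, pd i (F i) y = ρ y * (∑ i, ∑ j, (A.coef x y).1 i j * pd i (pd j w) y) +
        ρ y * ∑ j, (A.coef x y).2.1 j * pd j w y := by
      simp only [d3, sum_add_distrib]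
      congr 1
      · simp only [mul_sum]
        exact sum_sum_congr fun i j => by ring
      · rw [sum_comm, mul_sum]
        refine sum_congr rfl fun j _ => ?_
        rw [← mul_sum, hρdiv j y hy]
        ring
    have s2 : ∀ i, g i y * (∑ j, ρ y * (A.coef x y).1 i j * pd j w y) =
        g i y * (∑ j, (A.coef x y).1 i j * pd j (fun y => ρ y * w y) y) +
        g i y * (∑ j, pd j (fun z => (A.coef x z).1 i j) y) * (ρ y * w y) -
        g i y * (A.coef x y).2.1 i * (ρ y * w y) := by
      intro i
      have h1 := hρdiv i y hy
      simp only [d2, sum_add_distrib, ← mul_sum] at h1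
      have h2 : ∑ j, (A.coef x y).1 i j * pd j (fun y => ρ y * w y) y =
          (∑ j, ρ y * (A.coef x y).1 i j * pd j w y) +
          w y * ∑ j, (A.coef x y).1 i j * pd j ρ y := by
        simp only [d1, mul_add, sum_add_distrib, mul_sum]
        congr 1
        · exact sum_congr rfl fun j _ => by ring
        · exact sum_congr rfl fun j _ => by ring
      rw [h2]
      linear_combination (-(g i y * w y)) * h1
    have s3 : ∑ j, H j y * pd j (fun y => ρ y * w y) y =
        -∑ i, g i y * (∑ j, (A.coef x y).1 i j * pd j (fun y => ρ y * w y) y) := by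
      simp only [hH, neg_mul, sum_neg_distrib, sum_mul, mul_sum]
      rw [sum_comm]
      congr 1
      exact sum_sum_congr fun j i => by ring
    have s4 : ∑ i, g i y * F i y =
        (∑ i, g i y * (∑ j, (A.coef x y).1 i j * pd j (fun y => ρ y * w y) y)) +
        (∑ i, ∑ j, g i y * pd j (fun z => (A.coef x z).1 i j) y) * (ρ y * w y) -
        (∑ i, g i y * (A.coef x y).2.1 i) * (ρ y * w y) := by
      simp only [hF, s2, sum_add_distrib, sum_sub_distrib, sum_mul,
        mul_sum]
    rw [sum_add_distrib, s4, s3, ← mul_sum, s1, hH₀, Coef.eval]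
    simp only [hf]
    ring
  · intro y hy
    obtain ⟨z1, z2⟩ := hzero hs hy
    have z3 : ∀ j, pd j (fun y => ρ y * w y) y = 0 := fun j =>
      (hzero (tsupport_mul_subset_right.trans hs) hy).2 j
    have z4 : ∀ i, F i y = 0 := fun i => (hzero ((hFs i).trans hs) hy).1
    have z5 : ∀ i, pd i (F i) y = 0 := fun i => (hzero ((hFs i).trans hs) hy).2 i
    simp [z1, z3, z4, z5]

theorem DiffOp.integral_mul_op_of_isWeakSolution {A : DiffOp n r S} (hr : 2 ≤ r)
    (hell : A.IsElliptic) {ν : Measure S} [IsFiniteMeasure ν] (hν : IsVolumeMeasure n ν)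
    (hA : A.IsSelfAdjointWrt ν) {φ : S → ℝ} (hφ : Continuous φ) {μ : ℝ}
    (h : A.IsWeakSolution φ (fun p => -μ * φ p)) {u : S → ℝ}
    (hu : SmoothFn[n] 2 u) :
    ∫ p, φ p * (A.op u p + μ * u p) ∂ν = 0 := by
  obtain ⟨χ, hχ, hχs, hχ1⟩ := exists_partition n S
  have hm : ∀ z, SmoothFn[n] 2 (fun p => χ z p * u p) := fun z =>
    ((hχ z).of_le two_le_infty).mul hu
  have hts : ∀ z, tsupport (fun p => χ z p * u p) ⊆ (ch n z.1).source := fun z =>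
    tsupport_mul_subset_left.trans (hχs z)
  have key : ∀ z, ∫ p, φ p * (A.op (fun p => χ z p * u p) p + μ * (χ z p * u p)) ∂ν = 0 := by
    intro z
    have := DiffOp.integral_mul_extendChart_of_isWeakSolution hr hell hν hA hφ h
      (contDiffOn_pullChart two_le_infty (x := z.1) (hm z)) (hasCompactSupport_pullChart (hts z))
      ((tsupport_pullChart (hts z)).trans (image_tsupport_subset (hts z)))
    rwa [extendChart_pullChart (hts z)] at this
  have hsum : u = fun p => ∑ z, χ z p * u p := by
    funext p
    rw [← sum_mul, hχ1, one_mul]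
  have e : ∀ p, φ p * (A.op u p + μ * u p) =
      ∑ z, φ p * (A.op (fun p => χ z p * u p) p + μ * (χ z p * u p)) := by
    intro p
    have h1 : A.op u p = ∑ z, A.op (fun p => χ z p * u p) p := by
      conv_lhs => rw [hsum]
      exact A.op_sum univ hm p
    rw [← mul_sum, sum_add_distrib, h1, ← mul_sum, ← sum_mul, hχ1,
      one_mul]
  simp only [e]
  rw [integral_finsetSum _ fun z _ => ?_]
  · exact Finset.sum_eq_zero fun z _ => key z
  · refine integrable_of_compact (hφ.mul ((A.continuous_op (hm z)).add
      (continuous_const.mul (hm z).continuous)))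

/-- The first eigenvalue in the weak sense is that of the closed operator. -/
theorem DiffOp.IsEigenpair.isFirstEigenvalue_iff [ConnectedSpace S] {A : DiffOp n r S} (hr : 2 ≤ r)
    (hell : A.IsElliptic) {ν : Measure S} [IsFiniteMeasure ν] [ν.IsOpenPosMeasure]
    (hν : IsVolumeMeasure n ν) (hA : A.IsSelfAdjointWrt ν) {lam : ℝ} {φ : C(S, ℝ)}
    (h : A.IsEigenpair lam φ) (μ : ℝ) : A.IsFirstEigenvalue μ ↔ μ = lam := by
  constructor
  · rintro ⟨ψ, -, hψc, hψ0, hψ⟩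
    obtain ⟨a, ha, hav⟩ := DiffOp.exists_seq_of_mem_graph h.1
    have ha1 : Tendsto (fun m => (a m).1) atTop (𝓝 φ) := (continuous_fst.tendsto _).comp hav
    have ha2 : Tendsto (fun m => (a m).2) atTop (𝓝 (-(lam • φ))) :=
      (continuous_snd.tendsto _).comp hav
    set ψ' : C(S, ℝ) := ⟨ψ, hψc⟩
    have h1 := tendsto_integral_mul ν (tendsto_const_nhds (x := ψ')) (ha2.add (ha1.const_smul μ))
    have h2 : ∀ m, ∫ p, ψ' p * ((a m).2 + μ • (a m).1) p ∂ν = 0 := fun m => by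
      have := DiffOp.integral_mul_op_of_isWeakSolution hr hell hν hA hψc hψ
        ((ha m).1.of_le two_le_infty)
      simp only [← (ha m).2] at this
      exact this
    simp only [h2] at h1
    have h3 := tendsto_nhds_unique h1 tendsto_const_nhds
    have h4 : ∫ p, ψ' p * (-(lam • φ) + μ • φ) p ∂ν = (μ - lam) * ∫ p, ψ p * φ p ∂ν := by
      rw [← integral_const_mul]
      congr 1; funext p
      simp only [ContinuousMap.add_apply, neg_at, smul_at,
        smul_eq_mul, ψ', ContinuousMap.coe_mk]
      ring
    rw [h4] at h3
    obtain ⟨p⟩ := (inferInstance : Nonempty S)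
    have h5 : 0 < ∫ p, ψ p * φ p ∂ν := integral_pos_of_continuous (hψc.mul φ.continuous)
      (fun q => (mul_pos (hψ0 q) (h.2 q)).le) (p := p) (mul_pos (hψ0 p) (h.2 p)).ne'
    rcases mul_eq_zero.1 h3 with h6 | h6
    · linarith
    · exact absurd h6 h5.ne'
  · rintro rfl
    exact h.isFirstEigenvalue (one_le_two.trans hr) hell hν hA

end Adjoint

section Bounds
variable [IsManifold (𝓡 n) ∞ S] [T2Space S] [CompactSpace S]

/-- Quantities bounded by the norm of the operator, with locally bounded constants, on the chosen
pieces of charts, are so on any compact subset of a chart. -/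
theorem exists_bound_of_pieces {x : S} {K : Set (Rn n)} (hK : IsCompact K)
    (hKx : K ⊆ (ch n x).target) (f : DiffOp n r S → Rn n → ℝ)
    (h : ∀ z ∈ centers n S, ∃ G : Rn n → ℝ,
      ContinuousOn G {q | q ∈ (ch n z).target ∧
        (ch n z).symm q ∈ (ch n x).source} ∧
      ∀ (A : DiffOp n r S) (p : S), p ∈ (ch n z).source → p ∈ (ch n x).source →
        ch n z p ∈ piece n S z →
        |f A (ch n x p)| ≤ G (ch n z p) * ‖A‖) :
    ∃ C, 0 ≤ C ∧ ∀ A, ∀ y ∈ K, |f A y| ≤ C * ‖A‖ := by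
  have hb : ∀ z : S, ∃ C, 0 ≤ C ∧ (z ∈ centers n S → ∀ (A : DiffOp n r S) (p : S),
      p ∈ (ch n z).source → p ∈ (ch n x).source →
      ch n z p ∈ piece n S z → ch n x p ∈ K →
      |f A (ch n x p)| ≤ C * ‖A‖) := by
    intro z
    by_cases hz : z ∈ centers n S
    · obtain ⟨G, hG, hle⟩ := h z hz
      have hcl : IsClosed ((ch n x).symm '' K) := (hK.image_of_continuousOn
        ((ch n x).continuousOn_symm.mono hKx)).isClosed
      have hKz : IsCompact (piece n S z ∩ (ch n z).symm ⁻¹' ((ch n x).symm '' K)) :=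
        (isCompact_piece z).of_isClosed_subset
          (((ch n z).continuousOn_symm.mono (piece_subset z)).preimage_isClosed_of_isClosed
            (isCompact_piece z).isClosed hcl) Set.inter_subset_left
      obtain ⟨C, hC⟩ := hKz.exists_bound_of_continuousOn (hG.mono (by
        rintro q ⟨hq1, y, hy, hq2⟩
        refine ⟨piece_subset z hq1, ?_⟩
        rw [← hq2]
        exact (ch n x).map_target (hKx hy)))
      refine ⟨|C|, abs_nonneg _, fun _ A p hpz hpx hp hpK => (hle A p hpz hpx hp).trans ?_⟩
      gcongr
      refine ((le_abs_self _).trans (hC _ ⟨hp, _, hpK, ?_⟩)).trans (le_abs_self C)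
      rw [(ch n x).left_inv hpx, (ch n z).left_inv hpz]
    · exact ⟨0, le_rfl, fun hz' => absurd hz' hz⟩
  choose C hC0 hC using hb
  refine ⟨∑ z ∈ centers n S, C z, sum_nonneg fun z _ => hC0 z, fun A y hy => ?_⟩
  obtain ⟨z, hz, hp, hpz⟩ := exists_mem_piece n ((ch n x).symm y)
  have hyx := hKx hy
  have h1 := hC z hz A _ hp ((ch n x).map_target hyx) hpz
    (by rwa [(ch n x).right_inv hyx])
  rw [(ch n x).right_inv hyx] at h1
  exact h1.trans (mul_le_mul_of_nonneg_right
    (single_le_sum (f := C) (fun z _ => hC0 z) hz) (norm_nonneg _))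

theorem isOpen_overlap (x z : S) : IsOpen {q : Rn n | q ∈ (ch n z).target ∧
    (ch n z).symm q ∈ (ch n x).source} :=
  (ch n z).isOpen_inter_preimage_symm (ch n x).open_source

theorem contDiffOn_transition (x z : S) :
    ContDiffOn ℝ ∞ (ch n x ∘ (ch n z).symm)
      {q : Rn n | q ∈ (ch n z).target ∧
        (ch n z).symm q ∈ (ch n x).source} := fun q hq => by
  have := contDiffAt_transition (n := n) z x ((ch n z).map_target hq.1) hq.2
  rw [(ch n z).right_inv hq.1] at this
  exact this.contDiffWithinAt

theorem abs_sum_mul_le {ι : Type*} (t : Finset ι) {c q : ι → ℝ} {N : ℝ} (h : ∀ i ∈ t, |c i| ≤ N) :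
    |∑ i ∈ t, c i * q i| ≤ (∑ i ∈ t, |q i|) * N := by
  rw [sum_mul]
  refine (abs_sum_le_sum_abs _ _).trans (sum_le_sum fun i hi => ?_)
  rw [abs_mul, mul_comm]
  exact mul_le_mul_of_nonneg_left (h i hi) (abs_nonneg _)

theorem abs_sum_sum_mul_le {c q : Fin n → Fin n → ℝ} {N : ℝ} (h : ∀ i j, |c i j| ≤ N) :
    |∑ i, ∑ j, c i j * q i j| ≤ (∑ i, ∑ j, |q i j|) * N := by
  rw [sum_mul]
  exact (abs_sum_le_sum_abs _ _).trans
    (sum_le_sum fun i _ => abs_sum_mul_le _ fun j _ => h i j)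

theorem DiffOp.abs_coef_le (A : DiffOp n r S) {z : S} (hz : z ∈ centers n S)
    {y : Rn n} (hy : y ∈ piece n S z) : (∀ i j, |(A.coef z y).1 i j| ≤ ‖A‖) ∧
      (∀ i, |(A.coef z y).2.1 i| ≤ ‖A‖) ∧ |(A.coef z y).2.2| ≤ ‖A‖ := by
  have h := A.norm_coef_le hz hy
  exact ⟨fun i j => (((norm_le_pi_norm (_ : Fin n → ℝ) j).trans
    (norm_le_pi_norm (A.coef z y).1 i)).trans (norm_fst_le _)).trans h,
    fun i => ((norm_le_pi_norm (A.coef z y).2.1 i).trans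
      ((norm_fst_le _).trans (norm_snd_le (A.coef z y)))).trans h,
    ((norm_snd_le (A.coef z y).2).trans (norm_snd_le _)).trans h⟩

theorem DiffOp.abs_pd_coef_le (A : DiffOp n r S) (hr : 1 ≤ r) {z : S} (hz : z ∈ centers n S)
    {y : Rn n} (hy : y ∈ piece n S z) (s i j : Fin n) :
    |pd s (fun y => (A.coef z y).1 i j) y| ≤ ‖A‖ := by
  have hd : HasFDerivAt (A.coef z) (fderiv ℝ (A.coef z) y) y :=
    (((A.contDiffOn_coef z).contDiffAt ((ch n z).open_target.mem_nhds
      (piece_subset z hy))).differentiableAt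
      (by exact_mod_cast Nat.one_le_iff_ne_zero.1 hr)).hasFDerivAt
  have h1 : HasFDerivAt (fun y => (A.coef z y).1 i j) _ y :=
    (hasFDerivAt_pi'.1 ((hasFDerivAt_pi'.1 hd.fst) i)) j
  have h2 := A.norm_fderiv_coef_le hr hz hy
  rw [pd, h1.fderiv]
  have h3 : ‖fderiv ℝ (A.coef z) y (EuclideanSpace.single s 1)‖ ≤ ‖A‖ := by
    refine ((fderiv ℝ (A.coef z) y).le_opNorm _).trans ?_
    simpa using h2
  exact (((norm_le_pi_norm (_ : Fin n → ℝ) j).trans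
    (norm_le_pi_norm (fderiv ℝ (A.coef z) y (EuclideanSpace.single s 1)).1 i)).trans
    (norm_fst_le _)).trans h3

/-- On compact subsets of charts, the coefficients and the first derivatives of the leading
coefficients are bounded by the norm of the operator. -/
theorem DiffOp.exists_coef_bound (hr : 1 ≤ r) {x : S} {K : Set (Rn n)} (hK : IsCompact K)
    (hKx : K ⊆ (ch n x).target) : ∃ C, 0 ≤ C ∧ ∀ A : DiffOp n r S, ∀ y ∈ K,
      (∀ i j, |(A.coef x y).1 i j| ≤ C * ‖A‖) ∧ (∀ i, |(A.coef x y).2.1 i| ≤ C * ‖A‖) ∧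
      |(A.coef x y).2.2| ≤ C * ‖A‖ ∧
      ∀ s i j, |pd s (fun z => (A.coef x z).1 i j) y| ≤ C * ‖A‖ := by
  set T : S → Fin n → Fin n → Rn n → ℝ := fun z i k =>
    pd i (fun q => (ch n x ∘ (ch n z).symm) q k) with hTdef
  have hT1 : ∀ z i k, ContDiffOn ℝ 2 (T z i k)
      {q : Rn n | q ∈ (ch n z).target ∧
        (ch n z).symm q ∈ (ch n x).source} := fun z i k =>
    contDiffOn_pd (isOpen_overlap x z) i ((EuclideanSpace.proj (𝕜 := ℝ) k :
      Rn n →L[ℝ] ℝ).contDiff.comp_contDiffOn (contDiffOn_transition x z)) (by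
        exact WithTop.coe_le_coe.2 le_top)
  have hT2 : ∀ z i j k, ContinuousOn (pd j (T z i k))
      {q : Rn n | q ∈ (ch n z).target ∧
        (ch n z).symm q ∈ (ch n x).source} := fun z i j k =>
    (contDiffOn_pd (m := 1) (isOpen_overlap x z) j (hT1 z i k) (by norm_num)).continuousOn
  have b1 : ∀ k l, ∃ C, 0 ≤ C ∧ ∀ A : DiffOp n r S, ∀ y ∈ K, |(A.coef x y).1 k l| ≤ C * ‖A‖ := by
    refine fun k l => exists_bound_of_pieces hK hKx _ fun z hz =>
      ⟨fun q => ∑ i, ∑ j, |T z i k q * T z j l q|, ?_, fun A p hpz hpx hp => ?_⟩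
    rotate_left
    · rw [A.coef_change z x hpz hpx]
      exact abs_sum_sum_mul_le (A.abs_coef_le hz hp).1
    · exact continuousOn_finsetSum _ fun i _ => continuousOn_finsetSum _ fun j _ =>
        ((hT1 z i k).continuousOn.mul (hT1 z j l).continuousOn).abs
  have b2 : ∀ k, ∃ C, 0 ≤ C ∧ ∀ A : DiffOp n r S, ∀ y ∈ K, |(A.coef x y).2.1 k| ≤ C * ‖A‖ := by
    refine fun k => exists_bound_of_pieces hK hKx _ fun z hz =>
      ⟨fun q => (∑ i, ∑ j, |pd i (T z j k) q|) + ∑ i, |T z i k q|, ?_,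
      fun A p hpz hpx hp => ?_⟩
    rotate_left
    · rw [A.coef_change z x hpz hpx]
      refine (abs_add_le _ _).trans ((add_le_add (abs_sum_sum_mul_le (A.abs_coef_le hz hp).1)
        (abs_sum_mul_le univ fun i _ => (A.abs_coef_le hz hp).2.1 i)).trans_eq
          (add_mul _ _ _).symm)
    · exact (continuousOn_finsetSum _ fun i _ => continuousOn_finsetSum _ fun j _ =>
        (hT2 z j i k).abs).add (continuousOn_finsetSum _ fun i _ => (hT1 z i k).continuousOn.abs)
  have b3 : ∃ C, 0 ≤ C ∧ ∀ A : DiffOp n r S, ∀ y ∈ K, |(A.coef x y).2.2| ≤ C * ‖A‖ := by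
    refine exists_bound_of_pieces hK hKx _ fun z hz => ⟨fun _ => 1, continuousOn_const,
      fun A p hpz hpx hp => ?_⟩
    rw [A.coef_change z x hpz hpx, one_mul]
    exact (A.abs_coef_le hz hp).2.2
  have b4 : ∀ s k l, ∃ C, 0 ≤ C ∧ ∀ A : DiffOp n r S, ∀ y ∈ K,
      |pd s (fun z => (A.coef x z).1 k l) y| ≤ C * ‖A‖ := by
    intro s k l
    refine exists_bound_of_pieces hK hKx _ fun z hz => ⟨fun q => ∑ m,
      ((∑ i, ∑ j, |T z i k q * pd m (T z j l) q + T z j l q * pd m (T z i k) q|) +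
        ∑ i, ∑ j, |T z i k q * T z j l q|) *
      |pd s (fun y => (ch n z ∘ (ch n x).symm) y m)
        ((ch n x ∘ (ch n z).symm) q)|, ?_,
      fun A p hpz hpx hp => ?_⟩
    rotate_left
    · set τ := ch n x ∘ (ch n z).symm with hτ
      set σ := ch n z ∘ (ch n x).symm with hσ
      set N := {q : Rn n | q ∈ (ch n z).target ∧
        (ch n z).symm q ∈ (ch n x).source} with hN
      have hNo : IsOpen N := isOpen_overlap x z
      have hqN : ch n z p ∈ N := ⟨(ch n z).map_source hpz, by
        rwa [(ch n z).left_inv hpz]⟩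
      have hστ : σ (ch n x p) = ch n z p := by
        simp only [hσ, comp_apply, (ch n x).left_inv hpx]
      set F : Rn n → ℝ := fun q => ∑ i, ∑ j, (A.coef z q).1 i j *
        (T z i k q * T z j l q) with hF
      have hev : (fun y => (A.coef x y).1 k l) =ᶠ[𝓝 (ch n x p)] F ∘ σ := by
        have ho := (ch n x).isOpen_inter_preimage_symm (ch n z).open_source
        filter_upwards [ho.mem_nhds ⟨(ch n x).map_source hpx, by
          rwa [Set.mem_preimage, (ch n x).left_inv hpx]⟩] with y hy
        have := A.coef_change z x hy.2 ((ch n x).map_target hy.1)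
        rw [(ch n x).right_inv hy.1] at this
        rw [this]
        rfl
      have had : ∀ i j, DifferentiableAt ℝ (fun q => (A.coef z q).1 i j) (ch n z p) :=
        fun i j => by
          have h1 := (A.contDiffOn_coef z).contDiffAt ((ch n z).open_target.mem_nhds hqN.1)
          have h2 := h1.differentiableAt (by exact_mod_cast Nat.one_le_iff_ne_zero.1 hr)
          exact (differentiableAt_pi.1 (differentiableAt_pi.1 h2.fst i)) j
      have hTd : ∀ i k, DifferentiableAt ℝ (T z i k) (ch n z p) :=
        fun i k => ((hT1 z i k).contDiffAt (hNo.mem_nhds hqN)).differentiableAt (by simp)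
      have hd2 : ∀ i j, DifferentiableAt ℝ (fun q => (A.coef z q).1 i j *
          (T z i k q * T z j l q)) (ch n z p) := fun i j =>
        (had i j).mul ((hTd i k).mul (hTd j l))
      have hd1 : ∀ i, DifferentiableAt ℝ (fun q => ∑ j, (A.coef z q).1 i j *
          (T z i k q * T z j l q)) (ch n z p) := fun i =>
        DifferentiableAt.fun_sum fun j _ => hd2 i j
      have hFd : DifferentiableAt ℝ F (ch n z p) :=
        DifferentiableAt.fun_sum fun i _ => hd1 i
      have hσd : DifferentiableAt ℝ σ (ch n x p) :=
        (contDiffAt_transition x z hpx hpz).differentiableAt (by simp)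
      rw [pd_congr hev, pd_comp s (by rwa [hστ]) hσd, hστ, sum_mul]
      refine (abs_sum_le_sum_abs _ _).trans (sum_le_sum fun m _ => ?_)
      have hFm : pd m F (ch n z p) =
          (∑ i, ∑ j, (A.coef z (ch n z p)).1 i j *
            (T z i k (ch n z p) *
              pd m (T z j l) (ch n z p) +
              T z j l (ch n z p) *
              pd m (T z i k) (ch n z p))) +
          ∑ i, ∑ j, pd m (fun q => (A.coef z q).1 i j) (ch n z p) *
            (T z i k (ch n z p) *
              T z j l (ch n z p)) := by
        rw [hF, pd_sum _ fun i _ => hd1 i]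
        simp only [← sum_add_distrib]
        refine sum_congr rfl fun i _ => ?_
        rw [pd_sum _ fun j _ => hd2 i j]
        refine sum_congr rfl fun j _ => ?_
        have hm : DifferentiableAt ℝ (fun q => T z i k q * T z j l q) (ch n z p) :=
          (hTd i k).mul (hTd j l)
        rw [pd_mul (had i j) hm, pd_mul (hTd i k) (hTd j l)]
        ring
      have hσm : |pd s (fun z => σ z m) (ch n x p)| =
          |pd s (fun z => σ z m) (τ (ch n z p))| := by
        rw [hτ, comp_apply, (ch n z).left_inv hpz]
      rw [abs_mul, hFm, hσm, mul_right_comm]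
      refine mul_le_mul_of_nonneg_right ?_ (abs_nonneg _)
      rw [add_mul]
      exact (abs_add_le _ _).trans (add_le_add (abs_sum_sum_mul_le (A.abs_coef_le hz hp).1)
        (abs_sum_sum_mul_le fun i j => A.abs_pd_coef_le hr hz hp m i j))
    · refine continuousOn_finsetSum _ fun m _ => ContinuousOn.mul (ContinuousOn.add ?_ ?_) ?_
      · exact continuousOn_finsetSum _ fun i _ => continuousOn_finsetSum _ fun j _ =>
          (((hT1 z i k).continuousOn.mul (hT2 z j m l)).add
            ((hT1 z j l).continuousOn.mul (hT2 z i m k))).abs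
      · exact continuousOn_finsetSum _ fun i _ => continuousOn_finsetSum _ fun j _ =>
          ((hT1 z i k).continuousOn.mul (hT1 z j l).continuousOn).abs
      · have h1 := (contDiffOn_pd (m := 1) (isOpen_overlap z x) s
          ((EuclideanSpace.proj (𝕜 := ℝ) m : Rn n →L[ℝ] ℝ).contDiff.comp_contDiffOn
            (contDiffOn_transition z x)) (WithTop.coe_le_coe.2 le_top)).continuousOn
        refine (h1.comp (contDiffOn_transition x z).continuousOn fun q hq => ?_).abs
        refine ⟨(ch n x).map_source hq.2, ?_⟩
        rw [comp_apply, (ch n x).left_inv hq.2]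
        exact (ch n z).map_target hq.1
  choose C1 h1 h1' using b1
  choose C2 h2 h2' using b2
  obtain ⟨C3, h3, h3'⟩ := b3
  choose C4 h4 h4' using b4
  have s1 : ∀ i j, C1 i j ≤ ∑ i, ∑ j, C1 i j := fun i j =>
    (single_le_sum (f := C1 i) (fun j _ => h1 i j) (mem_univ j)).trans
      (single_le_sum (f := fun i => ∑ j, C1 i j)
        (fun i _ => sum_nonneg fun j _ => h1 i j) (mem_univ i))
  have s2 : ∀ i, C2 i ≤ ∑ i, C2 i := fun i =>
    single_le_sum (f := C2) (fun j _ => h2 j) (mem_univ i)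
  have s4 : ∀ s i j, C4 s i j ≤ ∑ s, ∑ i, ∑ j, C4 s i j := fun s i j =>
    ((single_le_sum (f := C4 s i) (fun j _ => h4 s i j) (mem_univ j)).trans
      (single_le_sum (f := fun i => ∑ j, C4 s i j)
        (fun i _ => sum_nonneg fun j _ => h4 s i j) (mem_univ i))).trans
      (single_le_sum (f := fun s => ∑ i, ∑ j, C4 s i j) (fun s _ => sum_nonneg
        fun i _ => sum_nonneg fun j _ => h4 s i j) (mem_univ s))
  have p1 : 0 ≤ ∑ i, ∑ j, C1 i j := sum_nonneg fun i _ => sum_nonneg fun j _ => h1 i j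
  have p2 : 0 ≤ ∑ i, C2 i := sum_nonneg fun i _ => h2 i
  have p4 : 0 ≤ ∑ s, ∑ i, ∑ j, C4 s i j := sum_nonneg fun s _ => sum_nonneg fun i _ =>
    sum_nonneg fun j _ => h4 s i j
  refine ⟨(∑ i, ∑ j, C1 i j) + (∑ i, C2 i) + C3 + ∑ s, ∑ i, ∑ j, C4 s i j, by positivity,
    fun A y hy => ⟨fun i j => (h1' i j A y hy).trans ?_, fun i => (h2' i A y hy).trans ?_,
      (h3' A y hy).trans ?_, fun s i j => (h4' s i j A y hy).trans ?_⟩⟩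
  · gcongr; linarith [s1 i j]
  · gcongr; linarith [s2 i]
  · gcongr; linarith
  · gcongr; linarith [s4 s i j]

end Bounds

section FormBound
variable [IsManifold (𝓡 n) ∞ S] [CompactSpace S] [MeasurableSpace S] [BorelSpace S]

/-- The size of a function and of its first derivatives in a chart. -/
noncomputable def chartJet (x : S) (u : S → ℝ) (y : Rn n) : ℝ :=
  |u ((ch n x).symm y)| + ∑ i, |pd i (u ∘ (ch n x).symm) y|

theorem chartJet_nonneg (x : S) (u : S → ℝ) (y : Rn n) : 0 ≤ chartJet x u y :=
  add_nonneg (abs_nonneg _) (sum_nonneg fun _ _ => abs_nonneg _)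

theorem abs_le_chartJet (x : S) (u : S → ℝ) (y : Rn n) : |u ((ch n x).symm y)| ≤ chartJet x u y :=
  le_add_of_nonneg_right (sum_nonneg fun _ _ => abs_nonneg _)

theorem abs_add_abs_pd_le_chartJet (x : S) (u : S → ℝ) (y : Rn n) (i : Fin n) :
    |u ((ch n x).symm y)| + |pd i (u ∘ (ch n x).symm) y| ≤ chartJet x u y := by
  rw [chartJet]
  gcongr
  exact single_le_sum (f := fun i => |pd i (u ∘ (ch n x).symm) y|)
    (fun _ _ => abs_nonneg _) (mem_univ i)

theorem continuousOn_chartJet (x : S) {u : S → ℝ} (hu : SmoothFn[n] 2 u) :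
    ContinuousOn (chartJet (n := n) x u) (ch n x).target := by
  have h := contDiffOn_comp_chart_symm two_le_infty hu x
  exact h.continuousOn.abs.add (continuousOn_finsetSum _ fun i _ =>
    (contDiffOn_pd (m := 1) (ch n x).open_target i h (by norm_num)).continuousOn.abs)

theorem chartJet_sq_le (x : S) (u : S → ℝ) (y : Rn n) :
    chartJet x u y ^ 2 ≤ (2 + 2 * n) * (u ((ch n x).symm y) ^ 2 +
      ∑ i, pd i (u ∘ (ch n x).symm) y ^ 2) := by
  have h1 := sq_sum_le_card_mul_sum_sq (s := univ)
    (f := fun i : Fin n => |pd i (u ∘ (ch n x).symm) y|)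
  simp only [sq_abs, Finset.card_univ, Fintype.card_fin] at h1
  have h2 := add_sq_le (a := |u ((ch n x).symm y)|)
    (b := ∑ i, |pd i (u ∘ (ch n x).symm) y|)
  rw [sq_abs] at h2
  have h3 : 0 ≤ ∑ i, pd i (u ∘ (ch n x).symm) y ^ 2 :=
    sum_nonneg fun _ _ => sq_nonneg _
  have h4 : 0 ≤ (n : ℝ) * u ((ch n x).symm y) ^ 2 := by positivity
  rw [chartJet]
  linarith

/-- The energy of a function with respect to an operator and a measure. -/
noncomputable def DiffOp.energy (A : DiffOp n r S) (ν : Measure S) (u : S → ℝ) : ℝ :=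
  (∫ p, A.grad2 u u p ∂ν) + ∫ p, u p ^ 2 ∂ν

theorem DiffOp.exists_chartJet_bound {A : DiffOp n r S} (hell : A.IsElliptic) {ν : Measure S}
    [IsFiniteMeasure ν] {x : S} {ρ : Rn n → ℝ} (hρ : IsChartDensity ν x ρ) {K : Set (Rn n)}
    (hK : IsCompact K) (hKx : K ⊆ (ch n x).target) : ∃ C, 0 ≤ C ∧ ∀ u : S → ℝ,
      SmoothFn[n] 2 u → ∫ y in K, chartJet x u y ^ 2 ≤ C * A.energy ν u := by
  choose θ hθc hθ0 hθ using fun i : Fin n => DiffOp.exists_weight hell hρ i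
  set Ω := (ch n x).target with hΩ
  have hinv : ContinuousOn (fun y => (ρ y)⁻¹ + ∑ i, (θ i y)⁻¹) K :=
    ((hρ.continuousOn.inv₀ fun y hy => (hρ.pos y hy).ne').add (continuousOn_finsetSum _ fun i _ =>
      (hθc i).inv₀ fun y hy => (hθ0 i y hy).ne')).mono hKx
  obtain ⟨M, hM⟩ := hK.exists_bound_of_continuousOn hinv
  have hM' : ∀ y ∈ K, 1 ≤ |M| * ρ y ∧ ∀ i, 1 ≤ |M| * θ i y := fun y hy => by
    have h1 := (le_abs_self _).trans ((hM y hy).trans (le_abs_self M))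
    have h2 := inv_pos.2 (hρ.pos y (hKx hy))
    have h3 : ∀ i ∈ univ, 0 ≤ (θ i y)⁻¹ := fun i _ => (inv_pos.2 (hθ0 i y (hKx hy))).le
    constructor
    · rw [← inv_mul_cancel₀ (hρ.pos y (hKx hy)).ne']
      refine mul_le_mul_of_nonneg_right ?_ (hρ.pos y (hKx hy)).le
      linarith [sum_nonneg h3]
    · intro i
      rw [← inv_mul_cancel₀ (hθ0 i y (hKx hy)).ne']
      refine mul_le_mul_of_nonneg_right ?_ (hθ0 i y (hKx hy)).le
      linarith [single_le_sum h3 (mem_univ i)]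
  refine ⟨(2 + 2 * n) * |M| * (1 + n), by positivity, fun u hu => ?_⟩
  obtain ⟨i1, e1⟩ := hρ.integrableOn (F := fun p => u p ^ 2) (hu.continuous.pow 2)
  have i2 : IntegrableOn (fun y => ∑ i, θ i y * pd i (u ∘ (ch n x).symm) y ^ 2) Ω :=
    integrable_finsetSum _ fun i _ => (hθ i u hu).1
  have i3 : IntegrableOn (fun y => (2 + 2 * n) * |M| * (ρ y * u ((ch n x).symm y) ^ 2 +
      ∑ i, θ i y * pd i (u ∘ (ch n x).symm) y ^ 2)) Ω := (i1.add i2).const_mul _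
  have hE1 : ∀ p, 0 ≤ A.grad2 u u p := fun p => DiffOp.grad2_self_nonneg hell u p
  have hE2 : 0 ≤ ∫ p, A.grad2 u u p ∂ν := integral_nonneg hE1
  have hE3 : 0 ≤ ∫ p, u p ^ 2 ∂ν := integral_nonneg fun p => sq_nonneg _
  calc ∫ y in K, chartJet x u y ^ 2
      ≤ ∫ y in K, (2 + 2 * n) * |M| * (ρ y * u ((ch n x).symm y) ^ 2 +
          ∑ i, θ i y * pd i (u ∘ (ch n x).symm) y ^ 2) := by
        refine setIntegral_mono_on (((continuousOn_chartJet x hu).mono hKx).pow 2 |>.integrableOn_compact hK)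
          (i3.mono_set hKx) hK.measurableSet fun y hy => (chartJet_sq_le x u y).trans ?_
        rw [mul_assoc]
        refine mul_le_mul_of_nonneg_left ?_ (by positivity)
        rw [mul_add, mul_sum]
        refine add_le_add ?_ (sum_le_sum fun i _ => ?_)
        · rw [← mul_assoc]
          exact le_mul_of_one_le_left (sq_nonneg _) (hM' y hy).1
        · rw [← mul_assoc]
          exact le_mul_of_one_le_left (sq_nonneg _) ((hM' y hy).2 i)
    _ ≤ ∫ y in Ω, (2 + 2 * n) * |M| * (ρ y * u ((ch n x).symm y) ^ 2 +
          ∑ i, θ i y * pd i (u ∘ (ch n x).symm) y ^ 2) := by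
        refine setIntegral_mono_set i3 ((ae_restrict_iff' (ch n x).open_target.measurableSet).2
          (Eventually.of_forall fun y hy => ?_)) (Eventually.of_forall hKx)
        have h1 := hρ.pos y hy
        have h2 : 0 ≤ ∑ i, θ i y * pd i (u ∘ (ch n x).symm) y ^ 2 :=
          sum_nonneg fun i _ => mul_nonneg (hθ0 i y hy).le (sq_nonneg _)
        simp only [Pi.zero_apply]
        positivity
    _ ≤ (2 + 2 * n) * |M| * (1 + n) * A.energy ν u := by
        rw [integral_const_mul, integral_add i1 i2, e1,
          integral_finsetSum _ fun i _ => (hθ i u hu).1, mul_assoc _ (1 + (n : ℝ))]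
        refine mul_le_mul_of_nonneg_left ?_ (by positivity)
        have h1 : ∫ p in (ch n x).source, u p ^ 2 ∂ν ≤ ∫ p, u p ^ 2 ∂ν :=
          setIntegral_le_integral (integrable_of_compact (hu.continuous.pow 2))
            (Eventually.of_forall fun p => sq_nonneg _)
        have h2 := sum_le_sum fun i (_ : i ∈ univ) => (hθ i u hu).2
        rw [Finset.sum_const, Finset.card_univ, Fintype.card_fin, nsmul_eq_mul] at h2
        have h3 : 0 ≤ (n : ℝ) * ∫ p, u p ^ 2 ∂ν := by positivity
        rw [DiffOp.energy]
        linarith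

variable [T2Space S]

/-- The form of an arbitrary operator is bounded with respect to the energy of a fixed one: the
contribution of a chart. -/
theorem DiffOp.exists_local_form_bound {A₀ : DiffOp n r S} (hr : 2 ≤ r) (hell : A₀.IsElliptic)
    {ν : Measure S} [IsFiniteMeasure ν] (hA₀ : A₀.IsSelfAdjointWrt ν) {x : S} {ρ : Rn n → ℝ}
    (hρ : IsChartDensity ν x ρ) {χ : S → ℝ} (hχ : SmoothFn[n] ∞ χ)
    (hχs : tsupport χ ⊆ (ch n x).source) :
    ∃ C, 0 ≤ C ∧ ∀ (A : DiffOp n r S) (u v : S → ℝ), SmoothFn[n] 2 u →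
      SmoothFn[n] 2 v →
      |∫ p, A.op u p * (χ p * v p) ∂ν| ≤ C * ‖A‖ * (A₀.energy ν u + A₀.energy ν v) := by
  set Ω := (ch n x).target with hΩdef
  have hΩ : IsOpen Ω := (ch n x).open_target
  have hK := isCompact_image_tsupport (n := n) hχs
  set K := ch n x '' tsupport χ
  have hKx : K ⊆ Ω := image_tsupport_subset hχs
  obtain ⟨C₁, hC₁, hjet⟩ := DiffOp.exists_chartJet_bound hell hρ hK hKx
  obtain ⟨C₂, hC₂, hcoef⟩ := DiffOp.exists_coef_bound (r := r) (by lia) hK hKx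
  have hρ1 : ContDiffOn ℝ 1 ρ Ω := (DiffOp.contDiffOn_density hr hell hA₀ hρ).1
  set g : Rn n → ℝ := fun y => ρ y * pullChart x χ y with hg
  have hgK : tsupport g ⊆ K := tsupport_mul_subset_right.trans (tsupport_pullChart hχs)
  have hg1 : ContDiff ℝ 1 g := contDiff_of_tsupport_subset hΩ
    (hρ1.mul ((contDiffOn_pullChart le_rfl hχ).of_le one_le_infty)) (hgK.trans hKx)
  have hgc : HasCompactSupport g := (hasCompactSupport_pullChart hχs).mul_left
  obtain ⟨M, hM⟩ := hK.exists_bound_of_continuousOn (f := fun y => |g y| + ∑ i, |pd i g y|)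
    (hg1.continuous.abs.add (continuous_finsetSum _ fun i _ =>
      (contDiff_pd (m := 0) i hg1 (by simp)).continuous.abs)).continuousOn
  have hgM : ∀ y ∈ K, |g y| ≤ |M| ∧ ∀ i, |pd i g y| ≤ |M| := fun y hy => by
    have h1 := (le_abs_self _).trans ((hM y hy).trans (le_abs_self M))
    have h3 : ∀ i ∈ univ, 0 ≤ |pd i g y| := fun i _ => abs_nonneg _
    exact ⟨by linarith [sum_nonneg h3], fun i => by
      linarith [single_le_sum h3 (mem_univ i), abs_nonneg (g y)]⟩
  refine ⟨(2 * (n * n) + n + 1) * (C₂ * |M| * C₁), by positivity, fun A u v hu hv => ?_⟩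
  set w := u ∘ (ch n x).symm with hw
  set η : Rn n → ℝ := fun y => g y * (v ∘ (ch n x).symm) y with hη
  have hv1 := contDiffOn_comp_chart_symm two_le_infty hv x
  have hηK : tsupport η ⊆ K := tsupport_mul_subset_left.trans hgK
  have hη1 : ContDiff ℝ 1 η := contDiff_of_tsupport_subset hΩ
    (hg1.contDiffOn.mul (hv1.of_le (by norm_num))) (hηK.trans hKx)
  have hηt : IsContTest Ω η := ⟨hη1.continuous, hgc.mul_right, hηK.trans hKx⟩
  have e : ∫ p, A.op u p * (χ p * v p) ∂ν = ∫ y, A.op u ((ch n x).symm y) * η y := by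
    have := hρ.integral_mul_extendChart (G := fun p => A.op u p * v p)
      ((A.continuous_op hu).mul hv.continuous) (contDiffOn_pullChart le_rfl hχ).continuousOn
      (hasCompactSupport_pullChart hχs) ((tsupport_pullChart hχs).trans hKx)
    rw [extendChart_pullChart hχs] at this
    rw [show (fun p => A.op u p * (χ p * v p)) = fun p => A.op u p * v p * χ p from
      funext fun p => by ring, this]
    exact congrArg _ (funext fun y => by simp only [hη, hg, comp_apply]; ring)
  rw [e, ← A.integral_weak_form_of_smooth (by lia) hu hη1 hηt]
  set J := C₂ * ‖A‖ * |M| * (C₁ * (A₀.energy ν u + A₀.energy ν v)) with hJ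
  have key : ∀ (s : ℝ) (f : Rn n → ℝ), 0 ≤ s → (∀ y ∉ K, f y = 0) →
      (∀ y ∈ K, |f y| ≤ s * (C₂ * ‖A‖ * |M|) * (chartJet x u y * chartJet x v y)) → |∫ y, f y| ≤ s * J := by
    intro s f hs h0 hf
    have i1 : IntegrableOn (fun y => chartJet x u y ^ 2) K :=
      (((continuousOn_chartJet x hu).mono hKx).pow 2).integrableOn_compact hK
    have i2 : IntegrableOn (fun y => chartJet x v y ^ 2) K :=
      (((continuousOn_chartJet x hv).mono hKx).pow 2).integrableOn_compact hK
    have i3 : IntegrableOn (fun y => s * (C₂ * ‖A‖ * |M|) * (chartJet x u y ^ 2 + chartJet x v y ^ 2)) K :=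
      (i1.add i2).const_mul _
    rw [← setIntegral_eq_integral_of_forall_compl_eq_zero h0, ← norm_eq_abs]
    refine (norm_integral_le_of_norm_le (f := f) i3 ((ae_restrict_iff' hK.measurableSet).2
      (Eventually.of_forall fun y hy => (hf y hy).trans ?_))).trans ?_
    · refine mul_le_mul_of_nonneg_left ?_ (by positivity)
      nlinarith [sq_nonneg (chartJet x u y - chartJet x v y), chartJet_nonneg x u y, chartJet_nonneg x v y]
    · rw [integral_const_mul, integral_add i1 i2, hJ,
        ← mul_assoc s (C₂ * ‖A‖ * |M|)]
      refine mul_le_mul_of_nonneg_left ?_ (by positivity)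
      rw [mul_add]
      exact add_le_add (hjet u hu) (hjet v hv)
  have hηb : ∀ y ∈ K, |η y| ≤ |M| * chartJet x v y := fun y hy => by
    rw [hη, abs_mul]
    exact mul_le_mul (hgM y hy).1 (abs_le_chartJet x v y) (abs_nonneg _) (abs_nonneg _)
  have hηd : ∀ y ∈ K, ∀ i, |pd i η y| ≤ |M| * chartJet x v y := fun y hy i => by
    rw [hη, pd_mul (hg1.differentiable (by simp) y)
      ((hv1.contDiffAt (hΩ.mem_nhds (hKx hy))).differentiableAt (by simp))]
    refine (abs_add_le _ _).trans ?_
    rw [abs_mul (g y), abs_mul _ (pd i g y)]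
    have h1 := mul_le_mul_of_nonneg_right (hgM y hy).1
      (abs_nonneg (pd i (v ∘ (ch n x).symm) y))
    have h2 := mul_le_mul_of_nonneg_left ((hgM y hy).2 i)
      (abs_nonneg ((v ∘ (ch n x).symm) y))
    have h3 := mul_le_mul_of_nonneg_left (abs_add_abs_pd_le_chartJet x v y i) (abs_nonneg M)
    simp only [comp_apply] at h2 ⊢
    linarith
  have hη0 : ∀ y ∉ K, η y = 0 := fun y hy => image_eq_zero_of_notMem_tsupport fun h => hy (hηK h)
  have hpw : ∀ y i, |pd i w y| ≤ chartJet x u y := fun y i =>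
    (le_add_of_nonneg_left (abs_nonneg _)).trans (abs_add_abs_pd_le_chartJet x u y i)
  have hb : ∀ y ∈ K, ∀ s b ζ c d : ℝ, |b| ≤ chartJet x u y → |ζ| ≤ s * (c * d) → d = |M| * chartJet x v y →
      c = C₂ * ‖A‖ → |b * ζ| ≤ s * (C₂ * ‖A‖ * |M|) * (chartJet x u y * chartJet x v y) := by
    rintro y hy s b ζ _ _ h1 h2 rfl rfl
    rw [abs_mul]
    refine (mul_le_mul h1 h2 (abs_nonneg _) (chartJet_nonneg x u y)).trans_eq (by ring)
  have hc2 : ∀ y ∈ K, ∀ a ζ : ℝ, |a| ≤ C₂ * ‖A‖ → |ζ| ≤ |M| * chartJet x v y →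
      |a * ζ| ≤ (C₂ * ‖A‖) * (|M| * chartJet x v y) := fun y hy a ζ h1 h2 => by
    rw [abs_mul]
    exact mul_le_mul h1 h2 (abs_nonneg _) (by positivity)
  have t1 : ∀ i j, |∫ y, pd i w y * pd j (fun z => (A.coef x z).1 j i * η z) y| ≤ 2 * J := by
    refine fun i j => key 2 _ zero_le_two (fun y hy => ?_) fun y hy => ?_
    · rw [image_eq_zero_of_notMem_tsupport fun h => hy (hηK (tsupport_mul_subset_right
        (tsupport_pd_subset j _ h))), mul_zero]
    · refine hb y hy 2 _ _ _ _ (hpw y i) ?_ rfl rfl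
      have had : DifferentiableAt ℝ (fun z => (A.coef x z).1 j i) y := by
        have h1 := ((A.contDiffOn_coef x).contDiffAt (hΩ.mem_nhds (hKx hy))).differentiableAt
          (by exact_mod_cast (by lia : r ≠ 0))
        exact (differentiableAt_pi.1 (differentiableAt_pi.1 h1.fst j)) i
      rw [pd_mul had (hη1.differentiable (by simp) y), mul_comm (η y), two_mul]
      obtain ⟨q1, -, -, q4⟩ := hcoef A y hy
      exact (abs_add_le _ _).trans (add_le_add (hc2 y hy _ _ (q1 j i) (hηd y hy j))
        (hc2 y hy _ _ (q4 j j i) (hηb y hy)))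
  have t2 : ∀ i, |∫ y, pd i w y * ((A.coef x y).2.1 i * η y)| ≤ 1 * J := by
    refine fun i => key 1 _ zero_le_one (fun y hy => by rw [hη0 y hy]; ring) fun y hy => ?_
    exact hb y hy 1 _ _ _ _ (hpw y i) ((hc2 y hy _ _ ((hcoef A y hy).2.1 i) (hηb y hy)).trans_eq
      (one_mul _).symm) rfl rfl
  have t3 : |∫ y, u ((ch n x).symm y) * ((A.coef x y).2.2 * η y)| ≤ 1 * J := by
    refine key 1 _ zero_le_one (fun y hy => by rw [hη0 y hy]; ring) fun y hy => ?_
    exact hb y hy 1 _ _ _ _ (abs_le_chartJet x u y) ((hc2 y hy _ _ (hcoef A y hy).2.2.1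
      (hηb y hy)).trans_eq (one_mul _).symm) rfl rfl
  have s1 : |∑ i, ∑ j, ∫ y, pd i w y * pd j (fun z => (A.coef x z).1 j i * η z) y| ≤
      n * (n * (2 * J)) := by
    refine (abs_sum_le_sum_abs _ _).trans ((sum_le_sum fun i _ =>
      (abs_sum_le_sum_abs _ _).trans (sum_le_sum fun j _ => t1 i j)).trans_eq ?_)
    simp
  have s2 : |∑ i, ∫ y, pd i w y * ((A.coef x y).2.1 i * η y)| ≤ n * (1 * J) :=
    (abs_sum_le_sum_abs _ _).trans ((sum_le_sum fun i _ => t2 i).trans_eq (by simp))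
  refine (abs_add_three _ _ _).trans ?_
  rw [abs_neg]
  refine (add_le_add (add_le_add s1 s2) t3).trans_eq ?_
  rw [hJ]
  ring

theorem DiffOp.exists_form_bound {A₀ : DiffOp n r S} (hr : 2 ≤ r) (hell : A₀.IsElliptic)
    {ν : Measure S} [IsFiniteMeasure ν] (hν : IsVolumeMeasure n ν) (hA₀ : A₀.IsSelfAdjointWrt ν) :
    ∃ C, 0 ≤ C ∧ ∀ (A : DiffOp n r S) (u v : S → ℝ), SmoothFn[n] 2 u →
      SmoothFn[n] 2 v →
      |∫ p, A.op u p * v p ∂ν| ≤ C * ‖A‖ * (A₀.energy ν u + A₀.energy ν v) := by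
  obtain ⟨χ, hχ, hχs, hχ1⟩ := exists_partition n S
  choose C hC hCb using fun z => DiffOp.exists_local_form_bound hr hell hA₀
    (hν.exists_isChartDensity z.1).choose_spec (hχ z) (hχs z)
  refine ⟨∑ z, C z, sum_nonneg fun z _ => hC z, fun A u v hu hv => ?_⟩
  have e : (fun p => A.op u p * v p) = fun p => ∑ z, A.op u p * (χ z p * v p) := funext fun p => by
    rw [← mul_sum, ← sum_mul, hχ1, one_mul]
  have hi : ∀ z, Integrable (fun p => A.op u p * (χ z p * v p)) ν := fun z =>
    integrable_of_compact ((A.continuous_op hu).mul ((hχ z).continuous.mul hv.continuous))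
  rw [e, integral_finsetSum _ fun z _ => hi z, sum_mul, sum_mul]
  exact (abs_sum_le_sum_abs _ _).trans (sum_le_sum fun z _ => hCb z A u v hu hv)

end FormBound

theorem exists_implicit_scalar {E : Type*} [NormedAddCommGroup E] [NormedSpace ℝ E] [CompleteSpace E]
    {k : ℕ∞ω} (hk : k ≠ 0) {F : E × ℝ → ℝ} {x₀ : E} {l₀ d : ℝ} (hF : ContDiffAt ℝ k F (x₀, l₀))
    (hd : HasDerivAt (fun l => F (x₀, l)) d l₀) (hd0 : d ≠ 0) :
    ∃ Λ : E → ℝ, ContDiffAt ℝ k Λ x₀ ∧ ∀ᶠ z in 𝓝 (x₀, l₀), F z = F (x₀, l₀) → Λ z.1 = z.2 := by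
  have hfd : fderiv ℝ F (x₀, l₀) ∘L .inr ℝ E ℝ = ContinuousLinearMap.toSpanSingleton ℝ d := by
    have h1 : HasFDerivAt (fun l : ℝ => F (x₀, l)) (fderiv ℝ F (x₀, l₀) ∘L .inr ℝ E ℝ) l₀ :=
      (hF.differentiableAt hk).hasFDerivAt.comp l₀ (hasFDerivAt_prodMk_right x₀ l₀)
    exact h1.unique hd.hasFDerivAt
  have hif : (fderiv ℝ F (x₀, l₀) ∘L .inr ℝ E ℝ).IsInvertible := by
    refine ⟨ContinuousLinearEquiv.smulLeft (Units.mk0 _ hd0), ?_⟩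
    rw [hfd]
    ext
    simp
  exact ⟨hF.implicitFunction hk hif, hF.contDiffAt_implicitFunction hk hif,
    (hF.eventually_apply_eq_iff_implicitFunction hk hif).mono fun z h => h.1⟩

theorem contDiff_sub_smul_add {E : Type*} [NormedAddCommGroup E] [NormedSpace ℝ E] (k : ℕ∞ω)
    (m c : E) : ContDiff ℝ k fun z : E × ℝ => z.1 - z.2 • m + c := by fun_prop

section Hilbert
variable {H : Type*} [NormedAddCommGroup H] [InnerProductSpace ℝ H] [CompleteSpace H]

/-- A coercive form is an isomorphism onto the dual. -/
theorem exists_equiv_of_isCoercive {M : H →L[ℝ] H →L[ℝ] ℝ} (hM : IsCoercive M) :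
    ∃ e : H ≃L[ℝ] (H →L[ℝ] ℝ), (e : H →L[ℝ] H →L[ℝ] ℝ) = M := by
  refine ⟨hM.continuousLinearEquivOfBilin.trans (InnerProductSpace.toDual ℝ H).toContinuousLinearEquiv, ?_⟩
  ext v w
  simpa using hM.continuousLinearEquivOfBilin_apply v w

/-- A simple eigenvalue of a form depends smoothly on it. -/
theorem exists_contDiffAt_eigenvalue {m B₀ : H →L[ℝ] H →L[ℝ] ℝ} {ℓ : H →L[ℝ] ℝ} {l₀ : ℝ} {h₀ : H}
    (hm : ∀ u v, m u v = m v u) (hB : ∀ u v, B₀ u v = B₀ v u)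
    (hco : IsCoercive (B₀ - l₀ • m + ℓ.smulRight ℓ)) (hh : B₀ h₀ = l₀ • m h₀) (hℓ : ℓ h₀ = 1)
    (hmh : m h₀ h₀ ≠ 0) (k : ℕ∞ω) (hk : k ≠ 0) :
    ∃ Λ : (H →L[ℝ] H →L[ℝ] ℝ) → ℝ, ContDiffAt ℝ k Λ B₀ ∧
      ∀ᶠ z in 𝓝 (B₀, l₀), ∀ h, z.1 h = z.2 • m h → ℓ h ≠ 0 → Λ z.1 = z.2 := by
  set T : (H →L[ℝ] H →L[ℝ] ℝ) × ℝ → H →L[ℝ] H →L[ℝ] ℝ := fun z => z.1 - z.2 • m + ℓ.smulRight ℓ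
    with hT
  have hTc : ContDiff ℝ k T := contDiff_sub_smul_add _ _ _
  obtain ⟨e, he⟩ := exists_equiv_of_isCoercive hco
  have hT0 : T (B₀, l₀) = e := he.symm
  set G : (H →L[ℝ] H →L[ℝ] ℝ) × ℝ → H := fun z => (T z).inverse ℓ with hG
  have hGc : ContDiffAt ℝ k G (B₀, l₀) := by
    have h1 : ContDiffAt ℝ k ContinuousLinearMap.inverse (T (B₀, l₀)) := by
      rw [hT0]; exact contDiffAt_map_inverse e
    exact (h1.comp (B₀, l₀) hTc.contDiffAt).clm_apply contDiffAt_const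
  have hinv : ∀ᶠ z in 𝓝 (B₀, l₀), ∃ e' : H ≃L[ℝ] (H →L[ℝ] ℝ), (e' : H →L[ℝ] H →L[ℝ] ℝ) = T z := by
    have := hTc.continuous.continuousAt (x := (B₀, l₀))
    exact this (by rw [hT0]; exact e.nhds)
  have hTG : ∀ z, (∃ e' : H ≃L[ℝ] (H →L[ℝ] ℝ), (e' : H →L[ℝ] H →L[ℝ] ℝ) = T z) → T z (G z) = ℓ ∧
      ∀ h, T z h = ℓ h • ℓ → h = ℓ h • G z := by
    rintro z ⟨e', h'⟩
    simp only [hG]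
    rw [← h', ContinuousLinearMap.inverse_equiv]
    refine ⟨e'.apply_symm_apply ℓ, fun h hh => ?_⟩
    rw [ContinuousLinearEquiv.coe_coe] at hh
    conv_lhs => rw [← e'.symm_apply_apply h, hh, map_smul]
    rfl
  have hG0 : G (B₀, l₀) = h₀ := by
    have h1 : T (B₀, l₀) h₀ = ℓ h₀ • ℓ := by simp [hT, hh]
    have h2 := (hTG (B₀, l₀) ⟨e, he⟩).2 h₀ h1
    rw [hℓ, one_smul] at h2
    exact h2.symm
  set F : (H →L[ℝ] H →L[ℝ] ℝ) × ℝ → ℝ := fun z => ℓ (G z) with hF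
  have hFc : ContDiffAt ℝ k F (B₀, l₀) := ℓ.contDiff.contDiffAt.comp _ hGc
  have hF0 : F (B₀, l₀) = 1 := by rw [hF]; simp only [hG0, hℓ]
  have hline : ContDiffAt ℝ k (fun l : ℝ => G (B₀, l)) l₀ :=
    hGc.comp l₀ (by fun_prop : ContDiffAt ℝ k (fun l : ℝ => (B₀, l)) l₀)
  have hFl : ∀ᶠ l in 𝓝 l₀, F (B₀, l) = 1 + (l - l₀) * m (G (B₀, l)) h₀ := by
    have ht : Tendsto (fun l : ℝ => (B₀, l)) (𝓝 l₀) (𝓝 (B₀, l₀)) :=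
      (by fun_prop : Continuous fun l : ℝ => (B₀, l)).tendsto l₀
    filter_upwards [ht.eventually hinv] with l hl
    have h1 := congrArg (fun f => f h₀) (hTG _ hl).1
    simp only [hT, _root_.add_apply, _root_.sub_apply, _root_.smul_apply, smul_eq_mul,
      ContinuousLinearMap.smulRight_apply, hℓ, mul_one] at h1
    rw [hB, hh, _root_.smul_apply, smul_eq_mul, hm h₀] at h1
    simp only [hF]
    linarith
  have hder : HasDerivAt (fun l => F (B₀, l)) (m h₀ h₀) l₀ := by
    have h1 : HasDerivAt (fun l => m (G (B₀, l)) h₀) _ l₀ :=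
      ((by fun_prop : Differentiable ℝ fun x => m x h₀).differentiableAt.comp l₀
        (hline.differentiableAt hk)).hasDerivAt
    have h2 := (((hasDerivAt_id l₀).sub_const l₀).mul h1).const_add 1
    simp only [id, sub_self, zero_mul, add_zero, one_mul, hG0] at h2
    exact h2.congr_of_eventuallyEq hFl
  obtain ⟨Λ, hΛ, hΛF⟩ := exists_implicit_scalar hk hFc hder hmh
  refine ⟨Λ, hΛ, ?_⟩
  filter_upwards [hΛF, hinv] with z h1 h2 h h3 h4
  refine h1 ?_
  have h5 : T z h = ℓ h • ℓ := by simp [hT, h3]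
  have h6 := congrArg ℓ ((hTG z h2).2 h h5)
  rw [map_smul, smul_eq_mul] at h6
  rw [hF0]
  exact mul_left_cancel₀ h4 (by rw [mul_one]; exact h6.symm)

end Hilbert

section Dense
variable {V H : Type*} [NormedAddCommGroup V] [InnerProductSpace ℝ V] [NormedAddCommGroup H]
  [InnerProductSpace ℝ H] {ι : V →ₗᵢ[ℝ] H}

theorem exists_extension (hd : DenseRange ι) (F : Type*) [NormedAddCommGroup F] [NormedSpace ℝ F]
    [CompleteSpace F] : ∃ R : (V →L[ℝ] F) →L[ℝ] (H →L[ℝ] F), ∀ f u, R f (ι u) = f u := by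
  have hd' : DenseRange ι.toContinuousLinearMap := hd
  have hi : IsUniformInducing ι.toContinuousLinearMap := ι.isometry.isUniformInducing
  have he : ∀ (f : V →L[ℝ] F) u, f.extend ι.toContinuousLinearMap (ι u) = f u :=
    fun f u => f.extend_eq hd' hi u
  refine ⟨LinearMap.mkContinuous
    { toFun := fun f => f.extend ι.toContinuousLinearMap
      map_add' := fun f g => ContinuousLinearMap.extend_unique _ hd' hi _ (by ext u; simp [he])
      map_smul' := fun c f => ContinuousLinearMap.extend_unique _ hd' hi _ (by ext u; simp [he]) } 1
    (fun f => ?_), he⟩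
  have := f.opNorm_extend_le (N := 1) hd' fun u => by simp
  simpa using this

theorem exists_form_extension (hd : DenseRange ι) :
    ∃ R : (V →L[ℝ] V →L[ℝ] ℝ) →L[ℝ] H →L[ℝ] H →L[ℝ] ℝ, ∀ B u v, R B (ι u) (ι v) = B u v := by
  obtain ⟨R₁, hR₁⟩ := exists_extension hd ℝ
  obtain ⟨R₂, hR₂⟩ := exists_extension hd (H →L[ℝ] ℝ)
  exact ⟨R₂.comp (ContinuousLinearMap.compL ℝ V _ _ R₁), fun B u v => by simp [hR₂, hR₁]⟩

theorem contDiffAt_comp_clm {E F : Type*} [NormedAddCommGroup E] [NormedSpace ℝ E]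
    [NormedAddCommGroup F] [NormedSpace ℝ F] (R : E →L[ℝ] F) {k : ℕ∞ω} {Λ : F → ℝ} {x : E}
    (h : ContDiffAt ℝ k Λ (R x)) : ContDiffAt ℝ k (fun y => Λ (R y)) x :=
  h.comp x R.contDiff.contDiffAt

/-- A simple eigenvalue of a form on a dense subspace depends smoothly on it. -/
theorem exists_contDiffAt_eigenvalue_of_dense [CompleteSpace H] (hd : DenseRange ι)
    {m B₀ : V →L[ℝ] V →L[ℝ] ℝ} {ℓ : V →L[ℝ] ℝ} {l₀ c : ℝ} {a : ℕ → V}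
    (hm : ∀ u v, m u v = m v u) (hB : ∀ u v, B₀ u v = B₀ v u) (hc : 0 < c)
    (hco : ∀ u, c * ‖u‖ ^ 2 ≤ B₀ u u - l₀ * m u u + ℓ u ^ 2) (ha : CauchySeq a)
    (hh : ∀ v, Tendsto (fun j => B₀ (a j) v - l₀ * m (a j) v) atTop (𝓝 0))
    (hℓ : Tendsto (fun j => ℓ (a j)) atTop (𝓝 1))
    (hmh : Tendsto (fun j => m (a j) (a j)) atTop (𝓝 1)) (k : ℕ∞ω) (hk : k ≠ 0) :
    ∃ Λ : (V →L[ℝ] V →L[ℝ] ℝ) → ℝ, ContDiffAt ℝ k Λ B₀ ∧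
      ∀ᶠ z in 𝓝 (B₀, l₀), ∀ (b : ℕ → V) (t : ℝ), CauchySeq b →
        (∀ v, Tendsto (fun j => z.1 (b j) v - z.2 * m (b j) v) atTop (𝓝 0)) →
        Tendsto (fun j => ℓ (b j)) atTop (𝓝 t) → t ≠ 0 → Λ z.1 = z.2 := by
  obtain ⟨R₁, hR₁⟩ := exists_extension hd ℝ
  obtain ⟨R, hR⟩ := exists_form_extension hd
  have hlim : ∀ b : ℕ → V, CauchySeq b → ∃ h : H, Tendsto (fun j => ι (b j)) atTop (𝓝 h) :=
    fun b hb => cauchySeq_tendsto_of_complete (hb.map ι.isometry.uniformContinuous)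
  have heig : ∀ (B : V →L[ℝ] V →L[ℝ] ℝ) (l : ℝ) (b : ℕ → V) (h : H),
      Tendsto (fun j => ι (b j)) atTop (𝓝 h) →
      (∀ v, Tendsto (fun j => B (b j) v - l * m (b j) v) atTop (𝓝 0)) → R B h = l • R m h := by
    intro B l b h hb hBb
    refine ContinuousLinearMap.ext fun w => ?_
    refine hd.induction_on w (isClosed_eq (R B h).continuous (l • R m h).continuous) fun v => ?_
    have h1 : Tendsto (fun j => R B (ι (b j)) (ι v) - l * R m (ι (b j)) (ι v)) atTop
        (𝓝 (R B h (ι v) - l * R m h (ι v))) :=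
      ((by fun_prop : Continuous fun x => R B x (ι v) - l * R m x (ι v)).tendsto h).comp hb
    simp only [hR] at h1
    have := tendsto_nhds_unique h1 (hBb v)
    rw [_root_.smul_apply, smul_eq_mul]
    linarith
  have hℓlim : ∀ (b : ℕ → V) (h : H) (t : ℝ), Tendsto (fun j => ι (b j)) atTop (𝓝 h) →
      Tendsto (fun j => ℓ (b j)) atTop (𝓝 t) → R₁ ℓ h = t := fun b h t hb ht => by
    have h1 := ((R₁ ℓ).continuous.tendsto h).comp hb
    simp only [comp_def, hR₁] at h1
    exact tendsto_nhds_unique h1 ht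
  have hsymm : ∀ B : V →L[ℝ] V →L[ℝ] ℝ, (∀ u v, B u v = B v u) →
      ∀ u v, R B u v = R B v u := fun B hB u v => by
    refine hd.induction_on₂ (p := fun u v => R B u v = R B v u)
      (isClosed_eq (by fun_prop) (by fun_prop)) (fun u v => ?_) u v
    rw [hR, hR, hB]
  obtain ⟨h₀, hh₀⟩ := hlim a ha
  have hm1 : R m h₀ h₀ = 1 := by
    have h1 := ((by fun_prop : Continuous fun x => R m x x).tendsto h₀).comp hh₀
    simp only [comp_def, hR] at h1
    exact tendsto_nhds_unique h1 hmh
  have hcoer : IsCoercive (R B₀ - l₀ • R m + (R₁ ℓ).smulRight (R₁ ℓ)) := by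
    refine ⟨c, hc, fun u => ?_⟩
    simp only [_root_.add_apply, _root_.sub_apply, _root_.smul_apply, smul_eq_mul,
      ContinuousLinearMap.smulRight_apply]
    refine hd.induction_on u (isClosed_le (by fun_prop) (by fun_prop)) fun u => ?_
    rw [hR, hR, hR₁, ι.norm_map]
    have := hco u
    rw [sq, sq, ← mul_assoc] at this
    linarith
  obtain ⟨Λ, hΛ, hΛ'⟩ := exists_contDiffAt_eigenvalue (hsymm m hm) (hsymm B₀ hB) hcoer
    (heig B₀ l₀ a h₀ hh₀ hh) (hℓlim a h₀ 1 hh₀ hℓ) (by rw [hm1]; exact one_ne_zero) k hk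
  have hΛR : ContDiffAt ℝ k (fun B => Λ (R B)) B₀ :=
    contDiffAt_comp_clm (E := V →L[ℝ] V →L[ℝ] ℝ) (F := H →L[ℝ] H →L[ℝ] ℝ) R hΛ
  refine ⟨fun B => Λ (R B), hΛR, ?_⟩
  have ht : Tendsto (fun z : (V →L[ℝ] V →L[ℝ] ℝ) × ℝ => (R z.1, z.2)) (𝓝 (B₀, l₀))
      (𝓝 (R B₀, l₀)) := ((R.continuous.comp continuous_fst).prodMk continuous_snd).tendsto (B₀, l₀)
  filter_upwards [ht.eventually hΛ'] with z hz b t hb hbz hbt ht0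
  obtain ⟨h, hh⟩ := hlim b hb
  exact hz h (heig _ _ b h hh hbz) (by rwa [hℓlim b h t hh hbt])

end Dense

section Forms
variable {D : Type*} [NormedAddCommGroup D] [NormedSpace ℝ D]

theorem abs_bilin_le {V : Type*} [NormedAddCommGroup V] [NormedSpace ℝ V] {f : V →ₗ[ℝ] V →ₗ[ℝ] ℝ}
    {C : ℝ} (h : ∀ u v, |f u v| ≤ C * (‖u‖ ^ 2 + ‖v‖ ^ 2)) (u v : V) :
    ‖f u v‖ ≤ 2 * C * ‖u‖ * ‖v‖ := by
  rcases eq_or_ne u 0 with rfl | hu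
  · simp
  rcases eq_or_ne v 0 with rfl | hv
  · simp
  have hu' := norm_pos_iff.2 hu
  have hv' := norm_pos_iff.2 hv
  have h1 := h (‖u‖⁻¹ • u) (‖v‖⁻¹ • v)
  simp only [map_smul, LinearMap.smul_apply, smul_eq_mul, abs_mul, abs_inv, abs_norm, norm_smul,
    norm_inv, norm_norm, inv_mul_cancel₀ hu'.ne', inv_mul_cancel₀ hv'.ne'] at h1
  rw [← mul_assoc, ← mul_inv, inv_mul_le_iff₀ (by positivity)] at h1
  rw [norm_eq_abs]
  linarith

/-- A simple eigenvalue of a bounded family of forms depends smoothly on the parameter. -/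
theorem exists_contDiffAt_eigenvalue_of_bounded {V : Type*} [NormedAddCommGroup V]
    [InnerProductSpace ℝ V] {m : V →ₗ[ℝ] V →ₗ[ℝ] ℝ} {β : D →ₗ[ℝ] V →ₗ[ℝ] V →ₗ[ℝ] ℝ}
    {ℓ : V →ₗ[ℝ] ℝ} {A₀ : D} {l₀ c C : ℝ} {a : ℕ → V}
    (hm : ∀ u v, m u v = m v u) (hmb : ∀ u v, |m u v| ≤ 1 * (‖u‖ ^ 2 + ‖v‖ ^ 2))
    (hβ : ∀ u v, β A₀ u v = β A₀ v u) (hC : 0 ≤ C)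
    (hβb : ∀ A u v, |β A u v| ≤ C * ‖A‖ * (‖u‖ ^ 2 + ‖v‖ ^ 2)) (hℓb : ∀ u, ℓ u ^ 2 ≤ ‖u‖ ^ 2)
    (hc : 0 < c) (hco : ∀ u, c * ‖u‖ ^ 2 ≤ β A₀ u u - l₀ * m u u + ℓ u ^ 2) (ha : CauchySeq a)
    (hh : ∀ v, Tendsto (fun j => β A₀ (a j) v - l₀ * m (a j) v) atTop (𝓝 0))
    (hℓ : Tendsto (fun j => ℓ (a j)) atTop (𝓝 1))
    (hmh : Tendsto (fun j => m (a j) (a j)) atTop (𝓝 1)) (k : ℕ∞ω) (hk : k ≠ 0) :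
    ∃ Λ : D → ℝ, ContDiffAt ℝ k Λ A₀ ∧
      ∀ᶠ z in 𝓝 (A₀, l₀), ∀ (b : ℕ → V) (t : ℝ), CauchySeq b →
        (∀ v, Tendsto (fun j => β z.1 (b j) v - z.2 * m (b j) v) atTop (𝓝 0)) →
        Tendsto (fun j => ℓ (b j)) atTop (𝓝 t) → t ≠ 0 → Λ z.1 = z.2 := by
  obtain ⟨m', hm'⟩ : ∃ m' : V →L[ℝ] V →L[ℝ] ℝ, ∀ u v, m' u v = m u v :=
    ⟨m.mkContinuous₂ _ (abs_bilin_le hmb), fun _ _ => rfl⟩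
  obtain ⟨ℓ', hℓ'⟩ : ∃ ℓ' : V →L[ℝ] ℝ, ∀ u, ℓ' u = ℓ u :=
    ⟨ℓ.mkContinuous 1 fun u => by
      rw [one_mul]; exact abs_le_of_sq_le_sq (hℓb u) (norm_nonneg u), fun _ => rfl⟩
  obtain ⟨β', hβ'⟩ : ∃ β' : D →L[ℝ] V →L[ℝ] V →L[ℝ] ℝ, ∀ A u v, β' A u v = β A u v :=
    ⟨LinearMap.mkContinuous
      { toFun := fun A => (β A).mkContinuous₂ _ (abs_bilin_le (hβb A))
        map_add' := fun A A' => by ext u v; simp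
        map_smul' := fun s A => by ext u v; simp } (2 * C)
      fun A => ((β A).mkContinuous₂_norm_le (by positivity)
        (abs_bilin_le (hβb A))).trans_eq (by ring), fun _ _ _ => rfl⟩
  obtain ⟨Λ, hΛ, hΛ'⟩ := exists_contDiffAt_eigenvalue_of_dense
    (ι := UniformSpace.Completion.toComplₗᵢ (𝕜 := ℝ) (E := V)) UniformSpace.Completion.denseRange_coe
    (m := m') (B₀ := β' A₀) (ℓ := ℓ') (by simpa only [hm'] using hm) (by simpa only [hβ'] using hβ)
    hc (by simpa only [hβ', hm', hℓ'] using hco) ha (by simpa only [hβ', hm'] using hh)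
    (by simpa only [hℓ'] using hℓ) (by simpa only [hm'] using hmh) k hk
  have ht : Tendsto (fun z : D × ℝ => (β' z.1, z.2)) (𝓝 (A₀, l₀)) (𝓝 (β' A₀, l₀)) :=
    ((β'.continuous.comp continuous_fst).prodMk continuous_snd).tendsto (A₀, l₀)
  have hΛβ : ContDiffAt ℝ k (fun A => Λ (β' A)) A₀ :=
    contDiffAt_comp_clm (F := V →L[ℝ] V →L[ℝ] ℝ) β' hΛ
  refine ⟨fun A => Λ (β' A), hΛβ, ?_⟩
  filter_upwards [ht.eventually hΛ'] with z hz b t hb hbz hbt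
  exact hz b t hb (by simpa only [hβ', hm'] using hbz) (by simpa only [hℓ'] using hbt)

theorem exists_contDiffAt_eigenvalue_of_forms {V : Type*} [AddCommGroup V] [Module ℝ V]
    {E m : V →ₗ[ℝ] V →ₗ[ℝ] ℝ} {β : D →ₗ[ℝ] V →ₗ[ℝ] V →ₗ[ℝ] ℝ}
    {ℓ : V →ₗ[ℝ] ℝ} {A₀ : D} {l₀ c C : ℝ} {a : ℕ → V}
    (hE : ∀ u v, E u v = E v u) (hE0 : ∀ u, u ≠ 0 → 0 < E u u)
    (hm : ∀ u v, m u v = m v u) (hmb : ∀ u v, |m u v| ≤ 1 * (E u u + E v v))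
    (hβ : ∀ u v, β A₀ u v = β A₀ v u) (hC : 0 ≤ C)
    (hβb : ∀ A u v, |β A u v| ≤ C * ‖A‖ * (E u u + E v v)) (hℓb : ∀ u, ℓ u ^ 2 ≤ E u u)
    (hc : 0 < c) (hco : ∀ u, c * E u u ≤ β A₀ u u - l₀ * m u u + ℓ u ^ 2)
    (ha : Tendsto (fun p : ℕ × ℕ => E (a p.1 - a p.2) (a p.1 - a p.2)) atTop (𝓝 0))
    (hh : ∀ v, Tendsto (fun j => β A₀ (a j) v - l₀ * m (a j) v) atTop (𝓝 0))
    (hℓ : Tendsto (fun j => ℓ (a j)) atTop (𝓝 1))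
    (hmh : Tendsto (fun j => m (a j) (a j)) atTop (𝓝 1)) (k : ℕ∞ω) (hk : k ≠ 0) :
    ∃ Λ : D → ℝ, ContDiffAt ℝ k Λ A₀ ∧
      ∀ᶠ z in 𝓝 (A₀, l₀), ∀ (b : ℕ → V) (t : ℝ),
        Tendsto (fun p : ℕ × ℕ => E (b p.1 - b p.2) (b p.1 - b p.2)) atTop (𝓝 0) →
        (∀ v, Tendsto (fun j => β z.1 (b j) v - z.2 * m (b j) v) atTop (𝓝 0)) →
        Tendsto (fun j => ℓ (b j)) atTop (𝓝 t) → t ≠ 0 → Λ z.1 = z.2 := by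
  let core : InnerProductSpace.Core ℝ V :=
    { inner := fun u v => E u v
      conj_inner_symm := fun u v => hE v u
      re_inner_nonneg := fun u => by
        rcases eq_or_ne u 0 with rfl | hu
        · simp
        · exact (hE0 u hu).le
      add_left := fun u v w => by simp
      smul_left := fun u v s => by simp
      definite := fun u hu => by
        by_contra h
        exact (hE0 u h).ne' hu }
  let _ : NormedAddCommGroup V := core.toNormedAddCommGroup
  let _ : InnerProductSpace ℝ V := InnerProductSpace.ofCore core.toCore
  have hn : ∀ u : V, E u u = ‖u‖ ^ 2 := fun u => real_inner_self_eq_norm_sq u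
  have hcs : ∀ b : ℕ → V,
      Tendsto (fun p : ℕ × ℕ => E (b p.1 - b p.2) (b p.1 - b p.2)) atTop (𝓝 0) → CauchySeq b := by
    intro b hb
    rw [cauchySeq_iff_tendsto_dist_atTop_0]
    have h1 := hb.sqrt
    simp only [hn, Real.sqrt_sq (norm_nonneg _), Real.sqrt_zero] at h1
    simpa only [dist_eq_norm] using h1
  simp only [hn] at hmb hβb hℓb hco
  obtain ⟨Λ, hΛ, hΛ'⟩ := exists_contDiffAt_eigenvalue_of_bounded hm hmb hβ hC hβb hℓb hc hco
    (hcs a ha) hh hℓ hmh k hk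
  exact ⟨Λ, hΛ, hΛ'.mono fun z hz b t hb => hz b t (hcs b hb)⟩

end Forms

section Application
variable [IsManifold (𝓡 n) ∞ S] [CompactSpace S]

/-- Smooth functions on a manifold. -/
abbrev SmoothFn (n : ℕ) (S : Type*) [TopologicalSpace S] [ChartedSpace (Rn n) S] : Type _ :=
  C^∞⟮𝓡 n, S; 𝓘(ℝ, ℝ), ℝ⟯

/-- Smooth functions as continuous functions. -/
noncomputable def smoothIncl (n : ℕ) (S : Type*) [TopologicalSpace S] [ChartedSpace (Rn n) S] :
    SmoothFn n S →ₗ[ℝ] C(S, ℝ) where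
  toFun u := ⟨u, u.contMDiff.continuous⟩
  map_add' _ _ := rfl
  map_smul' _ _ := rfl

/-- The action of operators on smooth functions. -/
noncomputable def opBilin (n r : ℕ) (S : Type*) [TopologicalSpace S] [ChartedSpace (Rn n) S]
    [IsManifold (𝓡 n) ∞ S] [CompactSpace S] :
    DiffOp n r S →ₗ[ℝ] SmoothFn n S →ₗ[ℝ] C(S, ℝ) :=
  LinearMap.mk₂ ℝ (fun A u => ⟨A.op u, A.continuous_op (u.contMDiff.of_le two_le_infty)⟩)
    (fun A A' u => ContinuousMap.ext fun p => DiffOp.add_op A A' u p)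
    (fun s A u => ContinuousMap.ext fun p => DiffOp.smul_op s A u p)
    (fun A u v => ContinuousMap.ext fun p => A.op_add (u.contMDiff.of_le two_le_infty)
      (v.contMDiff.of_le two_le_infty) p)
    (fun s A u => ContinuousMap.ext fun p => A.op_const_mul s (u.contMDiff.of_le two_le_infty) p)

variable [MeasurableSpace S] [BorelSpace S]

/-- The `L²` pairing of continuous functions. -/
noncomputable def pairing (ν : Measure S) [IsFiniteMeasure ν] : C(S, ℝ) →ₗ[ℝ] C(S, ℝ) →ₗ[ℝ] ℝ :=
  (LinearMap.mul ℝ C(S, ℝ)).compr₂ (integralCLM ν).toLinearMap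

variable [T2Space S]

theorem DiffOp.exists_contDiffAt_eigenvalue [Nonempty S] [ConnectedSpace S] {A₀ : DiffOp n r S}
    (hr : 2 ≤ r) (hell : A₀.IsElliptic) {ν : Measure S} [IsFiniteMeasure ν] [ν.IsOpenPosMeasure]
    (hν : IsVolumeMeasure n ν) (hA₀ : A₀.IsSelfAdjointWrt ν) (k : ℕ∞ω) (hk : k ≠ 0) :
    ∃ (l₀ : ℝ) (φ₀ : C(S, ℝ)), A₀.IsEigenpair l₀ φ₀ ∧ ∃ Λ : DiffOp n r S → ℝ,
      ContDiffAt ℝ k Λ A₀ ∧ ∀ᶠ z in 𝓝 (A₀, l₀), ∀ φ, z.1.IsEigenpair z.2 φ → Λ z.1 = z.2 := by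
  obtain ⟨κ, l₀, φ₀, hκ, hφ₀, hnorm, c, hc, hgap⟩ := A₀.exists_eigenpair (by lia) hell hA₀
  obtain ⟨C, hC, hform⟩ := DiffOp.exists_form_bound hr hell hν hA₀
  refine ⟨l₀, φ₀, hφ₀, ?_⟩
  set J := smoothIncl n S with hJ
  set m : SmoothFn n S →ₗ[ℝ] SmoothFn n S →ₗ[ℝ] ℝ :=
    (pairing ν).compl₁₂ J J with hmdef
  set β : DiffOp n r S →ₗ[ℝ] SmoothFn n S →ₗ[ℝ] SmoothFn n S →ₗ[ℝ] ℝ :=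
    (opBilin n r S).compr₂ (-((pairing ν).compl₂ J)) with hβdef
  set ℓ : SmoothFn n S →ₗ[ℝ] ℝ := ((pairing ν).flip φ₀).comp J with hℓdef
  have hm : ∀ u v, m u v = ∫ p, u p * v p ∂ν := fun _ _ => rfl
  have hβ : ∀ A u v, β A u v = -∫ p, A.op u p * v p ∂ν := fun _ _ _ => rfl
  have hℓ : ∀ u, ℓ u = ∫ p, u p * φ₀ p ∂ν := fun _ => rfl
  have hmc : ∀ u v, m u v = m v u := fun u v => by simp only [hm, mul_comm]
  have hβc : ∀ u v, β A₀ u v = β A₀ v u := fun u v => by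
    rw [hβ, hβ, hA₀ _ _ (u.contMDiff.of_le two_le_infty) (v.contMDiff.of_le two_le_infty)]
    simp only [mul_comm]
  set E := κ • m + β A₀ with hEdef
  have hE : ∀ u v, E u v = κ * m u v + β A₀ u v := fun _ _ => rfl
  have hE' : ∀ u, E u u = ∫ p, (κ * u p - A₀.op u p) * u p ∂ν := fun u => by
    have i1 : Integrable (fun p => u p * u p) ν :=
      integrable_of_compact (u.contMDiff.continuous.mul u.contMDiff.continuous)
    have i2 : Integrable (fun p => A₀.op u p * u p) ν := integrable_of_compact
      ((A₀.continuous_op (u.contMDiff.of_le two_le_infty)).mul u.contMDiff.continuous)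
    simp only [sub_mul, mul_assoc]
    rw [hE, hm, hβ, integral_sub (i1.const_mul κ) i2, integral_const_mul]
    rfl
  have hcoer : ∀ u : SmoothFn n S, (1 / 2) * (∫ p, A₀.grad2 u u p ∂ν) + m u u ≤ E u u := fun u => by
    have := DiffOp.integral_sq_le_of_smooth hA₀ hκ (u.contMDiff.of_le two_le_infty)
    simp only [sq] at this
    rwa [hE', hm]
  have hgrad : ∀ u : SmoothFn n S, 0 ≤ ∫ p, A₀.grad2 u u p ∂ν := fun u =>
    integral_nonneg fun p => DiffOp.grad2_self_nonneg hell u p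
  have hm0 : ∀ u, 0 ≤ m u u := fun u => integral_nonneg fun p => mul_self_nonneg _
  have hmE : ∀ u, m u u ≤ E u u := fun u => by linarith [hcoer u, hgrad u]
  have hen : ∀ u : SmoothFn n S, A₀.energy ν u ≤ 2 * E u u := fun u => by
    have h1 : A₀.energy ν u = (∫ p, A₀.grad2 u u p ∂ν) + m u u := by
      simp only [DiffOp.energy, sq]; rfl
    linarith [hcoer u, hm0 u]
  have hE0 : ∀ u, u ≠ 0 → 0 < E u u := fun u hu => by
    refine lt_of_lt_of_le ?_ (hmE u)
    obtain ⟨p, hp⟩ : ∃ p, u p ≠ 0 := by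
      by_contra! h
      exact hu (ContMDiffMap.ext h)
    exact integral_pos_of_continuous (u.contMDiff.continuous.mul u.contMDiff.continuous)
      (fun p => mul_self_nonneg _) (mul_self_ne_zero.2 hp)
  have hcs : ∀ u v, m u v ^ 2 ≤ m u u * m v v := fun u v => by
    have := integral_mul_sq_le (ν := ν) u.contMDiff.continuous v.contMDiff.continuous
    simp only [sq] at this ⊢
    exact this
  have hmb : ∀ u v, |m u v| ≤ 1 * (E u u + E v v) := fun u v => by
    refine abs_le_of_sq_le_sq ?_ (by linarith [hm0 u, hmE u, hm0 v, hmE v])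
    have h1 := mul_nonneg ((hm0 u).trans (hmE u)) ((hm0 v).trans (hmE v))
    have h2 := mul_le_mul (hmE u) (hmE v) (hm0 v) ((hm0 u).trans (hmE u))
    nlinarith [hcs u v, sq_nonneg (E u u), sq_nonneg (E v v)]
  have hβb : ∀ A u v, |β A u v| ≤ 2 * C * ‖A‖ * (E u u + E v v) := fun A u v => by
    rw [hβ, abs_neg]
    refine (hform A u v (u.contMDiff.of_le two_le_infty) (v.contMDiff.of_le two_le_infty)).trans ?_
    have := mul_le_mul_of_nonneg_left (add_le_add (hen u) (hen v)) (mul_nonneg hC (norm_nonneg A))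
    linarith
  have hℓb : ∀ u, ℓ u ^ 2 ≤ E u u := fun u => by
    have := integral_mul_sq_le (ν := ν) u.contMDiff.continuous φ₀.continuous
    simp only [sq (φ₀ _), hnorm, mul_one] at this
    refine this.trans ((le_of_eq ?_).trans (hmE u))
    simp only [sq]; rfl
  have hco : ∀ u, c * E u u ≤ β A₀ u u - l₀ * m u u + ℓ u ^ 2 := fun u => by
    have h1 := hgap _ (DiffOp.smoothGraph_le_graph _ (A₀.mk_mem_smoothGraph (u := J u) u.contMDiff))
    have h2 : ∫ p, (κ • J u - (⟨A₀.op u, A₀.continuous_op (u.contMDiff.of_le two_le_infty)⟩ :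
        C(S, ℝ))) p * J u p ∂ν = E u u := (hE' u).symm
    have h3 : c * E u u ≤ E u u - (κ + l₀) * m u u + ℓ u ^ 2 := by rw [← h2]; exact h1
    linarith [hE u u]
  have hseq : ∀ (A : DiffOp n r S) (l : ℝ) (φ : C(S, ℝ)), A.IsEigenpair l φ →
      (∀ w, E w w ≤ 2 * (κ * m w w + β A w w)) → ∃ b : ℕ → SmoothFn n S,
        Tendsto (fun p : ℕ × ℕ => E (b p.1 - b p.2) (b p.1 - b p.2)) atTop (𝓝 0) ∧
        (∀ v, Tendsto (fun j => β A (b j) v - l * m (b j) v) atTop (𝓝 0)) ∧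
        Tendsto (fun j => ℓ (b j)) atTop (𝓝 (∫ p, φ p * φ₀ p ∂ν)) ∧
        Tendsto (fun j => m (b j) (b j)) atTop (𝓝 (∫ p, φ p * φ p ∂ν)) := by
    intro A l φ hφ hA
    obtain ⟨a, ha, hav⟩ := DiffOp.exists_seq_of_mem_graph hφ.1
    have ha1 : Tendsto (fun j => (a j).1) atTop (𝓝 φ) := (continuous_fst.tendsto _).comp hav
    have ha2 : Tendsto (fun j => (a j).2) atTop (𝓝 (-(l • φ))) :=
      (continuous_snd.tendsto _).comp hav
    set b : ℕ → SmoothFn n S := fun j => ⟨(a j).1, (ha j).1⟩ with hb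
    have hβa : ∀ j v, β A (b j) v = -∫ p, (a j).2 p * J v p ∂ν := fun j v => by
      simp only [(ha j).2]; rfl
    refine ⟨b, ?_, fun v => ?_, tendsto_integral_mul ν ha1 tendsto_const_nhds,
      tendsto_integral_mul ν ha1 ha1⟩
    · have h1 : Tendsto (fun z : ℕ × ℕ => a z.1 - a z.2) atTop (𝓝 0) := by
        rw [← prod_atTop_atTop_eq, ← sub_self (φ, -(l • φ))]
        exact (hav.comp tendsto_fst).sub (hav.comp tendsto_snd)
      have h2 := tendsto_integral_mul ν ((continuous_fst.tendsto _).comp h1)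
        ((continuous_fst.tendsto _).comp h1)
      have h3 := tendsto_integral_mul ν ((continuous_snd.tendsto _).comp h1)
        ((continuous_fst.tendsto _).comp h1)
      have h4 := ((h2.const_mul κ).sub h3).const_mul 2
      simp only [Prod.fst_zero, Prod.snd_zero, ContinuousMap.zero_apply, mul_zero, integral_zero,
        sub_zero] at h4
      refine squeeze_zero (fun z => (hm0 _).trans (hmE _)) (fun z => (hA _).trans_eq ?_) h4
      have h5 : β A (b z.1 - b z.2) (b z.1 - b z.2) =
          -∫ p, (a z.1 - a z.2).2 p * (a z.1 - a z.2).1 p ∂ν := by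
        simp only [(A.smoothGraph.sub_mem (ha z.1) (ha z.2)).2]; rfl
      rw [h5, ← sub_eq_add_neg]
      rfl
    · have h1 := (tendsto_integral_mul ν ha2 (tendsto_const_nhds (x := J v))).neg.sub
        ((tendsto_integral_mul ν ha1 (tendsto_const_nhds (x := J v))).const_mul l)
      have h2 : -(∫ p, (-(l • φ)) p * J v p ∂ν) - l * ∫ p, φ p * J v p ∂ν = 0 := by
        rw [← integral_const_mul, ← integral_neg, sub_eq_zero]
        refine congrArg _ (funext fun p => ?_)
        simp only [neg_at, smul_at, smul_eq_mul]
        ring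
      rw [h2] at h1
      refine h1.congr fun j => ?_
      rw [hβa]
      rfl
  obtain ⟨a, ha, hh, hℓ1, hm1⟩ := hseq A₀ l₀ φ₀ hφ₀ fun w => by
    linarith [hE w w, hmE w, hm0 w]
  rw [hnorm] at hℓ1 hm1
  obtain ⟨Λ, hΛ, hΛ'⟩ := exists_contDiffAt_eigenvalue_of_forms
    (fun u v => by rw [hE, hE, hmc, hβc]) hE0 hmc hmb hβc (by positivity) hβb hℓb hc hco ha hh
    hℓ1 hm1 k hk
  refine ⟨Λ, hΛ, ?_⟩
  have hnear : ∀ᶠ z : DiffOp n r S × ℝ in 𝓝 (A₀, l₀), 2 * C * ‖z.1 - A₀‖ < 1 / 4 := by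
    have : Continuous fun z : DiffOp n r S × ℝ => 2 * C * ‖z.1 - A₀‖ := by fun_prop
    refine (this.tendsto (A₀, l₀)).eventually_lt_const ?_
    simp
  filter_upwards [hΛ', hnear] with z hz hzA φ hφ
  obtain ⟨b, h1, h2, h3, -⟩ := hseq z.1 z.2 φ hφ fun w => by
    have h4 := hβb (z.1 - A₀) w w
    have h5 := mul_le_mul_of_nonneg_right hzA.le (by linarith [hm0 w, hmE w] : 0 ≤ E w w + E w w)
    rw [map_sub, LinearMap.sub_apply, LinearMap.sub_apply] at h4
    linarith [neg_le_of_abs_le (h4.trans h5), hE w w]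
  obtain ⟨p⟩ := ‹Nonempty S›
  exact hz b _ h1 h2 h3 (integral_pos_of_continuous (φ.continuous.mul φ₀.continuous)
    (fun p => (mul_pos (hφ.2 p) (hφ₀.2 p)).le) (mul_pos (hφ.2 p) (hφ₀.2 p)).ne').ne'

/-- The eigenvalue with a positive eigenfunction depends continuously on the operator. -/
theorem DiffOp.IsEigenpair.exists_abs_sub_le [Nonempty S] {A₀ : DiffOp n r S} {l₀ : ℝ}
    {φ₀ : C(S, ℝ)} (h₀ : A₀.IsEigenpair l₀ φ₀) {ε : ℝ} (hε : 0 < ε) : ∃ δ > 0,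
      ∀ (A : DiffOp n r S) (l : ℝ) (φ : C(S, ℝ)) (ν : Measure S), IsFiniteMeasure ν →
        ν.IsOpenPosMeasure → A.IsSelfAdjointWrt ν → A.IsEigenpair l φ → ‖A - A₀‖ < δ →
        |l - l₀| ≤ ε := by
  obtain ⟨a, ha, hav⟩ := DiffOp.exists_seq_of_mem_graph h₀.1
  have ha1 : Tendsto (fun j => (a j).1) atTop (𝓝 φ₀) := (continuous_fst.tendsto _).comp hav
  have ha2 : Tendsto (fun j => (a j).2 + l₀ • (a j).1) atTop (𝓝 0) := by
    have := ((continuous_snd.tendsto _).comp hav).add (ha1.const_smul l₀)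
    rwa [neg_add_cancel] at this
  obtain ⟨p₀, -, hp₀⟩ := isCompact_univ.exists_isMinOn Set.univ_nonempty φ₀.continuous.continuousOn
  set d := φ₀ p₀ with hd
  have hd0 : 0 < d := h₀.2 p₀
  have hη : 0 < ε * d / 4 := by positivity
  obtain ⟨j, hj1, hj2⟩ := ((Metric.tendsto_nhds.1 ha1 (d / 2) (by positivity)).and
    (Metric.tendsto_nhds.1 ha2 (ε * d / 4) hη)).exists
  set u := (a j).1 with hu
  have hus : SmoothFn[n] ∞ u := (ha j).1
  have hup : ∀ p, d / 2 ≤ u p := fun p => by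
    have h1 := (abs_lt.1 ((ContinuousMap.dist_apply_le_dist p).trans_lt hj1)).1
    have h2 : d ≤ φ₀ p := hp₀ (Set.mem_univ p)
    linarith
  have hAu : ∀ p, |A₀.op u p + l₀ * u p| ≤ ε * d / 4 := fun p => by
    rw [dist_zero_right] at hj2
    rw [← (ha j).2]
    exact (((a j).2 + l₀ • (a j).1).norm_coe_le_norm p).trans hj2.le
  obtain ⟨C, hC, hop⟩ := DiffOp.exists_abs_op_le (n := n) (r := r) (hus.of_le two_le_infty)
  refine ⟨ε * d / 4 / (C + 1), by positivity, fun A l φ ν hνf hνp hA hφ hAA => ?_⟩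
  have h1 : ∀ p, |A.op u p + l₀ * u p| ≤ ε * u p := fun p => by
    have e : A.op u p + l₀ * u p = (A - A₀).op u p + (A₀.op u p + l₀ * u p) := by
      have := DiffOp.add_op (A - A₀) A₀ u p
      rw [sub_add_cancel] at this
      rw [this]; ring
    have h2 : C * ‖A - A₀‖ ≤ ε * d / 4 := by
      rw [lt_div_iff₀ (by positivity)] at hAA
      linarith [norm_nonneg (A - A₀)]
    rw [e]
    have h3 := mul_le_mul_of_nonneg_left (hup p) hε.le
    linarith [abs_add_le ((A - A₀).op u p) (A₀.op u p + l₀ * u p), hop (A - A₀) p, hAu p]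
  have hcu := u.continuous
  have hcA := A.continuous_op (hus.of_le two_le_infty)
  have hsym := DiffOp.integral_mul_symm_of_mem_graph hA
    (DiffOp.smoothGraph_le_graph _ (A.mk_mem_smoothGraph hus)) hφ.1
  have i1 : Integrable (fun p => u p * φ p) ν := integrable_of_compact (hcu.mul φ.continuous)
  have i2 : Integrable (fun p => A.op u p * φ p) ν :=
    integrable_of_compact (hcA.mul φ.continuous)
  have hint : ∫ p, (A.op u p + l₀ * u p) * φ p ∂ν = (l₀ - l) * ∫ p, u p * φ p ∂ν := by
    simp only [ContinuousMap.coe_mk, neg_at, smul_at,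
      smul_eq_mul] at hsym
    simp only [add_mul, mul_assoc]
    rw [integral_add i2 (i1.const_mul l₀), hsym, integral_const_mul, sub_mul, ← integral_const_mul l,
      sub_eq_neg_add, ← integral_neg]
    congr 2
    funext p
    ring
  have hpos : 0 < ∫ p, u p * φ p ∂ν :=
    have h2 : ∀ p, 0 < u p * φ p := fun p => mul_pos (by linarith [hup p]) (hφ.2 p)
    integral_pos_of_continuous (hcu.mul φ.continuous) (fun p => (h2 p).le) (h2 p₀).ne'
  have hle : |∫ p, (A.op u p + l₀ * u p) * φ p ∂ν| ≤ ε * ∫ p, u p * φ p ∂ν := by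
    rw [← integral_const_mul, ← norm_eq_abs]
    refine norm_integral_le_of_norm_le (i1.const_mul ε) (Eventually.of_forall fun p => ?_)
    rw [norm_mul, Real.norm_of_nonneg (hφ.2 p).le, ← mul_assoc]
    exact mul_le_mul_of_nonneg_right (h1 p) (hφ.2 p).le
  rw [hint, abs_mul, abs_of_pos hpos, abs_sub_comm] at hle
  exact le_of_mul_le_mul_right hle hpos

end Application

end FirstEigenvalue

theorem lemmaA1 {n r k : ℕ} (hr : 2 ≤ r) (hk : 1 ≤ k)
    {S : Type*} [TopologicalSpace S] [ChartedSpace (FirstEigenvalue.Rn n) S]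
    [IsManifold (𝓡 n) ∞ S] [T2Space S] [CompactSpace S] [ConnectedSpace S]
    [MeasurableSpace S] [BorelSpace S]
    {B : Type*} [NormedAddCommGroup B] [NormedSpace ℝ B] [CompleteSpace B]
    {U : Type*} [TopologicalSpace U] [ChartedSpace B U] [IsManifold 𝓘(ℝ, B) ∞ U]
    (Φ : U → FirstEigenvalue.DiffOp n r S)
    (hΦ : ContMDiff 𝓘(ℝ, B) 𝓘(ℝ, FirstEigenvalue.DiffOp n r S) k Φ)
    (helliptic : ∀ γ, (Φ γ).IsElliptic)
    (hselfadjoint : ∀ γ, ∃ ν : Measure S,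
      FirstEigenvalue.IsVolumeMeasure n ν ∧ (Φ γ).IsSelfAdjointWrt ν) :
    ∃ lam : U → ℝ, (∀ γ μ, (Φ γ).IsFirstEigenvalue μ ↔ μ = lam γ) ∧
      ContMDiff 𝓘(ℝ, B) 𝓘(ℝ, ℝ) k lam := by
  choose ν hν hsa using hselfadjoint
  have hfin : ∀ γ, IsFiniteMeasure (ν γ) := fun γ => (hν γ).isFiniteMeasure
  have hop : ∀ γ, (ν γ).IsOpenPosMeasure := fun γ => (hν γ).isOpenPosMeasure
  have hex : ∀ γ, ∃ (l : ℝ) (φ : C(S, ℝ)), (Φ γ).IsEigenpair l φ := fun γ => by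
    obtain ⟨-, l, φ, -, h, -⟩ := (Φ γ).exists_eigenpair (by lia) (helliptic γ) (hsa γ)
    exact ⟨l, φ, h⟩
  choose lam φ hlam using hex
  have hiff : ∀ γ l φ, (Φ γ).IsEigenpair l φ → ∀ μ, (Φ γ).IsFirstEigenvalue μ ↔ μ = l :=
    fun γ l φ h => h.isFirstEigenvalue_iff hr (helliptic γ) (hν γ) (hsa γ)
  refine ⟨lam, fun γ => hiff γ _ _ (hlam γ), fun γ₀ => ?_⟩
  have hk0 : (k : ℕ∞ω) ≠ 0 := by exact_mod_cast (by lia : k ≠ 0)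
  obtain ⟨l₀, φ₀, h₀, Λ, hΛ, hΛ'⟩ :=
    FirstEigenvalue.DiffOp.exists_contDiffAt_eigenvalue hr (helliptic γ₀) (hν γ₀) (hsa γ₀) k hk0
  have hl₀ : lam γ₀ = l₀ := (hiff γ₀ _ _ h₀ _).1 ((hiff γ₀ _ _ (hlam γ₀) _).2 rfl)
  have hΦc : Filter.Tendsto Φ (nhds γ₀) (nhds (Φ γ₀)) := hΦ.continuous.tendsto γ₀
  have hlc : Filter.Tendsto lam (nhds γ₀) (nhds l₀) := by
    refine Metric.tendsto_nhds.2 fun ε hε => ?_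
    obtain ⟨δ, hδ, h⟩ := h₀.exists_abs_sub_le (half_pos hε)
    filter_upwards [Metric.tendsto_nhds.1 hΦc δ hδ] with γ hγ
    rw [dist_eq_norm] at hγ
    exact (h _ _ _ _ (hfin γ) (hop γ) (hsa γ) (hlam γ) hγ).trans_lt (half_lt_self hε)
  have hev : lam =ᶠ[nhds γ₀] Λ ∘ Φ := by
    filter_upwards [(hΦc.prodMk_nhds hlc).eventually hΛ'] with γ hγ
    exact (hγ _ (hlam γ)).symm
  exact (hΛ.contMDiffAt.comp γ₀ (hΦ γ₀)).congr_of_eventuallyEq hev
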